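/- Let $n>4$ and let $(M^n,g_0)$ be a closed (compact, without boundary) connected smooth Riemannian manifold. For a smooth metric $g$ on $M$ let $A_g=\frac1{n-2}\bigl(Ric_g-\frac{R_g}{2(n-1)}g\bigr)$ be its Schouten tensor and let $\sigma_k(g)$ be the $k$-th elementary symmetric function of the eigenvalues of $g^{-1}A_g$. Fix $\varepsilon\in(0,1)$. For a smooth function $u$ on $M$ and $g=e^{-2u}g_0$ put $$r_\varepsilon(g)=\frac{\int_M\sigma_2(g)\,dvol(g)}{\int_M e^{2\varepsilon u}\,dvol(g)},$$ and, if $\sigma_1(g)$ has no zero, let $s_\varepsilon(g)\in\mathbb R$ be determined by $$\int_M e^{2\varepsilon u}\Bigl\{e^{-2u}\frac{\sigma_2(g)-r_\varepsilon(g)e^{2\varepsilon u}}{\sigma_1(g)}+s_\varepsilon(g)\Bigr\}\,dvol(g)=0 .$$ Consider the flow $$\frac{\partial u}{\partial t}=e^{-2u}\,\frac{\sigma_2(g)-r_\varepsilon(g)e^{2\varepsilon u}}{\sigma_1(g)}+s_\varepsilon(g),\qquad g=g(t)=e^{-2u(t,\cdot)}g_0. \qquad (*)$$ Then for every $\Lambda\in\mathbb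 R$ there is a constant $C$, depending only on $(M,g_0)$, $\varepsilon$ and $\Lambda$, with the following property. Let $T\ge 0$ and let $u$ be a smooth solution of $(*)$ on $[0,T]\times M$, with $\sigma_1(g(t))$ nowhere zero for all $t\in[0,T]$, such that $\sigma_1(g(0))>0$ on $M$, $r_\varepsilon(g(t))>0$ for all $t\in[0,T]$, and $\|u(0,\cdot)\|_{C^2(M)}\le\Lambda$. Then $$\|u(t,\cdot)\|_{C^2(M)}\le C\qquad\text{for all } t\in[0,T].$$ In particular $C$ is independent of $T$. Here $\|v\|_{C^2(M)}=\sup_M|v|+\sup_M|\nabla v|_{g_0}+\sup_M|\nabla^2v|_{g_0}$. -/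

import Mathlib

open MeasureTheory Set
open scoped Manifold ContDiff ENNReal Matrix

noncomputable section

namespace SigmaTwoFlow

/-! ### Riemannian geometry in local coordinates of `ℝⁿ`

A metric is given here by its coefficient matrix `G y = (g_{ij}(y))`. -/

/-- The partial derivative `∂_i f (y)`. -/
def pd {n : ℕ} (i : Fin n) (f : EuclideanSpace ℝ (Fin n) → ℝ) (y : EuclideanSpace ℝ (Fin n)) : ℝ :=
  fderiv ℝ f y (EuclideanSpace.single i 1)

/-- The Christoffel symbol `Γ^k_{ij} = ½ g^{kl} (∂_i g_{jl} + ∂_j g_{il} - ∂_l g_{ij})`. -/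
def christoffel {n : ℕ} (G : EuclideanSpace ℝ (Fin n) → Matrix (Fin n) (Fin n) ℝ)
    (k i j : Fin n) (y : EuclideanSpace ℝ (Fin n)) : ℝ :=
  (1 / 2) * ∑ l, (G y)⁻¹ k l *
    (pd i (fun z => G z j l) y + pd j (fun z => G z i l) y - pd l (fun z => G z i j) y)

/-- The Ricci tensor
`Ric_{ij} = ∂_k Γ^k_{ij} - ∂_j Γ^k_{ik} + Γ^k_{kl} Γ^l_{ij} - Γ^k_{jl} Γ^l_{ik}`
(positive on round spheres). -/
def ricci {n : ℕ} (G : EuclideanSpace ℝ (Fin n) → Matrix (Fin n) (Fin n) ℝ)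
    (y : EuclideanSpace ℝ (Fin n)) : Matrix (Fin n) (Fin n) ℝ :=
  Matrix.of fun i j =>
    ∑ k, pd k (christoffel G k i j) y - ∑ k, pd j (christoffel G k i k) y
      + ∑ k, ∑ l, christoffel G k k l y * christoffel G l i j y
      - ∑ k, ∑ l, christoffel G k j l y * christoffel G l i k y

/-- The scalar curvature `R = g^{ij} Ric_{ij}`. -/
def scalarCurv {n : ℕ} (G : EuclideanSpace ℝ (Fin n) → Matrix (Fin n) (Fin n) ℝ)
    (y : EuclideanSpace ℝ (Fin n)) : ℝ :=
  ((G y)⁻¹ * ricci G y).trace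

/-- The Schouten tensor `A = (Ric - R / (2 (n - 1)) g) / (n - 2)`. -/
def schouten {n : ℕ} (G : EuclideanSpace ℝ (Fin n) → Matrix (Fin n) (Fin n) ℝ)
    (y : EuclideanSpace ℝ (Fin n)) : Matrix (Fin n) (Fin n) ℝ :=
  (1 / ((n : ℝ) - 2)) • (ricci G y - (scalarCurv G y / (2 * ((n : ℝ) - 1))) • G y)

/-- The first elementary symmetric function of the eigenvalues of a matrix. -/
def sigma1 {n : ℕ} (B : Matrix (Fin n) (Fin n) ℝ) : ℝ := B.trace

/-- The second elementary symmetric function of the eigenvalues of a matrix,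
`σ₂(Λ) = ((∑ λ_i)² - ∑ λ_i²) / 2`. -/
def sigma2 {n : ℕ} (B : Matrix (Fin n) (Fin n) ℝ) : ℝ := (B.trace ^ 2 - (B * B).trace) / 2

/-- The Hessian `(∇²f)_{ij} = ∂_i ∂_j f - Γ^k_{ij} ∂_k f` with respect to the metric `G`. -/
def hessian {n : ℕ} (G : EuclideanSpace ℝ (Fin n) → Matrix (Fin n) (Fin n) ℝ)
    (f : EuclideanSpace ℝ (Fin n) → ℝ) (y : EuclideanSpace ℝ (Fin n)) :
    Matrix (Fin n) (Fin n) ℝ :=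
  Matrix.of fun i j => pd i (pd j f) y - ∑ k, christoffel G k i j y * pd k f y

/-! ### Riemannian geometry on a manifold without boundary -/

section Manifold

variable {n : ℕ} {M : Type*} [TopologicalSpace M] [ChartedSpace (EuclideanSpace ℝ (Fin n)) M]

/-- A field of bilinear forms on the tangent spaces of `M`. -/
abbrev BilinField (n : ℕ) (M : Type*) [TopologicalSpace M]
    [ChartedSpace (EuclideanSpace ℝ (Fin n)) M] :=
  ∀ x : M, TangentSpace (𝓡 n) x →L[ℝ] TangentSpace (𝓡 n) x →L[ℝ] ℝ

/-- The conformal metric `e^{-2v} g`. -/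
def conformal (g : BilinField n M) (v : M → ℝ) : BilinField n M :=
  fun x => Real.exp (-2 * v x) • g x

/-- The coefficients `g(∂_i, ∂_j)` of `g` in the chart around `p`, at the point with
coordinates `y`. -/
def coeff (g : BilinField n M) (p : M) (y : EuclideanSpace ℝ (Fin n)) :
    Matrix (Fin n) (Fin n) ℝ :=
  Matrix.of fun i j =>
    g ((extChartAt (𝓡 n) p).symm y)
      (mfderiv 𝓘(ℝ, EuclideanSpace ℝ (Fin n)) (𝓡 n) (extChartAt (𝓡 n) p).symm y
        (EuclideanSpace.single i (1 : ℝ) : EuclideanSpace ℝ (Fin n)))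
      (mfderiv 𝓘(ℝ, EuclideanSpace ℝ (Fin n)) (𝓡 n) (extChartAt (𝓡 n) p).symm y
        (EuclideanSpace.single j (1 : ℝ) : EuclideanSpace ℝ (Fin n)))

/-- The matrix `(g⁻¹ A_g)^i_j` at `x`, in the coordinates of the chart around `x`. -/
def schoutenEndo (g : BilinField n M) (x : M) : Matrix (Fin n) (Fin n) ℝ :=
  (coeff g x (extChartAt (𝓡 n) x x))⁻¹ * schouten (coeff g x) (extChartAt (𝓡 n) x x)

/-- The scalar `σ₁(g) = σ₁(g⁻¹ A_g)`. -/
def sig1 (g : BilinField n M) (x : M) : ℝ := sigma1 (schoutenEndo g x)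

/-- The scalar `σ₂(g) = σ₂(g⁻¹ A_g)`. -/
def sig2 (g : BilinField n M) (x : M) : ℝ := sigma2 (schoutenEndo g x)

/-- The Riemannian volume measure: the least measure that dominates, for every chart, the measure
`√(det g_{ij}) dy` on the domain of that chart. For a continuous Riemannian metric on a
second countable manifold these local measures agree on overlaps, and their supremum is the
measure that restricts to each of them. -/
def vol [MeasurableSpace M] (g : BilinField n M) : Measure M :=
  ⨆ p : M, Measure.map (extChartAt (𝓡 n) p).symm
    ((volume.restrict (extChartAt (𝓡 n) p).target).withDensity
      (fun y => ENNReal.ofReal (Real.sqrt (coeff g p y).det)))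

/-- A function on `M` in the chart around `p`. -/
def inChart (p : M) (v : M → ℝ) (y : EuclideanSpace ℝ (Fin n)) : ℝ :=
  v ((extChartAt (𝓡 n) p).symm y)

/-- The length `|∇v|_g = (g^{ij} v_i v_j)^{1/2}` at `x`. -/
def gradNorm (g : BilinField n M) (v : M → ℝ) (x : M) : ℝ :=
  Real.sqrt (∑ i, ∑ j, (coeff g x (extChartAt (𝓡 n) x x))⁻¹ i j *
    pd i (inChart x v) (extChartAt (𝓡 n) x x) * pd j (inChart x v) (extChartAt (𝓡 n) x x))

/-- The length `|∇²v|_g = (g^{ik} g^{jl} v_{ij} v_{kl})^{1/2}` of the Hessian at `x`. -/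
def hessNorm (g : BilinField n M) (v : M → ℝ) (x : M) : ℝ :=
  Real.sqrt (∑ i, ∑ j, ∑ k, ∑ l,
    (coeff g x (extChartAt (𝓡 n) x x))⁻¹ i k * (coeff g x (extChartAt (𝓡 n) x x))⁻¹ j l *
    hessian (coeff g x) (inChart x v) (extChartAt (𝓡 n) x x) i j *
    hessian (coeff g x) (inChart x v) (extChartAt (𝓡 n) x x) k l)

/-- The norm `‖v‖_{C²(M)} = sup |v| + sup |∇v|_g + sup |∇²v|_g`, a possibly infinite number. -/
def c2Norm (g : BilinField n M) (v : M → ℝ) : ℝ≥0∞ :=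
  (⨆ x, ENNReal.ofReal |v x|) + (⨆ x, ENNReal.ofReal (gradNorm g v x))
    + (⨆ x, ENNReal.ofReal (hessNorm g v x))

/-! ### The flow -/

variable [MeasurableSpace M]

/-- The number `r_ε(g) = ∫ σ₂(g) dvol(g) / ∫ e^{2εv} dvol(g)` of the metric `g = e^{-2v} g₀`. -/
def rEps (g₀ : BilinField n M) (ε : ℝ) (v : M → ℝ) : ℝ :=
  (∫ x, sig2 (conformal g₀ v) x ∂(vol (conformal g₀ v))) /
    ∫ x, Real.exp (2 * ε * v x) ∂(vol (conformal g₀ v))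

/-- The function `e^{-2v} (σ₂(g) - r_ε(g) e^{2εv}) / σ₁(g)` for `g = e^{-2v} g₀`. -/
def quot (g₀ : BilinField n M) (ε : ℝ) (v : M → ℝ) (x : M) : ℝ :=
  Real.exp (-2 * v x) *
    ((sig2 (conformal g₀ v) x - rEps g₀ ε v * Real.exp (2 * ε * v x)) /
      sig1 (conformal g₀ v) x)

/-- The number `s_ε(g)` determined by
`∫ e^{2εv} (e^{-2v} (σ₂(g) - r_ε(g) e^{2εv}) / σ₁(g) + s_ε(g)) dvol(g) = 0`,
for `g = e^{-2v} g₀`. -/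
def sEps (g₀ : BilinField n M) (ε : ℝ) (v : M → ℝ) : ℝ :=
  - (∫ x, Real.exp (2 * ε * v x) * quot g₀ ε v x ∂(vol (conformal g₀ v))) /
    ∫ x, Real.exp (2 * ε * v x) ∂(vol (conformal g₀ v))

/-- `u` is a smooth solution on `[0,T] × M` of the flow
`∂u/∂t = e^{-2u} (σ₂(g) - r_ε(g) e^{2εu}) / σ₁(g) + s_ε(g)`, `g = g(t) = e^{-2u(t,·)} g₀`.
The scalar `σ₁(g)` may not vanish, so that the right-hand side makes sense. -/
structure IsFlowSolution (g₀ : BilinField n M) (ε T : ℝ) (u : ℝ → M → ℝ) : Prop where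
  smooth : ContMDiffOn (𝓘(ℝ, ℝ).prod (𝓡 n)) 𝓘(ℝ, ℝ) ∞ (fun q : ℝ × M => u q.1 q.2)
    (Icc 0 T ×ˢ (univ : Set M))
  sig1_ne : ∀ t ∈ Icc 0 T, ∀ x, sig1 (conformal g₀ (u t)) x ≠ 0
  flow : ∀ t ∈ Icc 0 T, ∀ x,
    HasDerivWithinAt (fun τ => u τ x) (quot g₀ ε (u t) x + sEps g₀ ε (u t)) (Icc 0 T) t

end Manifold

end SigmaTwoFlow

end

open SigmaTwoFlow

open MeasureTheory Set
open scoped Manifold ContDiff ENNReal Matrix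
open Filter Topology

noncomputable section

namespace SigmaTwoFlow

section

/-! For `g = e^{-2u} g₀` the Schouten tensor is `W = A + ∇²u + du ⊗ du - ½|∇u|² g₀`
(`schouten_confM`). With all traces taken in `g₀`, the flow becomes `u_t = (σ₂(W) - r e^{-(4-2ε)u})
/ σ₁(W) + s` (`quot_eq`). Since `σ₁` never vanishes and starts positive, it stays positive
(`IsFlowSolution.sig1_pos`), and the equation is parabolic there. Three facts give the bound.

The number `r` does not increase. By the choice of `s`, the integral of `e^{2εu}` against `dvol(g)`
is conserved. The derivative of `∫ σ₂(g) dvol(g)` is `(4 - n) ∫ σ₂ u_t`: the remaining term is the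
first Newton tensor paired with the Hessian of `u_t`, and it integrates to zero because that tensor
is divergence free, by the contracted Bianchi identity (`IsNormal.div_newton`,
`integral_newtonHess`). By the choice of `r` and `s`, `∫ σ₂ u_t` is the integral of a square divided
by a positive function, and `n > 4` fixes the sign (`IsFlowSolution.integral_sig2_le`). Hence `r` is
bounded by its initial value, which the initial `C²` norm controls.

The Hessian is bounded above in terms of `m = min u`. Consider the maximum `c`, over time, point and
unit direction `e`, of `∇²u(e,e) + |∇u|²`. Instead of differentiating the operator twice, `u_t` is
touched from above by an expression linear in `W`, available because `σ₂/σ₁` is concave and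
`e^{-aw}/σ` is convex (`sigma2_div_le`, `exp_div_ge`). In coordinates that are Euclidean to first
order, the derivatives of order three and four cancel (`IsNormal.linearized_eq`). A term `-T
(∇²u(e,e))²` is left, where `T` is the trace of the linearised operator; all other terms are
nonpositive or at most `T` times something linear in the Hessian. The term with `r` fits this
pattern because `φ/σ ≤ √φ T` for `φ = r e^{-(4-2ε)u}`. So `c ≤ C (1 + √φ)`, which is of order
`e^{-(2-ε)m}` (`IsNormal.max_bound`, `exists_quadBound`). Positivity of `σ₁` turns this one-sided
bound into bounds for `|∇u|²` and the full Hessian (`bounds_of_quadBar`).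

The minimum is bounded below. If `m` is very negative, then `|∇u| ≤ L` with `L²` of order
`e^{-(2-ε)m}`. On a ball of radius about `1/L` around a minimum point `u` is within a constant of
`m`, so the conserved integral is at least a multiple of `e^{-(n-2ε)m} L^{-n}`, of order
`e^{-ε(n-4)m/2}` (`exists_volume_bound`, `neg_le_of_volume_le`). As `ε > 0` and `n > 4`, this bounds
`-m`. The Hessian and gradient are then bounded, and the conserved integral together with
connectedness bounds `u` above (`exists_osc_bound`). -/

/-- The coordinate space. -/
abbrev Euc (n : ℕ) := EuclideanSpace ℝ (Fin n)

variable {n : ℕ}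

/-! ### Partial derivatives -/

lemma _root_.ContDiffAt.smooth_differentiableAt {V : Type*} [NormedAddCommGroup V] [NormedSpace ℝ V]
    {f : V → ℝ} {y : V} (hf : ContDiffAt ℝ ∞ f y) : DifferentiableAt ℝ f y :=
  hf.differentiableAt (by simp)

lemma pd_congr {f g : Euc n → ℝ} {y : Euc n} (i : Fin n) (h : f =ᶠ[𝓝 y] g) :
    pd i f y = pd i g y := by
  unfold pd; rw [h.fderiv_eq]

lemma pd_congr_on {f g : Euc n → ℝ} {D : Set (Euc n)} (hD : IsOpen D) {y : Euc n} (hy : y ∈ D)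
    (i : Fin n) (h : ∀ z ∈ D, f z = g z) : pd i f y = pd i g y :=
  pd_congr i (Filter.eventuallyEq_of_mem (hD.mem_nhds hy) h)

@[simp] lemma pd_const (i : Fin n) (c : ℝ) (y : Euc n) : pd i (fun _ => c) y = 0 := by
  simp [pd]

lemma pd_add {f g : Euc n → ℝ} {y : Euc n} (i : Fin n) (hf : DifferentiableAt ℝ f y)
    (hg : DifferentiableAt ℝ g y) : pd i (fun z => f z + g z) y = pd i f y + pd i g y := by
  unfold pd; rw [fderiv_fun_add hf hg]; rfl

lemma pd_sub {f g : Euc n → ℝ} {y : Euc n} (i : Fin n) (hf : DifferentiableAt ℝ f y)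
    (hg : DifferentiableAt ℝ g y) : pd i (fun z => f z - g z) y = pd i f y - pd i g y := by
  unfold pd; rw [fderiv_fun_sub hf hg]; rfl

lemma pd_neg {f : Euc n → ℝ} {y : Euc n} (i : Fin n) :
    pd i (fun z => - f z) y = - pd i f y := by
  unfold pd; rw [fderiv_fun_neg]; rfl

lemma pd_mul {f g : Euc n → ℝ} {y : Euc n} (i : Fin n) (hf : DifferentiableAt ℝ f y)
    (hg : DifferentiableAt ℝ g y) :
    pd i (fun z => f z * g z) y = pd i f y * g y + f y * pd i g y := by
  unfold pd; rw [fderiv_fun_mul hf hg]; simp; ring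

lemma pd_const_mul {f : Euc n → ℝ} {y : Euc n} (i : Fin n) (c : ℝ) (hf : DifferentiableAt ℝ f y) :
    pd i (fun z => c * f z) y = c * pd i f y := by
  rw [pd_mul i (differentiableAt_const c) hf]; simp

lemma pd_sum {ι : Type*} {s : Finset ι} {f : ι → Euc n → ℝ} {y : Euc n} (i : Fin n)
    (hf : ∀ a ∈ s, DifferentiableAt ℝ (f a) y) :
    pd i (fun z => ∑ a ∈ s, f a z) y = ∑ a ∈ s, pd i (f a) y := by
  unfold pd; rw [fderiv_fun_sum hf]; simp

lemma contDiffAt_pd {f : Euc n → ℝ} {y : Euc n} (i : Fin n) (hf : ContDiffAt ℝ ∞ f y) :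
    ContDiffAt ℝ ∞ (pd i f) y := by
  unfold pd
  exact (hf.fderiv_right (m := ∞) (by simp)).clm_apply contDiffAt_const

lemma pd_comm {f : Euc n → ℝ} {y : Euc n} (i j : Fin n) (hf : ContDiffAt ℝ ∞ f y) :
    pd i (pd j f) y = pd j (pd i f) y := by
  have hs := hf.isSymmSndFDerivAt (by
    simp only [minSmoothness_of_isRCLikeNormedField]; exact WithTop.coe_le_coe.2 (le_top (a := (2 : ℕ∞))))
  have hd : DifferentiableAt ℝ (fderiv ℝ f) y :=
    (hf.fderiv_right (m := ∞) (by simp)).differentiableAt (by simp)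
  have key : ∀ a b : Fin n, pd a (pd b f) y
      = fderiv ℝ (fderiv ℝ f) y (EuclideanSpace.single a 1) (EuclideanSpace.single b 1) := by
    intro a b
    unfold pd
    rw [fderiv_clm_apply hd (differentiableAt_const _)]
    simp
  rw [key, key]
  exact hs _ _

/-- The derivative in the direction `v` is the combination of the partial derivatives. -/
lemma fderiv_eq_sum_pd (f : Euc n → ℝ) (y v : Euc n) :
    fderiv ℝ f y v = ∑ i, v i * pd i f y := by
  conv_lhs => rw [← (EuclideanSpace.basisFun (Fin n) ℝ).sum_repr v]
  simp [pd]

/-- The chain rule. -/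
lemma pd_comp {m : ℕ} {f : Euc m → ℝ} {Φ : Euc n → Euc m} {z : Euc n} (a : Fin n)
    (hf : DifferentiableAt ℝ f (Φ z)) (hΦ : DifferentiableAt ℝ Φ z) :
    pd a (fun w => f (Φ w)) z = ∑ i, pd a (fun w => Φ w i) z * pd i f (Φ z) := by
  have h1 : pd a (fun w => f (Φ w)) z
      = fderiv ℝ f (Φ z) (fderiv ℝ Φ z (EuclideanSpace.single a 1)) := by
    unfold pd
    rw [show (fun w => f (Φ w)) = f ∘ Φ from rfl, fderiv_comp z hf hΦ]; rfl
  rw [h1, fderiv_eq_sum_pd]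
  refine Finset.sum_congr rfl fun i _ => ?_
  congr 1
  have h2 := (EuclideanSpace.proj i : Euc m →L[ℝ] ℝ).hasFDerivAt.comp z
    hΦ.hasFDerivAt
  unfold pd
  rw [show (fun w => Φ w i) = (EuclideanSpace.proj i : Euc m →L[ℝ] ℝ) ∘ Φ from rfl,
    h2.fderiv]
  rfl

/-! ### Joint smoothness of families of functions -/

section JSmooth

variable {Q : Type*} [NormedAddCommGroup Q] [NormedSpace ℝ Q]

/-- A family `X q : ℝⁿ → ℝ` which is jointly smooth on `I × D`. -/
def JSmooth (I : Set Q) (D : Set (Euc n)) (X : Q → Euc n → ℝ) : Prop :=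
  ContDiffOn ℝ ∞ (fun q : Q × Euc n => X q.1 q.2) (I ×ˢ D)

variable {I : Set Q} {D : Set (Euc n)} {X Y : Q → Euc n → ℝ}

lemma JSmooth.congr (hX : JSmooth I D X) (h : ∀ q ∈ I, ∀ z ∈ D, Y q z = X q z) : JSmooth I D Y :=
  ContDiffOn.congr hX fun q hq => h q.1 hq.1 q.2 hq.2

lemma JSmooth.add (hX : JSmooth I D X) (hY : JSmooth I D Y) :
    JSmooth I D (fun q z => X q z + Y q z) := ContDiffOn.add hX hY

lemma JSmooth.sub (hX : JSmooth I D X) (hY : JSmooth I D Y) :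
    JSmooth I D (fun q z => X q z - Y q z) := ContDiffOn.sub hX hY

lemma JSmooth.mul (hX : JSmooth I D X) (hY : JSmooth I D Y) :
    JSmooth I D (fun q z => X q z * Y q z) := ContDiffOn.mul hX hY

lemma JSmooth.const (c : ℝ) : JSmooth I D (fun _ _ => c) := contDiffOn_const

lemma JSmooth.sum {ι : Type*} {s : Finset ι} {X : ι → Q → Euc n → ℝ}
    (hX : ∀ a ∈ s, JSmooth I D (X a)) : JSmooth I D (fun q z => ∑ a ∈ s, X a q z) :=
  ContDiffOn.sum hX

lemma JSmooth.prod {ι : Type*} {s : Finset ι} {X : ι → Q → Euc n → ℝ}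
    (hX : ∀ a ∈ s, JSmooth I D (X a)) : JSmooth I D (fun q z => ∏ a ∈ s, X a q z) :=
  contDiffOn_prod hX

lemma JSmooth.inv (hX : JSmooth I D X) (h : ∀ q ∈ I, ∀ z ∈ D, X q z ≠ 0) :
    JSmooth I D (fun q z => (X q z)⁻¹) :=
  ContDiffOn.inv hX fun q hq => h q.1 hq.1 q.2 hq.2

lemma JSmooth.div (hX : JSmooth I D X) (hY : JSmooth I D Y) (h : ∀ q ∈ I, ∀ z ∈ D, Y q z ≠ 0) :
    JSmooth I D (fun q z => X q z / Y q z) :=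
  ContDiffOn.div hX hY fun q hq => h q.1 hq.1 q.2 hq.2

lemma JSmooth.exp (hX : JSmooth I D X) : JSmooth I D (fun q z => Real.exp (X q z)) :=
  ContDiffOn.exp hX

lemma JSmooth.slice (hX : JSmooth I D X) (hD : IsOpen D) {q : Q} (hq : q ∈ I) {z : Euc n}
    (hz : z ∈ D) : ContDiffAt ℝ ∞ (X q) z := by
  have h1 : ContDiffOn ℝ ∞ (X q) D :=
    ContDiffOn.comp (g := fun q : Q × Euc n => X q.1 q.2) (f := fun z => (q, z)) hX
      (by fun_prop) (fun w hw => ⟨hq, hw⟩)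
  exact h1.contDiffAt (hD.mem_nhds hz)

lemma JSmooth.of_smooth {f : Euc n → ℝ} (hf : ∀ z ∈ D, ContDiffAt ℝ ∞ f z) :
    JSmooth I D (fun _ z => f z) :=
  ContDiffOn.comp (g := f) (f := fun q : Q × Euc n => q.2) (t := D)
    (fun z hz => (hf z hz).contDiffWithinAt) (by fun_prop) (fun _ hq => hq.2)

lemma JSmooth.continuousOn (hX : JSmooth I D X) :
    ContinuousOn (fun q : Q × Euc n => X q.1 q.2) (I ×ˢ D) := ContDiffOn.continuousOn hX

lemma JSmooth.mono {I' : Set Q} {D' : Set (Euc n)} (hX : JSmooth I D X) (h1 : I' ⊆ I)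
    (h2 : D' ⊆ D) : JSmooth I' D' X := ContDiffOn.mono hX (prod_mono h1 h2)

/-- Partial derivatives in the second variable of a jointly smooth family are jointly smooth. -/
lemma JSmooth.pd (hX : JSmooth I D X) (hI : UniqueDiffOn ℝ I) (hD : IsOpen D) (i : Fin n) :
    JSmooth I D (fun q z => pd i (X q) z) := by
  -- The parameter set may be a closed interval, so the joint derivative is taken within `I ×ˢ D`.
  -- As `D` is open, its restriction to a slice is an ordinary derivative.
  have hS : UniqueDiffOn ℝ (I ×ˢ D) := hI.prod hD.uniqueDiffOn
  have h1 : ContDiffOn ℝ ∞ (fun q : Q × Euc n =>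
      fderivWithin ℝ (fun q : Q × Euc n => X q.1 q.2) (I ×ˢ D) q
        ((0 : Q), (EuclideanSpace.single i (1 : ℝ) : Euc n))) (I ×ˢ D) :=
    (ContDiffOn.fderivWithin (m := ∞) hX hS (by simp)).clm_apply contDiffOn_const
  refine ContDiffOn.congr h1 fun q hq => ?_
  have h2 : HasFDerivWithinAt (fun q : Q × Euc n => X q.1 q.2) _ (I ×ˢ D) (q.1, q.2) :=
    (ContDiffOn.differentiableOn hX (by simp) q hq).hasFDerivWithinAt
  have h3 : HasFDerivWithinAt (fun z : Euc n => (q.1, z)) (ContinuousLinearMap.inr ℝ Q (Euc n)) D q.2 :=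
    (hasFDerivAt_prodMk_right q.1 q.2).hasFDerivWithinAt
  have h4 := (HasFDerivWithinAt.comp q.2 h2 h3 (fun w hw => ⟨hq.1, hw⟩)).hasFDerivAt
    (hD.mem_nhds hq.2)
  show fderiv ℝ (X q.1) q.2 _ = _
  rw [show X q.1 = (fun q : Q × Euc n => X q.1 q.2) ∘ (fun z : Euc n => (q.1, z)) from rfl, h4.fderiv]
  rfl

/-- A matrix-valued family with jointly smooth entries. -/
def JSmoothM {m : ℕ} (I : Set Q) (D : Set (Euc n)) (X : Q → Euc n → Matrix (Fin m) (Fin m) ℝ) :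
    Prop :=
  ∀ i j, JSmooth I D (fun q z => X q z i j)

variable {m : ℕ} {A B : Q → Euc n → Matrix (Fin m) (Fin m) ℝ}

lemma JSmoothM.mul (hA : JSmoothM I D A) (hB : JSmoothM I D B) :
    JSmoothM I D (fun q z => A q z * B q z) := by
  intro i j
  simp only [Matrix.mul_apply]
  exact JSmooth.sum fun a _ => (hA i a).mul (hB a j)

lemma JSmoothM.smul (hX : JSmooth I D X) (hA : JSmoothM I D A) :
    JSmoothM I D (fun q z => X q z • A q z) :=
  fun i j => hX.mul (hA i j)

lemma JSmoothM.sub (hA : JSmoothM I D A) (hB : JSmoothM I D B) :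
    JSmoothM I D (fun q z => A q z - B q z) :=
  fun i j => (hA i j).sub (hB i j)

lemma JSmoothM.trace (hA : JSmoothM I D A) : JSmooth I D (fun q z => (A q z).trace) := by
  simp only [Matrix.trace, Matrix.diag]
  exact JSmooth.sum fun a _ => hA a a

lemma JSmoothM.det (hA : JSmoothM I D A) : JSmooth I D (fun q z => (A q z).det) := by
  simp only [Matrix.det_apply']
  exact JSmooth.sum fun s _ => (JSmooth.const _).mul (JSmooth.prod fun i _ => hA _ _)

/-- Cramer's rule: the entries of the adjugate are determinants, hence polynomials in the entries of
the matrix. -/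
lemma JSmoothM.inv (hA : JSmoothM I D A) (h : ∀ q ∈ I, ∀ z ∈ D, (A q z).det ≠ 0) :
    JSmoothM I D (fun q z => (A q z)⁻¹) := by
  intro i j
  have h1 : JSmooth I D (fun q z => (A q z).adjugate i j) := by
    simp only [Matrix.adjugate_apply]
    refine JSmoothM.det fun a b => ?_
    by_cases hab : a = j
    · simp only [hab, Matrix.updateRow_self]; exact JSmooth.const _
    · simp only [Matrix.updateRow_ne hab]; exact hA a b
  simp only [Matrix.inv_def, Ring.inverse_eq_inv', Matrix.smul_apply, smul_eq_mul]
  exact (hA.det.inv h).mul h1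

lemma JSmoothM.sigma1 (hA : JSmoothM I D A) : JSmooth I D (fun q z => sigma1 (A q z)) := hA.trace

lemma JSmoothM.sigma2 (hA : JSmoothM I D A) : JSmooth I D (fun q z => sigma2 (A q z)) := by
  unfold SigmaTwoFlow.sigma2
  refine JSmooth.div ?_ (JSmooth.const 2) (fun _ _ _ _ => two_ne_zero)
  simp only [pow_two]
  exact (hA.trace.mul hA.trace).sub (hA.mul hA).trace

variable {G : Q → Euc n → Matrix (Fin n) (Fin n) ℝ}

/-- The parameter space is left general because two kinds of families occur: functions depending on
time over a fixed metric, and the metrics in normal coordinates depending on base point and frame.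
-/
lemma JSmoothM.christoffel (hG : JSmoothM I D G) (hd : ∀ q ∈ I, ∀ z ∈ D, (G q z).det ≠ 0)
    (hI : UniqueDiffOn ℝ I) (hD : IsOpen D) (k i j : Fin n) :
    JSmooth I D (fun q z => christoffel (G q) k i j z) := by
  unfold SigmaTwoFlow.christoffel
  refine (JSmooth.const _).mul (JSmooth.sum fun l _ => (hG.inv hd k l).mul ?_)
  exact (((hG j l).pd hI hD i).add ((hG i l).pd hI hD j)).sub ((hG i j).pd hI hD l)

lemma JSmoothM.ricci (hG : JSmoothM I D G) (hd : ∀ q ∈ I, ∀ z ∈ D, (G q z).det ≠ 0)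
    (hI : UniqueDiffOn ℝ I) (hD : IsOpen D) : JSmoothM I D (fun q z => ricci (G q) z) := by
  intro i j
  have hc := hG.christoffel hd hI hD
  simp only [SigmaTwoFlow.ricci, Matrix.of_apply]
  refine JSmooth.sub (JSmooth.add (JSmooth.sub ?_ ?_) ?_) ?_
  · exact JSmooth.sum fun k _ => (hc k i j).pd hI hD k
  · exact JSmooth.sum fun k _ => (hc k i k).pd hI hD j
  · exact JSmooth.sum fun k _ => JSmooth.sum fun l _ => (hc k k l).mul (hc l i j)
  · exact JSmooth.sum fun k _ => JSmooth.sum fun l _ => (hc k j l).mul (hc l i k)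

lemma JSmoothM.schouten (hG : JSmoothM I D G) (hd : ∀ q ∈ I, ∀ z ∈ D, (G q z).det ≠ 0)
    (hI : UniqueDiffOn ℝ I) (hD : IsOpen D) : JSmoothM I D (fun q z => schouten (G q) z) := by
  have hr := hG.ricci hd hI hD
  unfold SigmaTwoFlow.schouten SigmaTwoFlow.scalarCurv
  refine JSmoothM.smul (JSmooth.const _) (hr.sub (JSmoothM.smul ?_ hG))
  simp only [div_eq_mul_inv]
  exact ((hG.inv hd).mul hr).trace.mul (JSmooth.const _)

lemma JSmoothM.hessian (hG : JSmoothM I D G) (hd : ∀ q ∈ I, ∀ z ∈ D, (G q z).det ≠ 0)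
    (hI : UniqueDiffOn ℝ I) (hD : IsOpen D) (hX : JSmooth I D X) :
    JSmoothM I D (fun q z => hessian (G q) (X q) z) := by
  intro i j
  simp only [SigmaTwoFlow.hessian, Matrix.of_apply]
  exact ((hX.pd hI hD j).pd hI hD i).sub
    (JSmooth.sum fun k _ => (hG.christoffel hd hI hD k i j).mul (hX.pd hI hD k))

end JSmooth

end

section

variable {n : ℕ}

/-! ### Coordinate changes -/

/-- The entrywise partial derivative of a matrix-valued function. -/
def pdM {m l : ℕ} (i : Fin n) (X : Euc n → Matrix (Fin m) (Fin l) ℝ) (y : Euc n) :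
    Matrix (Fin m) (Fin l) ℝ :=
  Matrix.of fun a b => pd i (fun z => X z a b) y

/-- A Riemannian metric on an open set, given by its coefficients. -/
structure IsMetricOn (D : Set (Euc n)) (G : Euc n → Matrix (Fin n) (Fin n) ℝ) : Prop where
  isOpen : IsOpen D
  smooth : ∀ y ∈ D, ∀ i j, ContDiffAt ℝ ∞ (fun z => G z i j) y
  posDef : ∀ y ∈ D, (G y).PosDef

/-- The Jacobian matrix. -/
def jac (Φ : Euc n → Euc n) (z : Euc n) : Matrix (Fin n) (Fin n) ℝ :=
  Matrix.of fun i a => pd a (fun w => Φ w i) z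

/-- The coefficients of the pulled back metric. -/
def pullM (Φ : Euc n → Euc n) (G : Euc n → Matrix (Fin n) (Fin n) ℝ) (z : Euc n) :
    Matrix (Fin n) (Fin n) ℝ :=
  (jac Φ z)ᵀ * G (Φ z) * jac Φ z

/-- A smooth change of coordinates from `D` into `D'`. -/
structure IsChange (D D' : Set (Euc n)) (Φ : Euc n → Euc n) : Prop where
  isOpen : IsOpen D
  mapsTo : ∀ z ∈ D, Φ z ∈ D'
  smooth : ∀ z ∈ D, ContDiffAt ℝ ∞ Φ z
  det_ne : ∀ z ∈ D, (jac Φ z).det ≠ 0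

/-- The connection matrix `(Γ_i)^k_j`. -/
def conn (G : Euc n → Matrix (Fin n) (Fin n) ℝ) (i : Fin n) (y : Euc n) :
    Matrix (Fin n) (Fin n) ℝ :=
  Matrix.of fun k j => christoffel G k i j y

/-- The curvature matrix `(R_{ij})^k_l`. -/
def curv (G : Euc n → Matrix (Fin n) (Fin n) ℝ) (i j : Fin n) (y : Euc n) :
    Matrix (Fin n) (Fin n) ℝ :=
  pdM i (conn G j) y - pdM j (conn G i) y + conn G i y * conn G j y - conn G j y * conn G i y

lemma contDiffAt_coord {Φ : Euc n → Euc n} {z : Euc n} (h : ContDiffAt ℝ ∞ Φ z) (i : Fin n) :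
    ContDiffAt ℝ ∞ (fun w => Φ w i) z :=
  (EuclideanSpace.proj i : Euc n →L[ℝ] ℝ).contDiff.contDiffAt.comp z h

lemma contDiffAt_jac {Φ : Euc n → Euc n} {z : Euc n} (h : ContDiffAt ℝ ∞ Φ z) (i a : Fin n) :
    ContDiffAt ℝ ∞ (fun w => jac Φ w i a) z :=
  contDiffAt_pd a (contDiffAt_coord h i)

lemma pdM_jac_symm {Φ : Euc n → Euc n} {z : Euc n} (h : ContDiffAt ℝ ∞ Φ z) (i a b : Fin n) :
    pdM a (jac Φ) z i b = pdM b (jac Φ) z i a :=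
  pd_comm a b (contDiffAt_coord h i)

lemma pdM_mul {m l k : ℕ} {X : Euc n → Matrix (Fin m) (Fin l) ℝ}
    {Y : Euc n → Matrix (Fin l) (Fin k) ℝ} {y : Euc n} (i : Fin n)
    (hX : ∀ a b, DifferentiableAt ℝ (fun z => X z a b) y)
    (hY : ∀ a b, DifferentiableAt ℝ (fun z => Y z a b) y) :
    pdM i (fun z => X z * Y z) y = pdM i X y * Y y + X y * pdM i Y y := by
  ext a b
  simp only [pdM, Matrix.of_apply, Matrix.mul_apply, Matrix.add_apply]
  rw [pd_sum i (fun c _ => (hX a c).fun_mul (hY c b)), ← Finset.sum_add_distrib]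
  exact Finset.sum_congr rfl fun c _ => pd_mul i (hX a c) (hY c b)

lemma pdM_add {m l : ℕ} {X Y : Euc n → Matrix (Fin m) (Fin l) ℝ} {y : Euc n} (i : Fin n)
    (hX : ∀ a b, DifferentiableAt ℝ (fun z => X z a b) y)
    (hY : ∀ a b, DifferentiableAt ℝ (fun z => Y z a b) y) :
    pdM i (fun z => X z + Y z) y = pdM i X y + pdM i Y y := by
  ext a b
  exact pd_add i (hX a b) (hY a b)

lemma pdM_congr_on {m l : ℕ} {X Y : Euc n → Matrix (Fin m) (Fin l) ℝ} {D : Set (Euc n)}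
    (hD : IsOpen D) {y : Euc n} (hy : y ∈ D) (i : Fin n) (h : ∀ z ∈ D, X z = Y z) :
    pdM i X y = pdM i Y y := by
  ext a b
  exact pd_congr_on hD hy i fun z hz => by rw [h z hz]

/-- The chain rule for matrices. -/
lemma pdM_comp {m l : ℕ} {X : Euc n → Matrix (Fin m) (Fin l) ℝ} {Φ : Euc n → Euc n} {z : Euc n}
    (a : Fin n) (hX : ∀ c b, DifferentiableAt ℝ (fun z => X z c b) (Φ z))
    (hΦ : DifferentiableAt ℝ Φ z) :
    pdM a (fun w => X (Φ w)) z = ∑ i, jac Φ z i a • pdM i X (Φ z) := by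
  ext c b
  simp only [pdM, Matrix.of_apply, Matrix.sum_apply, Matrix.smul_apply, smul_eq_mul]
  exact pd_comp a (hX c b) hΦ

/-! ### The Levi-Civita connection in coordinates and its transformation law. -/

section Metric

variable {D D' : Set (Euc n)} {G : Euc n → Matrix (Fin n) (Fin n) ℝ} {Φ : Euc n → Euc n} {y : Euc n}

lemma IsMetricOn.symm (h : IsMetricOn D G) (hy : y ∈ D) : (G y)ᵀ = G y := by
  simpa using (h.posDef y hy).isHermitian.eq

lemma IsMetricOn.symm_apply (h : IsMetricOn D G) (hy : y ∈ D) (i j : Fin n) : G y i j = G y j i :=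
  congrFun (congrFun (h.symm hy) j) i

lemma IsMetricOn.det_pos (h : IsMetricOn D G) (hy : y ∈ D) : 0 < (G y).det := (h.posDef y hy).det_pos

lemma IsMetricOn.isUnit_det (h : IsMetricOn D G) (hy : y ∈ D) : IsUnit (G y).det :=
  (h.det_pos hy).ne'.isUnit

lemma IsMetricOn.jsmooth {Q : Type*} [NormedAddCommGroup Q] [NormedSpace ℝ Q] (h : IsMetricOn D G)
    (I : Set Q) : JSmoothM I D (fun _ z => G z) :=
  fun i j => JSmooth.of_smooth fun z hz => h.smooth z hz i j

lemma IsMetricOn.pd_symm (h : IsMetricOn D G) (hy : y ∈ D) (l i j : Fin n) :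
    pd l (fun z => G z i j) y = pd l (fun z => G z j i) y :=
  pd_congr_on h.isOpen hy l fun _ hz => h.symm_apply hz i j

/-- A single metric is a family that is constant in a dummy real parameter, so the statements on
joint smoothness apply. -/
lemma IsMetricOn.smooth_inv (h : IsMetricOn D G) (hy : y ∈ D) (i j : Fin n) :
    ContDiffAt ℝ ∞ (fun z => (G z)⁻¹ i j) y :=
  (((h.jsmooth (univ : Set ℝ)).inv fun _ _ _ hz => (h.det_pos hz).ne') i j).slice h.isOpen
    (mem_univ 0) hy

lemma IsMetricOn.smooth_christoffel (h : IsMetricOn D G) (hy : y ∈ D) (k i j : Fin n) :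
    ContDiffAt ℝ ∞ (christoffel G k i j) y :=
  ((h.jsmooth (univ : Set ℝ)).christoffel (fun _ _ _ hz => (h.det_pos hz).ne') uniqueDiffOn_univ
    h.isOpen k i j).slice h.isOpen (mem_univ 0) hy

lemma IsMetricOn.smooth_ricci (h : IsMetricOn D G) (hy : y ∈ D) (i j : Fin n) :
    ContDiffAt ℝ ∞ (fun z => ricci G z i j) y :=
  ((h.jsmooth (univ : Set ℝ)).ricci (fun _ _ _ hz => (h.det_pos hz).ne') uniqueDiffOn_univ
    h.isOpen i j).slice h.isOpen (mem_univ 0) hy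

lemma IsMetricOn.smooth_schouten (h : IsMetricOn D G) (hy : y ∈ D) (i j : Fin n) :
    ContDiffAt ℝ ∞ (fun z => schouten G z i j) y :=
  ((h.jsmooth (univ : Set ℝ)).schouten (fun _ _ _ hz => (h.det_pos hz).ne') uniqueDiffOn_univ
    h.isOpen i j).slice h.isOpen (mem_univ 0) hy

lemma christoffel_symm (h : IsMetricOn D G) (hy : y ∈ D) (k i j : Fin n) :
    christoffel G k i j y = christoffel G k j i y := by
  unfold christoffel
  congr 1
  refine Finset.sum_congr rfl fun l _ => ?_
  rw [h.pd_symm hy l i j]; ring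

/-- The lowered Christoffel symbol. -/
lemma conn_lower (h : IsMetricOn D G) (hy : y ∈ D) (i j l : Fin n) :
    (G y * conn G i y) l j = (1 / 2) *
      (pd i (fun z => G z j l) y + pd j (fun z => G z i l) y - pd l (fun z => G z i j) y) := by
  have h1 : conn G i y = (1 / 2 : ℝ) • ((G y)⁻¹ * Matrix.of fun l j =>
      (pd i (fun z => G z j l) y + pd j (fun z => G z i l) y - pd l (fun z => G z i j) y)) := by
    ext k j
    simp [conn, christoffel, Matrix.mul_apply]
  rw [h1, Matrix.mul_smul, ← Matrix.mul_assoc, Matrix.mul_nonsing_inv _ (h.isUnit_det hy)]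
  simp

/-- The connection is metric. -/
lemma pdM_metric (h : IsMetricOn D G) (hy : y ∈ D) (i : Fin n) :
    pdM i G y = (conn G i y)ᵀ * G y + G y * conn G i y := by
  have h1 : (conn G i y)ᵀ * G y = (G y * conn G i y)ᵀ := by
    rw [Matrix.transpose_mul, h.symm hy]
  rw [h1]
  ext a b
  rw [Matrix.add_apply, Matrix.transpose_apply, conn_lower h hy, conn_lower h hy,
    h.pd_symm hy i b a]
  simp only [pdM, Matrix.of_apply]
  ring

/-- The Levi-Civita connection is the only symmetric metric connection. -/
lemma conn_unique (h : IsMetricOn D G) (hy : y ∈ D) (Γ : Fin n → Matrix (Fin n) (Fin n) ℝ)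
    (hs : ∀ i j k, Γ i k j = Γ j k i) (hm : ∀ i, pdM i G y = (Γ i)ᵀ * G y + G y * Γ i) (i : Fin n) :
    conn G i y = Γ i := by
  -- Koszul's argument: with the upper index lowered, `Γ` is symmetric in two slots, and metricity
  -- writes each derivative of the metric as a sum of two such terms. The combination in the
  -- Christoffel symbol isolates one of them.
  have hL : ∀ i l j, (G y * Γ i) l j = (G y * Γ j) l i := by
    intro i l j
    simp only [Matrix.mul_apply]
    exact Finset.sum_congr rfl fun k _ => by rw [hs]
  have hp : ∀ i j l, pd i (fun z => G z j l) y = (G y * Γ i) l j + (G y * Γ i) j l := by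
    intro i j l
    have h1 : (Γ i)ᵀ * G y = (G y * Γ i)ᵀ := by rw [Matrix.transpose_mul, h.symm hy]
    have h2 := congrFun (congrFun (hm i) j) l
    rw [h1] at h2
    exact h2
  have h3 : G y * conn G i y = G y * Γ i := by
    ext l j
    rw [conn_lower h hy, hp, hp, hp, hL j l i, hL l i j, hL l j i]
    ring
  have h4 := congrArg (fun X => (G y)⁻¹ * X) h3
  simpa only [← Matrix.mul_assoc, Matrix.nonsing_inv_mul _ (h.isUnit_det hy), Matrix.one_mul] using h4

lemma IsChange.isUnit_det (hΦ : IsChange D D' Φ) (hy : y ∈ D) : IsUnit (jac Φ y).det :=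
  (hΦ.det_ne y hy).isUnit

lemma IsMetricOn.pull (h : IsMetricOn D' G) (hΦ : IsChange D D' Φ) : IsMetricOn D (pullM Φ G) where
  isOpen := hΦ.isOpen
  smooth y hy i j := by
    simp only [pullM, Matrix.mul_apply, Matrix.transpose_apply]
    refine ContDiffAt.sum fun b _ => ContDiffAt.mul (ContDiffAt.sum fun a _ => ContDiffAt.mul ?_ ?_) ?_
    · exact contDiffAt_jac (hΦ.smooth y hy) _ _
    · exact (h.smooth _ (hΦ.mapsTo y hy) a b).comp y (hΦ.smooth y hy)
    · exact contDiffAt_jac (hΦ.smooth y hy) _ _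
  posDef y hy := by
    have h1 := (h.posDef _ (hΦ.mapsTo y hy)).conjTranspose_mul_mul_same (B := jac Φ y)
      (Matrix.mulVec_injective_of_isUnit ((Matrix.isUnit_iff_isUnit_det _).2 (hΦ.isUnit_det hy)))
    simpa [pullM] using h1

/-- The transformation law of the Christoffel symbols. -/
lemma conn_pull (h : IsMetricOn D' G) (hΦ : IsChange D D' Φ) (hy : y ∈ D) (a : Fin n) :
    jac Φ y * conn (pullM Φ G) a y
      = (∑ i, jac Φ y i a • conn G i (Φ y)) * jac Φ y + pdM a (jac Φ) y := by
  have hJ := hΦ.isUnit_det hy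
  set J := jac Φ y with hJdef
  set Θ : Fin n → Matrix (Fin n) (Fin n) ℝ := fun a => ∑ i, J i a • conn G i (Φ y) with hΘ
  have hy' := hΦ.mapsTo y hy
  -- The matrices on the right, multiplied by the inverse Jacobian, form a symmetric metric
  -- connection for the pulled back metric. Uniqueness identifies them, without expanding the
  -- Christoffel formula.
  have key := conn_unique (h.pull hΦ) hy (fun a => J⁻¹ * (Θ a * J + pdM a (jac Φ) y)) ?_ ?_ a
  · rw [key, ← Matrix.mul_assoc, Matrix.mul_nonsing_inv _ hJ, Matrix.one_mul]
  · intro a b k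
    simp only [Matrix.mul_apply, Matrix.add_apply]
    refine Finset.sum_congr rfl fun i _ => ?_
    rw [pdM_jac_symm (hΦ.smooth y hy) i a b]
    congr 2
    simp only [hΘ, Matrix.sum_apply, Matrix.smul_apply, smul_eq_mul, Finset.sum_mul, conn,
      Matrix.of_apply]
    rw [Finset.sum_comm]
    refine Finset.sum_congr rfl fun c _ => Finset.sum_congr rfl fun d _ => ?_
    rw [christoffel_symm h hy' i c d]; ring
  · intro a
    have dJ : ∀ i b, DifferentiableAt ℝ (fun z => jac Φ z i b) y :=
      fun i b => (contDiffAt_jac (hΦ.smooth y hy) i b).smooth_differentiableAt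
    have dΦ : DifferentiableAt ℝ Φ y := (hΦ.smooth y hy).differentiableAt (by simp)
    have dG' : ∀ i b, DifferentiableAt ℝ (fun z => G z i b) (Φ y) :=
      fun i b => (h.smooth _ hy' i b).smooth_differentiableAt
    have dG : ∀ i b, DifferentiableAt ℝ (fun z => G (Φ z) i b) y :=
      fun i b => (dG' i b).comp y dΦ
    have d1 : ∀ i b, DifferentiableAt ℝ (fun z => ((jac Φ z)ᵀ * G (Φ z)) i b) y := by
      intro i b
      simp only [Matrix.mul_apply, Matrix.transpose_apply]
      exact DifferentiableAt.fun_sum fun c _ => (dJ c i).mul (dG c b)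
    have e1 : pdM a (pullM Φ G) y = (pdM a (jac Φ) y)ᵀ * G (Φ y) * J
        + Jᵀ * pdM a (fun z => G (Φ z)) y * J + Jᵀ * G (Φ y) * pdM a (jac Φ) y := by
      unfold pullM
      rw [pdM_mul a d1 dJ, pdM_mul a (X := fun z => (jac Φ z)ᵀ) (fun i b => dJ b i) dG]
      rw [Matrix.add_mul]
      rfl
    have e2 : pdM a (fun z => G (Φ z)) y = (Θ a)ᵀ * G (Φ y) + G (Φ y) * Θ a := by
      rw [pdM_comp a dG' dΦ]
      simp only [hΘ, Matrix.transpose_sum, Matrix.sum_mul, Matrix.mul_sum, Matrix.transpose_smul,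
        Matrix.smul_mul, Matrix.mul_smul, ← Finset.sum_add_distrib, ← smul_add]
      exact Finset.sum_congr rfl fun i _ => by rw [pdM_metric h hy']
    have e3 : pullM Φ G y * (J⁻¹ * (Θ a * J + pdM a (jac Φ) y))
        = Jᵀ * G (Φ y) * (Θ a * J + pdM a (jac Φ) y) := by
      show Jᵀ * G (Φ y) * J * _ = _
      rw [Matrix.mul_assoc (Jᵀ * G (Φ y)), ← Matrix.mul_assoc J, Matrix.mul_nonsing_inv _ hJ,
        Matrix.one_mul]
    have e4 : (J⁻¹ * (Θ a * J + pdM a (jac Φ) y))ᵀ * pullM Φ G y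
        = (Θ a * J + pdM a (jac Φ) y)ᵀ * G (Φ y) * J := by
      have := congrArg Matrix.transpose e3
      rw [Matrix.transpose_mul, (h.pull hΦ).symm hy] at this
      rw [this]
      simp only [Matrix.transpose_mul, Matrix.transpose_transpose, h.symm hy', Matrix.mul_assoc]
    rw [e1, e2, e3, e4]
    simp only [Matrix.transpose_add, Matrix.transpose_mul]
    noncomm_ring

end Metric

end

/-! ### Tensorial behaviour of the Hessian, the curvature and the Schouten tensor. -/

section

variable {n : ℕ}

section Metric

variable {D D' : Set (Euc n)} {G : Euc n → Matrix (Fin n) (Fin n) ℝ} {Φ : Euc n → Euc n} {y : Euc n}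

/-- The second derivatives of the coordinate change, which the chain rule produces, are exactly the
inhomogeneous term in the transformation law of the Christoffel symbols, and the two cancel. -/
lemma hessian_pull (h : IsMetricOn D' G) (hΦ : IsChange D D' Φ) (hy : y ∈ D) {f : Euc n → ℝ}
    (hf : ∀ z ∈ D', ContDiffAt ℝ ∞ f z) :
    hessian (pullM Φ G) (fun z => f (Φ z)) y = (jac Φ y)ᵀ * hessian G f (Φ y) * jac Φ y := by
  have hy' := hΦ.mapsTo y hy
  have dΦ : ∀ z ∈ D, DifferentiableAt ℝ Φ z := fun z hz => (hΦ.smooth z hz).differentiableAt (by simp)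
  have e1 : ∀ b, ∀ z ∈ D, pd b (fun z => f (Φ z)) z = ∑ i, jac Φ z i b * pd i f (Φ z) :=
    fun b z hz => pd_comp b (hf _ (hΦ.mapsTo z hz)).smooth_differentiableAt (dΦ z hz)
  have df : ∀ i, DifferentiableAt ℝ (pd i f) (Φ y) :=
    fun i => (contDiffAt_pd i (hf _ hy')).smooth_differentiableAt
  have dfc : ∀ i, DifferentiableAt ℝ (fun z => pd i f (Φ z)) y := fun i => (df i).comp y (dΦ y hy)
  have dJ : ∀ i b, DifferentiableAt ℝ (fun z => jac Φ z i b) y :=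
    fun i b => (contDiffAt_jac (hΦ.smooth y hy) i b).smooth_differentiableAt
  ext a b
  have e2 : pd a (pd b (fun z => f (Φ z))) y
      = ∑ i, (pdM a (jac Φ) y i b * pd i f (Φ y)
        + jac Φ y i b * ∑ j, jac Φ y j a * pd j (pd i f) (Φ y)) := by
    rw [pd_congr_on hΦ.isOpen hy a (e1 b),
      pd_sum a (fun i _ => (dJ i b).fun_mul (dfc i))]
    refine Finset.sum_congr rfl fun i _ => ?_
    rw [pd_mul a (dJ i b) (dfc i)]
    congr 2
    exact pd_comp a (df i) (dΦ y hy)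
  have e3 : ∑ c, christoffel (pullM Φ G) c a b y * pd c (fun z => f (Φ z)) y
      = ∑ i, (pdM a (jac Φ) y i b
          + ((∑ j, jac Φ y j a • conn G j (Φ y)) * jac Φ y) i b) * pd i f (Φ y) := by
    have e4 : ∀ i, ∑ c, jac Φ y i c * christoffel (pullM Φ G) c a b y = pdM a (jac Φ) y i b
          + ((∑ j, jac Φ y j a • conn G j (Φ y)) * jac Φ y) i b := by
      intro i
      have := congrFun (congrFun (conn_pull h hΦ hy a) i) b
      rw [Matrix.add_apply, add_comm] at this
      rw [← this]; rfl
    simp only [e1 _ y hy, Finset.mul_sum]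
    rw [Finset.sum_comm]
    refine Finset.sum_congr rfl fun i _ => ?_
    rw [← e4, Finset.sum_mul]
    exact Finset.sum_congr rfl fun c _ => by ring
  simp only [hessian, Matrix.of_apply]
  rw [e2, e3]
  simp only [Matrix.mul_apply, Matrix.transpose_apply, Matrix.of_apply, Matrix.sum_apply,
    Matrix.smul_apply, smul_eq_mul, conn, add_mul, Finset.sum_add_distrib, mul_sub, sub_mul,
    Finset.sum_sub_distrib, Finset.mul_sum, Finset.sum_mul]
  rw [add_sub_add_left_eq_sub]
  congr 1
  · refine Finset.sum_congr rfl fun i _ => Finset.sum_congr rfl fun j _ => ?_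
    rw [pd_comm j i (hf _ hy')]
    ring
  · rw [Finset.sum_comm]
    refine Finset.sum_congr rfl fun c _ => ?_
    rw [Finset.sum_comm]
    exact Finset.sum_congr rfl fun j _ => Finset.sum_congr rfl fun i _ => by ring

/-- The transformation law of the curvature. -/
lemma curv_pull (h : IsMetricOn D' G) (hΦ : IsChange D D' Φ) (hy : y ∈ D) (a b : Fin n) :
    jac Φ y * curv (pullM Φ G) a b y
      = (∑ i, ∑ j, (jac Φ y i a * jac Φ y j b) • curv G i j (Φ y)) * jac Φ y := by
  have hy' := hΦ.mapsTo y hy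
  have h' := h.pull hΦ
  have dΦ : DifferentiableAt ℝ Φ y := (hΦ.smooth y hy).differentiableAt (by simp)
  have dJ : ∀ i b, DifferentiableAt ℝ (fun z => jac Φ z i b) y :=
    fun i b => (contDiffAt_jac (hΦ.smooth y hy) i b).smooth_differentiableAt
  have dJ' : ∀ a i b, DifferentiableAt ℝ (fun z => pdM a (jac Φ) z i b) y := fun a i b =>
    (contDiffAt_pd a (contDiffAt_jac (hΦ.smooth y hy) i b)).smooth_differentiableAt
  have dΓ' : ∀ c i b, DifferentiableAt ℝ (fun z => conn (pullM Φ G) c z i b) y :=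
    fun c i b => (h'.smooth_christoffel hy i c b).smooth_differentiableAt
  have dΓ0 : ∀ c i b, DifferentiableAt ℝ (fun z => conn G c z i b) (Φ y) :=
    fun c i b => (h.smooth_christoffel hy' i c b).smooth_differentiableAt
  have dΓ : ∀ c i b, DifferentiableAt ℝ (fun z => conn G c (Φ z) i b) y :=
    fun c i b => (dΓ0 c i b).comp y dΦ
  set Θ : Fin n → Euc n → Matrix (Fin n) (Fin n) ℝ :=
    fun a z => ∑ i, jac Φ z i a • conn G i (Φ z) with hΘ
  have dΘ : ∀ c i b, DifferentiableAt ℝ (fun z => Θ c z i b) y := by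
    intro c i b
    simp only [hΘ, Matrix.sum_apply, Matrix.smul_apply, smul_eq_mul]
    exact DifferentiableAt.fun_sum fun j _ => (dJ j c).fun_mul (dΓ j i b)
  have dΘJ : ∀ c i b, DifferentiableAt ℝ (fun z => (Θ c z * jac Φ z) i b) y := by
    intro c i b
    simp only [Matrix.mul_apply]
    exact DifferentiableAt.fun_sum fun j _ => (dΘ c i j).fun_mul (dJ j b)
  have e0 : ∀ b, ∀ z ∈ D, jac Φ z * conn (pullM Φ G) b z = Θ b z * jac Φ z + pdM b (jac Φ) z :=
    fun b z hz => conn_pull h hΦ hz b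
  have e1 : ∀ a b, pdM a (jac Φ) y * conn (pullM Φ G) b y
      + jac Φ y * pdM a (conn (pullM Φ G) b) y
      = pdM a (Θ b) y * jac Φ y + Θ b y * pdM a (jac Φ) y + pdM a (pdM b (jac Φ)) y := by
    intro a b
    rw [← pdM_mul a dJ (dΓ' b), pdM_congr_on hΦ.isOpen hy a (e0 b), pdM_add a (dΘJ b) (dJ' b),
      pdM_mul a (dΘ b) dJ]
  -- Differentiating the law `J Γ'_b = Θ_b J + ∂_b J` once more and using it again. Except for the
  -- first summand the right-hand side is symmetric in `a` and `b`, so it disappears from the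
  -- curvature.
  have e2 : ∀ a b, jac Φ y * (pdM a (conn (pullM Φ G) b) y
        + conn (pullM Φ G) a y * conn (pullM Φ G) b y)
      = (pdM a (Θ b) y + Θ a y * Θ b y) * jac Φ y + (Θ b y * pdM a (jac Φ) y
        + Θ a y * pdM b (jac Φ) y) + pdM a (pdM b (jac Φ)) y := by
    intro a b
    have e3 : jac Φ y * (conn (pullM Φ G) a y * conn (pullM Φ G) b y)
        = Θ a y * (Θ b y * jac Φ y + pdM b (jac Φ) y)
          + pdM a (jac Φ) y * conn (pullM Φ G) b y := by
      rw [← e0 b y hy, ← Matrix.mul_assoc, e0 a y hy, Matrix.add_mul, Matrix.mul_assoc]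
    rw [Matrix.mul_add, e3, eq_sub_of_add_eq' (e1 a b)]
    noncomm_ring
  have e4 : pdM a (pdM b (jac Φ)) y = pdM b (pdM a (jac Φ)) y := by
    ext i c
    exact pd_comm a b (contDiffAt_jac (hΦ.smooth y hy) i c)
  have e5 : ∀ a b, pdM a (Θ b) y = ∑ i, (pdM a (jac Φ) y i b • conn G i (Φ y)
      + jac Φ y i b • ∑ j, jac Φ y j a • pdM j (conn G i) (Φ y)) := by
    intro a b
    ext c d
    simp only [hΘ, Matrix.sum_apply, Matrix.smul_apply, smul_eq_mul, pdM, Matrix.of_apply,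
      Matrix.add_apply]
    rw [pd_sum a fun i _ => (dJ i b).fun_mul (dΓ i c d)]
    refine Finset.sum_congr rfl fun i _ => ?_
    rw [pd_mul a (dJ i b) (dΓ i c d)]
    congr 2
    exact pd_comp a (dΓ0 i c d) dΦ
  -- The part of `∂_a Θ_b` in which the Jacobian is differentiated is symmetric in `a` and `b` and
  -- drops out in the same way.
  have e6 : pdM a (Θ b) y + Θ a y * Θ b y - (pdM b (Θ a) y + Θ b y * Θ a y)
      = ∑ i, ∑ j, (jac Φ y i a * jac Φ y j b) • curv G i j (Φ y) := by
    have e7 : ∀ a b, Θ a y * Θ b y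
        = ∑ i, ∑ j, (jac Φ y i a * jac Φ y j b) • (conn G i (Φ y) * conn G j (Φ y)) := by
      intro a b
      simp only [hΘ, Finset.sum_mul, Finset.mul_sum, Matrix.smul_mul, Matrix.mul_smul, smul_smul]
      rw [Finset.sum_comm]
      exact Finset.sum_congr rfl fun i _ => Finset.sum_congr rfl fun j _ => by rw [mul_comm (jac Φ y j b)]
    have e8 : ∀ a b, pdM a (Θ b) y = ∑ i, pdM a (jac Φ) y i b • conn G i (Φ y)
        + ∑ i, ∑ j, (jac Φ y i a * jac Φ y j b) • pdM i (conn G j) (Φ y) := by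
      intro a b
      rw [e5, Finset.sum_add_distrib]
      congr 1
      rw [Finset.sum_comm]
      refine Finset.sum_congr rfl fun i _ => ?_
      rw [Finset.smul_sum]
      exact Finset.sum_congr rfl fun j _ => by rw [smul_smul, mul_comm]
    have e9 : ∀ (K : Fin n → Fin n → Matrix (Fin n) (Fin n) ℝ),
        ∑ i, ∑ j, (jac Φ y i b * jac Φ y j a) • K i j
          = ∑ i, ∑ j, (jac Φ y i a * jac Φ y j b) • K j i := by
      intro K
      rw [Finset.sum_comm]
      exact Finset.sum_congr rfl fun i _ => Finset.sum_congr rfl fun j _ => by rw [mul_comm]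
    rw [e8, e8, e7, e7, e9, e9]
    have e10 : ∑ i, pdM a (jac Φ) y i b • conn G i (Φ y)
        = ∑ i, pdM b (jac Φ) y i a • conn G i (Φ y) :=
      Finset.sum_congr rfl fun i _ => by rw [pdM_jac_symm (hΦ.smooth y hy) i a b]
    rw [e10]
    simp only [curv, smul_add, smul_sub, Finset.sum_add_distrib, Finset.sum_sub_distrib]
    abel
  have e11 : curv (pullM Φ G) a b y = (pdM a (conn (pullM Φ G) b) y
        + conn (pullM Φ G) a y * conn (pullM Φ G) b y) - (pdM b (conn (pullM Φ G) a) y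
        + conn (pullM Φ G) b y * conn (pullM Φ G) a y) := by
    simp only [curv]; abel
  rw [e11, Matrix.mul_sub, e2, e2, e4, ← e6]
  noncomm_ring

/-- Symmetry of the Christoffel symbols in the lower indices rearranges the defining formula into a
trace of curvature matrices, whose transformation law is a conjugation. -/
lemma ricci_eq_curv (h : IsMetricOn D G) (hy : y ∈ D) (i j : Fin n) :
    ricci G y i j = ∑ k, curv G k j y k i := by
  simp only [ricci, curv, Matrix.of_apply, Matrix.add_apply, Matrix.sub_apply, Matrix.mul_apply,
    conn, pdM, Finset.sum_add_distrib, Finset.sum_sub_distrib]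
  have e1 : ∀ k, pd k (christoffel G k i j) y = pd k (fun z => christoffel G k j i z) y :=
    fun k => pd_congr_on h.isOpen hy k fun z hz => christoffel_symm h hz k i j
  have e2 : ∀ k, pd j (christoffel G k i k) y = pd j (fun z => christoffel G k k i z) y :=
    fun k => pd_congr_on h.isOpen hy j fun z hz => christoffel_symm h hz k i k
  simp only [e1, e2]
  congr 1
  · congr 1
    exact Finset.sum_congr rfl fun k _ => Finset.sum_congr rfl fun l _ => by
      rw [christoffel_symm h hy l i j]
  · exact Finset.sum_congr rfl fun k _ => Finset.sum_congr rfl fun l _ => by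
      rw [christoffel_symm h hy l i k]

/-- The contracted pair consists of one upper and one lower index, so the factor `J` on one meets
`J⁻¹` on the other. Only the two free indices keep a Jacobian. -/
lemma ricci_pull (h : IsMetricOn D' G) (hΦ : IsChange D D' Φ) (hy : y ∈ D) :
    ricci (pullM Φ G) y = (jac Φ y)ᵀ * ricci G (Φ y) * jac Φ y := by
  have hy' := hΦ.mapsTo y hy
  have hJ := hΦ.isUnit_det hy
  have e1 : ∀ a b, curv (pullM Φ G) a b y
      = ∑ i, ∑ j, (jac Φ y i a * jac Φ y j b) • ((jac Φ y)⁻¹ * curv G i j (Φ y) * jac Φ y) := by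
    intro a b
    have h1 := congrArg (fun X => (jac Φ y)⁻¹ * X) (curv_pull h hΦ hy a b)
    simp only [← Matrix.mul_assoc, Matrix.nonsing_inv_mul _ hJ, Matrix.one_mul] at h1
    rw [h1]
    simp only [Matrix.mul_sum, Matrix.sum_mul, Matrix.mul_smul, Matrix.smul_mul]
  have e2 : ∀ i k, ∑ c, jac Φ y i c * (jac Φ y)⁻¹ c k = if i = k then 1 else 0 := by
    intro i k
    have := congrFun (congrFun (Matrix.mul_nonsing_inv _ hJ) i) k
    rw [Matrix.mul_apply, Matrix.one_apply] at this
    exact this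
  ext a b
  rw [ricci_eq_curv (h.pull hΦ) hy]
  simp only [e1, Matrix.sum_apply, Matrix.smul_apply, smul_eq_mul]
  have e3 : ∀ i j, ∑ c, jac Φ y i c * jac Φ y j b
        * ((jac Φ y)⁻¹ * curv G i j (Φ y) * jac Φ y) c a
      = jac Φ y j b * ∑ l, curv G i j (Φ y) i l * jac Φ y l a := by
    intro i j
    have e4 : ∀ c, ((jac Φ y)⁻¹ * curv G i j (Φ y) * jac Φ y) c a
        = ∑ k, (jac Φ y)⁻¹ c k * ∑ l, curv G i j (Φ y) k l * jac Φ y l a := by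
      intro c
      rw [Matrix.mul_assoc, Matrix.mul_apply]
      exact Finset.sum_congr rfl fun k _ => by rw [Matrix.mul_apply]
    simp only [e4]
    have e5 : ∀ c, jac Φ y i c * jac Φ y j b * ∑ k, (jac Φ y)⁻¹ c k *
          ∑ l, curv G i j (Φ y) k l * jac Φ y l a
        = ∑ k, jac Φ y j b * (∑ l, curv G i j (Φ y) k l * jac Φ y l a) *
          (jac Φ y i c * (jac Φ y)⁻¹ c k) := by
      intro c
      rw [Finset.mul_sum]
      exact Finset.sum_congr rfl fun k _ => by ring
    simp only [e5]
    rw [Finset.sum_comm]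
    simp only [← Finset.mul_sum, e2]
    simp
  rw [Finset.sum_comm]
  have e6 : ∀ i, ∑ c, ∑ j, jac Φ y i c * jac Φ y j b
        * ((jac Φ y)⁻¹ * curv G i j (Φ y) * jac Φ y) c a
      = ∑ j, jac Φ y j b * ∑ l, curv G i j (Φ y) i l * jac Φ y l a := by
    intro i
    rw [Finset.sum_comm]
    exact Finset.sum_congr rfl fun j _ => e3 i j
  simp only [e6]
  simp only [Matrix.mul_apply, Matrix.transpose_apply, ricci_eq_curv h hy', Finset.mul_sum,
    Finset.sum_mul]
  rw [Finset.sum_comm]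
  refine Finset.sum_congr rfl fun j _ => ?_
  rw [Finset.sum_comm]
  exact Finset.sum_congr rfl fun l _ => Finset.sum_congr rfl fun i _ => by ring

/-- Raising one index turns a congruence into a conjugation. This is what makes traces, `sigma1` and
`sigma2` independent of coordinates. -/
lemma pullM_inv (hΦ : IsChange D D' Φ) (hy : y ∈ D) (X : Matrix (Fin n) (Fin n) ℝ) :
    (pullM Φ G y)⁻¹ * ((jac Φ y)ᵀ * X * jac Φ y) = (jac Φ y)⁻¹ * ((G (Φ y))⁻¹ * X) * jac Φ y := by
  have hJ := hΦ.isUnit_det hy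
  have hJt : IsUnit ((jac Φ y)ᵀ).det := by rwa [Matrix.det_transpose]
  unfold pullM
  rw [Matrix.mul_inv_rev, Matrix.mul_inv_rev]
  simp only [Matrix.mul_assoc]
  congr 2
  rw [← Matrix.mul_assoc ((jac Φ y)ᵀ)⁻¹, Matrix.nonsing_inv_mul _ hJt, Matrix.one_mul]

lemma trace_conj {J : Matrix (Fin n) (Fin n) ℝ} (hJ : IsUnit J.det) (X : Matrix (Fin n) (Fin n) ℝ) :
    (J⁻¹ * X * J).trace = X.trace := by
  rw [Matrix.trace_mul_comm, ← Matrix.mul_assoc, Matrix.mul_nonsing_inv _ hJ, Matrix.one_mul]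

lemma sigma1_conj {J : Matrix (Fin n) (Fin n) ℝ} (hJ : IsUnit J.det) (X : Matrix (Fin n) (Fin n) ℝ) :
    sigma1 (J⁻¹ * X * J) = sigma1 X := trace_conj hJ X

lemma sigma2_conj {J : Matrix (Fin n) (Fin n) ℝ} (hJ : IsUnit J.det) (X : Matrix (Fin n) (Fin n) ℝ) :
    sigma2 (J⁻¹ * X * J) = sigma2 X := by
  have e : J⁻¹ * X * J * (J⁻¹ * X * J) = J⁻¹ * (X * X) * J := by
    rw [show J⁻¹ * X * J * (J⁻¹ * X * J) = J⁻¹ * X * (J * J⁻¹) * X * J by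
      simp only [Matrix.mul_assoc], Matrix.mul_nonsing_inv _ hJ]
    simp only [Matrix.mul_assoc, Matrix.one_mul]
  unfold sigma2
  rw [e, trace_conj hJ, trace_conj hJ]

lemma scalarCurv_pull (h : IsMetricOn D' G) (hΦ : IsChange D D' Φ) (hy : y ∈ D) :
    scalarCurv (pullM Φ G) y = scalarCurv G (Φ y) := by
  unfold scalarCurv
  rw [ricci_pull h hΦ hy, pullM_inv hΦ hy, trace_conj (hΦ.isUnit_det hy)]

lemma schouten_pull (h : IsMetricOn D' G) (hΦ : IsChange D D' Φ) (hy : y ∈ D) :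
    schouten (pullM Φ G) y = (jac Φ y)ᵀ * schouten G (Φ y) * jac Φ y := by
  unfold schouten
  rw [scalarCurv_pull h hΦ hy, ricci_pull h hΦ hy]
  simp only [pullM, Matrix.mul_smul, Matrix.smul_mul, Matrix.mul_sub, Matrix.sub_mul]

end Metric

end

section

variable {n : ℕ}

/-! ### Normal coordinates -/

/-- Coordinates in which the metric is Euclidean to first order, for a frame `P` which is
orthonormal at `y₀`. -/
def normalMap (G : Euc n → Matrix (Fin n) (Fin n) ℝ) (y₀ : Euc n) (P : Fin n → Fin n → ℝ)
    (z : Euc n) : Euc n :=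
  WithLp.toLp 2 fun i => y₀ i + ∑ a, P i a * z a
    - (1 / 2) * ∑ j, ∑ k, christoffel G i j k y₀ * ((∑ a, P j a * z a) * ∑ a, P k a * z a)

lemma contDiff_coord (a : Fin n) : ContDiff ℝ ∞ (fun z : Euc n => z a) :=
  (EuclideanSpace.proj a : Euc n →L[ℝ] ℝ).contDiff

lemma contDiff_linear (p : Fin n → ℝ) : ContDiff ℝ ∞ (fun z : Euc n => ∑ a, p a * z a) :=
  ContDiff.sum fun a _ => contDiff_const.mul (contDiff_coord a)

lemma pd_linear (p : Fin n → ℝ) (c : Fin n) (y : Euc n) :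
    pd c (fun z => ∑ a, p a * z a) y = p c := by
  have h : ∀ a, pd c (fun z : Euc n => z a) y = if a = c then 1 else 0 := by
    intro a
    unfold pd
    rw [show (fun z : Euc n => z a) = (EuclideanSpace.proj a : Euc n →L[ℝ] ℝ) from rfl,
      ContinuousLinearMap.fderiv]
    simp [eq_comm]
  rw [pd_sum c fun a _ => (contDiff_const.mul (contDiff_coord a)).contDiffAt.smooth_differentiableAt]
  have h2 : ∀ a, pd c (fun z : Euc n => p a * z a) y = p a * if a = c then 1 else 0 := by
    intro a
    rw [pd_const_mul c _ (contDiff_coord a).contDiffAt.smooth_differentiableAt, h]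
  simp [h2]

section Normal

variable {D : Set (Euc n)} {G : Euc n → Matrix (Fin n) (Fin n) ℝ} {y₀ : Euc n}

lemma contDiff_normalMap (P : Fin n → Fin n → ℝ) : ContDiff ℝ ∞ (normalMap G y₀ P) := by
  rw [contDiff_euclidean]
  intro i
  simp only [normalMap]
  refine (contDiff_const.add (contDiff_linear _)).sub (contDiff_const.mul ?_)
  exact ContDiff.sum fun j _ => ContDiff.sum fun k _ => contDiff_const.mul
    ((contDiff_linear _).mul (contDiff_linear _))

lemma normalMap_zero (P : Fin n → Fin n → ℝ) : normalMap G y₀ P 0 = y₀ := by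
  ext i
  simp [normalMap]

lemma jac_normalMap (P : Fin n → Fin n → ℝ) (z : Euc n) (i c : Fin n) :
    jac (normalMap G y₀ P) z i c = P i c - (1 / 2) * ∑ j, ∑ k, christoffel G i j k y₀ *
      (P j c * (∑ a, P k a * z a) + (∑ a, P j a * z a) * P k c) := by
  have dl : ∀ j, DifferentiableAt ℝ (fun z : Euc n => ∑ a, P j a * z a) z :=
    fun j => (contDiff_linear (P j)).contDiffAt.smooth_differentiableAt
  have dt : ∀ j k, DifferentiableAt ℝ (fun z : Euc n => christoffel G i j k y₀ *
      ((∑ a, P j a * z a) * ∑ a, P k a * z a)) z :=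
    fun j k => (differentiableAt_const _).fun_mul ((dl j).fun_mul (dl k))
  have ds : ∀ j, DifferentiableAt ℝ (fun z : Euc n => ∑ k, christoffel G i j k y₀ *
      ((∑ a, P j a * z a) * ∑ a, P k a * z a)) z :=
    fun j => DifferentiableAt.fun_sum fun k _ => dt j k
  simp only [jac, Matrix.of_apply, normalMap]
  rw [pd_sub c ((differentiableAt_const _).fun_add (dl i))
    ((differentiableAt_const _).fun_mul (DifferentiableAt.fun_sum fun j _ => ds j)),
    pd_add c (differentiableAt_const _) (dl i), pd_linear, pd_const, zero_add,
    pd_const_mul c _ (DifferentiableAt.fun_sum fun j _ => ds j), pd_sum c fun j _ => ds j]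
  congr 2
  refine Finset.sum_congr rfl fun j _ => ?_
  rw [pd_sum c fun k _ => dt j k]
  refine Finset.sum_congr rfl fun k _ => ?_
  rw [pd_const_mul c _ ((dl j).fun_mul (dl k)), pd_mul c (dl j) (dl k), pd_linear, pd_linear]

lemma jac_normalMap_zero (P : Fin n → Fin n → ℝ) :
    jac (normalMap G y₀ P) 0 = Matrix.of P := by
  ext i c
  rw [jac_normalMap]
  simp

lemma pdM_jac_normalMap (P : Fin n → Fin n → ℝ) (z : Euc n) (a i c : Fin n) :
    pdM a (jac (normalMap G y₀ P)) z i c = - ((1 / 2) * ∑ j, ∑ k, christoffel G i j k y₀ *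
      (P j c * P k a + P j a * P k c)) := by
  have dl : ∀ j, DifferentiableAt ℝ (fun z : Euc n => ∑ a, P j a * z a) z :=
    fun j => (contDiff_linear (P j)).contDiffAt.smooth_differentiableAt
  have dt : ∀ j k, DifferentiableAt ℝ (fun z : Euc n => christoffel G i j k y₀ *
      (P j c * (∑ a, P k a * z a) + (∑ a, P j a * z a) * P k c)) z := fun j k =>
    (differentiableAt_const _).fun_mul (((differentiableAt_const _).fun_mul (dl k)).fun_add
      ((dl j).fun_mul (differentiableAt_const _)))
  have ds : ∀ j, DifferentiableAt ℝ (fun z : Euc n => ∑ k, christoffel G i j k y₀ *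
      (P j c * (∑ a, P k a * z a) + (∑ a, P j a * z a) * P k c)) z :=
    fun j => DifferentiableAt.fun_sum fun k _ => dt j k
  simp only [pdM, Matrix.of_apply]
  rw [show (fun z => jac (normalMap G y₀ P) z i c) = _ from funext fun z => jac_normalMap P z i c,
    pd_sub a (differentiableAt_const _)
    ((differentiableAt_const _).fun_mul (DifferentiableAt.fun_sum fun j _ => ds j)), pd_const, zero_sub,
    pd_const_mul a _ (DifferentiableAt.fun_sum fun j _ => ds j), pd_sum a fun j _ => ds j]
  congr 2
  refine Finset.sum_congr rfl fun j _ => ?_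
  rw [pd_sum a fun k _ => dt j k]
  refine Finset.sum_congr rfl fun k _ => ?_
  rw [pd_const_mul a _ (((differentiableAt_const _).fun_mul (dl k)).fun_add
      ((dl j).fun_mul (differentiableAt_const _))),
    pd_add a ((differentiableAt_const _).fun_mul (dl k)) ((dl j).fun_mul (differentiableAt_const _)),
    pd_const_mul a _ (dl k), pd_mul a (dl j) (differentiableAt_const _), pd_linear, pd_linear]
  simp

/-- A metric which is Euclidean to first order at the origin. -/
structure IsNormal (D : Set (Euc n)) (G : Euc n → Matrix (Fin n) (Fin n) ℝ) : Prop
    extends IsMetricOn D G where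
  zero_mem : (0 : Euc n) ∈ D
  eq_one : G 0 = 1
  christoffel_zero : ∀ k i j, christoffel G k i j 0 = 0
  pd_zero : ∀ l i j, pd l (fun z => G z i j) 0 = 0

lemma det_frame_ne {A P : Matrix (Fin n) (Fin n) ℝ} (hP : Pᵀ * A * P = 1) : P.det ≠ 0 := by
  intro h
  have := congrArg Matrix.det hP
  rw [Matrix.det_mul, h] at this
  simp at this

/-- No size of the domain is claimed: only derivatives at the origin are used later. -/
lemma isChange_normalMap (h : IsMetricOn D G) (hy : y₀ ∈ D) {P : Fin n → Fin n → ℝ}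
    (hP : (Matrix.of P)ᵀ * G y₀ * Matrix.of P = 1) :
    ∃ D₀ : Set (Euc n), (0 : Euc n) ∈ D₀ ∧ IsChange D₀ D (normalMap G y₀ P) := by
  have hc : Continuous (normalMap G y₀ P) := (contDiff_normalMap P).continuous
  have hj : Continuous fun z => (jac (normalMap G y₀ P) z).det := by
    refine Continuous.matrix_det (continuous_matrix fun i c => ?_)
    simp only [jac_normalMap]
    fun_prop
  refine ⟨normalMap G y₀ P ⁻¹' D ∩ {z | (jac (normalMap G y₀ P) z).det ≠ 0}, ⟨?_, ?_⟩, ?_⟩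
  · simpa [normalMap_zero] using hy
  · simpa [jac_normalMap_zero] using det_frame_ne hP
  · exact ⟨(h.isOpen.preimage hc).inter (isOpen_ne_fun hj continuous_const), fun z hz => hz.1,
      fun z _ => (contDiff_normalMap P).contDiffAt, fun z hz => hz.2⟩

/-- The quadratic part of `normalMap` is chosen so that the second derivatives of the map at the
origin cancel the Christoffel symbols in `conn_pull`. Metricity then kills the first derivatives of
the metric. A quadratic map suffices, so neither geodesics nor the exponential map are needed. -/
lemma isNormal_pull (h : IsMetricOn D G) (hy : y₀ ∈ D) {P : Fin n → Fin n → ℝ}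
    (hP : (Matrix.of P)ᵀ * G y₀ * Matrix.of P = 1) {D₀ : Set (Euc n)} (h0 : (0 : Euc n) ∈ D₀)
    (hD₀ : IsChange D₀ D (normalMap G y₀ P)) : IsNormal D₀ (pullM (normalMap G y₀ P) G) := by
  have hm := h.pull hD₀
  have hG : pullM (normalMap G y₀ P) G 0 = 1 := by
    unfold pullM
    rw [jac_normalMap_zero, normalMap_zero, hP]
  have hΓ : ∀ a, conn (pullM (normalMap G y₀ P) G) a 0 = 0 := by
    intro a
    have h1 := conn_pull h hD₀ h0 a
    have h2 : (∑ i, jac (normalMap G y₀ P) 0 i a • conn G i (normalMap G y₀ P 0))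
        * jac (normalMap G y₀ P) 0 + pdM a (jac (normalMap G y₀ P)) 0 = 0 := by
      ext i c
      rw [Matrix.add_apply, pdM_jac_normalMap, jac_normalMap_zero, normalMap_zero]
      simp only [Matrix.mul_apply, Matrix.sum_apply, Matrix.smul_apply, conn, Matrix.of_apply,
        smul_eq_mul, Matrix.zero_apply, mul_add, Finset.sum_add_distrib, Finset.sum_mul]
      have e1 : ∑ j, ∑ k, christoffel G i j k y₀ * (P j c * P k a)
          = ∑ j, ∑ k, christoffel G i j k y₀ * (P j a * P k c) := by
        rw [Finset.sum_comm]
        refine Finset.sum_congr rfl fun j _ => Finset.sum_congr rfl fun k _ => ?_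
        rw [christoffel_symm h hy]; ring
      have e2 : ∑ j, ∑ k, P k a * christoffel G i k j y₀ * P j c
          = ∑ j, ∑ k, christoffel G i j k y₀ * (P j a * P k c) := by
        rw [Finset.sum_comm]
        exact Finset.sum_congr rfl fun j _ => Finset.sum_congr rfl fun k _ => by ring
      rw [e1, e2]; ring
    rw [h2] at h1
    have h3 := congrArg (fun X => (jac (normalMap G y₀ P) 0)⁻¹ * X) h1
    simpa only [← Matrix.mul_assoc, Matrix.nonsing_inv_mul _ (hD₀.isUnit_det h0), Matrix.one_mul,
      Matrix.mul_zero] using h3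
  refine ⟨hm, h0, hG, fun k i j => congrFun (congrFun (hΓ i) k) j, fun l i j => ?_⟩
  have h4 := pdM_metric hm h0 l
  rw [hΓ] at h4
  rw [Matrix.transpose_zero, Matrix.zero_mul, Matrix.mul_zero, add_zero] at h4
  exact congrFun (congrFun h4 i) j

open scoped MatrixOrder Matrix.Norms.L2Operator in
lemma exists_eq_transpose_mul {A : Matrix (Fin n) (Fin n) ℝ} (hA : A.PosSemidef) :
    ∃ B : Matrix (Fin n) (Fin n) ℝ, A = Bᵀ * B := by
  obtain ⟨B, hB⟩ := CStarAlgebra.nonneg_iff_eq_star_mul_self.mp hA.nonneg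
  exact ⟨B, by simpa [Matrix.star_eq_conjTranspose] using hB⟩

lemma exists_sqrt {A : Matrix (Fin n) (Fin n) ℝ} (hA : A.PosDef) :
    ∃ B : Matrix (Fin n) (Fin n) ℝ, A = Bᵀ * B ∧ IsUnit B.det := by
  obtain ⟨B, hB⟩ := exists_eq_transpose_mul hA.posSemidef
  refine ⟨B, hB, ?_⟩
  have h := hA.det_pos
  rw [hB, Matrix.det_mul] at h
  exact (right_ne_zero_of_mul h.ne').isUnit

lemma exists_frame' {A : Matrix (Fin n) (Fin n) ℝ} (hA : A.PosDef) :
    ∃ P : Fin n → Fin n → ℝ, (Matrix.of P)ᵀ * A * Matrix.of P = 1 := by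
  obtain ⟨B, hB, hd⟩ := exists_sqrt hA
  refine ⟨(B⁻¹ : Matrix (Fin n) (Fin n) ℝ), ?_⟩
  show (B⁻¹)ᵀ * A * B⁻¹ = 1
  rw [hB, Matrix.mul_assoc, Matrix.mul_assoc, Matrix.mul_nonsing_inv _ hd, Matrix.mul_one,
    ← Matrix.transpose_mul, Matrix.mul_nonsing_inv _ hd, Matrix.transpose_one]

/-- A positive definite form has an orthonormal frame with a prescribed unit vector. -/
lemma exists_frame {A : Matrix (Fin n) (Fin n) ℝ} (hA : A.PosDef) (i₀ : Fin n) (e : Fin n → ℝ)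
    (he : e ⬝ᵥ A *ᵥ e = 1) :
    ∃ P : Fin n → Fin n → ℝ, (Matrix.of P)ᵀ * A * Matrix.of P = 1 ∧ ∀ i, P i i₀ = e i := by
  obtain ⟨B, hB, hd⟩ := exists_sqrt hA
  -- With `A = Bᵀ B`, the frame is `B⁻¹ O`, where `O` is orthogonal and has the unit vector `B e` as
  -- its column `i₀`.
  set w : Euc n := WithLp.toLp 2 (B *ᵥ e) with hw
  have hw1 : ‖w‖ = 1 := by
    rw [← sq_eq_sq₀ (norm_nonneg _) zero_le_one, EuclideanSpace.real_norm_sq_eq]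
    rw [hB, ← Matrix.mulVec_mulVec, Matrix.dotProduct_mulVec, Matrix.vecMul_transpose] at he
    rw [one_pow, ← he]
    simp [hw, dotProduct, pow_two]
  have ho : Orthonormal ℝ (({i₀} : Set (Fin n)).domRestrict fun _ => w) := by
    rw [orthonormal_iff_ite]
    rintro ⟨i, hi⟩ ⟨j, hj⟩
    have : i = j := by rw [hi, hj]
    subst this
    simp [Set.domRestrict_apply, hw1]
  obtain ⟨b, hb⟩ := ho.exists_orthonormalBasis_extension_of_card_eq (by simp)
  set O : Matrix (Fin n) (Fin n) ℝ := Matrix.of fun i j => b j i with hO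
  have hOO : Oᵀ * O = 1 := by
    ext i j
    have h1 := orthonormal_iff_ite.1 b.orthonormal i j
    rw [Matrix.one_apply, ← h1, PiLp.inner_apply]
    simp [hO, Matrix.mul_apply, mul_comm]
  refine ⟨(B⁻¹ * O : Matrix (Fin n) (Fin n) ℝ), ?_, fun i => ?_⟩
  · show (B⁻¹ * O)ᵀ * A * (B⁻¹ * O) = 1
    rw [hB, Matrix.mul_assoc, Matrix.mul_assoc, ← Matrix.mul_assoc B, Matrix.mul_nonsing_inv _ hd,
      Matrix.one_mul, ← Matrix.mul_assoc, ← Matrix.transpose_mul, ← Matrix.mul_assoc,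
      Matrix.mul_nonsing_inv _ hd, Matrix.one_mul, hOO]
  · have h2 : (fun j => O j i₀) = B *ᵥ e := by
      ext j
      simp [hO, hb i₀ rfl, hw]
    have h3 : (B⁻¹ * O) i i₀ = (B⁻¹ *ᵥ (fun j => O j i₀)) i := rfl
    rw [h3, h2, Matrix.mulVec_mulVec, Matrix.nonsing_inv_mul _ hd, Matrix.one_mulVec]

/-- Every point is the origin of normal coordinates. -/
lemma exists_normal (h : IsMetricOn D G) (hy : y₀ ∈ D) :
    ∃ (D₀ : Set (Euc n)) (Φ : Euc n → Euc n), Φ 0 = y₀ ∧ IsChange D₀ D Φ ∧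
      IsNormal D₀ (pullM Φ G) := by
  obtain ⟨P, hP⟩ := exists_frame' (h.posDef y₀ hy)
  obtain ⟨D₀, h0, hD₀⟩ := isChange_normalMap h hy hP
  exact ⟨D₀, _, normalMap_zero P, hD₀, isNormal_pull h hy hP h0 hD₀⟩

end Normal

end

section

variable {n : ℕ}

/-! ### Conformal change of the Schouten tensor -/

lemma pd_pd_mul {f g : Euc n → ℝ} {y : Euc n} (i j : Fin n) (hf : ContDiffAt ℝ ∞ f y)
    (hg : ContDiffAt ℝ ∞ g y) :
    pd i (pd j (fun z => f z * g z)) y = pd i (pd j f) y * g y + pd j f y * pd i g y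
      + (pd i f y * pd j g y + f y * pd i (pd j g) y) := by
  have ev : ∀ {f : Euc n → ℝ}, ContDiffAt ℝ ∞ f y → ∀ᶠ z in 𝓝 y, DifferentiableAt ℝ f z := by
    intro f hf
    have h1 : ContDiffAt ℝ 1 f y := hf.of_le (by exact_mod_cast le_top)
    filter_upwards [h1.eventually (by simp)] with z hz using hz.differentiableAt (by simp)
  have h1 : pd j (fun z => f z * g z) =ᶠ[𝓝 y] fun z => pd j f z * g z + f z * pd j g z := by
    filter_upwards [ev hf, ev hg] with z h1 h2 using pd_mul j h1 h2
  have df := hf.smooth_differentiableAt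
  have dg := hg.smooth_differentiableAt
  have df' := (contDiffAt_pd j hf).smooth_differentiableAt
  have dg' := (contDiffAt_pd j hg).smooth_differentiableAt
  rw [pd_congr i h1, pd_add i (df'.fun_mul dg) (df.fun_mul dg'), pd_mul i df' dg, pd_mul i df dg']

lemma pd_pd_add {f g : Euc n → ℝ} {y : Euc n} (i j : Fin n) (hf : ContDiffAt ℝ ∞ f y)
    (hg : ContDiffAt ℝ ∞ g y) :
    pd i (pd j (fun z => f z + g z)) y = pd i (pd j f) y + pd i (pd j g) y := by
  have ev : ∀ {f : Euc n → ℝ}, ContDiffAt ℝ ∞ f y → ∀ᶠ z in 𝓝 y, DifferentiableAt ℝ f z := by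
    intro f hf
    have h1 : ContDiffAt ℝ 1 f y := hf.of_le (by exact_mod_cast le_top)
    filter_upwards [h1.eventually (by simp)] with z hz using hz.differentiableAt (by simp)
  have h1 : pd j (fun z => f z + g z) =ᶠ[𝓝 y] fun z => pd j f z + pd j g z := by
    filter_upwards [ev hf, ev hg] with z h1 h2 using pd_add j h1 h2
  rw [pd_congr i h1, pd_add i (contDiffAt_pd j hf).smooth_differentiableAt
    (contDiffAt_pd j hg).smooth_differentiableAt]

lemma pd_pd_const {y : Euc n} (i j : Fin n) (c : ℝ) : pd i (pd j (fun _ => c)) y = 0 := by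
  rw [show pd j (fun _ : Euc n => c) = fun _ => 0 from funext fun z => pd_const j c z, pd_const]

lemma pd_pd_const_mul {f : Euc n → ℝ} {y : Euc n} (i j : Fin n) (c : ℝ) (hf : ContDiffAt ℝ ∞ f y) :
    pd i (pd j (fun z => c * f z)) y = c * pd i (pd j f) y := by
  rw [pd_pd_mul i j contDiffAt_const hf, pd_pd_const, pd_const, pd_const]; ring

lemma pd_pd_sub {f g : Euc n → ℝ} {y : Euc n} (i j : Fin n) (hf : ContDiffAt ℝ ∞ f y)
    (hg : ContDiffAt ℝ ∞ g y) :
    pd i (pd j (fun z => f z - g z)) y = pd i (pd j f) y - pd i (pd j g) y := by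
  have := pd_pd_add i j hf (contDiffAt_const (c := (-1 : ℝ)) |>.mul hg)
  rw [pd_pd_const_mul i j _ hg] at this
  rw [show (fun z => f z - g z) = fun z => f z + (-1) * g z from funext fun z => by ring, this]
  ring

lemma pd_pd_sum {ι : Type*} {s : Finset ι} {f : ι → Euc n → ℝ} {y : Euc n} (i j : Fin n)
    (hf : ∀ a ∈ s, ContDiffAt ℝ ∞ (f a) y) :
    pd i (pd j (fun z => ∑ a ∈ s, f a z)) y = ∑ a ∈ s, pd i (pd j (f a)) y := by
  classical
  induction s using Finset.induction_on with
  | empty => simp [pd_pd_const]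
  | insert a s ha ih =>
    simp only [Finset.sum_insert ha]
    rw [pd_pd_add i j (hf a (Finset.mem_insert_self a s))
      (ContDiffAt.sum fun b hb => hf b (Finset.mem_insert_of_mem hb)),
      ih fun b hb => hf b (Finset.mem_insert_of_mem hb)]

/-- The differential as a vector of partial derivatives. -/
def grad (v : Euc n → ℝ) (y : Euc n) : Fin n → ℝ := fun i => pd i v y

/-- The squared length of the gradient. -/
def gradSq (G : Euc n → Matrix (Fin n) (Fin n) ℝ) (v : Euc n → ℝ) (y : Euc n) : ℝ :=
  grad v y ⬝ᵥ (G y)⁻¹ *ᵥ grad v y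

/-- The conformal metric `e^{-2v} G`. -/
def confM (v : Euc n → ℝ) (G : Euc n → Matrix (Fin n) (Fin n) ℝ) (y : Euc n) :
    Matrix (Fin n) (Fin n) ℝ :=
  Real.exp (-2 * v y) • G y

/-- The Schouten tensor of `e^{-2v} G`, see `schouten_confM`. -/
def Wmat (G : Euc n → Matrix (Fin n) (Fin n) ℝ) (v : Euc n → ℝ) (y : Euc n) :
    Matrix (Fin n) (Fin n) ℝ :=
  schouten G y + hessian G v y + Matrix.vecMulVec (grad v y) (grad v y) - (gradSq G v y / 2) • G y

section Metric

variable {D D' : Set (Euc n)} {G : Euc n → Matrix (Fin n) (Fin n) ℝ} {Φ : Euc n → Euc n} {y : Euc n}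
  {v : Euc n → ℝ}

lemma grad_pull (hΦ : IsChange D D' Φ) (hy : y ∈ D) (hv : ContDiffAt ℝ ∞ v (Φ y)) :
    grad (fun z => v (Φ z)) y = (jac Φ y)ᵀ *ᵥ grad v (Φ y) := by
  ext a
  exact pd_comp a hv.smooth_differentiableAt ((hΦ.smooth y hy).differentiableAt (by simp))

lemma gradSq_pull (hΦ : IsChange D D' Φ) (hy : y ∈ D) (hv : ContDiffAt ℝ ∞ v (Φ y)) :
    gradSq (pullM Φ G) (fun z => v (Φ z)) y = gradSq G v (Φ y) := by
  have hJ := hΦ.isUnit_det hy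
  have hJt : IsUnit ((jac Φ y)ᵀ).det := by rwa [Matrix.det_transpose]
  unfold gradSq
  rw [grad_pull hΦ hy hv, pullM, Matrix.mul_inv_rev, Matrix.mul_inv_rev, Matrix.mulVec_mulVec,
    ← Matrix.mul_assoc, Matrix.mul_assoc _ ((jac Φ y)ᵀ)⁻¹, Matrix.nonsing_inv_mul _ hJt,
    Matrix.mul_one, Matrix.mulVec_transpose, ← Matrix.dotProduct_mulVec, Matrix.mulVec_mulVec,
    ← Matrix.mul_assoc, Matrix.mul_nonsing_inv _ hJ, Matrix.one_mul]

lemma Wmat_pull (h : IsMetricOn D' G) (hΦ : IsChange D D' Φ) (hy : y ∈ D)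
    (hv : ∀ z ∈ D', ContDiffAt ℝ ∞ v z) :
    Wmat (pullM Φ G) (fun z => v (Φ z)) y = (jac Φ y)ᵀ * Wmat G v (Φ y) * jac Φ y := by
  have hv' := hv _ (hΦ.mapsTo y hy)
  unfold Wmat
  rw [schouten_pull h hΦ hy, hessian_pull h hΦ hy hv, gradSq_pull hΦ hy hv', grad_pull hΦ hy hv']
  simp only [Matrix.mul_add, Matrix.add_mul, Matrix.mul_sub, Matrix.sub_mul, Matrix.mul_smul,
    Matrix.smul_mul, pullM]
  congr 2
  rw [Matrix.mul_vecMulVec, Matrix.vecMulVec_mul, Matrix.mulVec_transpose]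

lemma pullM_confM : pullM Φ (confM v G) = confM (fun z => v (Φ z)) (pullM Φ G) := by
  ext1 z
  simp only [pullM, confM, Matrix.mul_smul, Matrix.smul_mul]

lemma IsMetricOn.conf (h : IsMetricOn D G) (hv : ∀ z ∈ D, ContDiffAt ℝ ∞ v z) :
    IsMetricOn D (confM v G) where
  isOpen := h.isOpen
  smooth y hy i j := ((contDiffAt_const.mul (hv y hy)).exp).mul (h.smooth y hy i j)
  posDef y hy := (h.posDef y hy).smul (Real.exp_pos _)

/-- The right-hand side is symmetric in the lower indices and metric for the conformal metric, so
`conn_unique` applies. -/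
lemma conn_conf (h : IsMetricOn D G) (hv : ∀ z ∈ D, ContDiffAt ℝ ∞ v z) (hy : y ∈ D) (i : Fin n) :
    conn (confM v G) i y = conn G i y + Matrix.of fun k j =>
      (- pd i v y * (1 : Matrix (Fin n) (Fin n) ℝ) k j - pd j v y * (1 : Matrix (Fin n) (Fin n) ℝ) k i
        + G y i j * ((G y)⁻¹ *ᵥ grad v y) k) := by
  set B : Fin n → Matrix (Fin n) (Fin n) ℝ := fun i => Matrix.of fun k j =>
      (- pd i v y * (1 : Matrix (Fin n) (Fin n) ℝ) k j - pd j v y * (1 : Matrix (Fin n) (Fin n) ℝ) k i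
        + G y i j * ((G y)⁻¹ *ᵥ grad v y) k) with hB
  refine conn_unique (h.conf hv) hy (fun i => conn G i y + B i) ?_ ?_ i
  · intro i j k
    simp only [hB, conn, Matrix.add_apply, Matrix.of_apply]
    rw [christoffel_symm h hy k i j, h.symm_apply hy i j]; ring
  · intro i
    have hGB : ∀ i a j, (G y * B i) a j = - pd i v y * G y a j - pd j v y * G y a i
        + G y i j * pd a v y := by
      intro i a j
      simp only [Matrix.mul_apply, hB, Matrix.of_apply, mul_add, mul_sub, Finset.sum_add_distrib,
        Finset.sum_sub_distrib, Matrix.one_apply]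
      have e1 : ∑ k, G y a k * (G y i j * ((G y)⁻¹ *ᵥ grad v y) k) = G y i j * pd a v y := by
        have : (G y *ᵥ ((G y)⁻¹ *ᵥ grad v y)) a = pd a v y := by
          rw [Matrix.mulVec_mulVec, Matrix.mul_nonsing_inv _ (h.isUnit_det hy), Matrix.one_mulVec]; rfl
        rw [← this, Matrix.mulVec, dotProduct, Finset.mul_sum]
        exact Finset.sum_congr rfl fun k _ => by ring
      rw [e1]
      simp [mul_comm]
    have h1 : (B i)ᵀ * G y = (G y * B i)ᵀ := by rw [Matrix.transpose_mul, h.symm hy]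
    have h2 : pdM i (confM v G) y = Real.exp (-2 * v y) • (pdM i G y - (2 * pd i v y) • G y) := by
      ext a b
      simp only [pdM, confM, Matrix.of_apply, Matrix.smul_apply, smul_eq_mul, Matrix.sub_apply]
      have he : ContDiffAt ℝ ∞ (fun z => Real.exp (-2 * v z)) y := (contDiffAt_const.mul (hv y hy)).exp
      rw [pd_mul i he.smooth_differentiableAt (h.smooth y hy a b).smooth_differentiableAt]
      have he2 : pd i (fun z => Real.exp (-2 * v z)) y = Real.exp (-2 * v y) * (-2 * pd i v y) := by
        unfold pd
        rw [fderiv_exp ((hv y hy).smooth_differentiableAt.const_mul _),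
          fderiv_const_mul (hv y hy).smooth_differentiableAt]
        simp
      rw [he2]; ring
    rw [h2, pdM_metric h hy i]
    simp only [confM, Matrix.transpose_add, Matrix.add_mul, Matrix.mul_add, Matrix.mul_smul,
      Matrix.smul_mul]
    rw [h1, ← smul_add]
    ext a b
    simp only [Matrix.add_apply, Matrix.sub_apply, Matrix.smul_apply, smul_eq_mul,
      Matrix.transpose_apply, hGB]
    rw [h.symm_apply hy b a, h.symm_apply hy i b, h.symm_apply hy i a]; ring

lemma IsNormal.inv_zero (h : IsNormal D G) : (G 0)⁻¹ = 1 := by rw [h.eq_one, inv_one]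

/-- Differentiate `G G⁻¹ = 1` where the first derivatives of `G` vanish. -/
lemma IsNormal.pd_inv_zero (h : IsNormal D G) (l i j : Fin n) :
    pd l (fun z => (G z)⁻¹ i j) 0 = 0 := by
  have h0 := h.zero_mem
  have h1 : pdM l (fun z => G z * (G z)⁻¹) 0 = 0 := by
    rw [pdM_congr_on h.isOpen h0 l (Y := fun _ => 1) fun z hz =>
      Matrix.mul_nonsing_inv _ (h.isUnit_det hz)]
    ext a b
    simp [pdM]
  rw [pdM_mul l (fun a b => (h.smooth 0 h0 a b).smooth_differentiableAt)
    (fun a b => (h.smooth_inv h0 a b).smooth_differentiableAt)] at h1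
  have h2 : pdM l G 0 = 0 := by ext a b; exact h.pd_zero l a b
  rw [h2, Matrix.zero_mul, zero_add, h.eq_one, Matrix.one_mul] at h1
  exact congrFun (congrFun h1 i) j

/-- The Hessian and the gradient at the origin of normal coordinates. -/
lemma IsNormal.hessian_zero (h : IsNormal D G) (f : Euc n → ℝ) (i j : Fin n) :
    hessian G f 0 i j = pd i (pd j f) 0 := by
  simp [hessian, h.christoffel_zero]

lemma IsNormal.gradSq_zero (h : IsNormal D G) (f : Euc n → ℝ) :
    gradSq G f 0 = ∑ i, pd i f 0 ^ 2 := by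
  simp [gradSq, h.inv_zero, dotProduct, grad, pow_two]

lemma IsNormal.ricci_zero (h : IsNormal D G) (i j : Fin n) :
    ricci G 0 i j = ∑ k, pd k (christoffel G k i j) 0 - ∑ k, pd j (christoffel G k i k) 0 := by
  simp [ricci, h.christoffel_zero]

/-- The conformal change of the Ricci tensor, in normal coordinates. -/
lemma IsNormal.ricci_conf (h : IsNormal D G) (hv : ∀ z ∈ D, ContDiffAt ℝ ∞ v z) (i j : Fin n) :
    ricci (confM v G) 0 i j = ricci G 0 i j + ((n : ℝ) - 2) * (pd i (pd j v) 0 + pd i v 0 * pd j v 0)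
      + (∑ k, pd k (pd k v) 0 - ((n : ℝ) - 2) * ∑ k, pd k v 0 ^ 2)
        * (1 : Matrix (Fin n) (Fin n) ℝ) i j := by
  have h0 := h.zero_mem
  have hm := h.toIsMetricOn
  have hc : ∀ k i j, ∀ z ∈ D, christoffel (confM v G) k i j z = christoffel G k i j z
      + (- pd i v z * (1 : Matrix (Fin n) (Fin n) ℝ) k j
        - pd j v z * (1 : Matrix (Fin n) (Fin n) ℝ) k i
        + G z i j * ∑ l, (G z)⁻¹ k l * pd l v z) :=
    fun k i j z hz => congrFun (congrFun (conn_conf hm hv hz i) k) j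
  have dv : ∀ i, DifferentiableAt ℝ (pd i v) 0 :=
    fun i => (contDiffAt_pd i (hv 0 h0)).smooth_differentiableAt
  have dG : ∀ i j, DifferentiableAt ℝ (fun z => G z i j) 0 :=
    fun i j => (hm.smooth 0 h0 i j).smooth_differentiableAt
  have dP : ∀ i j, DifferentiableAt ℝ (fun z => (G z)⁻¹ i j) 0 :=
    fun i j => (hm.smooth_inv h0 i j).smooth_differentiableAt
  have dS : ∀ k, DifferentiableAt ℝ (fun z => ∑ l, (G z)⁻¹ k l * pd l v z) 0 :=
    fun k => DifferentiableAt.fun_sum fun l _ => (dP k l).fun_mul (dv l)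
  -- At the origin only the gradient terms survive in the new symbols. They produce the quadratic
  -- terms in the gradient, while `hc1` adds the second derivatives of `v` to the old curvature.
  have hc0 : ∀ k i j, christoffel (confM v G) k i j 0 =
      - pd i v 0 * (1 : Matrix (Fin n) (Fin n) ℝ) k j
        - pd j v 0 * (1 : Matrix (Fin n) (Fin n) ℝ) k i
        + (1 : Matrix (Fin n) (Fin n) ℝ) i j * pd k v 0 := by
    intro k i j
    rw [hc k i j 0 h0, h.christoffel_zero, h.inv_zero, h.eq_one]
    simp [Matrix.one_apply]
  have hc1 : ∀ m k i j, pd m (christoffel (confM v G) k i j) 0 = pd m (christoffel G k i j) 0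
      + (- pd m (pd i v) 0 * (1 : Matrix (Fin n) (Fin n) ℝ) k j
        - pd m (pd j v) 0 * (1 : Matrix (Fin n) (Fin n) ℝ) k i
        + (1 : Matrix (Fin n) (Fin n) ℝ) i j * pd m (pd k v) 0) := by
    intro m k i j
    have d1 : ∀ i (c : ℝ), DifferentiableAt ℝ (fun z => - pd i v z * c) 0 :=
      fun i c => ((dv i).fun_neg).fun_mul (differentiableAt_const _)
    have d2 : ∀ i (c : ℝ), DifferentiableAt ℝ (fun z => pd i v z * c) 0 :=
      fun i c => (dv i).fun_mul (differentiableAt_const _)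
    rw [pd_congr_on hm.isOpen h0 m (hc k i j),
      pd_add m (hm.smooth_christoffel h0 k i j).smooth_differentiableAt
        (((d1 _ _).fun_sub (d2 _ _)).fun_add ((dG i j).fun_mul (dS k))),
      pd_add m ((d1 _ _).fun_sub (d2 _ _)) ((dG i j).fun_mul (dS k)),
      pd_sub m (d1 _ _) (d2 _ _), pd_mul m ((dv i).fun_neg) (differentiableAt_const _),
      pd_mul m (dv j) (differentiableAt_const _), pd_mul m (dG i j) (dS k), h.pd_zero, pd_neg,
      pd_sum m fun l _ => (dP k l).fun_mul (dv l), h.eq_one]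
    have e : ∀ l, pd m (fun z => (G z)⁻¹ k l * pd l v z) 0
        = (1 : Matrix (Fin n) (Fin n) ℝ) k l * pd m (pd l v) 0 := by
      intro l
      rw [pd_mul m (dP k l) (dv l), h.pd_inv_zero, h.inv_zero]; ring
    simp [e, Matrix.one_apply]
  have hcomm : ∀ a b, pd a (pd b v) 0 = pd b (pd a v) 0 := fun a b => pd_comm a b (hv 0 h0)
  rw [h.ricci_zero]
  simp only [ricci, Matrix.of_apply, hc0, hc1]
  simp only [Matrix.one_apply, mul_add, add_mul, mul_sub, sub_mul, Finset.sum_add_distrib,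
    Finset.sum_sub_distrib, mul_ite, ite_mul, mul_one, mul_zero, one_mul, zero_mul,
    Finset.sum_ite_eq, Finset.sum_ite_eq', Finset.mem_univ, if_true, Finset.sum_const,
    Finset.card_univ, Fintype.card_fin, nsmul_eq_mul, Finset.sum_neg_distrib, neg_mul, mul_neg]
  by_cases hij : i = j
  · subst hij
    simp [pow_two, Finset.sum_add_distrib, Finset.sum_sub_distrib]
    ring
  · simp [hij, Ne.symm hij, Finset.sum_add_distrib]
    rw [hcomm j i]
    ring

end Metric

end

/-! ### The conformal Schouten tensor and the contracted Bianchi identity. -/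

section

variable {n : ℕ}

section Metric

variable {D D' : Set (Euc n)} {G : Euc n → Matrix (Fin n) (Fin n) ℝ} {Φ : Euc n → Euc n} {y : Euc n}
  {v : Euc n → ℝ}

/-- Carries tensor identities proved at the origin of normal coordinates back to arbitrary
coordinates. -/
lemma eq_of_conj_eq {J X Y : Matrix (Fin n) (Fin n) ℝ} (hJ : IsUnit J.det)
    (h : Jᵀ * X * J = Jᵀ * Y * J) : X = Y := by
  have hJt : IsUnit (Jᵀ).det := by rwa [Matrix.det_transpose]
  have h1 := congrArg (fun Z => (Jᵀ)⁻¹ * Z * J⁻¹) h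
  simpa only [Matrix.mul_assoc, Matrix.mul_nonsing_inv _ hJ, Matrix.mul_one, ← Matrix.mul_assoc,
    Matrix.nonsing_inv_mul _ hJt, Matrix.one_mul, Matrix.mul_nonsing_inv_cancel_right _ _ hJ] using h1

lemma IsNormal.scalarCurv_zero (h : IsNormal D G) : scalarCurv G 0 = ∑ i, ricci G 0 i i := by
  simp [scalarCurv, h.inv_zero, Matrix.trace]

/-- The conformal change of the Schouten tensor, in normal coordinates. -/
lemma IsNormal.schouten_conf (hn : 2 < n) (h : IsNormal D G) (hv : ∀ z ∈ D, ContDiffAt ℝ ∞ v z) :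
    schouten (confM v G) 0 = Wmat G v 0 := by
  have hn2 : (n : ℝ) - 2 ≠ 0 := by
    have : (2 : ℝ) < n := by exact_mod_cast hn
    linarith
  have hn1 : (n : ℝ) - 1 ≠ 0 := by
    have : (2 : ℝ) < n := by exact_mod_cast hn
    linarith
  have hE := (Real.exp_pos (-2 * v 0)).ne'
  have hs : Real.exp (-2 * v 0) * scalarCurv (confM v G) 0 = ∑ i, ricci (confM v G) 0 i i := by
    simp only [scalarCurv, confM, h.eq_one]
    have e : (Real.exp (-2 * v 0) • (1 : Matrix (Fin n) (Fin n) ℝ))⁻¹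
        = (Real.exp (-2 * v 0))⁻¹ • 1 := by
      refine Matrix.inv_eq_left_inv ?_
      rw [Matrix.smul_mul, Matrix.mul_smul, smul_smul, inv_mul_cancel₀ hE]; simp
    rw [e, Matrix.smul_mul, Matrix.one_mul, Matrix.trace_smul, smul_eq_mul, mul_inv_cancel_left₀ hE]
    rfl
  have hs2 : ∑ i, ricci (confM v G) 0 i i = scalarCurv G 0 + (2 * n - 2) * ∑ k, pd k (pd k v) 0
      - ((n : ℝ) - 2) * (n - 1) * ∑ k, pd k v 0 ^ 2 := by
    rw [h.scalarCurv_zero]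
    simp only [h.ricci_conf hv, Finset.sum_add_distrib, ← Finset.mul_sum, ← pow_two]
    simp
    ring
  ext i j
  have e : schouten (confM v G) 0 i j = (1 / ((n : ℝ) - 2)) * (ricci (confM v G) 0 i j
      - (Real.exp (-2 * v 0) * scalarCurv (confM v G) 0) / (2 * ((n : ℝ) - 1))
        * (1 : Matrix (Fin n) (Fin n) ℝ) i j) := by
    simp only [schouten, Matrix.smul_apply, Matrix.sub_apply, smul_eq_mul, confM, h.eq_one]
    ring
  rw [e, hs, hs2, h.ricci_conf hv]
  simp only [Wmat, schouten, Matrix.smul_apply, Matrix.sub_apply, Matrix.add_apply, smul_eq_mul,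
    h.hessian_zero, h.gradSq_zero, h.eq_one, Matrix.vecMulVec_apply, grad]
  field_simp
  ring

/-- The conformal change of the Schouten tensor. -/
lemma schouten_confM (hn : 2 < n) (h : IsMetricOn D G) (hv : ∀ z ∈ D, ContDiffAt ℝ ∞ v z)
    (hy : y ∈ D) : schouten (confM v G) y = Wmat G v y := by
  obtain ⟨D₀, Φ, hΦ0, hΦ, hN⟩ := exists_normal h hy
  have hv' : ∀ z ∈ D₀, ContDiffAt ℝ ∞ (fun w => v (Φ w)) z :=
    fun z hz => (hv _ (hΦ.mapsTo z hz)).comp z (hΦ.smooth z hz)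
  have h1 := hN.schouten_conf hn hv'
  rw [← pullM_confM, schouten_pull (h.conf hv) hΦ hN.zero_mem, Wmat_pull h hΦ hN.zero_mem hv] at h1
  rw [← hΦ0]
  exact eq_of_conj_eq (hΦ.isUnit_det hN.zero_mem) h1

/-! ### The contracted Bianchi identity -/

/-- Second derivatives of Christoffel symbols at the origin of normal coordinates. -/
lemma IsNormal.pd_pd_christoffel (h : IsNormal D G) (l m k i j : Fin n) :
    pd l (pd m (christoffel G k i j)) 0 = (1 / 2) * (pd l (pd m (pd i fun z => G z j k)) 0
      + pd l (pd m (pd j fun z => G z i k)) 0 - pd l (pd m (pd k fun z => G z i j)) 0) := by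
  have h0 := h.zero_mem
  have hm := h.toIsMetricOn
  have sG : ∀ i j, ContDiffAt ℝ ∞ (fun z => G z i j) 0 := fun i j => hm.smooth 0 h0 i j
  have sΓ : ∀ k, ContDiffAt ℝ ∞ (christoffel G k i j) 0 := fun k => hm.smooth_christoffel h0 k i j
  have e1 : (fun z => ∑ a, G z k a * christoffel G a i j z) =ᶠ[𝓝 0] fun z => (1 / 2) *
      (pd i (fun w => G w j k) z + pd j (fun w => G w i k) z - pd k (fun w => G w i j) z) := by
    filter_upwards [hm.isOpen.mem_nhds h0] with z hz
    rw [← conn_lower hm hz i j k]; rfl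
  -- Lowering the index does not change the second derivatives at the origin: the first derivatives
  -- of `G` vanish there, and its second derivatives multiply Christoffel symbols that vanish.
  have e2 : pd l (pd m fun z => ∑ a, G z k a * christoffel G a i j z) 0
      = pd l (pd m (christoffel G k i j)) 0 := by
    rw [pd_pd_sum l m fun a _ => (sG k a).mul (sΓ a)]
    have : ∀ a, pd l (pd m fun z => G z k a * christoffel G a i j z) 0
        = (1 : Matrix (Fin n) (Fin n) ℝ) k a * pd l (pd m (christoffel G a i j)) 0 := by
      intro a
      rw [pd_pd_mul l m (sG k a) (sΓ a), h.pd_zero, h.pd_zero, h.christoffel_zero, h.eq_one]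
      ring
    simp [this, Matrix.one_apply]
  have e3 : pd m (fun z => ∑ a, G z k a * christoffel G a i j z) =ᶠ[𝓝 0] pd m fun z => (1 / 2) *
      (pd i (fun w => G w j k) z + pd j (fun w => G w i k) z - pd k (fun w => G w i j) z) := by
    filter_upwards [e1.eventuallyEq_nhds] with z hz using pd_congr m hz
  rw [← e2, pd_congr l e3]
  have s1 := fun a b c => contDiffAt_pd a (sG b c)
  rw [pd_pd_const_mul l m _ (((s1 i j k).add (s1 j i k)).sub (s1 k i j)),
    pd_pd_sub l m ((s1 i j k).add (s1 j i k)) (s1 k i j), pd_pd_add l m (s1 i j k) (s1 j i k)]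

lemma IsNormal.pd_christoffel (h : IsNormal D G) (m k i j : Fin n) :
    pd m (christoffel G k i j) 0 = (1 / 2) * (pd m (pd i fun z => G z j k) 0
      + pd m (pd j fun z => G z i k) 0 - pd m (pd k fun z => G z i j) 0) := by
  have h0 := h.zero_mem
  have hm := h.toIsMetricOn
  have sG : ∀ i j, ContDiffAt ℝ ∞ (fun z => G z i j) 0 := fun i j => hm.smooth 0 h0 i j
  have sΓ : ∀ k, ContDiffAt ℝ ∞ (christoffel G k i j) 0 := fun k => hm.smooth_christoffel h0 k i j
  have e1 : (fun z => ∑ a, G z k a * christoffel G a i j z) =ᶠ[𝓝 0] fun z => (1 / 2) *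
      (pd i (fun w => G w j k) z + pd j (fun w => G w i k) z - pd k (fun w => G w i j) z) := by
    filter_upwards [hm.isOpen.mem_nhds h0] with z hz
    rw [← conn_lower hm hz i j k]; rfl
  have e2 : pd m (fun z => ∑ a, G z k a * christoffel G a i j z) 0
      = pd m (christoffel G k i j) 0 := by
    rw [pd_sum m fun a _ => ((sG k a).mul (sΓ a)).smooth_differentiableAt]
    have : ∀ a, pd m (fun z => G z k a * christoffel G a i j z) 0
        = (1 : Matrix (Fin n) (Fin n) ℝ) k a * pd m (christoffel G a i j) 0 := by
      intro a
      rw [pd_mul m (sG k a).smooth_differentiableAt (sΓ a).smooth_differentiableAt, h.pd_zero, h.eq_one]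
      ring
    simp [this, Matrix.one_apply]
  rw [← e2, pd_congr m e1]
  have s1 := fun a b c => (contDiffAt_pd a (sG b c)).smooth_differentiableAt
  rw [pd_const_mul m _ (((s1 i j k).fun_add (s1 j i k)).fun_sub (s1 k i j)),
    pd_sub m ((s1 i j k).fun_add (s1 j i k)) (s1 k i j), pd_add m (s1 i j k) (s1 j i k)]

lemma IsMetricOn.pd_fun_symm (h : IsMetricOn D G) (hy : y ∈ D) (l m i j : Fin n) :
    pd m (pd l fun z => G z i j) y = pd m (pd l fun z => G z j i) y :=
  pd_congr_on h.isOpen hy m fun _ hz => h.pd_symm hz l i j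

/-- At the origin of normal coordinates the Ricci tensor is linear in the second derivatives of the
metric, and the symmetry reduces to commuting partial derivatives. -/
lemma ricci_symm (h : IsMetricOn D G) (hy : y ∈ D) : (ricci G y)ᵀ = ricci G y := by
  obtain ⟨D₀, Φ, hΦ0, hΦ, hN⟩ := exists_normal h hy
  have h0 := hN.zero_mem
  have hm := hN.toIsMetricOn
  have h1 : (ricci (pullM Φ G) 0)ᵀ = ricci (pullM Φ G) 0 := by
    ext i j
    rw [Matrix.transpose_apply, hN.ricci_zero, hN.ricci_zero]
    simp only [hN.pd_christoffel]
    rw [← Finset.sum_sub_distrib, ← Finset.sum_sub_distrib]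
    refine Finset.sum_congr rfl fun k _ => ?_
    have c : ∀ a b c d, pd a (pd b fun z => pullM Φ G z c d) 0
        = pd b (pd a fun z => pullM Φ G z c d) 0 := fun a b c d => pd_comm a b (hm.smooth 0 h0 c d)
    rw [hm.pd_fun_symm h0 k k j i, c j i k k]
    ring
  rw [ricci_pull h hΦ h0, Matrix.transpose_mul, Matrix.transpose_mul, Matrix.transpose_transpose,
    ← Matrix.mul_assoc] at h1
  have h2 := eq_of_conj_eq (hΦ.isUnit_det h0) h1
  rwa [hΦ0] at h2

lemma schouten_symm (h : IsMetricOn D G) (hy : y ∈ D) : (schouten G y)ᵀ = schouten G y := by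
  simp only [schouten, Matrix.transpose_smul, Matrix.transpose_sub, ricci_symm h hy, h.symm hy]

/-- The contracted second Bianchi identity. -/
lemma IsNormal.bianchi (h : IsNormal D G) (j : Fin n) :
    ∑ i, pd i (fun z => ricci G z i j) 0 = (1 / 2) * ∑ i, pd j (fun z => ricci G z i i) 0 := by
  have h0 := h.zero_mem
  have hm := h.toIsMetricOn
  have sΓ : ∀ k i j, ContDiffAt ℝ ∞ (christoffel G k i j) 0 :=
    fun k i j => hm.smooth_christoffel h0 k i j
  have dΓ := fun k i j => (sΓ k i j).smooth_differentiableAt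
  have dΓ' := fun l k i j => (contDiffAt_pd l (sΓ k i j)).smooth_differentiableAt
  -- The products of two Christoffel symbols vanish to second order, so the derivative of the Ricci
  -- tensor is linear in the third derivatives of the metric.
  have key : ∀ l i j, pd l (fun z => ricci G z i j) 0 = ∑ k, pd l (pd k (christoffel G k i j)) 0
      - ∑ k, pd l (pd j (christoffel G k i k)) 0 := by
    intro l i j
    simp only [ricci, Matrix.of_apply]
    have dq : ∀ (a b c d e f : Fin n), DifferentiableAt ℝ
        (fun z => christoffel G a b c z * christoffel G d e f z) 0 :=
      fun a b c d e f => (dΓ a b c).fun_mul (dΓ d e f)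
    have q0 : ∀ (a b c d e f : Fin n),
        pd l (fun z => christoffel G a b c z * christoffel G d e f z) 0 = 0 := by
      intro a b c d e f
      rw [pd_mul l (dΓ a b c) (dΓ d e f), h.christoffel_zero, h.christoffel_zero]; ring
    have d1 : DifferentiableAt ℝ (fun z => ∑ k, pd k (christoffel G k i j) z) 0 :=
      DifferentiableAt.fun_sum fun k _ => dΓ' k k i j
    have d2 : DifferentiableAt ℝ (fun z => ∑ k, pd j (christoffel G k i k) z) 0 :=
      DifferentiableAt.fun_sum fun k _ => dΓ' j k i k
    have d3 : ∀ k, DifferentiableAt ℝ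
        (fun z => ∑ a, christoffel G k k a z * christoffel G a i j z) 0 :=
      fun k => DifferentiableAt.fun_sum fun a _ => dq _ _ _ _ _ _
    have d4 : ∀ k, DifferentiableAt ℝ
        (fun z => ∑ a, christoffel G k j a z * christoffel G a i k z) 0 :=
      fun k => DifferentiableAt.fun_sum fun a _ => dq _ _ _ _ _ _
    rw [pd_sub l ((d1.fun_sub d2).fun_add (DifferentiableAt.fun_sum fun k _ => d3 k))
      (DifferentiableAt.fun_sum fun k _ => d4 k),
      pd_add l (d1.fun_sub d2) (DifferentiableAt.fun_sum fun k _ => d3 k), pd_sub l d1 d2,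
      pd_sum l fun k _ => dΓ' k k i j, pd_sum l fun k _ => dΓ' j k i k, pd_sum l fun k _ => d3 k,
      pd_sum l fun k _ => d4 k]
    have z3 : ∀ k, pd l (fun z => ∑ a, christoffel G k k a z * christoffel G a i j z) 0 = 0 := by
      intro k
      rw [pd_sum l fun a _ => dq _ _ _ _ _ _]
      simp [q0]
    have z4 : ∀ k, pd l (fun z => ∑ a, christoffel G k j a z * christoffel G a i k z) 0 = 0 := by
      intro k
      rw [pd_sum l fun a _ => dq _ _ _ _ _ _]
      simp [q0]
    simp [z3, z4]
  simp only [key, h.pd_pd_christoffel]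
  have c1 : ∀ a b c d e, pd a (pd b (pd c fun z => G z d e)) 0
      = pd b (pd a (pd c fun z => G z d e)) 0 :=
    fun a b c d e => pd_comm a b (contDiffAt_pd c (hm.smooth 0 h0 d e))
  have c2 : ∀ a b c d e, pd a (pd b (pd c fun z => G z d e)) 0
      = pd a (pd c (pd b fun z => G z d e)) 0 :=
    fun a b c d e => pd_congr_on hm.isOpen h0 a fun z hz => pd_comm b c (hm.smooth z hz d e)
  have c3 : ∀ a b c d e, pd a (pd b (pd c fun z => G z d e)) 0
      = pd a (pd b (pd c fun z => G z e d)) 0 :=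
    fun a b c d e => pd_congr_on hm.isOpen h0 a fun z hz => hm.pd_fun_symm hz c b d e
  simp only [Finset.sum_sub_distrib, Finset.sum_add_distrib, ← Finset.mul_sum]
  -- What remains is to match third derivatives of the metric, by relabelling indices and commuting
  -- derivatives.
  have s1 : ∑ i, ∑ k, pd i (pd k (pd i fun z => G z j k)) 0
      = ∑ i, ∑ k, pd i (pd k (pd k fun z => G z i j)) 0 := by
    rw [Finset.sum_comm]
    exact Finset.sum_congr rfl fun i _ => Finset.sum_congr rfl fun k _ => by
      rw [c1 k i k j i, c3]
  have s2 : ∑ i, ∑ k, pd i (pd k (pd j fun z => G z i k)) 0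
      = ∑ i, ∑ k, pd j (pd k (pd i fun z => G z i k)) 0 :=
    Finset.sum_congr rfl fun i _ => Finset.sum_congr rfl fun k _ => by
      rw [c2, c1, c2]
  have s3 : ∑ i, ∑ k, pd i (pd j (pd i fun z => G z k k)) 0
      = ∑ i, ∑ k, pd j (pd k (pd k fun z => G z i i)) 0 := by
    rw [Finset.sum_comm]
    exact Finset.sum_congr rfl fun i _ => Finset.sum_congr rfl fun k _ => by rw [c1]
  have s4 : ∑ i, ∑ k, pd i (pd j (pd k fun z => G z i k)) 0
      = ∑ i, ∑ k, pd i (pd j (pd k fun z => G z k i)) 0 :=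
    Finset.sum_congr rfl fun i _ => Finset.sum_congr rfl fun k _ => by rw [c3]
  have s5 : ∑ i, ∑ k, pd j (pd i (pd k fun z => G z i k)) 0
      = ∑ i, ∑ k, pd j (pd k (pd i fun z => G z i k)) 0 := 
    Finset.sum_congr rfl fun i _ => Finset.sum_congr rfl fun k _ => by rw [c2]
  have s6 : ∑ i, ∑ k, pd j (pd i (pd i fun z => G z k k)) 0
      = ∑ i, ∑ k, pd j (pd k (pd k fun z => G z i i)) 0 := Finset.sum_comm
  linarith

end Metric

end

section

variable {n : ℕ}

/-! ### The divergence and the first Newton tensor -/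

/-- The divergence of a vector field. -/
def divg (G : Euc n → Matrix (Fin n) (Fin n) ℝ) (X : Euc n → Fin n → ℝ) (y : Euc n) : ℝ :=
  ∑ i, pd i (fun z => X z i) y + ∑ i, (conn G i y).trace * X y i

/-- The first Newton tensor `σ₁ g⁻¹ - g⁻¹ A g⁻¹` of a symmetric form `A`. -/
def newton (G A : Matrix (Fin n) (Fin n) ℝ) : Matrix (Fin n) (Fin n) ℝ :=
  (G⁻¹ * A).trace • G⁻¹ - G⁻¹ * A * G⁻¹

section Metric

variable {D D' : Set (Euc n)} {G : Euc n → Matrix (Fin n) (Fin n) ℝ} {Φ : Euc n → Euc n} {y : Euc n}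
  {v : Euc n → ℝ}

/-- The divergence does not depend on the coordinates. -/
lemma divg_pull (h : IsMetricOn D' G) (hΦ : IsChange D D' Φ) (hy : y ∈ D)
    {X X' : Euc n → Fin n → ℝ} (hX : ∀ i, ContDiffAt ℝ ∞ (fun z => X z i) (Φ y))
    (hX' : ∀ i, ContDiffAt ℝ ∞ (fun z => X' z i) y)
    (hXX : ∀ z ∈ D, X (Φ z) = jac Φ z *ᵥ X' z) :
    divg (pullM Φ G) X' y = divg G X (Φ y) := by
  have hJ := hΦ.isUnit_det hy
  have dΦ : DifferentiableAt ℝ Φ y := (hΦ.smooth y hy).differentiableAt (by simp)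
  have dJ : ∀ i b, DifferentiableAt ℝ (fun z => jac Φ z i b) y :=
    fun i b => (contDiffAt_jac (hΦ.smooth y hy) i b).smooth_differentiableAt
  set DX' : Matrix (Fin n) (Fin n) ℝ := Matrix.of fun c a => pd a (fun z => X' z c) y with hDX'
  set DX : Matrix (Fin n) (Fin n) ℝ := Matrix.of fun i k => pd k (fun z => X z i) (Φ y) with hDX
  have e1 : DX * jac Φ y = jac Φ y * DX' + ∑ c, X' y c • pdM c (jac Φ) y := by
    ext i a
    have e2 : pd a (fun z => X (Φ z) i) y = ∑ k, jac Φ y k a * pd k (fun z => X z i) (Φ y) :=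
      pd_comp a (hX i).smooth_differentiableAt dΦ
    have e3 : pd a (fun z => X (Φ z) i) y = pd a (fun z => ∑ c, jac Φ z i c * X' z c) y :=
      pd_congr_on hΦ.isOpen hy a fun z hz => by rw [hXX z hz]; rfl
    rw [pd_sum a fun c _ => (dJ i c).fun_mul (hX' c).smooth_differentiableAt] at e3
    have e4 : ∀ c, pd a (fun z => jac Φ z i c * X' z c) y
        = X' y c * pdM c (jac Φ) y i a + jac Φ y i c * pd a (fun z => X' z c) y := by
      intro c
      rw [pd_mul a (dJ i c) (hX' c).smooth_differentiableAt, ← pdM_jac_symm (hΦ.smooth y hy) i a c]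
      simp only [pdM, Matrix.of_apply]; ring
    simp only [Matrix.mul_apply, Matrix.add_apply, Matrix.sum_apply, Matrix.smul_apply, smul_eq_mul,
      hDX, hDX', Matrix.of_apply]
    rw [← Finset.sum_add_distrib]
    calc _ = ∑ k, jac Φ y k a * pd k (fun z => X z i) (Φ y) :=
          Finset.sum_congr rfl fun k _ => mul_comm _ _
      _ = _ := by
          rw [← e2, e3]
          exact Finset.sum_congr rfl fun c _ => by rw [e4, add_comm]
  have e5 : DX' = (jac Φ y)⁻¹ * DX * jac Φ y - ∑ c, X' y c • ((jac Φ y)⁻¹ * pdM c (jac Φ) y) := by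
    have e6 := congrArg (fun Z => (jac Φ y)⁻¹ * Z) e1
    simp only [Matrix.mul_add, ← Matrix.mul_assoc, Matrix.nonsing_inv_mul _ hJ, Matrix.one_mul,
      Matrix.mul_sum, Matrix.mul_smul] at e6
    rw [e6, add_sub_cancel_right]
  have e7 : ∀ c, (conn (pullM Φ G) c y).trace = ∑ i, jac Φ y i c * (conn G i (Φ y)).trace
      + ((jac Φ y)⁻¹ * pdM c (jac Φ) y).trace := by
    intro c
    have e8 := congrArg (fun Z => ((jac Φ y)⁻¹ * Z).trace) (conn_pull h hΦ hy c)
    simp only [Matrix.mul_add, ← Matrix.mul_assoc, Matrix.nonsing_inv_mul _ hJ, Matrix.one_mul,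
      Matrix.trace_add] at e8
    rw [e8, trace_conj hJ, Matrix.trace_sum]
    simp only [Matrix.trace_smul, smul_eq_mul]
  have e9 : divg (pullM Φ G) X' y = DX'.trace + ∑ c, (conn (pullM Φ G) c y).trace * X' y c := rfl
  have e10 : divg G X (Φ y) = DX.trace + ∑ i, (conn G i (Φ y)).trace * X (Φ y) i := rfl
  rw [e9, e10, e5, Matrix.trace_sub, trace_conj hJ, Matrix.trace_sum]
  simp only [Matrix.trace_smul, smul_eq_mul, e7, add_mul, Finset.sum_add_distrib, hXX y hy,
    Matrix.mulVec, dotProduct, Finset.mul_sum, Finset.sum_mul]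
  rw [Finset.sum_comm (f := fun c i => jac Φ y i c * (conn G i (Φ y)).trace * X' y c)]
  have e11 : ∀ i c, jac Φ y i c * (conn G i (Φ y)).trace * X' y c
      = (conn G i (Φ y)).trace * (jac Φ y i c * X' y c) := fun i c => by ring
  simp only [e11, mul_comm (X' y _)]
  ring

/-- The Newton tensor has both indices raised, so it transforms with inverse Jacobians. Applied to a
differential it therefore gives a vector field, to which `divg_pull` applies. -/
lemma newton_pull (hΦ : IsChange D D' Φ) (hy : y ∈ D) (A : Matrix (Fin n) (Fin n) ℝ) :
    newton (pullM Φ G y) ((jac Φ y)ᵀ * A * jac Φ y)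
      = (jac Φ y)⁻¹ * newton (G (Φ y)) A * ((jac Φ y)ᵀ)⁻¹ := by
  have hJ := hΦ.isUnit_det hy
  have hJt : IsUnit ((jac Φ y)ᵀ).det := by rwa [Matrix.det_transpose]
  unfold newton
  rw [pullM_inv hΦ hy, trace_conj hJ, pullM, Matrix.mul_inv_rev, Matrix.mul_inv_rev]
  simp only [Matrix.mul_sub, Matrix.sub_mul, Matrix.mul_smul, Matrix.smul_mul, Matrix.mul_assoc]
  congr 4
  rw [← Matrix.mul_assoc (jac Φ y), Matrix.mul_nonsing_inv _ hJ, Matrix.one_mul]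

lemma IsNormal.pdM_inv_mul (h : IsNormal D G) {X : Euc n → Matrix (Fin n) (Fin n) ℝ}
    (hX : ∀ i j, ContDiffAt ℝ ∞ (fun z => X z i j) 0) (l : Fin n) :
    pdM l (fun z => (G z)⁻¹ * X z) 0 = pdM l X 0 := by
  have h0 := h.zero_mem
  rw [pdM_mul l (fun i j => (h.smooth_inv h0 i j).smooth_differentiableAt)
    fun i j => (hX i j).smooth_differentiableAt]
  have e : pdM l (fun z => (G z)⁻¹) 0 = 0 := by ext i j; exact h.pd_inv_zero l i j
  rw [e, h.inv_zero, Matrix.zero_mul, zero_add, Matrix.one_mul]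

lemma IsNormal.pdM_mul_inv (h : IsNormal D G) {X : Euc n → Matrix (Fin n) (Fin n) ℝ}
    (hX : ∀ i j, ContDiffAt ℝ ∞ (fun z => X z i j) 0) (l : Fin n) :
    pdM l (fun z => X z * (G z)⁻¹) 0 = pdM l X 0 := by
  have h0 := h.zero_mem
  rw [pdM_mul l (fun i j => (hX i j).smooth_differentiableAt)
    fun i j => (h.smooth_inv h0 i j).smooth_differentiableAt]
  have e : pdM l (fun z => (G z)⁻¹) 0 = 0 := by ext i j; exact h.pd_inv_zero l i j
  rw [e, h.inv_zero, Matrix.mul_zero, add_zero, Matrix.mul_one]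

lemma pd_trace {X : Euc n → Matrix (Fin n) (Fin n) ℝ}
    (hX : ∀ i j, ContDiffAt ℝ ∞ (fun z => X z i j) y) (l : Fin n) :
    pd l (fun z => (X z).trace) y = (pdM l X y).trace := by
  simp only [Matrix.trace, Matrix.diag, pdM, Matrix.of_apply]
  exact pd_sum l fun i _ => (hX i i).smooth_differentiableAt

lemma contDiffAt_matrix_mul {X Y : Euc n → Matrix (Fin n) (Fin n) ℝ}
    (hX : ∀ i j, ContDiffAt ℝ ∞ (fun z => X z i j) y)
    (hY : ∀ i j, ContDiffAt ℝ ∞ (fun z => Y z i j) y) (i j : Fin n) :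
    ContDiffAt ℝ ∞ (fun z => (X z * Y z) i j) y := by
  simp only [Matrix.mul_apply]
  exact ContDiffAt.sum fun a _ => (hX i a).mul (hY a j)

lemma contDiffAt_trace {X : Euc n → Matrix (Fin n) (Fin n) ℝ}
    (hX : ∀ i j, ContDiffAt ℝ ∞ (fun z => X z i j) y) : ContDiffAt ℝ ∞ (fun z => (X z).trace) y := by
  simp only [Matrix.trace, Matrix.diag]
  exact ContDiffAt.sum fun a _ => hX a a

lemma contDiffAt_newton (h : IsMetricOn D G) (hy : y ∈ D) (i j : Fin n) :
    ContDiffAt ℝ ∞ (fun z => newton (G z) (schouten G z) i j) y := by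
  have sP := fun i j => h.smooth_inv hy i j
  have sA := fun i j => h.smooth_schouten hy i j
  simp only [newton, Matrix.sub_apply, Matrix.smul_apply, smul_eq_mul]
  exact ((contDiffAt_trace (contDiffAt_matrix_mul sP sA)).mul (sP i j)).sub
    (contDiffAt_matrix_mul (contDiffAt_matrix_mul sP sA) sP i j)

/-- The first Newton tensor of the Schouten tensor is divergence free. -/
lemma IsNormal.div_newton (hn : 2 < n) (h : IsNormal D G) (j : Fin n) :
    ∑ i, pd i (fun z => newton (G z) (schouten G z) i j) 0 = 0 := by
  have h0 := h.zero_mem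
  have hm := h.toIsMetricOn
  have hn1 : (n : ℝ) - 1 ≠ 0 := by
    have : (2 : ℝ) < n := by exact_mod_cast hn
    linarith
  have sP := fun i j => hm.smooth_inv h0 i j
  have sA := fun i j => hm.smooth_schouten h0 i j
  have sR := fun i j => hm.smooth_ricci h0 i j
  have sPR := contDiffAt_matrix_mul sP sR
  have sPA := contDiffAt_matrix_mul sP sA
  have hR : ∀ l, pd l (scalarCurv G) 0 = ∑ a, pd l (fun z => ricci G z a a) 0 := by
    intro l
    have : pd l (scalarCurv G) 0 = _ := pd_trace sPR l
    rw [this, h.pdM_inv_mul sR]; rfl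
  have sS : ContDiffAt ℝ ∞ (scalarCurv G) 0 := contDiffAt_trace sPR
  have hA : ∀ l a b, pd l (fun z => schouten G z a b) 0 = (1 / ((n : ℝ) - 2)) *
      (pd l (fun z => ricci G z a b) 0
        - (1 / (2 * ((n : ℝ) - 1))) * pd l (scalarCurv G) 0 * (1 : Matrix (Fin n) (Fin n) ℝ) a b) := by
    intro l a b
    have e : (fun z => schouten G z a b) = fun z => (1 / ((n : ℝ) - 2)) *
        (ricci G z a b - (1 / (2 * ((n : ℝ) - 1))) * (scalarCurv G z * G z a b)) := by
      ext z
      simp only [schouten, Matrix.smul_apply, Matrix.sub_apply, smul_eq_mul]; ring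
    have d1 := (sR a b).smooth_differentiableAt
    have d2 := sS.smooth_differentiableAt
    have d3 := (hm.smooth 0 h0 a b).smooth_differentiableAt
    rw [e, pd_const_mul l _ (d1.fun_sub ((differentiableAt_const _).fun_mul (d2.fun_mul d3))),
      pd_sub l d1 ((differentiableAt_const _).fun_mul (d2.fun_mul d3)),
      pd_const_mul l _ (d2.fun_mul d3), pd_mul l d2 d3, h.pd_zero, h.eq_one]
    ring
  have hT : ∀ i, pd i (fun z => newton (G z) (schouten G z) i j) 0
      = (∑ a, pd i (fun z => schouten G z a a) 0) * (1 : Matrix (Fin n) (Fin n) ℝ) i j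
        - pd i (fun z => schouten G z i j) 0 := by
    intro i
    simp only [newton, Matrix.sub_apply, Matrix.smul_apply, smul_eq_mul]
    have d1 := (contDiffAt_trace sPA).smooth_differentiableAt
    have d2 := (sP i j).smooth_differentiableAt
    have d3 := (contDiffAt_matrix_mul sPA sP i j).smooth_differentiableAt
    rw [pd_sub i (d1.fun_mul d2) d3, pd_mul i d1 d2, h.pd_inv_zero, h.inv_zero, pd_trace sPA,
      h.pdM_inv_mul sA]
    have e : pd i (fun z => ((G z)⁻¹ * schouten G z * (G z)⁻¹) i j) 0
        = pdM i (fun z => (G z)⁻¹ * schouten G z * (G z)⁻¹) 0 i j := rfl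
    rw [e, h.pdM_mul_inv sPA, h.pdM_inv_mul sA]
    simp [Matrix.trace, pdM]
  -- Both `∂_j tr A` and `∂_i A_ij` equal `∂_j R / (2(n-1))`, the second one by the contracted
  -- Bianchi identity.
  have hb := h.bianchi j
  simp only [hT, hA, Finset.sum_sub_distrib, ← Finset.mul_sum, hR]
  simp only [Matrix.one_apply, mul_ite, mul_one, mul_zero, Finset.sum_ite_eq', Finset.mem_univ, if_true,
    Finset.sum_const, Finset.card_univ, Fintype.card_fin, nsmul_eq_mul, hb]
  field_simp
  ring

lemma contDiffAt_newton_grad (h : IsMetricOn D G) (hy : y ∈ D) (hv : ContDiffAt ℝ ∞ v y) (i : Fin n) :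
    ContDiffAt ℝ ∞ (fun z => (newton (G z) (schouten G z) *ᵥ grad v z) i) y := by
  simp only [Matrix.mulVec, dotProduct]
  exact ContDiffAt.sum fun j _ => (contDiffAt_newton h hy i j).mul (contDiffAt_pd j hv)

/-- `div (T ∇v) = ⟨T, ∇²v⟩` for the first Newton tensor `T`. -/
lemma divg_newton_grad (hn : 2 < n) (h : IsMetricOn D G) (hy : y ∈ D)
    (hv : ∀ z ∈ D, ContDiffAt ℝ ∞ v z) :
    divg G (fun z => newton (G z) (schouten G z) *ᵥ grad v z) y
      = (newton (G y) (schouten G y) * hessian G v y).trace := by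
  obtain ⟨D₀, Φ, hΦ0, hΦ, hN⟩ := exists_normal h hy
  have h0 := hN.zero_mem
  have hm := hN.toIsMetricOn
  have hv' : ∀ z ∈ D₀, ContDiffAt ℝ ∞ (fun w => v (Φ w)) z :=
    fun z hz => (hv _ (hΦ.mapsTo z hz)).comp z (hΦ.smooth z hz)
  set G' := pullM Φ G with hG'
  set v' := fun w => v (Φ w) with hv'def
  have e1 := divg_pull (X := fun z => newton (G z) (schouten G z) *ᵥ grad v z)
    (X' := fun z => newton (G' z) (schouten G' z) *ᵥ grad v' z) h hΦ h0
    (fun i => contDiffAt_newton_grad h (hΦ.mapsTo 0 h0) (hv _ (hΦ.mapsTo 0 h0)) i)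
    (fun i => contDiffAt_newton_grad hm h0 (hv' 0 h0) i) (by
      intro z hz
      have hJ := hΦ.isUnit_det hz
      have hJt : IsUnit ((jac Φ z)ᵀ).det := by rwa [Matrix.det_transpose]
      show _ = jac Φ z *ᵥ (newton (G' z) (schouten G' z) *ᵥ grad v' z)
      rw [hG', schouten_pull h hΦ hz, newton_pull hΦ hz, hv'def,
        grad_pull hΦ hz (hv _ (hΦ.mapsTo z hz))]
      simp only [Matrix.mulVec_mulVec]
      rw [Matrix.nonsing_inv_mul_cancel_right _ _ hJt, ← Matrix.mul_assoc,
        Matrix.mul_nonsing_inv _ hJ, Matrix.one_mul])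
  have e2 : (newton (G y) (schouten G y) * hessian G v y).trace
      = (newton (G' 0) (schouten G' 0) * hessian G' v' 0).trace := by
    have hJ := hΦ.isUnit_det h0
    have hJt : IsUnit ((jac Φ 0)ᵀ).det := by rwa [Matrix.det_transpose]
    rw [hG', schouten_pull h hΦ h0, newton_pull hΦ h0, hv'def, hessian_pull h hΦ h0 hv, hΦ0,
      ← Matrix.mul_assoc, ← Matrix.mul_assoc, Matrix.nonsing_inv_mul_cancel_right _ _ hJt,
      Matrix.mul_assoc _ (newton _ _), trace_conj hJ]
  change divg G' _ 0 = _ at e1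
  rw [e2, ← hΦ0, ← e1]
  have d1 : ∀ i j, DifferentiableAt ℝ (fun z => newton (G' z) (schouten G' z) i j) 0 :=
    fun i j => (contDiffAt_newton hm h0 i j).smooth_differentiableAt
  have d2 : ∀ j, DifferentiableAt ℝ (pd j v') 0 :=
    fun j => (contDiffAt_pd j (hv' 0 h0)).smooth_differentiableAt
  have e3 : ∀ i, pd i (fun z => (newton (G' z) (schouten G' z) *ᵥ grad v' z) i) 0
      = ∑ j, (pd i (fun z => newton (G' z) (schouten G' z) i j) 0 * pd j v' 0
        + newton (G' 0) (schouten G' 0) i j * pd i (pd j v') 0) := by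
    intro i
    simp only [Matrix.mulVec, dotProduct, grad]
    rw [pd_sum i fun j _ => (d1 i j).fun_mul (d2 j)]
    exact Finset.sum_congr rfl fun j _ => pd_mul i (d1 i j) (d2 j)
  have e4 : ∀ i, (conn G' i 0).trace = 0 := fun i => by
    simp [conn, Matrix.trace, hN.christoffel_zero]
  unfold divg
  simp only [e3, e4, zero_mul, Finset.sum_const_zero, add_zero, Finset.sum_add_distrib]
  -- By the product rule the derivatives falling on the Newton tensor add up to its divergence,
  -- which is zero. Those falling on the gradient give the Hessian.
  rw [Finset.sum_comm]
  simp only [← Finset.sum_mul, hN.div_newton hn, zero_mul, Finset.sum_const_zero, zero_add,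
    Matrix.trace, Matrix.diag, Matrix.mul_apply, hN.hessian_zero]
  exact Finset.sum_congr rfl fun i _ => Finset.sum_congr rfl fun j _ => by
    rw [pd_comm i j (hv' 0 h0)]

/-- Jacobi's formula. -/
lemma pd_det {X : Euc n → Matrix (Fin n) (Fin n) ℝ}
    (hX : ∀ i j, DifferentiableAt ℝ (fun z => X z i j) y) (hd : IsUnit (X y).det) (l : Fin n) :
    pd l (fun z => (X z).det) y = (X y).det * ((X y)⁻¹ * pdM l X y).trace := by
  set F : (Fin n → Fin n → ℝ) → ℝ := fun A => (Matrix.of A).det with hF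
  have dF : Differentiable ℝ F := by
    simp only [hF, Matrix.det_apply', Matrix.of_apply]
    fun_prop
  have dX : HasFDerivAt (fun z => (X z : Fin n → Fin n → ℝ))
      (ContinuousLinearMap.pi fun i => ContinuousLinearMap.pi fun j =>
        fderiv ℝ (fun z => X z i j) y) y :=
    hasFDerivAt_pi.2 fun i => hasFDerivAt_pi.2 fun j => (hX i j).hasFDerivAt
  have e1 := ((dF (X y)).hasFDerivAt.comp y dX).fderiv
  have e2 : pd l (fun z => (X z).det) y = fderiv ℝ F (X y) (pdM l X y) := by
    unfold pd
    rw [show (fun z => (X z).det) = F ∘ fun z => (X z : Fin n → Fin n → ℝ) from rfl, e1]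
    rfl
  -- The differential of the determinant is computed along lines, where the determinant is a
  -- polynomial in one variable.
  have e4 : ∀ A C : Fin n → Fin n → ℝ,
      HasDerivAt (fun s : ℝ => F (A + s • C)) (fderiv ℝ F A C) 0 := by
    intro A C
    have e3 : HasDerivAt (fun s : ℝ => A + s • C) C 0 := by
      simpa using ((hasDerivAt_id (0 : ℝ)).smul_const C).const_add A
    have h5 : HasFDerivAt F (fderiv ℝ F A) (A + (0 : ℝ) • C) := by
      simpa using (dF A).hasFDerivAt
    exact h5.comp_hasDerivAt (0 : ℝ) e3
  have e4 := e4 (X y) (pdM l X y)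
  set B := (X y)⁻¹ * pdM l X y with hB
  -- `p` is what is left of `det(1 + sB)` after the constant and the linear term are removed and
  -- `s²` is divided out. Its value plays no role.
  set p := (Matrix.det (1 + (Polynomial.X : Polynomial ℝ) • B.map Polynomial.C)).divX.divX with hp
  have e5 : ∀ s : ℝ, F ((X y : Fin n → Fin n → ℝ) + s • (pdM l X y : Fin n → Fin n → ℝ))
      = (X y).det * (1 + B.trace * s + p.eval s * s ^ 2) := by
    intro s
    rw [hp, ← Matrix.det_one_add_smul, ← Matrix.det_mul, Matrix.mul_add, Matrix.mul_one,
      Matrix.mul_smul, hB, ← Matrix.mul_assoc, Matrix.mul_nonsing_inv _ hd, Matrix.one_mul]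
    rfl
  have e6 : HasDerivAt (fun s : ℝ => (X y).det * (1 + B.trace * s + p.eval s * s ^ 2))
      ((X y).det * B.trace) 0 := by
    have h1 := ((hasDerivAt_id (0 : ℝ)).const_mul B.trace).const_add 1
    have h2 := (p.hasDerivAt 0).mul ((hasDerivAt_id (0 : ℝ)).pow 2)
    simpa using (h1.add h2).const_mul (X y).det
  rw [e2]
  exact e4.unique (e6.congr_of_eventuallyEq (Filter.Eventually.of_forall e5))

/-- The density `√det G` turns the divergence into a sum of partial derivatives. -/
lemma sqrt_det_mul_divg (h : IsMetricOn D G) (hy : y ∈ D) {X : Euc n → Fin n → ℝ}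
    (hX : ∀ i, DifferentiableAt ℝ (fun z => X z i) y) :
    Real.sqrt (G y).det * divg G X y = ∑ i, pd i (fun z => Real.sqrt (G z).det * X z i) y := by
  have dG : ∀ i j, DifferentiableAt ℝ (fun z => G z i j) y :=
    fun i j => (h.smooth y hy i j).smooth_differentiableAt
  have hp := h.det_pos hy
  have dd : DifferentiableAt ℝ (fun z => (G z).det) y := by
    simp only [Matrix.det_apply']
    fun_prop
  have ds : DifferentiableAt ℝ (fun z => Real.sqrt (G z).det) y := dd.sqrt hp.ne'
  -- Metricity of the connection: `∂_i G` is a term plus its transpose, and both have the same trace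
  -- against `G⁻¹`. Thus the logarithmic derivative of `√det G` is the trace of the connection
  -- matrix.
  have e1 : ∀ i, ((G y)⁻¹ * pdM i G y).trace = 2 * (conn G i y).trace := by
    intro i
    rw [pdM_metric h hy, Matrix.mul_add, Matrix.trace_add, ← Matrix.mul_assoc, Matrix.trace_mul_comm,
      ← Matrix.mul_assoc, Matrix.mul_nonsing_inv _ (h.isUnit_det hy), Matrix.one_mul,
      Matrix.trace_transpose, ← Matrix.mul_assoc, Matrix.nonsing_inv_mul _ (h.isUnit_det hy),
      Matrix.one_mul]
    ring
  have e2 : ∀ i, pd i (fun z => Real.sqrt (G z).det) y = Real.sqrt (G y).det * (conn G i y).trace := by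
    intro i
    have h1 : pd i (fun z => Real.sqrt (G z).det) y
        = 1 / (2 * Real.sqrt (G y).det) * pd i (fun z => (G z).det) y := by
      unfold pd
      rw [fderiv_sqrt dd hp.ne']
      simp
    rw [h1, pd_det dG (h.isUnit_det hy), e1]
    have h2 := Real.mul_self_sqrt hp.le
    have h3 := (Real.sqrt_pos.2 hp).ne'
    field_simp
    rw [pow_two, h2]
  have e3 : ∀ i, pd i (fun z => Real.sqrt (G z).det * X z i) y
      = Real.sqrt (G y).det * pd i (fun z => X z i) y
        + Real.sqrt (G y).det * ((conn G i y).trace * X y i) := by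
    intro i
    rw [pd_mul i ds (hX i), e2]; ring
  simp only [e3, Finset.sum_add_distrib, divg, mul_add, Finset.mul_sum]

/-- The integral of a derivative of a compactly supported function vanishes. -/
lemma integral_pd_eq_zero {f : Euc n → ℝ} (hf : ContDiff ℝ 1 f) (hc : HasCompactSupport f) (i : Fin n) :
    ∫ y, pd i f y = 0 := by
  have hcf : HasCompactSupport (pd i f) := hc.fderiv_apply ℝ _
  have hcont : Continuous (pd i f) := (hf.continuous_fderiv (by simp)).clm_apply continuous_const
  have h := integral_mul_fderiv_eq_neg_fderiv_mul_of_integrable (μ := (volume : Measure (Euc n)))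
    (f := fun _ => (1 : ℝ)) (g := f) (v := EuclideanSpace.single i 1) (by simp)
    (by simp only [one_mul]; exact hcont.integrable_of_hasCompactSupport hcf)
    (by simp only [one_mul]; exact hf.continuous.integrable_of_hasCompactSupport hc)
    (fun _ _ => differentiableAt_const _) (fun _ _ => hf.differentiable (by simp) _)
  simpa [pd] using h

/-- The integral of `⟨T, ∇²f⟩` vanishes if `f` has compact support. -/
lemma integral_newton_hessian (hn : 2 < n) (h : IsMetricOn D G) {f : Euc n → ℝ}
    (hf : ContDiff ℝ ∞ f) (hc : HasCompactSupport f) (hs : tsupport f ⊆ D) :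
    ∫ y, Real.sqrt (G y).det * (newton (G y) (schouten G y) * hessian G f y).trace = 0 := by
  set X : Euc n → Fin n → ℝ := fun z => newton (G z) (schouten G z) *ᵥ grad f z with hX
  set Y : Fin n → Euc n → ℝ := fun i z => Real.sqrt (G z).det * X z i with hY
  have hg0 : ∀ z ∉ tsupport f, grad f z = 0 := by
    intro z hz
    ext i
    show pd i f z = 0
    unfold pd
    rw [(notMem_tsupport_iff_eventuallyEq.1 hz).fderiv_eq]
    simp
  have hY0 : ∀ i, ∀ z ∉ tsupport f, Y i z = 0 := fun i z hz => by simp [hY, hX, hg0 z hz]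
  -- Nothing is known about `G` outside `D`, but there `f` vanishes in a neighbourhood, so the field
  -- extends by zero.
  have hYs : ∀ i, ContDiff ℝ 1 (Y i) := by
    intro i
    rw [contDiff_iff_contDiffAt]
    intro z
    by_cases hz : z ∈ D
    · have dd : ContDiffAt ℝ ∞ (fun z => (G z).det) z := by
        simp only [Matrix.det_apply']
        exact ContDiffAt.sum fun s _ => contDiffAt_const.mul (contDiffAt_prod fun j _ => h.smooth z hz _ _)
      exact ((dd.sqrt (h.det_pos hz).ne').mul
        (contDiffAt_newton_grad h hz hf.contDiffAt i)).of_le (by exact_mod_cast le_top)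
    · have hz' : z ∉ tsupport f := fun h' => hz (hs h')
      refine contDiffAt_const (c := (0 : ℝ)) |>.congr_of_eventuallyEq ?_
      filter_upwards [(isClosed_tsupport f).isOpen_compl.mem_nhds hz'] with w hw using hY0 i w hw
  have hYc : ∀ i, HasCompactSupport (Y i) := fun i =>
    HasCompactSupport.intro hc fun z hz => hY0 i z hz
  have key : ∀ z, Real.sqrt (G z).det * (newton (G z) (schouten G z) * hessian G f z).trace
      = ∑ i, pd i (Y i) z := by
    intro z
    by_cases hz : z ∈ D
    · rw [← divg_newton_grad hn h hz fun w _ => hf.contDiffAt, sqrt_det_mul_divg h hz fun i =>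
        (contDiffAt_newton_grad h hz hf.contDiffAt i).smooth_differentiableAt]
    · have hz' : z ∉ tsupport f := fun h' => hz (hs h')
      have h1 : hessian G f z = 0 := by
        have h2 : ∀ j, pd j f =ᶠ[𝓝 z] fun _ => 0 := by
          intro j
          filter_upwards [(isClosed_tsupport f).isOpen_compl.mem_nhds hz'] with w hw
          exact congrFun (hg0 w hw) j
        ext i j
        simp [hessian, pd_congr i (h2 j), fun k => (h2 k).eq_of_nhds]
      have h3 : ∀ i, pd i (Y i) z = 0 := by
        intro i
        rw [pd_congr i (g := fun _ => 0), pd_const]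
        filter_upwards [(isClosed_tsupport f).isOpen_compl.mem_nhds hz'] with w hw using hY0 i w hw
      simp [h1, h3]
  simp only [key]
  rw [integral_finsetSum]
  · exact Finset.sum_eq_zero fun i _ => integral_pd_eq_zero (hYs i) (hYc i) i
  · intro i _
    exact (((hYs i).continuous_fderiv (by simp)).clm_apply
      continuous_const).integrable_of_hasCompactSupport ((hYc i).fderiv_apply ℝ _)

end Metric

end

section

variable {n : ℕ}

/-! ### Second order conditions at a maximum -/

lemma pd_eq_zero_of_isLocalMax {f : Euc n → ℝ} {y : Euc n} (h : IsLocalMax f y) (i : Fin n) :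
    pd i f y = 0 := by
  unfold pd
  rw [h.fderiv_eq_zero]; rfl

/-- Along a line, a positive second derivative at a critical point forces a local minimum. Being
also a local maximum, the function would be constant near the point and its second derivative zero.
-/
lemma second_dir_le_of_isLocalMax {f : Euc n → ℝ} {y : Euc n} (hf : ContDiffAt ℝ ∞ f y)
    (h : IsLocalMax f y) (v : Fin n → ℝ) : ∑ i, ∑ j, v i * v j * pd i (pd j f) y ≤ 0 := by
  by_contra! hc
  set w : Euc n := WithLp.toLp 2 v with hw
  have hline : ∀ s : ℝ, HasDerivAt (fun s : ℝ => y + s • w) w s := fun s => by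
    simpa using ((hasDerivAt_id s).smul_const w).const_add y
  have hcont : ContinuousAt (fun s : ℝ => y + s • w) 0 := (hline 0).continuousAt
  have hy0 : y + (0 : ℝ) • w = y := by simp
  have hct : Tendsto (fun s : ℝ => y + s • w) (𝓝 0) (𝓝 y) := by
    have := hcont.tendsto
    rwa [hy0] at this
  have ev : ∀ᶠ z in 𝓝 y, DifferentiableAt ℝ f z := by
    have h1 : ContDiffAt ℝ 1 f y := hf.of_le (by exact_mod_cast le_top)
    filter_upwards [h1.eventually (by simp)] with z hz using hz.differentiableAt (by simp)
  have ev' : ∀ᶠ s in 𝓝 (0 : ℝ), DifferentiableAt ℝ f (y + s • w) :=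
    hct.eventually ev
  have hd1 : deriv (fun s : ℝ => f (y + s • w)) =ᶠ[𝓝 0]
      fun s => ∑ j, v j * pd j f (y + s • w) := by
    filter_upwards [ev'] with s hs
    have := hs.hasFDerivAt.comp_hasDerivAt s (hline s)
    rw [show (fun s : ℝ => f (y + s • w)) = f ∘ fun s : ℝ => y + s • w from rfl, this.deriv,
      fderiv_eq_sum_pd]
  have hdj : ∀ j, HasDerivAt (fun s : ℝ => pd j f (y + s • w)) (∑ i, v i * pd i (pd j f) y) 0 := by
    intro j
    have h1 := (contDiffAt_pd j hf).smooth_differentiableAt.hasFDerivAt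
    rw [← hy0] at h1
    have h2 := h1.comp_hasDerivAt (0 : ℝ) (hline 0)
    rw [hy0, fderiv_eq_sum_pd] at h2
    exact h2
  have hd2 : deriv (deriv fun s : ℝ => f (y + s • w)) 0 = ∑ i, ∑ j, v i * v j * pd i (pd j f) y := by
    rw [hd1.deriv_eq]
    have := HasDerivAt.fun_sum (u := Finset.univ) fun j _ => (hdj j).const_mul (v j)
    rw [this.deriv, Finset.sum_comm]
    refine Finset.sum_congr rfl fun j _ => ?_
    rw [Finset.mul_sum]
    exact Finset.sum_congr rfl fun i _ => by ring
  have hmax : IsLocalMax (fun s : ℝ => f (y + s • w)) 0 := by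
    have : ∀ᶠ s in 𝓝 (0 : ℝ), f (y + s • w) ≤ f y := hct.eventually h
    simpa [IsLocalMax, IsMaxFilter] using this
  have hmin : IsLocalMin (fun s : ℝ => f (y + s • w)) 0 := by
    refine isLocalMin_of_deriv_deriv_pos (by rw [hd2]; exact hc) hmax.deriv_eq_zero ?_
    exact ContinuousAt.comp (f := fun s : ℝ => y + s • w) (g := f)
      (by simpa using hf.continuousAt) hcont
  have hconst : (fun s : ℝ => f (y + s • w)) =ᶠ[𝓝 0] fun _ => f (y + (0 : ℝ) • w) := by
    filter_upwards [hmax, hmin] with s h1 h2 using le_antisymm h1 h2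
  have : deriv (deriv fun s : ℝ => f (y + s • w)) 0 = 0 := by
    have h1 : deriv (fun s : ℝ => f (y + s • w)) =ᶠ[𝓝 0] fun _ => 0 := by
      filter_upwards [hconst.eventuallyEq_nhds] with s hs
      rw [hs.deriv_eq]; simp
    rw [h1.deriv_eq]; simp
  linarith

/-- A positive semidefinite `F = Bᵀ B` is a sum of squares of the rows of `B`, and each row is a
direction for the previous lemma. -/
lemma trace_second_le_of_isLocalMax {f : Euc n → ℝ} {y : Euc n} (hf : ContDiffAt ℝ ∞ f y)
    (h : IsLocalMax f y) {F : Matrix (Fin n) (Fin n) ℝ} (hF : F.PosSemidef) :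
    ∑ i, ∑ j, F i j * pd i (pd j f) y ≤ 0 := by
  obtain ⟨B, hB⟩ := exists_eq_transpose_mul hF
  have e : ∑ i, ∑ j, F i j * pd i (pd j f) y = ∑ k, ∑ i, ∑ j, B k i * B k j * pd i (pd j f) y := by
    simp only [hB, Matrix.mul_apply, Matrix.transpose_apply, Finset.sum_mul]
    exact (Finset.sum_comm.trans (Finset.sum_congr rfl fun i _ => Finset.sum_comm)).symm
  rw [e]
  exact Finset.sum_nonpos fun k _ => second_dir_le_of_isLocalMax hf h (B k)

/-! ### Derivatives at the origin of normal coordinates -/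

section Normal

variable {D : Set (Euc n)} {G : Euc n → Matrix (Fin n) (Fin n) ℝ} {f : Euc n → ℝ}

lemma IsNormal.pd_gradSq (h : IsNormal D G) (hf : ContDiffAt ℝ ∞ f 0) (k : Fin n) :
    pd k (gradSq G f) 0 = 2 * ∑ l, pd k (pd l f) 0 * pd l f 0 := by
  have h0 := h.zero_mem
  have hm := h.toIsMetricOn
  have sP := fun i j => (hm.smooth_inv h0 i j).smooth_differentiableAt
  have sf := fun i => (contDiffAt_pd i hf).smooth_differentiableAt
  have s2 := fun i j => (sP i j).fun_mul (sf j)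
  have s3 := fun i => (sf i).fun_mul (DifferentiableAt.fun_sum (u := Finset.univ) fun j _ => s2 i j)
  have e : gradSq G f = fun z => ∑ i, pd i f z * ∑ j, (G z)⁻¹ i j * pd j f z := rfl
  rw [e, pd_sum k fun i _ => s3 i, Finset.mul_sum]
  refine Finset.sum_congr rfl fun i _ => ?_
  rw [pd_mul k (sf i) (DifferentiableAt.fun_sum (u := Finset.univ) fun j _ => s2 i j),
    pd_sum k fun j _ => s2 i j]
  have e2 : ∀ j, pd k (fun z => (G z)⁻¹ i j * pd j f z) 0
      = (1 : Matrix (Fin n) (Fin n) ℝ) i j * pd k (pd j f) 0 := by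
    intro j
    rw [pd_mul k (sP i j) (sf j), h.pd_inv_zero, h.inv_zero]; ring
  simp only [e2, h.inv_zero, Matrix.one_apply, ite_mul, one_mul, zero_mul, Finset.sum_ite_eq,
    Finset.mem_univ, if_true]
  ring

/-- First derivatives of the inverse metric vanish at the origin but second derivatives do not. The
last sum carries the curvature and is only quadratic in the gradient. -/
lemma IsNormal.pd_pd_gradSq (h : IsNormal D G) (hf : ContDiffAt ℝ ∞ f 0) (a b : Fin n) :
    pd a (pd b (gradSq G f)) 0 = 2 * ∑ l, (pd a (pd b (pd l f)) 0 * pd l f 0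
      + pd a (pd l f) 0 * pd b (pd l f) 0)
      + ∑ i, ∑ j, pd a (pd b fun z => (G z)⁻¹ i j) 0 * (pd i f 0 * pd j f 0) := by
  have h0 := h.zero_mem
  have hm := h.toIsMetricOn
  have sP := fun i j => hm.smooth_inv h0 i j
  have sf := fun i => contDiffAt_pd i hf
  have s2 := fun i j => (sf i).mul (sf j)
  have e : gradSq G f = fun z => ∑ i, ∑ j, (G z)⁻¹ i j * (pd i f z * pd j f z) := by
    ext z
    simp only [gradSq, grad, dotProduct, Matrix.mulVec, Finset.mul_sum]
    exact Finset.sum_congr rfl fun i _ => Finset.sum_congr rfl fun j _ => by ring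
  have e2 : ∀ i j, pd a (pd b fun z => (G z)⁻¹ i j * (pd i f z * pd j f z)) 0
      = pd a (pd b fun z => (G z)⁻¹ i j) 0 * (pd i f 0 * pd j f 0)
        + (1 : Matrix (Fin n) (Fin n) ℝ) i j * (pd a (pd b (pd i f)) 0 * pd j f 0
          + pd b (pd i f) 0 * pd a (pd j f) 0 + (pd a (pd i f) 0 * pd b (pd j f) 0
          + pd i f 0 * pd a (pd b (pd j f)) 0)) := by
    intro i j
    rw [pd_pd_mul a b (sP i j) (s2 i j), h.pd_inv_zero, h.pd_inv_zero, h.inv_zero,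
      pd_pd_mul a b (sf i) (sf j)]
    ring
  rw [e, pd_pd_sum a b fun i _ => ContDiffAt.sum fun j _ => (sP i j).mul (s2 i j)]
  simp only [pd_pd_sum a b fun j _ => (sP _ j).mul (s2 _ j), e2, Finset.sum_add_distrib]
  rw [add_comm]
  congr 1
  simp only [Matrix.one_apply, ite_mul, one_mul, zero_mul, Finset.sum_ite_eq, Finset.mem_univ, if_true]
  rw [← Finset.sum_add_distrib, Finset.mul_sum]
  exact Finset.sum_congr rfl fun i _ => by ring

lemma IsNormal.pd_hessian (h : IsNormal D G) (hf : ContDiffAt ℝ ∞ f 0) (k i j : Fin n) :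
    pd k (fun z => hessian G f z i j) 0 = pd k (pd i (pd j f)) 0
      - ∑ l, pd k (christoffel G l i j) 0 * pd l f 0 := by
  have h0 := h.zero_mem
  have hm := h.toIsMetricOn
  have sΓ := fun l => (hm.smooth_christoffel h0 l i j).smooth_differentiableAt
  have sf := fun i => (contDiffAt_pd i hf).smooth_differentiableAt
  have sff := (contDiffAt_pd i (contDiffAt_pd j hf)).smooth_differentiableAt
  have s2 := fun l => (sΓ l).fun_mul (sf l)
  simp only [hessian, Matrix.of_apply]
  rw [pd_sub k sff (DifferentiableAt.fun_sum (u := Finset.univ) fun l _ => s2 l),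
    pd_sum k fun l _ => s2 l]
  congr 1
  refine Finset.sum_congr rfl fun l _ => ?_
  rw [pd_mul k (sΓ l) (sf l), h.christoffel_zero]; ring

lemma IsNormal.pd_pd_hessian (h : IsNormal D G) (hf : ContDiffAt ℝ ∞ f 0) (a b i j : Fin n) :
    pd a (pd b fun z => hessian G f z i j) 0 = pd a (pd b (pd i (pd j f))) 0
      - ∑ l, (pd a (pd b (christoffel G l i j)) 0 * pd l f 0
        + pd b (christoffel G l i j) 0 * pd a (pd l f) 0
        + pd a (christoffel G l i j) 0 * pd b (pd l f) 0) := by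
  have h0 := h.zero_mem
  have hm := h.toIsMetricOn
  have sΓ := fun l => hm.smooth_christoffel h0 l i j
  have sf := fun i => contDiffAt_pd i hf
  simp only [hessian, Matrix.of_apply]
  rw [pd_pd_sub a b (contDiffAt_pd i (sf j)) (ContDiffAt.sum fun l _ => (sΓ l).mul (sf l)),
    pd_pd_sum a b fun l _ => (sΓ l).mul (sf l)]
  congr 1
  refine Finset.sum_congr rfl fun l _ => ?_
  rw [pd_pd_mul a b (sΓ l) (sf l), h.christoffel_zero]; ring

lemma contDiffAt_hessian (h : IsMetricOn D G) {y : Euc n} (hy : y ∈ D) (hf : ContDiffAt ℝ ∞ f y)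
    (i j : Fin n) : ContDiffAt ℝ ∞ (fun z => hessian G f z i j) y := by
  simp only [hessian, Matrix.of_apply]
  exact (contDiffAt_pd i (contDiffAt_pd j hf)).sub
    (ContDiffAt.sum fun l _ => (h.smooth_christoffel hy l i j).mul (contDiffAt_pd l hf))

lemma contDiffAt_gradSq (h : IsMetricOn D G) {y : Euc n} (hy : y ∈ D) (hf : ContDiffAt ℝ ∞ f y) :
    ContDiffAt ℝ ∞ (gradSq G f) y := by
  have e : gradSq G f = fun z => ∑ i, pd i f z * ∑ j, (G z)⁻¹ i j * pd j f z := rfl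
  rw [e]
  exact ContDiffAt.sum fun i _ => (contDiffAt_pd i hf).mul
    (ContDiffAt.sum fun j _ => (h.smooth_inv hy i j).mul (contDiffAt_pd j hf))

lemma Wmat_apply (z : Euc n) (i j : Fin n) : Wmat G f z i j = schouten G z i j + hessian G f z i j
    + pd i f z * pd j f z - (1 / 2) * (gradSq G f z * G z i j) := by
  simp only [Wmat, Matrix.add_apply, Matrix.sub_apply, Matrix.smul_apply, smul_eq_mul,
    Matrix.vecMulVec_apply, grad]
  ring

lemma contDiffAt_Wmat (h : IsMetricOn D G) {y : Euc n} (hy : y ∈ D) (hf : ContDiffAt ℝ ∞ f y)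
    (i j : Fin n) : ContDiffAt ℝ ∞ (fun z => Wmat G f z i j) y := by
  simp only [Wmat_apply]
  exact (((h.smooth_schouten hy i j).add (contDiffAt_hessian h hy hf i j)).add
    ((contDiffAt_pd i hf).mul (contDiffAt_pd j hf))).sub
    (contDiffAt_const.mul ((contDiffAt_gradSq h hy hf).mul (h.smooth y hy i j)))

lemma IsNormal.pd_Wmat (h : IsNormal D G) (hf : ContDiffAt ℝ ∞ f 0) (k i j : Fin n) :
    pd k (fun z => Wmat G f z i j) 0 = pd k (fun z => schouten G z i j) 0
      + (pd k (pd i (pd j f)) 0 - ∑ l, pd k (christoffel G l i j) 0 * pd l f 0)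
      + (pd k (pd i f) 0 * pd j f 0 + pd i f 0 * pd k (pd j f) 0)
      - (∑ l, pd k (pd l f) 0 * pd l f 0) * (1 : Matrix (Fin n) (Fin n) ℝ) i j := by
  have h0 := h.zero_mem
  have hm := h.toIsMetricOn
  have s1 := (hm.smooth_schouten h0 i j).smooth_differentiableAt
  have s2 := (contDiffAt_hessian hm h0 hf i j).smooth_differentiableAt
  have s3 := fun i => (contDiffAt_pd i hf).smooth_differentiableAt
  have s4 := (contDiffAt_gradSq hm h0 hf).smooth_differentiableAt
  have s5 := (hm.smooth 0 h0 i j).smooth_differentiableAt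
  simp only [Wmat_apply]
  rw [pd_sub k ((s1.fun_add s2).fun_add ((s3 i).fun_mul (s3 j)))
    ((differentiableAt_const _).fun_mul (s4.fun_mul s5)),
    pd_add k (s1.fun_add s2) ((s3 i).fun_mul (s3 j)), pd_add k s1 s2, pd_mul k (s3 i) (s3 j),
    pd_const_mul k _ (s4.fun_mul s5), pd_mul k s4 s5, h.pd_zero, h.eq_one, h.pd_gradSq hf,
    h.pd_hessian hf]
  ring

/-- Besides the derivatives of `f` of order three and four, this shows the terms quadratic in the
Hessian: one from `du ⊗ du` and the negative one from `-½|∇u|² g`, from which the final estimate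
gains its sign. -/
lemma IsNormal.pd_pd_Wmat (h : IsNormal D G) (hf : ContDiffAt ℝ ∞ f 0) (a i j : Fin n) :
    pd a (pd a fun z => Wmat G f z i j) 0 = pd a (pd a fun z => schouten G z i j) 0
      + (pd a (pd a (pd i (pd j f))) 0 - ∑ l, (pd a (pd a (christoffel G l i j)) 0 * pd l f 0
        + pd a (christoffel G l i j) 0 * pd a (pd l f) 0
        + pd a (christoffel G l i j) 0 * pd a (pd l f) 0))
      + (pd a (pd a (pd i f)) 0 * pd j f 0 + 2 * (pd a (pd i f) 0 * pd a (pd j f) 0)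
        + pd i f 0 * pd a (pd a (pd j f)) 0)
      - (∑ l, (pd a (pd a (pd l f)) 0 * pd l f 0 + pd a (pd l f) 0 * pd a (pd l f) 0)
          + (1 / 2) * ∑ k, ∑ l, pd a (pd a fun z => (G z)⁻¹ k l) 0 * (pd k f 0 * pd l f 0))
        * (1 : Matrix (Fin n) (Fin n) ℝ) i j
      - (1 / 2) * (∑ l, pd l f 0 ^ 2) * pd a (pd a fun z => G z i j) 0 := by
  have h0 := h.zero_mem
  have hm := h.toIsMetricOn
  have s1 := hm.smooth_schouten h0 i j
  have s2 := contDiffAt_hessian hm h0 hf i j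
  have s3 := fun i => contDiffAt_pd i hf
  have s4 := contDiffAt_gradSq hm h0 hf
  have s5 := hm.smooth 0 h0 i j
  simp only [Wmat_apply]
  rw [pd_pd_sub a a ((s1.add s2).add ((s3 i).mul (s3 j))) (contDiffAt_const.mul (s4.mul s5)),
    pd_pd_add a a (s1.add s2) ((s3 i).mul (s3 j)), pd_pd_add a a s1 s2, pd_pd_mul a a (s3 i) (s3 j),
    pd_pd_const_mul a a _ (s4.mul s5), pd_pd_mul a a s4 s5, h.pd_zero, h.eq_one, h.pd_pd_gradSq hf,
    h.pd_pd_hessian hf, h.gradSq_zero]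
  ring

end Normal

end

section

variable {n : ℕ}

/-! ### Concavity -/

/-- With `P = Bᵀ B` the trace is the sum of the squared entries of `B Y Bᵀ`. -/
lemma trace_sq_nonneg {P Y : Matrix (Fin n) (Fin n) ℝ} (hP : P.PosSemidef) (hY : Yᵀ = Y) :
    0 ≤ (P * Y * P * Y).trace := by
  obtain ⟨B, hB⟩ := exists_eq_transpose_mul hP
  have e : (P * Y * P * Y).trace = ((B * Y * Bᵀ)ᵀ * (B * Y * Bᵀ)).trace := by
    rw [Matrix.transpose_mul, Matrix.transpose_mul, Matrix.transpose_transpose, hY, hB]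
    rw [show Bᵀ * B * Y * (Bᵀ * B) * Y = Bᵀ * (B * Y * (Bᵀ * B) * Y) by simp only [Matrix.mul_assoc],
      Matrix.trace_mul_comm]
    simp only [Matrix.mul_assoc]
  rw [e]
  simp only [Matrix.trace, Matrix.diag, Matrix.mul_apply (M := (B * Y * Bᵀ)ᵀ), Matrix.transpose_apply]
  exact Finset.sum_nonneg fun i _ => Finset.sum_nonneg fun j _ => mul_self_nonneg _

/-- A supporting hyperplane for the concave function `σ₂/σ₁`. -/
lemma sigma2_div_le {G W Y : Matrix (Fin n) (Fin n) ℝ} (hG : G.PosDef) (hW : Wᵀ = W) (hY : Yᵀ = Y)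
    (hσ : 0 < sigma1 (G⁻¹ * W)) :
    sigma2 (G⁻¹ * W) / sigma1 (G⁻¹ * W)
      ≤ (1 / 2) * (1 + (Y * G * Y * G).trace) * sigma1 (G⁻¹ * W) - (Y * W).trace := by
  have hu : IsUnit G.det := hG.det_pos.ne'.isUnit
  have hGt : Gᵀ = G := by simpa using hG.isHermitian.eq
  set σ := sigma1 (G⁻¹ * W) with hσd
  -- Since `σ₂/σ₁ = σ/2 - |W|²/(2σ)`, the right side minus the left side is `|W - σ GYG|² / (2σ)`.
  -- Equality holds for `Y = σ⁻¹ G⁻¹ W G⁻¹`.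
  have h1 := trace_sq_nonneg hG.posSemidef.inv (Y := W - σ • (G * Y * G)) (by
    rw [Matrix.transpose_sub, Matrix.transpose_smul, Matrix.transpose_mul, Matrix.transpose_mul, hW, hY,
      hGt, Matrix.mul_assoc])
  have e1 : G⁻¹ * (W - σ • (G * Y * G)) = G⁻¹ * W - σ • (Y * G) := by
    rw [Matrix.mul_sub, Matrix.mul_smul, Matrix.mul_assoc, ← Matrix.mul_assoc,
      Matrix.nonsing_inv_mul _ hu, Matrix.one_mul]
  have e2 : (G⁻¹ * (W - σ • (G * Y * G)) * G⁻¹ * (W - σ • (G * Y * G))).trace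
      = (G⁻¹ * W * (G⁻¹ * W)).trace - 2 * σ * (Y * W).trace + σ ^ 2 * (Y * G * Y * G).trace := by
    rw [Matrix.mul_assoc _ G⁻¹, e1, Matrix.sub_mul, Matrix.mul_sub, Matrix.mul_sub]
    have e3 : (G⁻¹ * W * (Y * G)).trace = (Y * W).trace := by
      rw [Matrix.trace_mul_comm, Matrix.mul_assoc, ← Matrix.mul_assoc G, Matrix.mul_nonsing_inv _ hu,
        Matrix.one_mul]
    have e4 : (Y * G * (G⁻¹ * W)).trace = (Y * W).trace := by
      rw [Matrix.mul_assoc, ← Matrix.mul_assoc G, Matrix.mul_nonsing_inv _ hu, Matrix.one_mul]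
    simp only [Matrix.trace_sub, Matrix.smul_mul, Matrix.mul_smul, Matrix.trace_smul, smul_eq_mul, e3, e4]
    rw [← Matrix.mul_assoc (Y * G)]
    ring
  rw [e2] at h1
  rw [div_le_iff₀ hσ]
  unfold sigma2
  rw [show (G⁻¹ * W).trace = σ from rfl]
  nlinarith

/-- A supporting hyperplane for the convex function `e^{-aw}/σ`. -/
lemma exp_div_ge {φ σ₀ σ w w₀ a : ℝ} (hφ : 0 ≤ φ) (hσ₀ : 0 < σ₀) (hσ : 0 < σ) :
    φ * Real.exp (-a * w₀) / σ₀ * (2 - a * (w - w₀) - σ / σ₀) ≤ φ * Real.exp (-a * w) / σ := by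
  -- Write the quotient of the two values as one exponential and use `1 + x ≤ e^x`, then `log x ≤ x
  -- - 1`. Both are equalities at the base point.
  have h1 : 2 - a * (w - w₀) - σ / σ₀ ≤ Real.exp (-a * (w - w₀)) * (σ₀ / σ) := by
    have h2 : σ₀ / σ = Real.exp (- Real.log (σ / σ₀)) := by
      rw [Real.exp_neg, Real.exp_log (div_pos hσ hσ₀), inv_div]
    rw [h2, ← Real.exp_add]
    have h3 := Real.add_one_le_exp (-a * (w - w₀) + - Real.log (σ / σ₀))
    have h4 := Real.log_le_sub_one_of_pos (div_pos hσ hσ₀)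
    linarith
  calc _ ≤ φ * Real.exp (-a * w₀) / σ₀ * (Real.exp (-a * (w - w₀)) * (σ₀ / σ)) :=
        mul_le_mul_of_nonneg_left h1 (div_nonneg (mul_nonneg hφ (Real.exp_pos _).le) hσ₀.le)
    _ = φ * (Real.exp (-a * w₀) * Real.exp (-a * (w - w₀))) / σ := by field_simp
    _ = _ := by rw [← Real.exp_add]; ring_nf

/-! ### Time derivatives -/

lemma JSmooth.deriv {I : Set ℝ} {D : Set (Euc n)} {u : ℝ → Euc n → ℝ} (hu : JSmooth I D u)
    (hI : IsOpen I) (hD : IsOpen D) : JSmooth I D (fun t z => deriv (fun τ => u τ z) t) := by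
  have hS : UniqueDiffOn ℝ (I ×ˢ D) := (hI.prod hD).uniqueDiffOn
  have h1 : ContDiffOn ℝ ∞ (fun q : ℝ × Euc n =>
      fderivWithin ℝ (fun q : ℝ × Euc n => u q.1 q.2) (I ×ˢ D) q ((1 : ℝ), (0 : Euc n))) (I ×ˢ D) :=
    (ContDiffOn.fderivWithin (m := ∞) hu hS (by simp)).clm_apply contDiffOn_const
  refine ContDiffOn.congr h1 fun q hq => ?_
  rw [fderivWithin_of_isOpen (hI.prod hD) hq]
  have h2 : HasFDerivAt (fun q : ℝ × Euc n => u q.1 q.2) _ (q.1, q.2) :=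
    ((ContDiffOn.contDiffAt hu ((hI.prod hD).mem_nhds hq)).differentiableAt (by simp)).hasFDerivAt
  have h3 : HasDerivAt (fun τ : ℝ => (τ, q.2)) ((1 : ℝ), (0 : Euc n)) q.1 :=
    (hasDerivAt_id q.1).prodMk (hasDerivAt_const q.1 q.2)
  exact (h2.comp_hasDerivAt q.1 h3).deriv

/-- Time derivatives commute with spatial derivatives. -/
lemma JSmooth.hasDerivAt_pd {I : Set ℝ} {D : Set (Euc n)} {u : ℝ → Euc n → ℝ} (hu : JSmooth I D u)
    (hI : IsOpen I) (hD : IsOpen D) {t : ℝ} (ht : t ∈ I) {z : Euc n} (hz : z ∈ D) (i : Fin n) :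
    HasDerivAt (fun τ => SigmaTwoFlow.pd i (u τ) z)
      (SigmaTwoFlow.pd i (fun w => _root_.deriv (fun τ => u τ w) t) z) t := by
  set U : ℝ × Euc n → ℝ := fun q => u q.1 q.2 with hU
  have hS : IsOpen (I ×ˢ D) := hI.prod hD
  have sU : ∀ q ∈ I ×ˢ D, ContDiffAt ℝ ∞ U q := fun q hq => ContDiffOn.contDiffAt hu (hS.mem_nhds hq)
  have dU : ∀ q ∈ I ×ˢ D, HasFDerivAt U (fderiv ℝ U q) q :=
    fun q hq => ((sU q hq).differentiableAt (by simp)).hasFDerivAt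
  have hq : (t, z) ∈ I ×ˢ D := ⟨ht, hz⟩
  have dU2 : HasFDerivAt (fderiv ℝ U) (fderiv ℝ (fderiv ℝ U) (t, z)) (t, z) :=
    (((sU _ hq).fderiv_right (m := ∞) (by simp)).differentiableAt (by simp)).hasFDerivAt
  have e1 : ∀ τ ∈ I, SigmaTwoFlow.pd i (u τ) z
      = fderiv ℝ U (τ, z) ((0 : ℝ), (EuclideanSpace.single i (1 : ℝ) : Euc n)) := by
    intro τ hτ
    have := (dU (τ, z) ⟨hτ, hz⟩).comp z (hasFDerivAt_prodMk_right τ z)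
    unfold SigmaTwoFlow.pd
    rw [show u τ = U ∘ fun z => (τ, z) from rfl, this.fderiv]; rfl
  have e2 : ∀ w ∈ D, _root_.deriv (fun τ => u τ w) t = fderiv ℝ U (t, w) ((1 : ℝ), (0 : Euc n)) := by
    intro w hw
    have h3 : HasDerivAt (fun τ : ℝ => (τ, w)) ((1 : ℝ), (0 : Euc n)) t :=
      (hasDerivAt_id t).prodMk (hasDerivAt_const t w)
    exact ((dU (t, w) ⟨ht, hw⟩).comp_hasDerivAt t h3).deriv
  have e3 : SigmaTwoFlow.pd i (fun w => _root_.deriv (fun τ => u τ w) t) z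
      = fderiv ℝ (fderiv ℝ U) (t, z) ((0 : ℝ), (EuclideanSpace.single i (1 : ℝ) : Euc n))
        ((1 : ℝ), (0 : Euc n)) := by
    rw [pd_congr_on hD hz i e2]
    have h5 : HasFDerivAt (fun w => fderiv ℝ U (t, w))
        ((fderiv ℝ (fderiv ℝ U) (t, z)).comp (ContinuousLinearMap.inr ℝ ℝ (Euc n))) z :=
      dU2.comp z (hasFDerivAt_prodMk_right t z)
    have h6 : HasFDerivAt (fun w => fderiv ℝ U (t, w) ((1 : ℝ), (0 : Euc n))) _ z :=
      (ContinuousLinearMap.apply ℝ ℝ ((1 : ℝ), (0 : Euc n))).hasFDerivAt.comp z h5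
    unfold SigmaTwoFlow.pd
    rw [h6.fderiv]
    rfl
  have h4 : HasDerivAt (fun τ : ℝ => (τ, z)) ((1 : ℝ), (0 : Euc n)) t :=
    (hasDerivAt_id t).prodMk (hasDerivAt_const t z)
  have e4 : HasDerivAt
      (fun τ => fderiv ℝ U (τ, z) ((0 : ℝ), (EuclideanSpace.single i (1 : ℝ) : Euc n)))
      (fderiv ℝ (fderiv ℝ U) (t, z) ((1 : ℝ), (0 : Euc n))
        ((0 : ℝ), (EuclideanSpace.single i (1 : ℝ) : Euc n))) t := by
    have h5 : HasDerivAt (fun τ => fderiv ℝ U (τ, z))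
        (fderiv ℝ (fderiv ℝ U) (t, z) ((1 : ℝ), (0 : Euc n))) t := dU2.comp_hasDerivAt t h4
    exact ((ContinuousLinearMap.apply ℝ ℝ
      ((0 : ℝ), (EuclideanSpace.single i (1 : ℝ) : Euc n))).hasFDerivAt.comp_hasDerivAt t h5)
  -- Both mixed derivatives are values of the second derivative of the joint function of time and
  -- space, which is symmetric.
  have hsymm := (sU _ hq).isSymmSndFDerivAt (by
    simp only [minSmoothness_of_isRCLikeNormedField]; exact WithTop.coe_le_coe.2 (le_top (a := (2 : ℕ∞))))
  rw [e3, ← hsymm.eq]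
  refine e4.congr_of_eventuallyEq ?_
  filter_upwards [hI.mem_nhds ht] with τ hτ using e1 τ hτ

end

section

variable {n : ℕ}

/-! ### The maximum principle in normal coordinates -/

/-- At the first maximum only earlier times can be compared, hence the one-sided difference
quotient. -/
lemma deriv_nonneg_of_le_left {φ : ℝ → ℝ} {t₀ d : ℝ} (hd : HasDerivAt φ d t₀)
    (h : ∀ᶠ τ in 𝓝 t₀, τ ≤ t₀ → φ τ ≤ φ t₀) : 0 ≤ d := by
  have h1 : Tendsto (slope φ t₀) (𝓝[<] t₀) (𝓝 d) :=
    (hasDerivAt_iff_tendsto_slope.1 hd).mono_left (nhdsWithin_mono _ fun x hx => ne_of_lt hx)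
  refine ge_of_tendsto h1 ?_
  filter_upwards [self_mem_nhdsWithin, nhdsWithin_le_nhds h] with τ hτ hle
  rw [slope_def_field]
  exact div_nonneg_of_nonpos (sub_nonpos.2 (hle (le_of_lt hτ))) (sub_nonpos.2 (le_of_lt hτ))

/-- Ellipticity of the linearised operator: an eigenvalue `λ` of `Y` satisfies `λ ≤ (1 + λ²)/2 ≤ (1
+ |Y|²)/2`. The number `c` leaves room for the term coming from `r`. -/
lemma posSemidef_supporting {Y : Matrix (Fin n) (Fin n) ℝ} (hY : Yᵀ = Y) {c : ℝ} (hc : 0 ≤ c) :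
    (((1 / 2) * (1 + (Y * Y).trace) + c) • (1 : Matrix (Fin n) (Fin n) ℝ) - Y).PosSemidef := by
  refine Matrix.PosSemidef.of_dotProduct_mulVec_nonneg ?_ ?_
  · show _ᴴ = _
    simp [hY]
  · intro x
    have e0 : star x = x := by simp
    rw [e0, Matrix.sub_mulVec, Matrix.smul_mulVec, Matrix.one_mulVec, dotProduct_sub, dotProduct_smul,
      smul_eq_mul]
    have h1 : 0 ≤ (x - Y *ᵥ x) ⬝ᵥ (x - Y *ᵥ x) :=
      Finset.sum_nonneg fun i _ => mul_self_nonneg _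
    rw [sub_dotProduct, dotProduct_sub, dotProduct_sub, dotProduct_comm (Y *ᵥ x) x] at h1
    have h2 : (Y *ᵥ x) ⬝ᵥ (Y *ᵥ x) ≤ (Y * Y).trace * (x ⬝ᵥ x) := by
      have e1 : (Y * Y).trace = ∑ i, ∑ j, Y i j ^ 2 := by
        simp only [Matrix.trace, Matrix.diag, Matrix.mul_apply]
        refine Finset.sum_congr rfl fun i _ => Finset.sum_congr rfl fun j _ => ?_
        rw [pow_two]
        congr 1
        exact congrFun (congrFun hY i) j
      rw [e1, Finset.sum_mul]
      refine Finset.sum_le_sum fun i _ => ?_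
      have := Finset.sum_mul_sq_le_sq_mul_sq Finset.univ (fun j => Y i j) x
      calc (Y *ᵥ x) i * (Y *ᵥ x) i = (∑ j, Y i j * x j) ^ 2 := by rw [pow_two]; rfl
        _ ≤ _ := this
        _ = _ := by simp [dotProduct, pow_two]
    have h3 : 0 ≤ c * (x ⬝ᵥ x) := mul_nonneg hc (Finset.sum_nonneg fun i _ => mul_self_nonneg _)
    nlinarith

section Normal

variable {D : Set (Euc n)} {G : Euc n → Matrix (Fin n) (Fin n) ℝ} {f : Euc n → ℝ}

/-- The function whose vanishing maximum is attained at the origin. -/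
def barrier (G : Euc n → Matrix (Fin n) (Fin n) ℝ) (e : Fin n) (c : ℝ) (f : Euc n → ℝ) (z : Euc n) : ℝ :=
  hessian G f z e e + G z e e * (gradSq G f z - c)

lemma contDiffAt_barrier (h : IsMetricOn D G) {y : Euc n} (hy : y ∈ D) (hf : ContDiffAt ℝ ∞ f y)
    (e : Fin n) (c : ℝ) : ContDiffAt ℝ ∞ (barrier G e c f) y :=
  (contDiffAt_hessian h hy hf e e).add ((h.smooth y hy e e).mul
    ((contDiffAt_gradSq h hy hf).sub contDiffAt_const))

lemma IsNormal.pd_barrier (h : IsNormal D G) (hf : ContDiffAt ℝ ∞ f 0) (e i : Fin n) (c : ℝ) :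
    pd i (barrier G e c f) 0 = pd i (pd e (pd e f)) 0
      - ∑ l, pd i (christoffel G l e e) 0 * pd l f 0 + 2 * ∑ l, pd i (pd l f) 0 * pd l f 0 := by
  have h0 := h.zero_mem
  have hm := h.toIsMetricOn
  have s1 := (contDiffAt_hessian hm h0 hf e e).smooth_differentiableAt
  have s2 := (hm.smooth 0 h0 e e).smooth_differentiableAt
  have s3 := (contDiffAt_gradSq hm h0 hf).smooth_differentiableAt
  unfold barrier
  rw [pd_add i s1 (s2.fun_mul (s3.fun_sub (differentiableAt_const _))),
    pd_mul i s2 (s3.fun_sub (differentiableAt_const _)), pd_sub i s3 (differentiableAt_const _),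
    pd_const, h.pd_zero, h.eq_one, h.pd_hessian hf, h.pd_gradSq hf]
  simp

lemma IsNormal.pd_pd_barrier (h : IsNormal D G) (hf : ContDiffAt ℝ ∞ f 0) (e i j : Fin n) (c : ℝ) :
    pd i (pd j (barrier G e c f)) 0 = pd i (pd j (pd e (pd e f))) 0
      - ∑ l, (pd i (pd j (christoffel G l e e)) 0 * pd l f 0
        + pd j (christoffel G l e e) 0 * pd i (pd l f) 0
        + pd i (christoffel G l e e) 0 * pd j (pd l f) 0)
      + pd i (pd j fun z => G z e e) 0 * (gradSq G f 0 - c)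
      + (2 * ∑ l, (pd i (pd j (pd l f)) 0 * pd l f 0 + pd i (pd l f) 0 * pd j (pd l f) 0)
      + ∑ k, ∑ l, pd i (pd j fun z => (G z)⁻¹ k l) 0 * (pd k f 0 * pd l f 0)) := by
  have h0 := h.zero_mem
  have hm := h.toIsMetricOn
  have s1 := contDiffAt_hessian hm h0 hf e e
  have s2 := hm.smooth 0 h0 e e
  have s3 := contDiffAt_gradSq hm h0 hf
  unfold barrier
  rw [pd_pd_add i j s1 (s2.mul (s3.sub contDiffAt_const)),
    pd_pd_mul i j s2 (s3.sub contDiffAt_const), pd_pd_sub i j s3 contDiffAt_const, pd_pd_const,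
    h.pd_zero, h.pd_zero, h.eq_one, h.pd_pd_hessian hf, h.pd_pd_gradSq hf, Matrix.one_apply_eq]
  ring

/-- The terms of lower order in `IsNormal.linearized_eq`. -/
def lowerTerm (G : Euc n → Matrix (Fin n) (Fin n) ℝ) (e : Fin n) (f : Euc n → ℝ) (i j : Fin n) : ℝ :=
  pd e (pd e fun z => schouten G z i j) 0 + 2 * ∑ k, pd k f 0 * pd k (fun z => schouten G z i j) 0
  - ∑ l, (pd e (pd e (christoffel G l i j)) 0 * pd l f 0
      + 2 * (pd e (christoffel G l i j) 0 * pd e (pd l f) 0))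
  - (1 / 2) * (∑ k, ∑ l, pd e (pd e fun z => (G z)⁻¹ k l) 0 * (pd k f 0 * pd l f 0))
      * (1 : Matrix (Fin n) (Fin n) ℝ) i j
  - (1 / 2) * (∑ l, pd l f 0 ^ 2) * pd e (pd e fun z => G z i j) 0
  - 2 * ∑ k, pd k f 0 * ∑ l, pd k (christoffel G l i j) 0 * pd l f 0
  + ∑ l, (pd i (pd j (christoffel G l e e)) 0 * pd l f 0
      + pd j (christoffel G l e e) 0 * pd i (pd l f) 0
      + pd i (christoffel G l e e) 0 * pd j (pd l f) 0)
  + pd i (pd j fun z => G z e e) 0 * pd e (pd e f) 0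
  - ∑ k, ∑ l, pd i (pd j fun z => (G z)⁻¹ k l) 0 * (pd k f 0 * pd l f 0)
  + (∑ l, pd i (christoffel G l e e) 0 * pd l f 0) * pd j f 0
  + pd i f 0 * (∑ l, pd j (christoffel G l e e) 0 * pd l f 0)
  - (∑ k, (∑ l, pd k (christoffel G l e e) 0 * pd l f 0) * pd k f 0)
      * (1 : Matrix (Fin n) (Fin n) ℝ) i j

/-- The cancellation of the derivatives of order three and four at a maximum. -/
lemma IsNormal.linearized_eq (h : IsNormal D G) (hf : ∀ z ∈ D, ContDiffAt ℝ ∞ f z) (e : Fin n)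
    (hg : ∀ i, pd i (barrier G e (pd e (pd e f) 0 + gradSq G f 0) f) 0 = 0) (i j : Fin n) :
    pd e (pd e fun z => Wmat G f z i j) 0 + 2 * ∑ k, pd k f 0 * pd k (fun z => Wmat G f z i j) 0
      - pd i (pd j (barrier G e (pd e (pd e f) 0 + gradSq G f 0) f)) 0
    = 2 * (pd e (pd i f) 0 * pd e (pd j f) 0)
      - (∑ l, pd e (pd l f) 0 ^ 2) * (1 : Matrix (Fin n) (Fin n) ℝ) i j
      - 2 * ∑ l, pd i (pd l f) 0 * pd j (pd l f) 0 + lowerTerm G e f i j := by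
  have h0 := h.zero_mem
  have hm := h.toIsMetricOn
  have hf0 := hf 0 h0
  -- The vanishing gradient of the barrier expresses these third derivatives through the gradient
  -- and the Hessian.
  have t3 : ∀ i, pd e (pd e (pd i f)) 0 = ∑ l, pd i (christoffel G l e e) 0 * pd l f 0
      - 2 * ∑ l, pd i (pd l f) 0 * pd l f 0 := by
    intro i
    have h1 := hg i
    rw [h.pd_barrier hf0] at h1
    have h2 : pd e (pd e (pd i f)) 0 = pd i (pd e (pd e f)) 0 := by
      rw [pd_congr_on hm.isOpen h0 e fun z hz => pd_comm e i (hf z hz)]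
      exact pd_comm e i (contDiffAt_pd e hf0)
    rw [h2]; linarith
  -- Partial derivatives commute, so the fourth derivatives in `W` and in the barrier cancel
  -- exactly. Curvature enters only through derivatives of Christoffel symbols, collected in
  -- `lowerTerm`.
  have t4 : pd e (pd e (pd i (pd j f))) 0 = pd i (pd j (pd e (pd e f))) 0 := by
    have a1 : ∀ z ∈ D, pd e (pd i (pd j f)) z = pd i (pd j (pd e f)) z := by
      intro z hz
      rw [pd_comm e i (contDiffAt_pd j (hf z hz))]
      exact pd_congr_on hm.isOpen hz i fun w hw => pd_comm e j (hf w hw)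
    rw [pd_congr_on hm.isOpen h0 e a1, pd_comm e i (contDiffAt_pd j (contDiffAt_pd e hf0))]
    exact pd_congr_on hm.isOpen h0 i fun w hw => pd_comm e j (contDiffAt_pd e (hf w hw))
  have t3' : ∀ k, pd k (pd i (pd j f)) 0 = pd i (pd j (pd k f)) 0 := by
    intro k
    rw [pd_comm k i (contDiffAt_pd j hf0)]
    exact pd_congr_on hm.isOpen h0 i fun w hw => pd_comm k j (hf w hw)
  rw [h.pd_pd_barrier hf0, h.pd_pd_Wmat hf0]
  simp only [h.pd_Wmat hf0, t3, t4, t3', lowerTerm, h.gradSq_zero]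
  -- The remaining third derivatives `u_k u_{ijk}` come from differentiating `W` along the gradient
  -- and cancel those in the second derivatives of `|∇u|²`. This is the reason for adding `|∇u|²` to
  -- the barrier.
  have x1 : ∑ k, pd k f 0 * (pd k (fun z => schouten G z i j) 0
      + (pd i (pd j (pd k f)) 0 - ∑ l, pd k (christoffel G l i j) 0 * pd l f 0)
      + (pd k (pd i f) 0 * pd j f 0 + pd i f 0 * pd k (pd j f) 0)
      - (∑ l, pd k (pd l f) 0 * pd l f 0) * (1 : Matrix (Fin n) (Fin n) ℝ) i j)
      = ∑ k, pd k f 0 * pd k (fun z => schouten G z i j) 0 + ∑ k, pd i (pd j (pd k f)) 0 * pd k f 0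
        - ∑ k, pd k f 0 * (∑ l, pd k (christoffel G l i j) 0 * pd l f 0)
        + ((∑ l, pd i (pd l f) 0 * pd l f 0) * pd j f 0 + pd i f 0 * ∑ l, pd j (pd l f) 0 * pd l f 0)
        - (∑ k, (∑ l, pd k (pd l f) 0 * pd l f 0) * pd k f 0)
          * (1 : Matrix (Fin n) (Fin n) ℝ) i j := by
    have c : ∀ a b, pd a (pd b f) 0 = pd b (pd a f) 0 := fun a b => pd_comm a b hf0
    have y1 : ∑ k, pd k f 0 * pd i (pd j (pd k f)) 0 = ∑ k, pd i (pd j (pd k f)) 0 * pd k f 0 :=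
      Finset.sum_congr rfl fun k _ => mul_comm _ _
    have y2 : ∑ k, pd k f 0 * (pd k (pd i f) 0 * pd j f 0) = (∑ l, pd i (pd l f) 0 * pd l f 0) * pd j f 0 := by
      rw [Finset.sum_mul]
      exact Finset.sum_congr rfl fun k _ => by rw [c k i]; ring
    have y3 : ∑ k, pd k f 0 * (pd i f 0 * pd k (pd j f) 0) = pd i f 0 * ∑ l, pd j (pd l f) 0 * pd l f 0 := by
      rw [Finset.mul_sum]
      exact Finset.sum_congr rfl fun k _ => by rw [c k j]; ring
    have y4 : ∑ k, pd k f 0 * ((∑ l, pd k (pd l f) 0 * pd l f 0) * (1 : Matrix (Fin n) (Fin n) ℝ) i j)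
        = (∑ k, (∑ l, pd k (pd l f) 0 * pd l f 0) * pd k f 0) * (1 : Matrix (Fin n) (Fin n) ℝ) i j := by
      rw [Finset.sum_mul]
      exact Finset.sum_congr rfl fun k _ => by ring
    simp only [mul_add, mul_sub, Finset.sum_add_distrib, Finset.sum_sub_distrib]
    rw [y1, y2, y3, y4]
    ring
  rw [x1]
  simp only [sub_mul, mul_assoc, Finset.sum_sub_distrib, Finset.sum_add_distrib, ← Finset.mul_sum,
    ← pow_two, add_mul]
  ring

end Normal

end

/-! ### The differential inequality at the maximum of the barrier. -/

section

variable {n : ℕ} {D : Set (Euc n)} {G : Euc n → Matrix (Fin n) (Fin n) ℝ} {f : Euc n → ℝ}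

lemma contDiffAt_sigma1 (h : IsMetricOn D G) {y : Euc n} (hy : y ∈ D) (hf : ContDiffAt ℝ ∞ f y) :
    ContDiffAt ℝ ∞ (fun z => sigma1 ((G z)⁻¹ * Wmat G f z)) y := by
  simp only [sigma1]
  exact contDiffAt_trace (contDiffAt_matrix_mul (fun i j => h.smooth_inv hy i j)
    fun i j => contDiffAt_Wmat h hy hf i j)

lemma sigma1_eq_sum (z : Euc n) : sigma1 ((G z)⁻¹ * Wmat G f z)
    = ∑ i, ∑ j, (G z)⁻¹ i j * Wmat G f z j i := by
  simp [sigma1, Matrix.trace, Matrix.mul_apply]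

lemma IsNormal.pd_sigma1 (h : IsNormal D G) (hf : ContDiffAt ℝ ∞ f 0) (k : Fin n) :
    pd k (fun z => sigma1 ((G z)⁻¹ * Wmat G f z)) 0 = ∑ i, pd k (fun z => Wmat G f z i i) 0 := by
  have h0 := h.zero_mem
  have hm := h.toIsMetricOn
  have sP := fun i j => (hm.smooth_inv h0 i j).smooth_differentiableAt
  have sW := fun i j => (contDiffAt_Wmat hm h0 hf i j).smooth_differentiableAt
  have s2 := fun i j => (sP i j).fun_mul (sW j i)
  simp only [sigma1_eq_sum]
  rw [pd_sum k fun i _ => DifferentiableAt.fun_sum (u := Finset.univ) fun j _ => s2 i j]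
  refine Finset.sum_congr rfl fun i _ => ?_
  rw [pd_sum k fun j _ => s2 i j]
  simp only [fun j => pd_mul k (sP i j) (sW j i), h.pd_inv_zero, h.inv_zero, zero_mul, zero_add,
    Matrix.one_apply, ite_mul, one_mul, Finset.sum_ite_eq, Finset.mem_univ, if_true]

lemma IsNormal.pd_pd_sigma1 (h : IsNormal D G) (hf : ContDiffAt ℝ ∞ f 0) (a b : Fin n) :
    pd a (pd b (fun z => sigma1 ((G z)⁻¹ * Wmat G f z))) 0 = ∑ i, pd a (pd b (fun z => Wmat G f z i i)) 0
      + ∑ i, ∑ j, pd a (pd b fun z => (G z)⁻¹ i j) 0 * Wmat G f 0 j i := by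
  have h0 := h.zero_mem
  have hm := h.toIsMetricOn
  have sP := fun i j => hm.smooth_inv h0 i j
  have sW := fun i j => contDiffAt_Wmat hm h0 hf i j
  have s2 := fun i j => (sP i j).mul (sW j i)
  simp only [sigma1_eq_sum]
  rw [pd_pd_sum a b fun i _ => ContDiffAt.sum fun j _ => s2 i j, ← Finset.sum_add_distrib]
  refine Finset.sum_congr rfl fun i _ => ?_
  rw [pd_pd_sum a b fun j _ => s2 i j]
  simp only [fun j => pd_pd_mul a b (sP i j) (sW j i), h.pd_inv_zero, h.inv_zero, zero_mul, zero_add,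
    add_zero, Finset.sum_add_distrib, Matrix.one_apply, ite_mul, one_mul, Finset.sum_ite_eq,
    Finset.mem_univ, if_true]
  rw [add_comm]

lemma IsNormal.trace_conj_smooth (h : IsMetricOn D G) {y : Euc n} (hy : y ∈ D)
    (Y : Matrix (Fin n) (Fin n) ℝ) : ContDiffAt ℝ ∞ (fun z => (Y * G z * Y * G z).trace) y := by
  have c : ∀ i j, ContDiffAt ℝ ∞ (fun _ : Euc n => Y i j) y := fun i j => contDiffAt_const
  exact contDiffAt_trace (contDiffAt_matrix_mul (contDiffAt_matrix_mul
    (contDiffAt_matrix_mul c fun i j => h.smooth y hy i j) c) fun i j => h.smooth y hy i j)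

lemma IsNormal.pd_trace_conj (h : IsNormal D G) (Y : Matrix (Fin n) (Fin n) ℝ) (k : Fin n) :
    pd k (fun z => (Y * G z * Y * G z).trace) 0 = 0 := by
  have h0 := h.zero_mem
  have hm := h.toIsMetricOn
  have sG := fun i j => (hm.smooth 0 h0 i j).smooth_differentiableAt
  have sX := fun i j => DifferentiableAt.fun_sum (u := Finset.univ) fun l _ => (sG l j).const_mul (Y i l)
  have dX : ∀ i j, pd k (fun z => ∑ l, Y i l * G z l j) 0 = 0 := by
    intro i j
    rw [pd_sum k fun l _ => (sG l j).const_mul (Y i l)]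
    simp only [fun l => pd_const_mul k (Y i l) (sG l j), h.pd_zero, mul_zero, Finset.sum_const_zero]
  have e : (fun z => (Y * G z * Y * G z).trace)
      = fun z => ∑ i, ∑ j, (∑ l, Y i l * G z l j) * (∑ l, Y j l * G z l i) := by
    ext z
    rw [Matrix.mul_assoc (Y * G z)]
    simp [Matrix.trace, Matrix.mul_apply]
  rw [e, pd_sum k fun i _ => DifferentiableAt.fun_sum (u := Finset.univ) fun j _ => (sX i j).fun_mul (sX j i)]
  refine Finset.sum_eq_zero fun i _ => ?_
  rw [pd_sum k fun j _ => (sX i j).fun_mul (sX j i)]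
  refine Finset.sum_eq_zero fun j _ => ?_
  rw [pd_mul k (sX i j) (sX j i), dX, dX]; ring

/-- The supporting functional is built with a constant matrix `Y` at nearby points, so its
coefficient varies with the metric. Only this second derivative, a curvature term, survives at the
origin. -/
lemma IsNormal.pd_pd_trace_conj (h : IsNormal D G) (Y : Matrix (Fin n) (Fin n) ℝ) (k : Fin n) :
    pd k (pd k (fun z => (Y * G z * Y * G z).trace)) 0
      = 2 * ∑ i, ∑ j, (∑ l, Y i l * pd k (pd k fun z => G z l j) 0) * Y j i := by
  have h0 := h.zero_mem
  have hm := h.toIsMetricOn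
  have sG := fun i j => hm.smooth 0 h0 i j
  have sG' := fun i j => (hm.smooth 0 h0 i j).smooth_differentiableAt
  have sY : ∀ i j, ContDiffAt ℝ ∞ (fun z => Y i j) (0 : Euc n) := fun i j => contDiffAt_const
  have sX := fun i j => ContDiffAt.sum (s := Finset.univ) fun l _ => (sY i l).mul (sG l j)
  have dX : ∀ i j, pd k (fun z => ∑ l, Y i l * G z l j) 0 = 0 := by
    intro i j
    rw [pd_sum k fun l _ => (sG' l j).const_mul (Y i l)]
    simp only [fun l => pd_const_mul k (Y i l) (sG' l j), h.pd_zero, mul_zero, Finset.sum_const_zero]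
  have ddX : ∀ i j, pd k (pd k (fun z => ∑ l, Y i l * G z l j)) 0
      = ∑ l, Y i l * pd k (pd k fun z => G z l j) 0 := by
    intro i j
    rw [pd_pd_sum k k fun l _ => (sY i l).mul (sG l j)]
    simp only [fun l => pd_pd_const_mul k k (Y i l) (sG l j)]
  have X0 : ∀ i j, ∑ l, Y i l * G 0 l j = Y i j := by
    intro i j
    simp [h.eq_one, Matrix.one_apply]
  have e : (fun z => (Y * G z * Y * G z).trace)
      = fun z => ∑ i, ∑ j, (∑ l, Y i l * G z l j) * (∑ l, Y j l * G z l i) := by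
    ext z
    rw [Matrix.mul_assoc (Y * G z)]
    simp [Matrix.trace, Matrix.mul_apply]
  rw [e, pd_pd_sum k k fun i _ => ContDiffAt.sum (s := Finset.univ) fun j _ => (sX i j).mul (sX j i)]
  have e2 : ∀ i, pd k (pd k fun z => ∑ j, (∑ l, Y i l * G z l j) * (∑ l, Y j l * G z l i)) 0
      = ∑ j, (∑ l, Y i l * pd k (pd k fun z => G z l j) 0) * Y j i
        + ∑ j, (∑ l, Y j l * pd k (pd k fun z => G z l i) 0) * Y i j := by
    intro i
    rw [pd_pd_sum k k fun j _ => (sX i j).mul (sX j i), ← Finset.sum_add_distrib]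
    refine Finset.sum_congr rfl fun j _ => ?_
    rw [pd_pd_mul k k (sX i j) (sX j i), dX, dX, ddX, ddX, X0, X0]; ring
  simp only [e2, Finset.sum_add_distrib]
  rw [Finset.sum_comm (f := fun i j => (∑ l, Y j l * pd k (pd k fun z => G z l i) 0) * Y i j)]
  ring

/-! ### The linearized inequality -/

section Linearized

variable {I : Set ℝ} {u : ℝ → Euc n → ℝ} {t₀ : ℝ}

lemma IsNormal.barrier_zero (h : IsNormal D G) (e : Fin n) (c : ℝ) (v : Euc n → ℝ) :
    barrier G e c v 0 = pd e (pd e v) 0 + ∑ l, pd l v 0 ^ 2 - c := by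
  rw [barrier, h.hessian_zero, h.gradSq_zero, h.eq_one, Matrix.one_apply_eq]; ring

lemma IsNormal.hasDerivAt_barrier (h : IsNormal D G) (hI : IsOpen I) (hu : JSmooth I D u) (ht : t₀ ∈ I)
    (e : Fin n) (c : ℝ) : HasDerivAt (fun τ => barrier G e c (u τ) 0)
      (pd e (pd e fun z => deriv (fun τ => u τ z) t₀) 0
        + 2 * ∑ l, pd l (u t₀) 0 * pd l (fun z => deriv (fun τ => u τ z) t₀) 0) t₀ := by
  have h0 := h.zero_mem
  have hD := h.isOpen
  have e1 : (fun τ => barrier G e c (u τ) 0)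
      = fun τ => pd e (pd e (u τ)) 0 + ∑ l, pd l (u τ) 0 ^ 2 - c := by
    ext τ; exact h.barrier_zero e c _
  have d1 := (hu.pd hI.uniqueDiffOn hD e).hasDerivAt_pd hI hD ht h0 e
  have d2 : pd e (fun z => deriv (fun τ => pd e (u τ) z) t₀) 0
      = pd e (pd e fun z => deriv (fun τ => u τ z) t₀) 0 :=
    pd_congr_on hD h0 e fun z hz => (hu.hasDerivAt_pd hI hD ht hz e).deriv
  rw [d2] at d1
  have d3 := HasDerivAt.fun_sum (u := Finset.univ) fun l _ => (hu.hasDerivAt_pd hI hD ht h0 l).pow 2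
  have d4 : HasDerivAt (fun τ => pd e (pd e (u τ)) 0 + ∑ l, pd l (u τ) 0 ^ 2 - c) _ t₀ :=
    (d1.add d3).sub_const c
  rw [e1]
  refine d4.congr_deriv ?_
  rw [Finset.mul_sum]
  congr 1
  exact Finset.sum_congr rfl fun l _ => by simp; ring

lemma Wmat_symm (h : IsMetricOn D G) {y : Euc n} (hy : y ∈ D) (hf : ContDiffAt ℝ ∞ f y) :
    (Wmat G f y)ᵀ = Wmat G f y := by
  ext i j
  have h1 : G y j i = G y i j := h.symm_apply hy j i
  have h2 : schouten G y j i = schouten G y i j := congrFun (congrFun (schouten_symm h hy) i) j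
  have h3 : hessian G f y j i = hessian G f y i j := by
    simp only [hessian, Matrix.of_apply]
    rw [pd_comm j i hf]
    congr 1
    exact Finset.sum_congr rfl fun k _ => by rw [christoffel_symm h hy k j i]
  rw [Matrix.transpose_apply, Wmat_apply, Wmat_apply, h1, h2, h3]; ring

/-- The inequality at an interior maximum, with the derivatives of order three and four left in. -/
lemma IsNormal.max_ineq (h : IsNormal D G) (hI : IsOpen I) (hu : JSmooth I D u) (ht : t₀ ∈ I)
    {r a s : ℝ} (hr : 0 ≤ r)
    (hσ : ∀ z ∈ D, 0 < sigma1 ((G z)⁻¹ * Wmat G (u t₀) z))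
    (hflow : ∀ z ∈ D, deriv (fun τ => u τ z) t₀ = (sigma2 ((G z)⁻¹ * Wmat G (u t₀) z)
      - r * Real.exp (-a * u t₀ z)) / sigma1 ((G z)⁻¹ * Wmat G (u t₀) z) + s)
    (e : Fin n) {c : ℝ} (hc : c = pd e (pd e (u t₀)) 0 + gradSq G (u t₀) 0)
    (hmax : ∀ t ∈ I, t ≤ t₀ → ∀ z ∈ D, barrier G e c (u t) z ≤ 0)
    {W Y F : Matrix (Fin n) (Fin n) ℝ} {σ φ : ℝ} (hW : W = Wmat G (u t₀) 0)
    (hσ0 : σ = W.trace) (hY : Y = σ⁻¹ • W) (hφ : φ = r * Real.exp (-a * u t₀ 0))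
    (hF : F = ((1 / 2) * (1 + (Y * Y).trace) + φ / σ ^ 2) • (1 : Matrix (Fin n) (Fin n) ℝ) - Y) :
    0 ≤ ∑ i, ∑ j, F i j * (2 * (pd e (pd i (u t₀)) 0 * pd e (pd j (u t₀)) 0)
        - (∑ l, pd e (pd l (u t₀)) 0 ^ 2) * (1 : Matrix (Fin n) (Fin n) ℝ) i j
        - 2 * ∑ l, pd i (pd l (u t₀)) 0 * pd j (pd l (u t₀)) 0 + lowerTerm G e (u t₀) i j)
      + ((1 / 2) * (1 + (Y * Y).trace) + φ / σ ^ 2)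
          * ∑ i, ∑ j, pd e (pd e fun z => (G z)⁻¹ i j) 0 * W j i
      + σ * ∑ i, ∑ j, (∑ l, Y i l * pd e (pd e fun z => G z l j) 0) * Y j i
      + a * φ / σ * (pd e (pd e (u t₀)) 0 + 2 * ∑ l, pd l (u t₀) 0 ^ 2) := by
  have h0 := h.zero_mem
  have hm := h.toIsMetricOn
  have hD := h.isOpen
  have hfD : ∀ z ∈ D, ContDiffAt ℝ ∞ (u t₀) z := fun z hz => hu.slice hD ht hz
  set f := u t₀ with hf
  have hf0 := hfD 0 h0
  have hσ00 : sigma1 ((G 0)⁻¹ * Wmat G f 0) = σ := by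
    rw [h.inv_zero, Matrix.one_mul, hσ0, hW]; rfl
  have hσp : 0 < σ := hσ00 ▸ hσ 0 h0
  have hφp : 0 ≤ φ := hφ ▸ mul_nonneg hr (Real.exp_pos _).le
  have hWt : Wᵀ = W := hW ▸ Wmat_symm hm h0 hf0
  have hYt : Yᵀ = Y := by rw [hY, Matrix.transpose_smul, hWt]
  set κ := φ / σ ^ 2 with hκ
  have hκ0 : 0 ≤ κ := div_nonneg hφp (sq_nonneg _)
  set α : Euc n → ℝ := fun z => (1 / 2) * (1 + (Y * G z * Y * G z).trace) + κ with hα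
  set α₀ := (1 / 2) * (1 + (Y * Y).trace) + κ with hα₀
  have hα0 : α 0 = α₀ := by simp only [hα, h.eq_one, Matrix.mul_one, hα₀]
  have hFs : F.PosSemidef := hF ▸ posSemidef_supporting hYt hκ0
  set b := a * φ / σ with hb
  set ut : Euc n → ℝ := fun z => deriv (fun τ => u τ z) t₀ with hut
  -- Up to an additive constant `ℓ` is the sum of the two supporting bounds, taken at the origin:
  -- `sigma2_div_le` with `Y = W/σ`, and `exp_div_ge`. It is linear in `W` and in `f`, with
  -- coefficients that depend only on the metric at the point.
  set ℓ : Euc n → ℝ := fun z => α z * sigma1 ((G z)⁻¹ * Wmat G f z)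
    - ∑ i, ∑ j, Y i j * Wmat G f z j i + b * f z with hℓ
  -- smoothness
  have sW := fun z hz i j => contDiffAt_Wmat hm hz (hfD z hz) i j
  have st := IsNormal.trace_conj_smooth hm h0 Y
  have sα : ContDiffAt ℝ ∞ α 0 :=
    (contDiffAt_const.mul (contDiffAt_const.add st)).add contDiffAt_const
  have sσ := contDiffAt_sigma1 hm h0 hf0
  have sYW : ContDiffAt ℝ ∞ (fun z => ∑ i, ∑ j, Y i j * Wmat G f z j i) 0 :=
    ContDiffAt.sum fun i _ => ContDiffAt.sum fun j _ => contDiffAt_const.mul (sW 0 h0 j i)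
  have sbf : ContDiffAt ℝ ∞ (fun z => b * f z) 0 := contDiffAt_const.mul hf0
  have sℓ : ContDiffAt ℝ ∞ ℓ 0 := ((sα.mul sσ).sub sYW).add sbf
  have sut : ContDiffAt ℝ ∞ ut 0 := (hu.deriv hI hD).slice hD ht h0
  -- comparison
  have hle : ∀ z ∈ D, ut z - ℓ z ≤ ut 0 - ℓ 0 := by
    intro z hz
    have b1 := sigma2_div_le (hm.posDef z hz) (Wmat_symm hm hz (hfD z hz)) hYt (hσ z hz)
    have b2 := exp_div_ge (w := f z) (w₀ := f 0) (a := a) hr hσp (hσ z hz)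
    have b3 : ut z = _ := hflow z hz
    have b4 : ut 0 = _ := hflow 0 h0
    have tYW : ∀ z, ∑ i, ∑ j, Y i j * Wmat G f z j i = (Y * Wmat G f z).trace := fun z => by
      simp [Matrix.trace, Matrix.mul_apply]
    have y1 : (Y * W).trace = (W * W).trace / σ := by
      rw [hY, Matrix.smul_mul, Matrix.trace_smul, smul_eq_mul]; field_simp
    have y2 : (Y * Y).trace = (W * W).trace / σ ^ 2 := by
      rw [hY, Matrix.smul_mul, Matrix.mul_smul, Matrix.trace_smul, Matrix.trace_smul, smul_eq_mul,
        smul_eq_mul]; field_simp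
    -- At the origin both supporting inequalities are equalities, so this value is the maximum.
    have e0 : ut 0 - ℓ 0 = s - 2 * φ / σ - b * f 0 := by
      rw [b4, hσ00, h.inv_zero, Matrix.one_mul, ← hW, ← hφ]
      simp only [hℓ]
      rw [hα0, hσ00, tYW, ← hW, y1, hα₀, y2, hκ, sigma2, ← hσ0]
      field_simp
      ring
    rw [e0, b3, sub_div]
    simp only [hℓ, hα]
    rw [tYW]
    rw [← hφ] at b2
    have e1 : φ / σ * (2 - a * (f z - f 0) - sigma1 ((G z)⁻¹ * Wmat G f z) / σ)
        = 2 * φ / σ - b * f z + b * f 0 - κ * sigma1 ((G z)⁻¹ * Wmat G f z) := by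
      rw [hb, hκ]; field_simp; ring
    rw [e1] at b2
    linarith
  -- Touching from above replaces two differentiations of the quotient: first derivatives agree and
  -- the second derivative in the direction `e` is comparable, which is all that is needed.
  have hloc : IsLocalMax (fun z => ut z - ℓ z) 0 := by
    filter_upwards [hD.mem_nhds h0] with z hz using hle z hz
  have k1 : ∀ k, pd k ut 0 = pd k ℓ 0 := by
    intro k
    have := pd_eq_zero_of_isLocalMax hloc k
    rw [pd_sub k sut.smooth_differentiableAt sℓ.smooth_differentiableAt] at this
    linarith
  have k2 : pd e (pd e ut) 0 ≤ pd e (pd e ℓ) 0 := by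
    have := second_dir_le_of_isLocalMax (sut.sub sℓ) hloc (Pi.single e 1)
    simp only [Pi.single_apply, ite_mul, mul_ite, one_mul, zero_mul, mul_zero, Finset.sum_ite_eq',
      Finset.mem_univ, if_true, mul_one] at this
    rw [pd_pd_sub e e sut sℓ] at this
    linarith
  have pα : ∀ k, pd k α 0 = 0 := by
    intro k
    have d := st.smooth_differentiableAt
    rw [hα, pd_add k ((differentiableAt_const _).fun_mul ((differentiableAt_const _).fun_add d))
      (differentiableAt_const _), pd_const, pd_const_mul k _ ((differentiableAt_const _).fun_add d),
      pd_add k (differentiableAt_const _) d, pd_const, h.pd_trace_conj]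
    ring
  have ppα : pd e (pd e α) 0
      = ∑ i, ∑ j, (∑ l, Y i l * pd e (pd e fun z => G z l j) 0) * Y j i := by
    rw [hα, pd_pd_add e e (contDiffAt_const.mul (contDiffAt_const.add st)) contDiffAt_const,
      pd_pd_const, pd_pd_const_mul e e _ (contDiffAt_const.add st),
      pd_pd_add e e contDiffAt_const st, pd_pd_const, h.pd_pd_trace_conj]
    ring
  have hFsum : ∀ X : Fin n → Fin n → ℝ, (∀ i j, X i j = X j i) →
      ∑ i, ∑ j, F i j * X i j = α₀ * ∑ i, X i i - ∑ i, ∑ j, Y i j * X j i := by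
    intro X hX
    rw [Finset.mul_sum, ← Finset.sum_sub_distrib]
    refine Finset.sum_congr rfl fun i _ => ?_
    simp only [hF, Matrix.sub_apply, Matrix.smul_apply, smul_eq_mul, sub_mul, Finset.sum_sub_distrib,
      Matrix.one_apply, mul_ite, mul_one, mul_zero, ite_mul, zero_mul, Finset.sum_ite_eq,
      Finset.mem_univ, if_true]
    congr 1
    exact Finset.sum_congr rfl fun j _ => by rw [hX i j]
  have hWs : ∀ z ∈ D, ∀ i j, Wmat G f z i j = Wmat G f z j i := fun z hz i j =>
    congrFun (congrFun (Wmat_symm hm hz (hfD z hz)) j) i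
  have pℓ : ∀ k, pd k ℓ 0 = ∑ i, ∑ j, F i j * pd k (fun z => Wmat G f z i j) 0 + b * pd k f 0 := by
    intro k
    have dW := fun i j => (sW 0 h0 i j).smooth_differentiableAt
    have dYW := fun i j => (dW j i).const_mul (Y i j)
    rw [hℓ, pd_add k ((sα.mul sσ).sub sYW).smooth_differentiableAt sbf.smooth_differentiableAt,
      pd_sub k (sα.mul sσ).smooth_differentiableAt sYW.smooth_differentiableAt,
      pd_mul k sα.smooth_differentiableAt sσ.smooth_differentiableAt, pα, h.pd_sigma1 hf0, hα0,
      pd_const_mul k _ hf0.smooth_differentiableAt,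
      pd_sum k fun i _ => DifferentiableAt.fun_sum (u := Finset.univ) fun j _ => dYW i j,
      hFsum _ fun i j => pd_congr_on hD h0 k fun z hz => hWs z hz i j]
    simp only [fun i => pd_sum k fun j (_ : j ∈ Finset.univ) => dYW i j,
      fun i j => pd_const_mul k (Y i j) (dW j i)]
    ring
  have ppℓ : pd e (pd e ℓ) 0 = ∑ i, ∑ j, F i j * pd e (pd e fun z => Wmat G f z i j) 0
      + α₀ * ∑ i, ∑ j, pd e (pd e fun z => (G z)⁻¹ i j) 0 * W j i
      + σ * ∑ i, ∑ j, (∑ l, Y i l * pd e (pd e fun z => G z l j) 0) * Y j i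
      + b * pd e (pd e f) 0 := by
    have cW : ∀ i j, ContDiffAt ℝ ∞ (fun z => Y i j * Wmat G f z j i) 0 :=
      fun i j => contDiffAt_const.mul (sW 0 h0 j i)
    rw [hℓ, pd_pd_add e e ((sα.mul sσ).sub sYW) sbf, pd_pd_sub e e (sα.mul sσ) sYW,
      pd_pd_mul e e sα sσ, pα, h.pd_pd_sigma1 hf0, hα0, ppα, hσ00, pd_pd_const_mul e e _ hf0,
      pd_pd_sum e e fun i _ => ContDiffAt.sum fun j _ => cW i j,
      hFsum _ fun i j => pd_congr_on hD h0 e fun z hz => pd_congr_on hD hz e fun w hw => hWs w hw i j]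
    simp only [fun i => pd_pd_sum e e fun j (_ : j ∈ Finset.univ) => cW i j,
      fun i j => pd_pd_const_mul e e (Y i j) (sW 0 h0 j i), ← hW]
    ring
  -- the barrier
  have hb0 : barrier G e c f 0 = 0 := by rw [h.barrier_zero, hc, h.gradSq_zero]; ring
  have hbm : IsLocalMax (barrier G e c f) 0 := by
    filter_upwards [hD.mem_nhds h0] with z hz
    rw [hb0]; exact hmax t₀ ht le_rfl z hz
  -- The maximum of the barrier is used twice: in space, its second derivatives have nonpositive
  -- trace against `F`; in time, its derivative at `t₀` is nonnegative (`k4`). The latter equals the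
  -- derivative of `u_t` controlled by `k1` and `k2`.
  have k3 := trace_second_le_of_isLocalMax (contDiffAt_barrier hm h0 hf0 e c) hbm hFs
  have k4 := deriv_nonneg_of_le_left (h.hasDerivAt_barrier hI hu ht e c) (by
    filter_upwards [hI.mem_nhds ht] with τ hτ hle
    rw [← hf, hb0]; exact hmax τ hτ hle 0 h0)
  have k5 : ∀ i j, _ := fun i j => h.linearized_eq hfD e (fun i => by
    rw [← hc]; exact pd_eq_zero_of_isLocalMax hbm i) i j
  rw [← hc] at k5
  simp only [← k5, mul_sub, mul_add, Finset.sum_sub_distrib, Finset.sum_add_distrib]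
  have k6 : ∑ i, ∑ j, F i j * (2 * ∑ k, pd k f 0 * pd k (fun z => Wmat G f z i j) 0)
      = 2 * ∑ k, pd k f 0 * ∑ i, ∑ j, F i j * pd k (fun z => Wmat G f z i j) 0 := by
    simp only [Finset.mul_sum]
    rw [Finset.sum_congr rfl fun i _ => Finset.sum_comm, Finset.sum_comm]
    exact Finset.sum_congr rfl fun k _ => Finset.sum_congr rfl fun i _ =>
      Finset.sum_congr rfl fun j _ => by ring
  have k7 : ∑ l, pd l f 0 * pd l ut 0 = ∑ k, pd k f 0 * (∑ i, ∑ j, F i j * pd k (fun z => Wmat G f z i j) 0)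
      + b * ∑ l, pd l f 0 ^ 2 := by
    rw [Finset.mul_sum, ← Finset.sum_add_distrib]
    exact Finset.sum_congr rfl fun l _ => by rw [k1, pℓ]; ring
  rw [k6]
  rw [← hf, k7] at k4
  linarith

end Linearized

end

section

variable {n : ℕ} {D : Set (Euc n)} {G : Euc n → Matrix (Fin n) (Fin n) ℝ} {f : Euc n → ℝ}

/-! ### Estimates at a maximum -/

/-- Bounds for the derivatives at the origin of the geometric quantities. -/
structure JetBound (G : Euc n → Matrix (Fin n) (Fin n) ℝ) (B : ℝ) : Prop where
  schouten₀ : ∀ i j, |schouten G 0 i j| ≤ B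
  schouten₁ : ∀ k i j, |pd k (fun z => schouten G z i j) 0| ≤ B
  schouten₂ : ∀ k i j, |pd k (pd k fun z => schouten G z i j) 0| ≤ B
  metric₂ : ∀ k l i j, |pd k (pd l fun z => G z i j) 0| ≤ B
  inv₂ : ∀ k l i j, |pd k (pd l fun z => (G z)⁻¹ i j) 0| ≤ B
  christoffel₁ : ∀ a k i j, |pd a (christoffel G k i j) 0| ≤ B
  christoffel₂ : ∀ a b k i j, |pd a (pd b (christoffel G k i j)) 0| ≤ B

lemma abs_sum_le_card_mul {x : Fin n → ℝ} {K : ℝ} (h : ∀ i, |x i| ≤ K) : |∑ i, x i| ≤ n * K := by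
  refine (Finset.abs_sum_le_sum_abs _ _).trans ((Finset.sum_le_sum fun i _ => h i).trans ?_)
  simp

lemma abs_mul_le' {x y K L : ℝ} (hx : |x| ≤ K) (hy : |y| ≤ L) : |x * y| ≤ K * L := by
  rw [abs_mul]; exact mul_le_mul hx hy (abs_nonneg _) ((abs_nonneg _).trans hx)

lemma abs_one_apply_le (i j : Fin n) : |(1 : Matrix (Fin n) (Fin n) ℝ) i j| ≤ 1 := by
  rw [Matrix.one_apply]; split_ifs <;> simp

/-- With `F = Bᵀ B` an off-diagonal entry is at most the mean of two diagonal ones, and these are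
nonnegative with sum the trace. -/
lemma abs_le_trace_of_posSemidef {F : Matrix (Fin n) (Fin n) ℝ} (hF : F.PosSemidef) (i j : Fin n) :
    |F i j| ≤ F.trace := by
  obtain ⟨B, hB⟩ := exists_eq_transpose_mul hF
  have hd : ∀ i, F i i = ∑ k, B k i ^ 2 := fun i => by
    rw [hB, Matrix.mul_apply]; exact Finset.sum_congr rfl fun k _ => by simp [pow_two]
  have hd0 : ∀ i, 0 ≤ F i i := fun i => by rw [hd]; exact Finset.sum_nonneg fun k _ => sq_nonneg _
  have ht : ∀ i, F i i ≤ F.trace := fun i =>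
    Finset.single_le_sum (f := fun i => F i i) (fun i _ => hd0 i) (Finset.mem_univ i)
  have h1 : |F i j| ≤ (1 / 2) * (F i i + F j j) := by
    rw [hd, hd, ← Finset.sum_add_distrib, Finset.mul_sum, hB, Matrix.mul_apply]
    refine (Finset.abs_sum_le_sum_abs _ _).trans (Finset.sum_le_sum fun k _ => ?_)
    rw [Matrix.transpose_apply, abs_mul]
    nlinarith [sq_nonneg (|B k i| - |B k j|), sq_abs (B k i), sq_abs (B k j)]
  linarith [ht i, ht j]

lemma posSemidef_quad_nonneg {F : Matrix (Fin n) (Fin n) ℝ} (hF : F.PosSemidef) (v : Fin n → ℝ) :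
    0 ≤ ∑ i, ∑ j, F i j * (v i * v j) := by
  have := hF.dotProduct_mulVec_nonneg v
  simp only [star_trivial, dotProduct, Matrix.mulVec, Finset.mul_sum] at this
  refine this.trans (le_of_eq ?_)
  exact Finset.sum_congr rfl fun i _ => Finset.sum_congr rfl fun j _ => by ring

/-- Each summand is linear in the Hessian or at most quadratic in the gradient, so it is bounded by
a multiple of the first power of `N`. That growth loses against the good quadratic term. The number
17 adds up the coefficients of the twelve groups of terms. -/
lemma abs_lowerTerm_le (hn : 1 ≤ n) {B N : ℝ} (hB : JetBound G B) (e i j : Fin n)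
    (hp : ∀ k, |pd k f 0| ≤ N) (hpp : ∀ k l, |pd k f 0 * pd l f 0| ≤ N)
    (hp2 : ∑ l, pd l f 0 ^ 2 ≤ N) (hq : ∀ k l, |pd k (pd l f) 0| ≤ N) (hN : 1 ≤ N) :
    |lowerTerm G e f i j| ≤ 17 * (n : ℝ) ^ 2 * B * N := by
  have hB0 : 0 ≤ B := (abs_nonneg _).trans (hB.schouten₀ i j)
  have hn1 : (1 : ℝ) ≤ n := by exact_mod_cast hn
  have two : |(2 : ℝ)| ≤ 2 := by norm_num
  have half : |(1 / 2 : ℝ)| ≤ 1 / 2 := by norm_num [abs_of_pos]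
  have hs : |∑ l, pd l f 0 ^ 2| ≤ N := by
    rwa [abs_of_nonneg (Finset.sum_nonneg fun l _ => sq_nonneg _)]
  have t1 := hB.schouten₂ e i j
  have t2 := abs_mul_le' two (abs_sum_le_card_mul fun k => abs_mul_le' (hp k) (hB.schouten₁ k i j))
  have t3 := abs_sum_le_card_mul fun l => (abs_add_le _ _).trans (add_le_add
    (abs_mul_le' (hB.christoffel₂ e e l i j) (hp l))
    (abs_mul_le' two (abs_mul_le' (hB.christoffel₁ e l i j) (hq e l))))
  have t4 := abs_mul_le' (abs_mul_le' half (abs_sum_le_card_mul fun k => abs_sum_le_card_mul fun l =>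
    abs_mul_le' (hB.inv₂ e e k l) (hpp k l))) (abs_one_apply_le i j)
  have t5 := abs_mul_le' (abs_mul_le' half hs) (hB.metric₂ e e i j)
  have q1 : ∀ (g : Fin n → Fin n → ℝ), (∀ k l, |g k l| ≤ B) →
      |∑ k, pd k f 0 * ∑ l, g k l * pd l f 0| ≤ n * (n * (B * N)) := by
    intro g hg
    refine abs_sum_le_card_mul fun k => ?_
    rw [Finset.mul_sum]
    refine abs_sum_le_card_mul fun l => ?_
    rw [show pd k f 0 * (g k l * pd l f 0) = g k l * (pd k f 0 * pd l f 0) by ring]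
    exact abs_mul_le' (hg k l) (hpp k l)
  have t6 := abs_mul_le' two (q1 (fun k l => pd k (christoffel G l i j) 0)
    fun k l => hB.christoffel₁ k l i j)
  have t7 := abs_sum_le_card_mul fun l => (abs_add_le _ _).trans (add_le_add ((abs_add_le _ _).trans
    (add_le_add (abs_mul_le' (hB.christoffel₂ i j l e e) (hp l))
    (abs_mul_le' (hB.christoffel₁ j l e e) (hq i l)))) (abs_mul_le' (hB.christoffel₁ i l e e) (hq j l)))
  have t8 := abs_mul_le' (hB.metric₂ i j e e) (hq e e)
  have t9 := abs_sum_le_card_mul fun k => abs_sum_le_card_mul fun l =>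
    abs_mul_le' (hB.inv₂ i j k l) (hpp k l)
  have q2 : ∀ i j, |(∑ l, pd i (christoffel G l e e) 0 * pd l f 0) * pd j f 0| ≤ n * (B * N) := by
    intro i j
    rw [Finset.sum_mul]
    refine abs_sum_le_card_mul fun l => ?_
    rw [mul_assoc]
    exact abs_mul_le' (hB.christoffel₁ i l e e) (hpp l j)
  have t10 := q2 i j
  have t11 := q2 j i
  rw [mul_comm] at t11
  have t12 := abs_mul_le' (abs_sum_le_card_mul fun k => q2 k k) (abs_one_apply_le i j)
  have m1 : (0 : ℝ) ≤ B * N := mul_nonneg hB0 (by linarith)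
  have m2 : B * N ≤ n * (B * N) := by nlinarith
  have m3 : n * (B * N) ≤ n * (n * (B * N)) := by nlinarith
  have m4 : B ≤ B * N := by nlinarith
  rw [abs_le] at t1 t2 t3 t4 t5 t6 t7 t8 t9 t10 t11 t12
  rw [lowerTerm, abs_le]
  constructor <;> nlinarith
lemma le_of_sq_le_mul {Q R B : ℝ} (hB : 0 ≤ B) (hR : 0 ≤ R) (h : Q ^ 2 ≤ R * (Q + 2 * B)) :
    Q ≤ R + 2 * B := by
  by_contra! hc
  nlinarith [mul_nonneg hR hB]

/-- Bounds for the two-jet of the solution in terms of the largest eigenvalue of its Hessian. -/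
lemma IsNormal.jet_le (hn : 3 ≤ n) (h : IsNormal D G) (hf : ContDiffAt ℝ ∞ f 0) {B Q : ℝ}
    (hB : JetBound G B) (hB1 : 1 ≤ B) (hσ : 0 < (Wmat G f 0).trace)
    (hq : ∀ v : Fin n → ℝ, ∑ i, ∑ j, v i * v j * pd i (pd j f) 0 ≤ Q * ∑ i, v i ^ 2) :
    B ≤ Q + 2 * B ∧ ∑ l, pd l f 0 ^ 2 ≤ 2 * n * (Q + 2 * B)
      ∧ (∀ i j, |pd i (pd j f) 0| ≤ 2 * n * (Q + 2 * B)) ∧ (Wmat G f 0).trace ≤ n * (Q + 2 * B) := by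
  have hn3 : (3 : ℝ) ≤ n := by exact_mod_cast hn
  set q : Matrix (Fin n) (Fin n) ℝ := Matrix.of fun i j => pd i (pd j f) 0 with hqd
  set g := ∑ l, pd l f 0 ^ 2 with hg
  have hg0 : 0 ≤ g := Finset.sum_nonneg fun l _ => sq_nonneg _
  have hpsd : (Q • (1 : Matrix (Fin n) (Fin n) ℝ) - q).PosSemidef := by
    refine Matrix.PosSemidef.of_dotProduct_mulVec_nonneg ?_ fun v => ?_
    · show _ᴴ = _
      have : qᵀ = q := by ext i j; exact pd_comm j i hf
      simp [this]
    · have e0 : star v = v := by simp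
      have := hq v
      have e1 : v ⬝ᵥ q *ᵥ v = ∑ i, ∑ j, v i * v j * pd i (pd j f) 0 := by
        simp only [dotProduct, Matrix.mulVec, Finset.mul_sum]
        exact Finset.sum_congr rfl fun i _ => Finset.sum_congr rfl fun j _ => by
          simp only [hqd, Matrix.of_apply]; ring
      have e2 : v ⬝ᵥ v = ∑ i, v i ^ 2 := Finset.sum_congr rfl fun i _ => by ring
      rw [e0, Matrix.sub_mulVec, Matrix.smul_mulVec, Matrix.one_mulVec, dotProduct_sub, dotProduct_smul,
        smul_eq_mul, e1, e2]
      linarith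
  have htr : (Q • (1 : Matrix (Fin n) (Fin n) ℝ) - q).trace = n * Q - q.trace := by
    rw [Matrix.trace_sub, Matrix.trace_smul, Matrix.trace_one, smul_eq_mul]; simp; ring
  have hW : (Wmat G f 0).trace = (schouten G 0).trace + q.trace + g - n / 2 * g := by
    simp only [Matrix.trace, Matrix.diag, Wmat_apply, h.hessian_zero, h.gradSq_zero, h.eq_one,
      Matrix.one_apply_eq, Finset.sum_add_distrib, Finset.sum_sub_distrib, hqd, Matrix.of_apply, hg]
    simp only [← pow_two, Finset.sum_const, Finset.card_univ, Fintype.card_fin, nsmul_eq_mul]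
    ring
  have hA := (abs_le.1 (abs_sum_le_card_mul fun i => hB.schouten₀ i i)).2
  change (schouten G 0).trace ≤ n * B at hA
  -- `Q` dominates every eigenvalue of the Hessian, so its trace is at most `nQ`. Positivity of `σ₁`
  -- gives the reverse control: it bounds `(n/2 - 1)|∇u|²`, where `n/2 - 1 ≥ 1/2`, and bounds the
  -- trace from below, hence all eigenvalues.
  have hqt : 0 ≤ n * Q - q.trace := by
    rw [← htr]; exact (abs_nonneg _).trans (abs_le_trace_of_posSemidef hpsd ⟨0, by omega⟩ ⟨0, by omega⟩)
  have hQ : 0 ≤ Q + B := by nlinarith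
  have hg1 : g ≤ 2 * n * (Q + B) := by nlinarith
  refine ⟨by linarith, by nlinarith, fun i j => ?_, by nlinarith⟩
  have h1 := abs_le.1 (abs_le_trace_of_posSemidef hpsd i j)
  rw [htr, Matrix.sub_apply, Matrix.smul_apply, smul_eq_mul, hqd, Matrix.of_apply] at h1
  have h2 : n * Q - q.trace ≤ n * (Q + B) := by nlinarith
  have h3 : |Q * (1 : Matrix (Fin n) (Fin n) ℝ) i j| ≤ Q + 2 * B :=
    (abs_mul_le' (abs_le.2 ⟨by linarith, by linarith⟩ : |Q| ≤ Q + 2 * B)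
      (abs_one_apply_le i j)).trans (by simp)
  rw [abs_le] at h3 ⊢
  constructor <;> nlinarith [h1.1, h1.2, h3.1, h3.2]

/-- The algebraic part of the bound at a maximum. -/
lemma max_bound_scalar {m B a T N Q g σ α S ρ X₁ X₂ X₃ X₄ X₅ X₆ : ℝ} (hm : 3 ≤ m) (hB : 1 ≤ B)
    (ha : 0 ≤ a) (hT : 1 / 2 ≤ T) (hαT : α ≤ T) (hα : 0 ≤ α) (hσ : 0 ≤ σ) (hσN : σ ≤ N) (hρ : 0 ≤ ρ)
    (hS : 0 ≤ S) (hρS : ρ ≤ S * T) (hK : B ≤ Q + 2 * B) (hN : N = 2 * m * (Q + 2 * B)) (hg : g ≤ N)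
    (h12 : X₁ ≤ X₂) (h3 : Q ^ 2 ≤ X₃) (h4 : X₄ ≤ m * (m * (T * (17 * m ^ 2 * B * N))))
    (h5 : X₅ ≤ m * (m * (B * (4 * N)))) (h6 : X₆ ≤ m * (m * (B * (2 * α))))
    (key : 0 ≤ 2 * X₁ - T * X₃ - 2 * X₂ + X₄ + α * X₅ + σ * X₆ + (a * ρ * Q + a * ρ * (2 * g))) :
    Q + g ≤ (1 + 2 * m) * (2 * m * (23 * m ^ 4 * B + 3 * a * S) + 4 * B) := by
  have hN0 : 0 ≤ N := hσ.trans hσN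
  have hm0 : 0 ≤ m := by linarith
  have hB0 : 0 ≤ B := by linarith
  have hT0 : 0 ≤ T := by linarith
  have f1 : α * X₅ ≤ T * (m * (m * (B * (4 * N)))) :=
    (mul_le_mul_of_nonneg_left h5 hα).trans (mul_le_mul_of_nonneg_right hαT (by positivity))
  have f2 : σ * X₆ ≤ N * (m * (m * (B * (2 * T)))) :=
    (mul_le_mul_of_nonneg_left h6 hσ).trans ((mul_le_mul_of_nonneg_right hσN (by positivity)).trans
      (by gcongr))
  -- The hypothesis `ρ ≤ S T` gives the term from `r` the factor `T` that all other terms have.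
  have f3 : a * ρ * Q + a * ρ * (2 * g) ≤ a * (S * T) * (3 * N) := by
    rw [← mul_add]
    have c1 : Q + 2 * g ≤ 3 * N := by nlinarith
    exact (mul_le_mul_of_nonneg_left c1 (by positivity)).trans (mul_le_mul_of_nonneg_right
      (mul_le_mul_of_nonneg_left hρS ha) (by positivity))
  have f4 : T * Q ^ 2 ≤ T * X₃ := mul_le_mul_of_nonneg_left h3 hT0
  -- Every term carries the factor `T`, which is positive and cancels. It need not be bounded above.
  have f5 : T * Q ^ 2 ≤ T * (N * (17 * m ^ 4 * B + 6 * m ^ 2 * B + 3 * a * S)) := by linarith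
  have f6 : Q ^ 2 ≤ N * (17 * m ^ 4 * B + 6 * m ^ 2 * B + 3 * a * S) :=
    le_of_mul_le_mul_left f5 (by linarith)
  have f7 : m ^ 2 * B ≤ m ^ 4 * B :=
    mul_le_mul_of_nonneg_right (pow_le_pow_right₀ (by linarith) (by norm_num)) hB0
  -- A quadratic quantity in `Q` against a linear one; `le_of_sq_le_mul` turns this into a bound for
  -- `Q`.
  have f8 : Q ^ 2 ≤ (2 * m * (23 * m ^ 4 * B + 3 * a * S)) * (Q + 2 * B) := by
    have : N * (17 * m ^ 4 * B + 6 * m ^ 2 * B + 3 * a * S) ≤ N * (23 * m ^ 4 * B + 3 * a * S) :=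
      mul_le_mul_of_nonneg_left (by linarith) hN0
    refine (f6.trans this).trans (le_of_eq ?_)
    rw [hN]; ring
  have f9 := le_of_sq_le_mul hB0 (by positivity) f8
  have f10 : Q + g ≤ (1 + 2 * m) * Q + 4 * m * B := by linarith
  have f11 := mul_le_mul_of_nonneg_left f9 (by linarith : 0 ≤ 1 + 2 * m)
  linarith

section Linearized

variable {I : Set ℝ} {u : ℝ → Euc n → ℝ} {t₀ : ℝ}

set_option maxHeartbeats 800000 in
/-- The bound at an interior maximum. -/
lemma IsNormal.max_bound (hn : 3 ≤ n) (h : IsNormal D G) (hI : IsOpen I) (hu : JSmooth I D u) (ht : t₀ ∈ I)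
    {r a s B : ℝ} (hr : 0 ≤ r) (ha : 0 ≤ a) (hB : JetBound G B) (hB1 : 1 ≤ B)
    (hσ : ∀ z ∈ D, 0 < sigma1 ((G z)⁻¹ * Wmat G (u t₀) z))
    (hflow : ∀ z ∈ D, deriv (fun τ => u τ z) t₀ = (sigma2 ((G z)⁻¹ * Wmat G (u t₀) z)
      - r * Real.exp (-a * u t₀ z)) / sigma1 ((G z)⁻¹ * Wmat G (u t₀) z) + s)
    (e : Fin n) {c : ℝ} (hc : c = pd e (pd e (u t₀)) 0 + gradSq G (u t₀) 0)
    (hmax : ∀ t ∈ I, t ≤ t₀ → ∀ z ∈ D, barrier G e c (u t) z ≤ 0)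
    (hq : ∀ v : Fin n → ℝ, ∑ i, ∑ j, v i * v j * pd i (pd j (u t₀)) 0
      ≤ pd e (pd e (u t₀)) 0 * ∑ i, v i ^ 2) :
    c ≤ (1 + 2 * n) * (2 * n * (23 * n ^ 4 * B + 3 * a * Real.sqrt (r * Real.exp (-a * u t₀ 0)))
      + 4 * B) := by
  have h0 := h.zero_mem
  have hm := h.toIsMetricOn
  have hn3 : (3 : ℝ) ≤ n := by exact_mod_cast hn
  have hf0 : ContDiffAt ℝ ∞ (u t₀) 0 := hu.slice h.isOpen ht h0
  have key := h.max_ineq hI hu ht hr hσ hflow e hc hmax rfl rfl rfl rfl rfl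
  have hσp := hσ 0 h0
  rw [h.inv_zero, Matrix.one_mul] at hσp
  change 0 < (Wmat G (u t₀) 0).trace at hσp
  obtain ⟨hK, hp2, hqN, hσN⟩ := h.jet_le hn hf0 hB hB1 hσp hq
  rw [h.gradSq_zero] at hc
  have hWt := Wmat_symm hm h0 hf0
  have hWa : ∀ i j, Wmat G (u t₀) 0 i j = _ := fun i j => Wmat_apply 0 i j
  simp only [h.hessian_zero, h.gradSq_zero, h.eq_one] at hWa
  have hqs : ∀ i j, pd i (pd j (u t₀)) 0 = pd j (pd i (u t₀)) 0 := fun i j => pd_comm i j hf0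
  set f := u t₀
  set Q := pd e (pd e f) 0
  set N := 2 * n * (Q + 2 * B)
  set g := ∑ l, pd l f 0 ^ 2
  set W := Wmat G f 0
  set σ := W.trace
  set Y := σ⁻¹ • W
  set φ := r * Real.exp (-a * f 0)
  set α := (1 / 2) * (1 + (Y * Y).trace) + φ / σ ^ 2
  set F := α • (1 : Matrix (Fin n) (Fin n) ℝ) - Y
  have hφ : 0 ≤ φ := mul_nonneg hr (Real.exp_pos _).le
  have hκ : 0 ≤ φ / σ ^ 2 := div_nonneg hφ (sq_nonneg _)
  have hYt : Yᵀ = Y := by simp only [Y, Matrix.transpose_smul, hWt]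
  have hYY : (Y * Y).PosSemidef := by
    have := Matrix.posSemidef_conjTranspose_mul_self Y
    rwa [Matrix.conjTranspose_eq_transpose_of_trivial, hYt] at this
  have hYY0 : ∀ i j, |(Y * Y) i j| ≤ (Y * Y).trace := abs_le_trace_of_posSemidef hYY
  have hFs : F.PosSemidef := posSemidef_supporting hYt hκ
  have hYt1 : Y.trace = 1 := by
    simp only [Y, Matrix.trace_smul, smul_eq_mul]; exact inv_mul_cancel₀ hσp.ne'
  have hFt : F.trace = n * α - 1 := by
    simp only [F, Matrix.trace_sub, Matrix.trace_smul, Matrix.trace_one, smul_eq_mul, hYt1,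
      Fintype.card_fin]; ring
  have htYY : 0 ≤ (Y * Y).trace := (abs_nonneg _).trans (hYY0 e e)
  have hα2 : 1 / 2 + φ / σ ^ 2 ≤ α := by simp only [α]; linarith
  have hαYY : (Y * Y).trace ≤ 2 * α := by simp only [α]; linarith
  -- Here `T = nα - 1` with `α ≥ 1/2` and `n ≥ 3`.
  have hαT : α ≤ F.trace := by rw [hFt]; nlinarith
  set T := F.trace
  have hT : 1 / 2 ≤ T := by linarith
  have hN1 : 1 ≤ N := by simp only [N]; nlinarith
  have hKN : Q + 2 * B ≤ N := by simp only [N]; nlinarith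
  have hσN' : σ ≤ N := by simp only [N]; nlinarith
  have hpk : ∀ k, pd k f 0 ^ 2 ≤ N := fun k =>
    (Finset.single_le_sum (f := fun k => pd k f 0 ^ 2) (fun i _ => sq_nonneg _) (Finset.mem_univ k)).trans hp2
  have hpp : ∀ k l, |pd k f 0 * pd l f 0| ≤ N := by
    intro k l
    rw [abs_le]
    constructor <;> nlinarith [hpk k, hpk l, sq_nonneg (pd k f 0 + pd l f 0), sq_nonneg (pd k f 0 - pd l f 0)]
  have hp1 : ∀ k, |pd k f 0| ≤ N := fun k => abs_le_of_sq_le_sq (by nlinarith [hpk k]) (by linarith)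
  have hlow := fun i j => abs_lowerTerm_le (by omega) hB e i j hp1 hpp hp2 hqN hN1
  -- the terms of the inequality
  have hW4 : ∀ i j, |W i j| ≤ 4 * N := by
    intro i j
    have a1 := hB.schouten₀ i j
    have a2 := hqN i j
    have a3 := hpp i j
    have a4 : |g * (1 : Matrix (Fin n) (Fin n) ℝ) i j| ≤ N * 1 :=
      abs_mul_le' (by rwa [abs_of_nonneg (Finset.sum_nonneg fun l _ => sq_nonneg _)]) (abs_one_apply_le i j)
    rw [hWa]
    rw [abs_le] at a1 a2 a3 a4 ⊢
    constructor <;> linarith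
  have e1 : ∑ i, ∑ j, F i j * (2 * (pd e (pd i f) 0 * pd e (pd j f) 0))
      = 2 * ∑ i, ∑ j, F i j * (pd e (pd i f) 0 * pd e (pd j f) 0) := by
    simp only [Finset.mul_sum]
    exact Finset.sum_congr rfl fun i _ => Finset.sum_congr rfl fun j _ => by ring
  have e2 : ∑ i, ∑ j, F i j * ((∑ l, pd e (pd l f) 0 ^ 2) * (1 : Matrix (Fin n) (Fin n) ℝ) i j)
      = T * ∑ l, pd e (pd l f) 0 ^ 2 := by
    simp only [T, Matrix.trace, Matrix.diag, Finset.sum_mul, Matrix.one_apply, mul_ite, mul_one, mul_zero,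
      Finset.sum_ite_eq, Finset.mem_univ, if_true]
  have e3 : ∑ i, ∑ j, F i j * (2 * ∑ l, pd i (pd l f) 0 * pd j (pd l f) 0)
      = 2 * ∑ l, ∑ i, ∑ j, F i j * (pd l (pd i f) 0 * pd l (pd j f) 0) := by
    simp only [Finset.mul_sum]
    rw [Finset.sum_congr rfl fun i _ => Finset.sum_comm, Finset.sum_comm]
    exact Finset.sum_congr rfl fun l _ => Finset.sum_congr rfl fun i _ => Finset.sum_congr rfl fun j _ => by
      rw [hqs i l, hqs j l]; ring
  -- The positive quadratic term is one summand of the sum over `l`, which occurs with the opposite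
  -- sign and the same factor, and all its summands are nonnegative.
  have e4 : ∑ i, ∑ j, F i j * (pd e (pd i f) 0 * pd e (pd j f) 0)
      ≤ ∑ l, ∑ i, ∑ j, F i j * (pd l (pd i f) 0 * pd l (pd j f) 0) :=
    Finset.single_le_sum (f := fun l => ∑ i, ∑ j, F i j * (pd l (pd i f) 0 * pd l (pd j f) 0))
      (fun l _ => posSemidef_quad_nonneg hFs fun i => pd l (pd i f) 0) (Finset.mem_univ e)
  have e5 : Q ^ 2 ≤ ∑ l, pd e (pd l f) 0 ^ 2 :=
    Finset.single_le_sum (f := fun l => pd e (pd l f) 0 ^ 2) (fun l _ => sq_nonneg _) (Finset.mem_univ e)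
  have e6 := (abs_le.1 (abs_sum_le_card_mul fun i => abs_sum_le_card_mul fun j =>
    abs_mul_le' (abs_le_trace_of_posSemidef hFs i j) (hlow i j))).2
  have e7 := (abs_le.1 (abs_sum_le_card_mul fun i => abs_sum_le_card_mul fun j =>
    abs_mul_le' (hB.inv₂ e e i j) (hW4 j i))).2
  have e8 : ∑ i, ∑ j, (∑ l, Y i l * pd e (pd e fun z => G z l j) 0) * Y j i
      = ∑ l, ∑ j, pd e (pd e fun z => G z l j) 0 * (Y * Y) j l := by
    simp only [Finset.sum_mul, Matrix.mul_apply, Finset.mul_sum]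
    rw [Finset.sum_congr rfl fun i _ => Finset.sum_comm, Finset.sum_comm]
    refine Finset.sum_congr rfl fun l _ => ?_
    rw [Finset.sum_comm]
    exact Finset.sum_congr rfl fun j _ => Finset.sum_congr rfl fun i _ => by ring
  have e9 := (abs_le.1 (abs_sum_le_card_mul fun l => abs_sum_le_card_mul fun j =>
    abs_mul_le' (hB.metric₂ e e l j) ((hYY0 j l).trans hαYY))).2
  -- By the arithmetic-geometric mean, `√φ/σ ≤ 1/2 + φ/(2σ²)`, which is at most `α ≤ T`. The term
  -- `φ/σ²` in `α` is the contribution of `r` to the ellipticity.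
  have e10 : φ / σ ≤ Real.sqrt φ * T := by
    have b1 : φ / σ = Real.sqrt φ * (Real.sqrt φ / σ) := by
      rw [← mul_div_assoc, Real.mul_self_sqrt hφ]
    have b2 : (Real.sqrt φ / σ) ^ 2 = φ / σ ^ 2 := by rw [div_pow, Real.sq_sqrt hφ]
    rw [b1]
    refine mul_le_mul_of_nonneg_left ?_ (Real.sqrt_nonneg _)
    nlinarith [sq_nonneg (Real.sqrt φ / σ - 1)]
  simp only [mul_sub, mul_add, Finset.sum_sub_distrib, Finset.sum_add_distrib] at key
  rw [e1, e2, e3, e8] at key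
  have fin := max_bound_scalar (m := n) hn3 hB1 ha hT hαT (by linarith) hσp.le hσN'
    (div_nonneg hφ hσp.le) (Real.sqrt_nonneg φ) e10 hK rfl hp2 e4 e5 e6 e7 e9
    (by rwa [mul_div_assoc] at key)
  rw [hc]
  exact fin

end Linearized

end

section

variable {n : ℕ} {D : Set (Euc n)} {G : Euc n → Matrix (Fin n) (Fin n) ℝ}

/-! ### Uniform bounds in normal coordinates -/

/-- Points of the frame bundle in coordinates. -/
abbrev FrameSpace (n : ℕ) := Euc n × (Fin n → Fin n → ℝ)

/-- Smoothness is needed jointly in the base point, the frame and the normal coordinate, so that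
jets at the origin depend continuously on the frame. -/
lemma contDiffAt_pull_normalMap (h : IsMetricOn D G) {p : FrameSpace n × Euc n} (hp : p.1.1 ∈ D)
    (hp' : normalMap G p.1.1 p.1.2 p.2 ∈ D) (i j : Fin n) :
    ContDiffAt ℝ ∞ (fun p : FrameSpace n × Euc n => pullM (normalMap G p.1.1 p.1.2) G p.2 i j) p := by
  have sΓ : ∀ i j k, ContDiffAt ℝ ∞ (fun p : FrameSpace n × Euc n => christoffel G i j k p.1.1) p :=
    fun i j k => ContDiffAt.comp p (g := christoffel G i j k) (f := fun p : FrameSpace n × Euc n => p.1.1)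
      (h.smooth_christoffel hp i j k) (contDiffAt_fst.comp p contDiffAt_fst)
  have sy : ∀ i, ContDiffAt ℝ ∞ (fun p : FrameSpace n × Euc n => p.1.1 i) p := fun i =>
    ((contDiff_coord i).comp (contDiff_fst.comp contDiff_fst)).contDiffAt
  have sz : ∀ i, ContDiffAt ℝ ∞ (fun p : FrameSpace n × Euc n => p.2 i) p := fun i =>
    ((contDiff_coord i).comp contDiff_snd).contDiffAt
  have sP : ∀ i j, ContDiffAt ℝ ∞ (fun p : FrameSpace n × Euc n => p.1.2 i j) p := fun i j =>
    ((contDiff_apply_apply ℝ ℝ i j).comp (contDiff_snd.comp contDiff_fst)).contDiffAt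
  have sl : ∀ j, ContDiffAt ℝ ∞ (fun p : FrameSpace n × Euc n => ∑ a, p.1.2 j a * p.2 a) p := fun j =>
    ContDiffAt.sum fun a _ => (sP j a).mul (sz a)
  have sZ : ContDiffAt ℝ ∞ (fun p : FrameSpace n × Euc n => normalMap G p.1.1 p.1.2 p.2) p := by
    rw [contDiffAt_euclidean]
    intro i
    simp only [normalMap]
    exact ((sy i).add (sl i)).sub (contDiffAt_const.mul (ContDiffAt.sum fun j _ => ContDiffAt.sum fun k _ =>
      (sΓ i j k).mul ((sl j).mul (sl k))))
  have sJ : ∀ i c, ContDiffAt ℝ ∞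
      (fun p : FrameSpace n × Euc n => jac (normalMap G p.1.1 p.1.2) p.2 i c) p := by
    intro i c
    simp only [jac_normalMap]
    exact (sP i c).sub (contDiffAt_const.mul (ContDiffAt.sum fun j _ => ContDiffAt.sum fun k _ =>
      (sΓ i j k).mul (((sP j c).mul (sl k)).add ((sl j).mul (sP k c)))))
  have sG : ∀ i j, ContDiffAt ℝ ∞
      (fun p : FrameSpace n × Euc n => G (normalMap G p.1.1 p.1.2 p.2) i j) p := fun i j =>
    ContDiffAt.comp p (g := fun y => G y i j) (h.smooth _ hp' i j) sZ
  simp only [pullM, Matrix.mul_apply, Matrix.transpose_apply]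
  exact ContDiffAt.sum fun a _ => (ContDiffAt.sum fun b _ => (sJ b i).mul (sG b a)).mul (sJ a j)

lemma continuousAt_normalMap (h : IsMetricOn D G) {p : FrameSpace n × Euc n} (hp : p.1.1 ∈ D) :
    ContinuousAt (fun p : FrameSpace n × Euc n => normalMap G p.1.1 p.1.2 p.2) p := by
  have sΓ : ∀ i j k, ContinuousAt (fun p : FrameSpace n × Euc n => christoffel G i j k p.1.1) p :=
    fun i j k => ContinuousAt.comp (g := christoffel G i j k) (f := fun p : FrameSpace n × Euc n => p.1.1)
      (h.smooth_christoffel hp i j k).continuousAt (by fun_prop)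
  have sl : ∀ j, ContinuousAt (fun p : FrameSpace n × Euc n => ∑ a, p.1.2 j a * p.2 a) p := fun j => by
    fun_prop
  unfold normalMap
  refine (PiLp.continuous_toLp 2 _).continuousAt.comp (continuousAt_pi.2 fun i => ?_)
  exact (ContinuousAt.add (by fun_prop) (sl i)).sub (continuousAt_const.mul
    (tendsto_finsetSum _ fun j _ => tendsto_finsetSum _ fun k _ =>
      (sΓ i j k).mul ((sl j).mul (sl k))))

lemma jsmooth_pull_normalMap (h : IsMetricOn D G) {q : FrameSpace n} (hq : q.1 ∈ D)
    (hP : (Matrix.of q.2)ᵀ * G q.1 * Matrix.of q.2 = 1) :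
    ∃ (I : Set (FrameSpace n)) (D₀ : Set (Euc n)), IsOpen I ∧ IsOpen D₀ ∧ q ∈ I ∧ (0 : Euc n) ∈ D₀ ∧
      JSmoothM I D₀ (fun q z => pullM (normalMap G q.1 q.2) G z) ∧
      ∀ q ∈ I, ∀ z ∈ D₀, (pullM (normalMap G q.1 q.2) G z).det ≠ 0 := by
  have h0 : normalMap G q.1 q.2 0 ∈ D := by rwa [normalMap_zero]
  have c1 : ∀ i j, ContinuousAt (fun p : FrameSpace n × Euc n =>
      pullM (normalMap G p.1.1 p.1.2) G p.2 i j) (q, 0) := fun i j =>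
    (contDiffAt_pull_normalMap h (p := (q, 0)) hq h0 i j).continuousAt
  have c2 : ContinuousAt (fun p : FrameSpace n × Euc n =>
      (pullM (normalMap G p.1.1 p.1.2) G p.2).det) (q, 0) := by
    have : ContinuousAt (fun p : FrameSpace n × Euc n => pullM (normalMap G p.1.1 p.1.2) G p.2) (q, 0) :=
      continuousAt_pi.2 fun i => continuousAt_pi.2 fun j => c1 i j
    exact (continuous_id.matrix_det).continuousAt.comp this
  have d0 : (pullM (normalMap G q.1 q.2) G 0).det ≠ 0 := by
    unfold pullM
    rw [jac_normalMap_zero, normalMap_zero, hP]; simp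
  have e1 : ∀ᶠ p : FrameSpace n × Euc n in 𝓝 (q, 0), p.1.1 ∈ D :=
    (continuous_fst.comp continuous_fst).continuousAt.eventually (h.isOpen.mem_nhds hq)
  have e2 : ∀ᶠ p : FrameSpace n × Euc n in 𝓝 (q, 0), normalMap G p.1.1 p.1.2 p.2 ∈ D :=
    (continuousAt_normalMap h (p := (q, 0)) hq).eventually (h.isOpen.mem_nhds h0)
  have e3 := c2.eventually_ne d0
  obtain ⟨I, D₀, hI, hqI, hD, h0D, hsub⟩ := mem_nhds_prod_iff'.1 ((e1.and e2).and e3)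
  refine ⟨I, D₀, hI, hD, hqI, h0D, fun i j p hp => ?_, fun q hq z hz => ?_⟩
  · have := hsub hp
    exact (contDiffAt_pull_normalMap h this.1.1 this.1.2 i j).contDiffWithinAt
  · exact (hsub (mk_mem_prod hq hz)).2

/-- The orthonormal frames over a set. -/
def frames (G : Euc n → Matrix (Fin n) (Fin n) ℝ) (K : Set (Euc n)) : Set (FrameSpace n) :=
  {q | q.1 ∈ K ∧ (Matrix.of q.2)ᵀ * G q.1 * Matrix.of q.2 = 1}

/-- An orthonormal frame satisfies `P Pᵀ = A⁻¹`. Frames over a compact set are therefore bounded,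
which makes the frame bundle over it compact. -/
lemma frame_sq_le {A : Matrix (Fin n) (Fin n) ℝ} {P : Fin n → Fin n → ℝ}
    (hP : (Matrix.of P)ᵀ * A * Matrix.of P = 1) (i j : Fin n) : P i j ^ 2 ≤ A⁻¹ i i := by
  have h1 : A⁻¹ = Matrix.of P * (Matrix.of P)ᵀ := by
    have h2 : Matrix.of P * ((Matrix.of P)ᵀ * A) = 1 := mul_eq_one_comm.1 (by rw [← hP, Matrix.mul_assoc])
    refine Matrix.inv_eq_left_inv ?_
    rw [Matrix.mul_assoc, h2]
  rw [h1, Matrix.mul_apply]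
  simp only [Matrix.transpose_apply, Matrix.of_apply, ← pow_two]
  exact Finset.single_le_sum (f := fun k => P i k ^ 2) (fun k _ => sq_nonneg _) (Finset.mem_univ j)

lemma isCompact_frames (h : IsMetricOn D G) {K : Set (Euc n)} (hK : IsCompact K) (hKD : K ⊆ D) :
    IsCompact (frames G K) := by
  have cP : ∀ i, ContinuousOn (fun y => (G y)⁻¹ i i) K := fun i y hy =>
    (h.smooth_inv (hKD hy) i i).continuousAt.continuousWithinAt
  have hb : ∃ b : ℝ, ∀ i, ∀ y ∈ K, (G y)⁻¹ i i ≤ b := by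
    choose b hb using fun i => hK.bddAbove_image (cP i)
    refine ⟨∑ i, |b i|, fun i y hy => ?_⟩
    exact (hb i (mem_image_of_mem _ hy)).trans ((le_abs_self _).trans
      (Finset.single_le_sum (f := fun i => |b i|) (fun i _ => abs_nonneg _) (Finset.mem_univ i)))
  obtain ⟨b, hb⟩ := hb
  have hcomp : IsCompact (K ×ˢ (Set.pi univ fun _ : Fin n => Set.pi univ fun _ : Fin n =>
      Icc (-Real.sqrt b) (Real.sqrt b))) :=
    hK.prod (isCompact_univ_pi fun _ => isCompact_univ_pi fun _ => isCompact_Icc)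
  have hcont : ContinuousOn (fun q : FrameSpace n => (Matrix.of q.2)ᵀ * G q.1 * Matrix.of q.2)
      (K ×ˢ (Set.pi univ fun _ : Fin n => Set.pi univ fun _ : Fin n =>
      Icc (-Real.sqrt b) (Real.sqrt b))) := by
    refine continuousOn_pi.2 fun i => continuousOn_pi.2 fun j => ?_
    simp only [Matrix.mul_apply, Matrix.transpose_apply, Matrix.of_apply]
    have cG : ∀ i j, ContinuousOn (fun q : FrameSpace n => G q.1 i j)
        (K ×ˢ (Set.pi univ fun _ : Fin n => Set.pi univ fun _ : Fin n =>
        Icc (-Real.sqrt b) (Real.sqrt b))) := fun i j q hq =>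
      (ContinuousAt.comp (f := fun q : FrameSpace n => q.1) (g := fun y => G y i j)
        (h.smooth q.1 (hKD hq.1) i j).continuousAt (by fun_prop)).continuousWithinAt
    have c2 : ∀ i j, ContinuousOn (fun q : FrameSpace n => q.2 i j)
        (K ×ˢ (Set.pi univ fun _ : Fin n => Set.pi univ fun _ : Fin n =>
        Icc (-Real.sqrt b) (Real.sqrt b))) := fun i j => by fun_prop
    exact continuousOn_finsetSum _ fun k _ => (continuousOn_finsetSum _ fun l _ =>
      (c2 l i).mul (cG l k)).mul (c2 k j)
  have hcl := hcont.preimage_isClosed_of_isClosed hcomp.isClosed (isClosed_singleton (x := 1))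
  have heq : frames G K = (K ×ˢ (Set.pi univ fun _ : Fin n => Set.pi univ fun _ : Fin n =>
      Icc (-Real.sqrt b) (Real.sqrt b))) ∩
      (fun q : FrameSpace n => (Matrix.of q.2)ᵀ * G q.1 * Matrix.of q.2) ⁻¹' {1} := by
    ext q
    refine ⟨fun hq => ⟨⟨hq.1, fun i _ j _ => ?_⟩, hq.2⟩, fun hq => ⟨hq.1.1, hq.2⟩⟩
    exact abs_le.1 (Real.abs_le_sqrt ((frame_sq_le hq.2 i j).trans (hb i q.1 hq.1)))
  rw [heq]
  exact hcomp.of_isClosed_subset hcl inter_subset_left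

lemma exists_bound_family {X ι : Type*} [TopologicalSpace X] [Finite ι] {S : Set X} (hS : IsCompact S)
    {F : ι → X → ℝ} (hF : ∀ i, ContinuousOn (F i) S) : ∃ B, ∀ i, ∀ x ∈ S, |F i x| ≤ B := by
  choose b hb using fun i => hS.exists_bound_of_continuousOn (hF i)
  cases nonempty_fintype ι
  exact ⟨∑ i, |b i|, fun i x hx => (hb i x hx).trans ((le_abs_self _).trans
    (Finset.single_le_sum (f := fun i => |b i|) (fun i _ => abs_nonneg _) (Finset.mem_univ i)))⟩

/-- The derivatives of the metric in normal coordinates are bounded, uniformly over a compact set. -/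
lemma exists_jetBound (h : IsMetricOn D G) {K : Set (Euc n)} (hK : IsCompact K) (hKD : K ⊆ D) :
    ∃ B : ℝ, 1 ≤ B ∧ ∀ y ∈ K, ∀ P : Fin n → Fin n → ℝ, (Matrix.of P)ᵀ * G y * Matrix.of P = 1 →
      JetBound (pullM (normalMap G y P) G) B := by
  have hS := isCompact_frames h hK hKD
  -- Any quantity that is the value at the origin of a jointly smooth family is continuous on the
  -- frames. The bounds below are instances of this, followed by compactness.
  have loc : ∀ J : FrameSpace n → ℝ, (∀ (I : Set (FrameSpace n)) (D₀ : Set (Euc n)), IsOpen I → IsOpen D₀ →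
      (0 : Euc n) ∈ D₀ → JSmoothM I D₀ (fun q z => pullM (normalMap G q.1 q.2) G z) →
      (∀ q ∈ I, ∀ z ∈ D₀, (pullM (normalMap G q.1 q.2) G z).det ≠ 0) →
      ∃ X : FrameSpace n → Euc n → ℝ, JSmooth I D₀ X ∧ ∀ q, J q = X q 0) → ContinuousOn J (frames G K) := by
    intro J hJ q hq
    obtain ⟨I, D₀, hI, hD, hqI, h0, hX, hd⟩ := jsmooth_pull_normalMap h (hKD hq.1) hq.2
    obtain ⟨X, hX, hJX⟩ := hJ I D₀ hI hD h0 hX hd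
    have h1 : ContinuousAt (fun p : FrameSpace n × Euc n => X p.1 p.2) (q, 0) :=
      hX.continuousOn.continuousAt ((hI.prod hD).mem_nhds ⟨hqI, h0⟩)
    have h2 : ContinuousAt (fun q : FrameSpace n => X q 0) q :=
      ContinuousAt.comp (f := fun q : FrameSpace n => (q, (0 : Euc n))) h1 (by fun_prop)
    rw [show J = fun q => X q 0 from funext hJX]
    exact h2.continuousWithinAt
  obtain ⟨b1, h1⟩ := exists_bound_family hS (F := fun (a : Fin n × Fin n) q =>
    schouten (pullM (normalMap G q.1 q.2) G) 0 a.1 a.2) fun a => loc _ fun I D₀ hI hD h0 hX hd =>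
    ⟨_, hX.schouten hd hI.uniqueDiffOn hD a.1 a.2, fun _ => rfl⟩
  obtain ⟨b2, h2⟩ := exists_bound_family hS (F := fun (a : Fin n × Fin n × Fin n) q =>
    pd a.1 (fun z => schouten (pullM (normalMap G q.1 q.2) G) z a.2.1 a.2.2) 0) fun a => loc _
    fun I D₀ hI hD h0 hX hd =>
    ⟨_, (hX.schouten hd hI.uniqueDiffOn hD a.2.1 a.2.2).pd hI.uniqueDiffOn hD a.1, fun _ => rfl⟩
  obtain ⟨b3, h3⟩ := exists_bound_family hS (F := fun (a : Fin n × Fin n × Fin n) q =>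
    pd a.1 (pd a.1 fun z => schouten (pullM (normalMap G q.1 q.2) G) z a.2.1 a.2.2) 0) fun a => loc _
    fun I D₀ hI hD h0 hX hd =>
    ⟨_, ((hX.schouten hd hI.uniqueDiffOn hD a.2.1 a.2.2).pd hI.uniqueDiffOn hD a.1).pd
      hI.uniqueDiffOn hD a.1, fun _ => rfl⟩
  obtain ⟨b4, h4⟩ := exists_bound_family hS (F := fun (a : Fin n × Fin n × Fin n × Fin n) q =>
    pd a.1 (pd a.2.1 fun z => pullM (normalMap G q.1 q.2) G z a.2.2.1 a.2.2.2) 0) fun a => loc _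
    fun I D₀ hI hD h0 hX hd =>
    ⟨_, ((hX a.2.2.1 a.2.2.2).pd hI.uniqueDiffOn hD a.2.1).pd hI.uniqueDiffOn hD a.1, fun _ => rfl⟩
  obtain ⟨b5, h5⟩ := exists_bound_family hS (F := fun (a : Fin n × Fin n × Fin n × Fin n) q =>
    pd a.1 (pd a.2.1 fun z => (pullM (normalMap G q.1 q.2) G z)⁻¹ a.2.2.1 a.2.2.2) 0) fun a => loc _
    fun I D₀ hI hD h0 hX hd =>
    ⟨_, ((hX.inv hd a.2.2.1 a.2.2.2).pd hI.uniqueDiffOn hD a.2.1).pd hI.uniqueDiffOn hD a.1, fun _ => rfl⟩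
  obtain ⟨b6, h6⟩ := exists_bound_family hS (F := fun (a : Fin n × Fin n × Fin n × Fin n) q =>
    pd a.1 (christoffel (pullM (normalMap G q.1 q.2) G) a.2.1 a.2.2.1 a.2.2.2) 0) fun a => loc _
    fun I D₀ hI hD h0 hX hd =>
    ⟨_, (hX.christoffel hd hI.uniqueDiffOn hD a.2.1 a.2.2.1 a.2.2.2).pd hI.uniqueDiffOn hD a.1,
      fun _ => rfl⟩
  obtain ⟨b7, h7⟩ := exists_bound_family hS (F := fun (a : Fin n × Fin n × Fin n × Fin n × Fin n) q =>
    pd a.1 (pd a.2.1 (christoffel (pullM (normalMap G q.1 q.2) G) a.2.2.1 a.2.2.2.1 a.2.2.2.2)) 0)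
    fun a => loc _ fun I D₀ hI hD h0 hX hd =>
    ⟨_, ((hX.christoffel hd hI.uniqueDiffOn hD a.2.2.1 a.2.2.2.1 a.2.2.2.2).pd
      hI.uniqueDiffOn hD a.2.1).pd hI.uniqueDiffOn hD a.1, fun _ => rfl⟩
  have m := fun b => le_abs_self (b : ℝ)
  have m0 := fun b => abs_nonneg (b : ℝ)
  refine ⟨1 + |b1| + |b2| + |b3| + |b4| + |b5| + |b6| + |b7|, ?_, fun y hy P hP => ?_⟩
  · linarith [m0 b1, m0 b2, m0 b3, m0 b4, m0 b5, m0 b6, m0 b7]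
  · have hq : ((y, P) : FrameSpace n) ∈ frames G K := ⟨hy, hP⟩
    constructor
    · exact fun i j => (h1 (i, j) _ hq).trans
        (by linarith [m b1, m0 b1, m0 b2, m0 b3, m0 b4, m0 b5, m0 b6, m0 b7])
    · exact fun k i j => (h2 (k, i, j) _ hq).trans
        (by linarith [m b2, m0 b1, m0 b2, m0 b3, m0 b4, m0 b5, m0 b6, m0 b7])
    · exact fun k i j => (h3 (k, i, j) _ hq).trans
        (by linarith [m b3, m0 b1, m0 b2, m0 b3, m0 b4, m0 b5, m0 b6, m0 b7])
    · exact fun k l i j => (h4 (k, l, i, j) _ hq).trans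
        (by linarith [m b4, m0 b1, m0 b2, m0 b3, m0 b4, m0 b5, m0 b6, m0 b7])
    · exact fun k l i j => (h5 (k, l, i, j) _ hq).trans
        (by linarith [m b5, m0 b1, m0 b2, m0 b3, m0 b4, m0 b5, m0 b6, m0 b7])
    · exact fun a k i j => (h6 (a, k, i, j) _ hq).trans
        (by linarith [m b6, m0 b1, m0 b2, m0 b3, m0 b4, m0 b5, m0 b6, m0 b7])
    · exact fun a b k i j => (h7 (a, b, k, i, j) _ hq).trans
        (by linarith [m b7, m0 b1, m0 b2, m0 b3, m0 b4, m0 b5, m0 b6, m0 b7])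

end

section

variable {n : ℕ}

/-! ### The bound at an interior maximum in arbitrary coordinates -/

/-- The quadratic form `∇²f + (|∇f|² - c) G` at `z`. -/
def quadBar (G : Euc n → Matrix (Fin n) (Fin n) ℝ) (c : ℝ) (f : Euc n → ℝ) (z : Euc n) (w : Fin n → ℝ) :
    ℝ :=
  w ⬝ᵥ hessian G f z *ᵥ w + (w ⬝ᵥ G z *ᵥ w) * (gradSq G f z - c)

lemma quad_conj (J X : Matrix (Fin n) (Fin n) ℝ) (w : Fin n → ℝ) :
    w ⬝ᵥ (Jᵀ * X * J) *ᵥ w = (J *ᵥ w) ⬝ᵥ X *ᵥ (J *ᵥ w) := by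
  rw [← Matrix.mulVec_mulVec, ← Matrix.mulVec_mulVec, Matrix.dotProduct_mulVec, Matrix.vecMul_transpose]

lemma quad_single (X : Matrix (Fin n) (Fin n) ℝ) (e : Fin n) :
    Pi.single e 1 ⬝ᵥ X *ᵥ Pi.single e 1 = X e e := by simp

lemma mulVec_single_one' (J : Matrix (Fin n) (Fin n) ℝ) (e : Fin n) :
    J *ᵥ Pi.single e 1 = fun i => J i e := by
  ext i; simp

variable {D D' : Set (Euc n)} {G : Euc n → Matrix (Fin n) (Fin n) ℝ} {Φ : Euc n → Euc n}

lemma quadBar_pull (h : IsMetricOn D' G) (hΦ : IsChange D D' Φ) {y : Euc n} (hy : y ∈ D) {f : Euc n → ℝ}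
    (hf : ∀ z ∈ D', ContDiffAt ℝ ∞ f z) (c : ℝ) (w : Fin n → ℝ) :
    quadBar (pullM Φ G) c (fun z => f (Φ z)) y w = quadBar G c f (Φ y) (jac Φ y *ᵥ w) := by
  rw [quadBar, quadBar, hessian_pull h hΦ hy hf, gradSq_pull hΦ hy (hf _ (hΦ.mapsTo y hy)), pullM,
    quad_conj, quad_conj]

lemma sigma_pull (h : IsMetricOn D' G) (hΦ : IsChange D D' Φ) {y : Euc n} (hy : y ∈ D) {f : Euc n → ℝ}
    (hf : ∀ z ∈ D', ContDiffAt ℝ ∞ f z) :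
    sigma1 ((pullM Φ G y)⁻¹ * Wmat (pullM Φ G) (fun z => f (Φ z)) y)
      = sigma1 ((G (Φ y))⁻¹ * Wmat G f (Φ y)) ∧
    sigma2 ((pullM Φ G y)⁻¹ * Wmat (pullM Φ G) (fun z => f (Φ z)) y)
      = sigma2 ((G (Φ y))⁻¹ * Wmat G f (Φ y)) := by
  rw [Wmat_pull h hΦ hy hf, pullM_inv hΦ hy]
  exact ⟨sigma1_conj (hΦ.isUnit_det hy) _, sigma2_conj (hΦ.isUnit_det hy) _⟩

lemma JSmooth.comp_right {Q : Type*} [NormedAddCommGroup Q] [NormedSpace ℝ Q] {I : Set Q} {u : Q → Euc n → ℝ}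
    (hu : JSmooth I D' u) (hm : ∀ z ∈ D, Φ z ∈ D') (hs : ∀ z ∈ D, ContDiffAt ℝ ∞ Φ z) :
    JSmooth I D (fun t z => u t (Φ z)) := by
  refine ContDiffOn.comp (g := fun q : Q × Euc n => u q.1 q.2) (f := fun q : Q × Euc n => (q.1, Φ q.2))
    hu ?_ fun q hq => ⟨hq.1, hm _ hq.2⟩
  refine contDiffOn_fst.prodMk fun q hq => ?_
  exact ((hs q.2 hq.2).comp q contDiffAt_snd).contDiffWithinAt

/-- The bound at an interior maximum, with a constant that is uniform over a compact set. -/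
lemma exists_max_bound (hn : 3 ≤ n) (h : IsMetricOn D G) {K : Set (Euc n)} (hK : IsCompact K) (hKD : K ⊆ D)
    {a : ℝ} (ha : 0 ≤ a) :
    ∃ C : ℝ, 0 ≤ C ∧ ∀ (I : Set ℝ) (u : ℝ → Euc n → ℝ) (t₀ r s c : ℝ) (y₀ : Euc n) (v : Fin n → ℝ),
      IsOpen I → JSmooth I D u → t₀ ∈ I → y₀ ∈ K → 0 ≤ r →
      (∀ z ∈ D, 0 < sigma1 ((G z)⁻¹ * Wmat G (u t₀) z)) →
      (∀ z ∈ D, deriv (fun τ => u τ z) t₀ = (sigma2 ((G z)⁻¹ * Wmat G (u t₀) z)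
        - r * Real.exp (-a * u t₀ z)) / sigma1 ((G z)⁻¹ * Wmat G (u t₀) z) + s) →
      v ⬝ᵥ G y₀ *ᵥ v = 1 → quadBar G c (u t₀) y₀ v = 0 →
      (∀ t ∈ I, t ≤ t₀ → ∀ z ∈ D, ∀ w, quadBar G c (u t) z w ≤ 0) →
      c ≤ C * (1 + Real.sqrt (r * Real.exp (-a * u t₀ y₀))) := by
  obtain ⟨B, hB1, hB⟩ := exists_jetBound h hK hKD
  refine ⟨(1 + 2 * n) * (2 * n * (23 * n ^ 4 * B + 3 * a) + 4 * B), by positivity, ?_⟩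
  intro I u t₀ r s c y₀ v hI hu ht hy hr hσ hflow hv hv0 hmax
  let e : Fin n := ⟨0, by omega⟩
  -- The maximising direction `v` becomes the coordinate vector `e` of the normal coordinates.
  obtain ⟨P, hP, hPe⟩ := exists_frame (h.posDef y₀ (hKD hy)) e v hv
  obtain ⟨D₀, h0, hΦ⟩ := isChange_normalMap h (hKD hy) hP
  have hN := isNormal_pull h (hKD hy) hP h0 hΦ
  have hJ := hB y₀ hy P hP
  set Φ := normalMap G y₀ P with hΦd
  have hΦ0 : Φ 0 = y₀ := normalMap_zero P
  have hJ0 : jac Φ 0 = Matrix.of P := jac_normalMap_zero P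
  have hut : ∀ t ∈ I, ∀ z ∈ D, ContDiffAt ℝ ∞ (u t) z := fun t ht z hz => hu.slice h.isOpen ht hz
  have hPv : Matrix.of P *ᵥ Pi.single e 1 = v := by
    rw [mulVec_single_one']; exact funext hPe
  -- the quadratic form at the origin
  have q0 : ∀ w : Fin n → ℝ, quadBar (pullM Φ G) c (fun z => u t₀ (Φ z)) 0 w
      = ∑ i, ∑ j, w i * w j * pd i (pd j fun z => u t₀ (Φ z)) 0
        + (∑ i, w i ^ 2) * (gradSq (pullM Φ G) (fun z => u t₀ (Φ z)) 0 - c) := by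
    intro w
    rw [quadBar, hN.eq_one, Matrix.one_mulVec]
    congr 1
    · simp only [dotProduct, Matrix.mulVec, hN.hessian_zero, Finset.mul_sum]
      exact Finset.sum_congr rfl fun i _ => Finset.sum_congr rfl fun j _ => by ring
    · congr 1
      exact Finset.sum_congr rfl fun i _ => by ring
  have q1 : quadBar (pullM Φ G) c (fun z => u t₀ (Φ z)) 0 (Pi.single e 1) = 0 := by
    rw [quadBar_pull h hΦ h0 (hut t₀ ht), hJ0, hPv, hΦ0, hv0]
  have hc : c = pd e (pd e fun z => u t₀ (Φ z)) 0 + gradSq (pullM Φ G) (fun z => u t₀ (Φ z)) 0 := by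
    rw [quadBar, quad_single, quad_single, hN.hessian_zero, hN.eq_one, Matrix.one_apply_eq] at q1
    linarith
  have key := hN.max_bound (u := fun t z => u t (Φ z)) (t₀ := t₀) (r := r) (a := a) (s := s) hn hI
    (hu.comp_right hΦ.mapsTo hΦ.smooth) ht hr ha hJ hB1
    (fun z hz => by
      rw [(sigma_pull h hΦ hz (hut t₀ ht)).1]; exact hσ _ (hΦ.mapsTo z hz))
    (fun z hz => by
      rw [(sigma_pull h hΦ hz (hut t₀ ht)).1, (sigma_pull h hΦ hz (hut t₀ ht)).2]
      exact hflow _ (hΦ.mapsTo z hz)) e hc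
    (fun t ht' hle z hz => by
      have := hmax t ht' hle _ (hΦ.mapsTo z hz) (jac Φ z *ᵥ (Pi.single e 1 : Fin n → ℝ))
      rw [← quadBar_pull h hΦ hz (hut t ht'), quadBar, quad_single _ e, quad_single _ e] at this
      exact this)
    -- At the origin the bound in all directions says that the second derivative along `e` is the
    -- largest eigenvalue of the Hessian.
    (fun w => by
      have := hmax t₀ ht le_rfl _ (hΦ.mapsTo 0 h0) (jac Φ 0 *ᵥ w)
      rw [← quadBar_pull h hΦ h0 (hut t₀ ht), q0] at this
      have e1 : pd e (pd e fun z => u t₀ (Φ z)) 0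
          = c - gradSq (pullM Φ G) (fun z => u t₀ (Φ z)) 0 := by linarith
      rw [e1]; linarith)
  rw [hΦ0] at key
  refine key.trans ?_
  set S := Real.sqrt (r * Real.exp (-a * u t₀ y₀))
  have hS : 0 ≤ S := Real.sqrt_nonneg _
  rw [mul_assoc (1 + 2 * (n : ℝ))]
  refine mul_le_mul_of_nonneg_left ?_ (by positivity)
  have x1 : 0 ≤ 2 * n * (23 * n ^ 4 * B) * S + 4 * B * S + 2 * n * (3 * a) := by positivity
  linarith

end

section

variable {n : ℕ} {M : Type*} [TopologicalSpace M] [ChartedSpace (EuclideanSpace ℝ (Fin n)) M]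

/-! ### Coordinate changes of a manifold -/

/-- The change from the chart around `p` to the chart around `q`. -/
def transition (p q : M) (y : Euc n) : Euc n := extChartAt (𝓡 n) q ((extChartAt (𝓡 n) p).symm y)

/-- The domain of `transition p q`. -/
def overlap (p q : M) : Set (Euc n) :=
  (extChartAt (𝓡 n) p).target ∩ (extChartAt (𝓡 n) p).symm ⁻¹' (extChartAt (𝓡 n) q).source

lemma isOpen_overlap (p q : M) : IsOpen (overlap p q : Set (Euc n)) :=
  (continuousOn_extChartAt_symm p).isOpen_inter_preimage (isOpen_extChartAt_target p)
    (isOpen_extChartAt_source q)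

lemma symm_transition {p q : M} {y : Euc n} (hy : y ∈ overlap p q) :
    (extChartAt (𝓡 n) q).symm (transition p q y) = (extChartAt (𝓡 n) p).symm y :=
  (extChartAt (𝓡 n) q).left_inv hy.2

lemma transition_mem {p q : M} {y : Euc n} (hy : y ∈ overlap p q) :
    transition p q y ∈ (extChartAt (𝓡 n) q).target := (extChartAt (𝓡 n) q).map_source hy.2

lemma transition_mem_overlap {p q : M} {y : Euc n} (hy : y ∈ overlap p q) :
    transition p q y ∈ (overlap q p : Set (Euc n)) :=
  ⟨transition_mem hy, by
    rw [mem_preimage, symm_transition hy]; exact (extChartAt (𝓡 n) p).map_target hy.1⟩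

lemma transition_transition {p q : M} {y : Euc n} (hy : y ∈ overlap p q) :
    transition q p (transition p q y) = y := by
  rw [transition, symm_transition hy, (extChartAt (𝓡 n) p).right_inv hy.1]

/-- The differential of the inverse of a chart. -/
def dchart (p : M) (y : Euc n) : Euc n →L[ℝ] Euc n :=
  mfderiv 𝓘(ℝ, EuclideanSpace ℝ (Fin n)) (𝓡 n) (extChartAt (𝓡 n) p).symm y

/-- A field of bilinear forms in the trivialisation given by the preferred charts. -/
def bil (g : BilinField n M) (x : M) : Euc n →L[ℝ] Euc n →L[ℝ] ℝ := g x

lemma coeff_apply (g : BilinField n M) (p : M) (y : Euc n) (i j : Fin n) :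
    coeff g p y i j = bil g ((extChartAt (𝓡 n) p).symm y) (dchart p y (EuclideanSpace.single i 1))
      (dchart p y (EuclideanSpace.single j 1)) := rfl

lemma inChart_transition (v : M → ℝ) {p q : M} {y : Euc n} (hy : y ∈ overlap p q) :
    inChart p v y = inChart q v (transition p q y) := by
  simp only [inChart, symm_transition hy]

lemma coeff_conformal (g : BilinField n M) (v : M → ℝ) (p : M) :
    coeff (conformal g v) p = confM (inChart p v) (coeff g p) := by
  ext y i j
  rfl

variable [IsManifold (𝓡 n) ∞ M]

lemma contDiffAt_transition {p q : M} {y : Euc n} (hy : y ∈ overlap p q) :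
    ContDiffAt ℝ ∞ (transition p q) y := by
  have h := contDiffOn_ext_coord_change (I := 𝓡 n) (n := ∞) q p
  refine (h.mono ?_).contDiffAt ((isOpen_overlap p q).mem_nhds hy)
  intro z hz
  simpa [overlap, PartialEquiv.trans_source] using hz

lemma jac_comp {Φ Ψ : Euc n → Euc n} {y : Euc n} (hΦ : DifferentiableAt ℝ Φ y)
    (hΨ : DifferentiableAt ℝ Ψ (Φ y)) : jac (fun z => Ψ (Φ z)) y = jac Ψ (Φ y) * jac Φ y := by
  ext i a
  have hi : DifferentiableAt ℝ (fun w => Ψ w i) (Φ y) :=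
    (EuclideanSpace.proj i : Euc n →L[ℝ] ℝ).differentiableAt.comp _ hΨ
  have := pd_comp (f := fun w => Ψ w i) a hi hΦ
  rw [Matrix.mul_apply]
  simp only [jac, Matrix.of_apply]
  rw [this]
  simp [mul_comm]

lemma isChange_transition (p q : M) :
    IsChange (overlap p q) (extChartAt (𝓡 n) q).target (transition p q) where
  isOpen := isOpen_overlap p q
  mapsTo _ hz := transition_mem hz
  smooth _ hz := contDiffAt_transition hz
  det_ne z hz := by
    have h1 := jac_comp ((contDiffAt_transition hz).differentiableAt (by simp))
      ((contDiffAt_transition (transition_mem_overlap hz)).differentiableAt (by simp))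
    have h2 : jac (fun w => transition q p (transition p q w)) z = 1 := by
      ext i a
      simp only [jac, Matrix.of_apply]
      rw [pd_congr_on (isOpen_overlap p q) hz a fun w hw => by rw [transition_transition hw]]
      have h3 := pd_linear (Pi.single i 1) a z
      simp only [Pi.single_apply, ite_mul, one_mul, zero_mul, Finset.sum_ite_eq', Finset.mem_univ, if_true] at h3
      rw [h3, Matrix.one_apply]
      simp [eq_comm]
    intro h0
    have := congrArg Matrix.det (h1.symm.trans h2)
    rw [Matrix.det_mul, h0, mul_zero, Matrix.det_one] at this
    exact zero_ne_one this

lemma mdifferentiableAt_symm {p : M} {y : Euc n} (hy : y ∈ (extChartAt (𝓡 n) p).target) :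
    MDifferentiableAt 𝓘(ℝ, EuclideanSpace ℝ (Fin n)) (𝓡 n) (extChartAt (𝓡 n) p).symm y := by
  have : IsManifold (𝓡 n) 1 M := IsManifold.of_le (n := ∞) (by exact_mod_cast le_top)
  exact (mdifferentiableOn_extChartAt_symm y hy).mdifferentiableAt
    ((isOpen_extChartAt_target p).mem_nhds hy)

/-- Chain rule for the inverse of one chart, factored through the other chart. -/
lemma dchart_transition {p q : M} {y : Euc n} (hy : y ∈ overlap p q) (w : Euc n) :
    dchart p y w = dchart q (transition p q y) (fderiv ℝ (transition p q) y w) := by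
  have e1 : (extChartAt (𝓡 n) p).symm =ᶠ[𝓝 y] (extChartAt (𝓡 n) q).symm ∘ transition p q := by
    filter_upwards [(isOpen_overlap p q).mem_nhds hy] with z hz using (symm_transition hz).symm
  have e2 : MDifferentiableAt 𝓘(ℝ, EuclideanSpace ℝ (Fin n)) 𝓘(ℝ, EuclideanSpace ℝ (Fin n))
      (transition p q) y :=
    ((contDiffAt_transition hy).differentiableAt (by simp)).mdifferentiableAt
  have e3 := mfderiv_comp y (mdifferentiableAt_symm (transition_mem hy)) e2
  have e4 := e1.mfderiv_eq (I := 𝓘(ℝ, EuclideanSpace ℝ (Fin n))) (I' := 𝓡 n)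
  rw [e3, mfderiv_eq_fderiv] at e4
  exact congrArg (fun L : Euc n →L[ℝ] Euc n => L w) e4

lemma fderiv_single_eq_sum {Φ : Euc n → Euc n} {y : Euc n} (hΦ : DifferentiableAt ℝ Φ y) (a : Fin n) :
    fderiv ℝ Φ y (EuclideanSpace.single a 1) = ∑ i, jac Φ y i a • EuclideanSpace.single i (1 : ℝ) := by
  have h : ∀ i, jac Φ y i a = fderiv ℝ Φ y (EuclideanSpace.single a 1) i := by
    intro i
    simp only [jac, Matrix.of_apply, pd]
    have := ((EuclideanSpace.proj i : Euc n →L[ℝ] ℝ).hasFDerivAt.comp y hΦ.hasFDerivAt).fderiv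
    rw [show (fun w => Φ w i) = (EuclideanSpace.proj i : Euc n →L[ℝ] ℝ) ∘ Φ from rfl, this]
    rfl
  ext k
  simp [h, Pi.single_apply]

lemma bil_sum (B : Euc n →L[ℝ] Euc n →L[ℝ] ℝ) (L : Euc n →L[ℝ] Euc n) (a b : Fin n → ℝ) :
    B (L (∑ i, a i • EuclideanSpace.single i (1 : ℝ))) (L (∑ i, b i • EuclideanSpace.single i (1 : ℝ)))
      = ∑ i, ∑ j, a i * b j * B (L (EuclideanSpace.single i 1)) (L (EuclideanSpace.single j 1)) := by
  simp only [map_sum, map_smul, sum_apply, smul_apply, smul_eq_mul,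
    Finset.mul_sum]
  rw [Finset.sum_comm]
  exact Finset.sum_congr rfl fun i _ => Finset.sum_congr rfl fun j _ => by ring

lemma coeff_transition (g : BilinField n M) {p q : M} {y : Euc n} (hy : y ∈ overlap p q) :
    coeff g p y = pullM (transition p q) (coeff g q) y := by
  ext a b
  have hd := (contDiffAt_transition hy).differentiableAt (by simp)
  rw [coeff_apply, dchart_transition hy, dchart_transition hy, fderiv_single_eq_sum hd,
    fderiv_single_eq_sum hd, bil_sum, ← symm_transition hy]
  simp only [pullM, Matrix.mul_apply, Matrix.transpose_apply, coeff_apply, Finset.sum_mul]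
  rw [Finset.sum_comm]
  exact Finset.sum_congr rfl fun j _ => Finset.sum_congr rfl fun i _ => by ring

/-! ### A Riemannian metric in a chart -/

section Metric

variable (g₀ : Bundle.ContMDiffRiemannianMetric (𝓡 n) ∞ (EuclideanSpace ℝ (Fin n))
  (fun x : M => TangentSpace (𝓡 n) x))

lemma dchart_injective {p : M} {y : Euc n} (hy : y ∈ (extChartAt (𝓡 n) p).target) :
    Function.Injective (dchart p y) := by
  have : IsManifold (𝓡 n) 1 M := IsManifold.of_le (n := ∞) (by exact_mod_cast le_top)
  have h := isInvertible_mfderivWithin_extChartAt_symm (I := 𝓡 n) hy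
  have e : mfderivWithin 𝓘(ℝ, EuclideanSpace ℝ (Fin n)) (𝓡 n) (extChartAt (𝓡 n) p).symm (range (𝓡 n)) y
      = mfderiv 𝓘(ℝ, EuclideanSpace ℝ (Fin n)) (𝓡 n) (extChartAt (𝓡 n) p).symm y := by
    rw [ModelWithCorners.range_eq_univ, mfderivWithin_univ]
  rw [e] at h
  exact h.injective

/-- A smooth section of the bundle of bilinear forms, evaluated on the smooth coordinate fields
obtained by pushing constant vectors forward by the inverse chart. -/
lemma contDiffOn_coeff (p : M) (i j : Fin n) :
    ContDiffOn ℝ ∞ (fun y => coeff g₀.inner p y i j) (extChartAt (𝓡 n) p).target := by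
  have : IsManifold (𝓡 n) 1 M := IsManifold.of_le (n := ∞) (by exact_mod_cast le_top)
  have ht := isOpen_extChartAt_target (I := 𝓡 n) p
  have hψ := contMDiffOn_extChartAt_symm (I := 𝓡 n) (n := ∞) p
  have h1 : ContMDiffOn 𝓘(ℝ, EuclideanSpace ℝ (Fin n)) ((𝓡 n).prod 𝓘(ℝ, Euc n →L[ℝ] Euc n →L[ℝ] ℝ)) ∞
      (fun y => Bundle.TotalSpace.mk' (Euc n →L[ℝ] Euc n →L[ℝ] ℝ)
        (E := fun x : M => TangentSpace (𝓡 n) x →L[ℝ] TangentSpace (𝓡 n) x →L[ℝ] ℝ)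
        ((extChartAt (𝓡 n) p).symm y) (g₀.inner ((extChartAt (𝓡 n) p).symm y)))
      (extChartAt (𝓡 n) p).target := g₀.contMDiff.comp_contMDiffOn hψ
  have h2 : ∀ k : Fin n, ContMDiffOn 𝓘(ℝ, EuclideanSpace ℝ (Fin n)) ((𝓡 n).prod 𝓘(ℝ, Euc n)) ∞
      (fun y => Bundle.TotalSpace.mk' (Euc n) (E := fun x : M => TangentSpace (𝓡 n) x)
        ((extChartAt (𝓡 n) p).symm y) (mfderiv 𝓘(ℝ, EuclideanSpace ℝ (Fin n)) (𝓡 n)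
          (extChartAt (𝓡 n) p).symm y (EuclideanSpace.single k (1 : ℝ) : EuclideanSpace ℝ (Fin n))))
      (extChartAt (𝓡 n) p).target := by
    intro k
    have h3 := hψ.contMDiffOn_tangentMapWithin (m := ∞) (by simp) ht.uniqueMDiffOn
    have h4 : ContMDiffOn 𝓘(ℝ, EuclideanSpace ℝ (Fin n)) 𝓘(ℝ, EuclideanSpace ℝ (Fin n)).tangent ∞
        (fun y => (⟨y, (EuclideanSpace.single k (1 : ℝ) : EuclideanSpace ℝ (Fin n))⟩ :
          TangentBundle 𝓘(ℝ, EuclideanSpace ℝ (Fin n)) (EuclideanSpace ℝ (Fin n))))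
        (extChartAt (𝓡 n) p).target :=
      contMDiffOn_vectorSpace_iff_contDiffOn.2 contDiffOn_const
    refine (h3.comp h4 fun y hy => hy).congr fun y hy => ?_
    simp only [Function.comp, tangentMapWithin]
    rw [mfderivWithin_of_isOpen ht hy]
  have h5 := h1.clm_bundle_apply₂ (F₃ := ℝ) (E₃ := Bundle.Trivial M ℝ) (h2 i) (h2 j)
  intro y hy
  have h6 := (Bundle.contMDiffWithinAt_totalSpace.1 (h5 y hy)).2
  exact contMDiffWithinAt_iff_contDiffWithinAt.1 h6

lemma isMetricOn_coeff (p : M) : IsMetricOn (extChartAt (𝓡 n) p).target (coeff g₀.inner p) where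
  isOpen := isOpen_extChartAt_target p
  smooth y hy i j := (contDiffOn_coeff g₀ p i j).contDiffAt ((isOpen_extChartAt_target p).mem_nhds hy)
  posDef y hy := by
    refine Matrix.PosDef.of_dotProduct_mulVec_pos ?_ fun w hw => ?_
    · ext i j
      simp only [Matrix.conjTranspose_apply, star_trivial]
      exact g₀.symm _ _ _
    · have e1 : star w ⬝ᵥ coeff g₀.inner p y *ᵥ w = bil g₀.inner ((extChartAt (𝓡 n) p).symm y)
          (dchart p y (∑ i, w i • EuclideanSpace.single i (1 : ℝ)))
          (dchart p y (∑ i, w i • EuclideanSpace.single i (1 : ℝ))) := by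
        rw [bil_sum, star_trivial]
        simp only [dotProduct, Matrix.mulVec, coeff_apply, Finset.mul_sum]
        exact Finset.sum_congr rfl fun i _ => Finset.sum_congr rfl fun j _ => by ring
      rw [e1]
      refine g₀.pos _ _ fun h0 => hw ?_
      have h1 : (∑ i, w i • EuclideanSpace.single i (1 : ℝ) : Euc n) = 0 :=
        dchart_injective hy (by rw [map_zero]; exact h0)
      ext k
      have := congrArg (fun x : Euc n => x k) h1
      simpa [Pi.single_apply] using this

end Metric

end

section

variable {n : ℕ}

/-! ### Locality -/

section Local

variable {D : Set (Euc n)} {G G' : Euc n → Matrix (Fin n) (Fin n) ℝ} {f f' : Euc n → ℝ} {y : Euc n}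

lemma christoffel_congr (hD : IsOpen D) (h : ∀ z ∈ D, G z = G' z) (hy : y ∈ D) (k i j : Fin n) :
    christoffel G k i j y = christoffel G' k i j y := by
  unfold christoffel
  have e : ∀ a b c, pd a (fun z => G z b c) y = pd a (fun z => G' z b c) y := fun a b c =>
    pd_congr_on hD hy a fun z hz => by rw [h z hz]
  simp only [e, h y hy]

lemma ricci_congr (hD : IsOpen D) (h : ∀ z ∈ D, G z = G' z) (hy : y ∈ D) :
    ricci G y = ricci G' y := by
  have e : ∀ a k i j, pd a (christoffel G k i j) y = pd a (christoffel G' k i j) y := fun a k i j =>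
    pd_congr_on hD hy a fun z hz => christoffel_congr hD h hz k i j
  have e2 := fun k i j => christoffel_congr hD h hy k i j
  unfold ricci
  simp only [e, e2]

lemma schouten_congr (hD : IsOpen D) (h : ∀ z ∈ D, G z = G' z) (hy : y ∈ D) :
    schouten G y = schouten G' y := by
  simp only [schouten, scalarCurv, ricci_congr hD h hy, h y hy]

lemma hessian_congr (hD : IsOpen D) (h : ∀ z ∈ D, G z = G' z) (hf : ∀ z ∈ D, f z = f' z) (hy : y ∈ D) :
    hessian G f y = hessian G' f' y := by
  have e1 : ∀ i, ∀ z ∈ D, pd i f z = pd i f' z := fun i z hz => pd_congr_on hD hz i hf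
  ext i j
  simp only [hessian, Matrix.of_apply, christoffel_congr hD h hy, e1 _ y hy]
  rw [pd_congr_on hD hy i (e1 j)]

lemma grad_congr (hD : IsOpen D) (hf : ∀ z ∈ D, f z = f' z) (hy : y ∈ D) : grad f y = grad f' y :=
  funext fun i => pd_congr_on hD hy i hf

lemma gradSq_congr (hD : IsOpen D) (h : ∀ z ∈ D, G z = G' z) (hf : ∀ z ∈ D, f z = f' z) (hy : y ∈ D) :
    gradSq G f y = gradSq G' f' y := by
  simp only [gradSq, grad_congr hD hf hy, h y hy]

lemma Wmat_congr (hD : IsOpen D) (h : ∀ z ∈ D, G z = G' z) (hf : ∀ z ∈ D, f z = f' z) (hy : y ∈ D) :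
    Wmat G f y = Wmat G' f' y := by
  simp only [Wmat, schouten_congr hD h hy, hessian_congr hD h hf hy, gradSq_congr hD h hf hy,
    grad_congr hD hf hy, h y hy]

lemma quadBar_congr (hD : IsOpen D) (h : ∀ z ∈ D, G z = G' z) (hf : ∀ z ∈ D, f z = f' z) (hy : y ∈ D)
    (c : ℝ) (w : Fin n → ℝ) : quadBar G c f y w = quadBar G' c f' y w := by
  simp only [quadBar, hessian_congr hD h hf hy, gradSq_congr hD h hf hy, h y hy]

end Local

/-! ### Invariance under changes of charts -/

variable {M : Type*} [TopologicalSpace M] [ChartedSpace (EuclideanSpace ℝ (Fin n)) M]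

/-- Smoothness of a function on a manifold, tested in charts. -/
def SmoothInCharts (v : M → ℝ) : Prop :=
  ∀ p : M, ∀ y ∈ (extChartAt (𝓡 n) p).target, ContDiffAt ℝ ∞ (inChart p v : Euc n → ℝ) y

/-- The first elementary symmetric function of `W` in a chart. -/
def s1 (g : BilinField n M) (v : M → ℝ) (p : M) (y : Euc n) : ℝ :=
  sigma1 ((coeff g p y)⁻¹ * Wmat (coeff g p) (inChart p v) y)

/-- The second elementary symmetric function of `W` in a chart. -/
def s2 (g : BilinField n M) (v : M → ℝ) (p : M) (y : Euc n) : ℝ :=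
  sigma2 ((coeff g p y)⁻¹ * Wmat (coeff g p) (inChart p v) y)

lemma inv_exp_smul (t : ℝ) {A : Matrix (Fin n) (Fin n) ℝ} (hA : IsUnit A.det) :
    (Real.exp (-2 * t) • A)⁻¹ = Real.exp (2 * t) • A⁻¹ := by
  refine Matrix.inv_eq_right_inv ?_
  rw [Matrix.smul_mul, Matrix.mul_smul, smul_smul, ← Real.exp_add, Matrix.mul_nonsing_inv _ hA]
  simp

variable [IsManifold (𝓡 n) ∞ M]

section Metric

variable (g₀ : Bundle.ContMDiffRiemannianMetric (𝓡 n) ∞ (EuclideanSpace ℝ (Fin n))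
  (fun x : M => TangentSpace (𝓡 n) x)) {v : M → ℝ}

/-- The quadratic form is intrinsic: a bound checked at a point in one chart holds in every chart
containing that point. -/
lemma quadBar_transition (hv : SmoothInCharts (n := n) v) {p q : M} {y : Euc n} (hy : y ∈ overlap p q)
    (c : ℝ) (w : Fin n → ℝ) :
    quadBar (coeff g₀.inner p) c (inChart p v) y w
      = quadBar (coeff g₀.inner q) c (inChart q v) (transition p q y) (jac (transition p q) y *ᵥ w) := by
  rw [← quadBar_pull (isMetricOn_coeff g₀ q) (isChange_transition p q) hy (hv q)]
  exact quadBar_congr (isOpen_overlap p q) (fun z hz => coeff_transition g₀.inner hz)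
    (fun z hz => inChart_transition v hz) hy c w

lemma s_transition (hv : SmoothInCharts (n := n) v) {p q : M} {y : Euc n} (hy : y ∈ overlap p q) :
    s1 g₀.inner v p y = s1 g₀.inner v q (transition p q y) ∧
      s2 g₀.inner v p y = s2 g₀.inner v q (transition p q y) := by
  have h := sigma_pull (isMetricOn_coeff g₀ q) (isChange_transition p q) hy (hv q)
  have e : Wmat (pullM (transition p q) (coeff g₀.inner q)) (fun z => inChart q v (transition p q z)) y
      = Wmat (coeff g₀.inner p) (inChart p v) y :=
    (Wmat_congr (isOpen_overlap p q) (fun z hz => coeff_transition g₀.inner hz)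
      (fun z hz => inChart_transition v hz) hy).symm
  rw [e, ← coeff_transition g₀.inner hy] at h
  exact h

/-- The curvature scalars are defined in the chart centred at the point itself. Invariance under
transitions allows them to be read in any fixed chart, and inverting `e^{-2v} g₀` contributes one
factor `e^{2v}` per index raised. -/
lemma sig_conformal (hn : 2 < n) (hv : SmoothInCharts (n := n) v) {p : M} {y : Euc n}
    (hy : y ∈ (extChartAt (𝓡 n) p).target) :
    sig1 (conformal g₀.inner v) ((extChartAt (𝓡 n) p).symm y)
        = Real.exp (2 * inChart p v y) * s1 g₀.inner v p y ∧
      sig2 (conformal g₀.inner v) ((extChartAt (𝓡 n) p).symm y)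
        = Real.exp (2 * inChart p v y) ^ 2 * s2 g₀.inner v p y := by
  set x := (extChartAt (𝓡 n) p).symm y with hx
  have ho : y ∈ (overlap p x : Set (Euc n)) := ⟨hy, mem_extChartAt_source (I := 𝓡 n) x⟩
  have ht : transition p x y = extChartAt (𝓡 n) x x := rfl
  obtain ⟨e1, e2⟩ := s_transition g₀ hv ho
  rw [e1, e2, ht, inChart_transition v ho, ht]
  set z := extChartAt (𝓡 n) x x with hz
  have hzt : z ∈ (extChartAt (𝓡 n) x).target := mem_extChartAt_target x
  have e3 : schoutenEndo (conformal g₀.inner v) x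
      = Real.exp (2 * inChart x v z) • ((coeff g₀.inner x z)⁻¹ * Wmat (coeff g₀.inner x) (inChart x v) z) := by
    rw [schoutenEndo, coeff_conformal, ← hz, schouten_confM hn (isMetricOn_coeff g₀ x) (hv x) hzt, confM,
      inv_exp_smul _ ((isMetricOn_coeff g₀ x).isUnit_det hzt), Matrix.smul_mul]
  simp only [sig1, sig2, e3, s1, s2, sigma1, sigma2, Matrix.trace_smul, smul_eq_mul, Matrix.smul_mul,
    Matrix.mul_smul]
  exact ⟨trivial, by ring⟩

/-- The numerator scales with `e^{4v}` and the denominator with `e^{2v}`, which the prefactor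
`e^{-2v}` balances. The weight `e^{2εv}` becomes `e^{-(4-2ε)v}`, the exponent that decides the
argument for the lower bound. -/
lemma quot_eq (hn : 2 < n) (hv : SmoothInCharts (n := n) v) (ε : ℝ) [MeasurableSpace M] {p : M} {y : Euc n}
    (hy : y ∈ (extChartAt (𝓡 n) p).target) :
    quot g₀.inner ε v ((extChartAt (𝓡 n) p).symm y)
      = (s2 g₀.inner v p y - rEps g₀.inner ε v * Real.exp (-(4 - 2 * ε) * inChart p v y))
        / s1 g₀.inner v p y := by
  obtain ⟨e1, e2⟩ := sig_conformal g₀ hn hv hy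
  rw [quot, e1, e2, show v ((extChartAt (𝓡 n) p).symm y) = inChart p v y from rfl]
  set f := inChart p v y
  have h1 : Real.exp (-2 * f) = (Real.exp (2 * f))⁻¹ := by rw [← Real.exp_neg]; ring_nf
  have h2 : Real.exp (2 * ε * f) = Real.exp (2 * f) ^ 2 * Real.exp (-(4 - 2 * ε) * f) := by
    rw [pow_two, ← Real.exp_add, ← Real.exp_add]; ring_nf
  rw [h1, h2]
  have : Real.exp (2 * f) ≠ 0 := (Real.exp_pos _).ne'
  -- If the denominator vanishes, both sides are zero by the convention for division.
  by_cases h3 : s1 g₀.inner v p y = 0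
  · simp [h3]
  field_simp

end Metric

/-! ### Families of functions in charts -/

lemma jsmooth_inChart {T : ℝ} {u : ℝ → M → ℝ}
    (hu : ContMDiffOn (𝓘(ℝ, ℝ).prod (𝓡 n)) 𝓘(ℝ, ℝ) ∞ (fun q : ℝ × M => u q.1 q.2)
      (Icc 0 T ×ˢ (univ : Set M))) (p : M) :
    JSmooth (n := n) (Icc 0 T) (extChartAt (𝓡 n) p).target (fun t => inChart p (u t)) := by
  have hψ := contMDiffOn_extChartAt_symm (I := 𝓡 n) (n := ∞) p
  have h1 : ContMDiffOn 𝓘(ℝ, ℝ × Euc n) (𝓘(ℝ, ℝ).prod (𝓡 n)) ∞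
      (fun q : ℝ × Euc n => (q.1, (extChartAt (𝓡 n) p).symm q.2))
      (Icc 0 T ×ˢ (extChartAt (𝓡 n) p).target) := by
    refine ContMDiffOn.prodMk ?_ ?_
    · exact contMDiffOn_iff_contDiffOn.2 contDiffOn_fst
    · refine hψ.comp (contMDiffOn_iff_contDiffOn.2 contDiffOn_snd) fun q hq => hq.2
  have h2 := hu.comp h1 fun q hq => ⟨hq.1, mem_univ _⟩
  exact contMDiffOn_iff_contDiffOn.1 h2

end

section

variable {n : ℕ} {M : Type*} [TopologicalSpace M] [ChartedSpace (EuclideanSpace ℝ (Fin n)) M]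

/-! ### The Riemannian volume -/

/-- The volume density in a chart. -/
def density (g : BilinField n M) (p : M) (y : Euc n) : ℝ := Real.sqrt (coeff g p y).det

/-- The volume measure of a chart. -/
def chartVol [MeasurableSpace M] (g : BilinField n M) (p : M) : Measure M :=
  Measure.map (extChartAt (𝓡 n) p).symm
    ((volume.restrict (extChartAt (𝓡 n) p).target).withDensity fun y => ENNReal.ofReal (density g p y))

lemma vol_eq_iSup [MeasurableSpace M] (g : BilinField n M) : vol g = ⨆ p : M, chartVol g p := rfl

/-- Continuity of the volume density in all charts. -/
def ContDensity (g : BilinField n M) : Prop :=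
  ∀ p : M, ContinuousOn (density g p) (extChartAt (𝓡 n) p).target

lemma density_nonneg (g : BilinField n M) (p : M) (y : Euc n) : 0 ≤ density g p y := Real.sqrt_nonneg _

section Measurable

lemma measurableSet_target (p : M) : MeasurableSet (extChartAt (𝓡 n) p).target :=
  (isOpen_extChartAt_target p).measurableSet

lemma aemeasurable_density {g : BilinField n M} (hg : ContDensity g) (p : M) :
    AEMeasurable (fun y => ENNReal.ofReal (density g p y))
      (volume.restrict (extChartAt (𝓡 n) p).target) :=
  ((hg p).aemeasurable (measurableSet_target p)).ennreal_ofReal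

lemma density_transition [IsManifold (𝓡 n) ∞ M] (g : BilinField n M) {p q : M} {y : Euc n}
    (hy : y ∈ overlap p q) :
    density g p y = |(jac (transition p q) y).det| * density g q (transition p q y) := by
  rw [density, coeff_transition g hy, pullM, Matrix.det_mul, Matrix.det_mul, Matrix.det_transpose,
    show (jac (transition p q) y).det * (coeff g q (transition p q y)).det * (jac (transition p q) y).det
      = (jac (transition p q) y).det ^ 2 * (coeff g q (transition p q y)).det by ring,
    Real.sqrt_mul (sq_nonneg _), Real.sqrt_sq_eq_abs]
  rfl

variable [MeasurableSpace M] [BorelSpace M] {g : BilinField n M}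

lemma measurableSet_source (p : M) : MeasurableSet (extChartAt (𝓡 n) p).source :=
  (isOpen_extChartAt_source p).measurableSet

lemma aemeasurable_symm (p : M) : AEMeasurable (extChartAt (𝓡 n) p).symm
    (volume.restrict (extChartAt (𝓡 n) p).target) :=
  (continuousOn_extChartAt_symm p).aemeasurable (measurableSet_target p)

lemma measurableSet_inter_preimage (p : M) {A : Set M} (hA : MeasurableSet A) :
    MeasurableSet ((extChartAt (𝓡 n) p).target ∩ (extChartAt (𝓡 n) p).symm ⁻¹' A) := by
  have h1 : Measurable ((extChartAt (𝓡 n) p).target.domRestrict (extChartAt (𝓡 n) p).symm) :=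
    (continuousOn_iff_continuous_domRestrict.1 (continuousOn_extChartAt_symm p)).measurable
  have h2 := (MeasurableEmbedding.subtype_coe (measurableSet_target (n := n) p)).measurableSet_image.2 (h1 hA)
  convert h2 using 1
  ext y
  simp only [mem_inter_iff, mem_preimage, mem_image, Subtype.exists, exists_and_right, exists_eq_right]
  exact ⟨fun h => ⟨h.1, h.2⟩, fun ⟨h, h'⟩ => ⟨h, h'⟩⟩

lemma lintegral_chartVol (hg : ContDensity g) (p : M) {F : M → ℝ≥0∞} (hF : Measurable F) :
    ∫⁻ x, F x ∂(chartVol g p) = ∫⁻ y in (extChartAt (𝓡 n) p).target,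
      ENNReal.ofReal (density g p y) * F ((extChartAt (𝓡 n) p).symm y) := by
  have hψ := aemeasurable_symm (n := n) p
  rw [chartVol, lintegral_map' hF.aemeasurable (hψ.mono_ac (withDensity_absolutelyContinuous _ _))]
  exact lintegral_withDensity_eq_lintegral_mul₀ (aemeasurable_density hg p) (hF.comp_aemeasurable hψ)

lemma chartVol_apply (hg : ContDensity g) (p : M) {A : Set M} (hA : MeasurableSet A) :
    chartVol g p A = ∫⁻ y in (extChartAt (𝓡 n) p).target ∩ (extChartAt (𝓡 n) p).symm ⁻¹' A,
      ENNReal.ofReal (density g p y) := by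
  rw [← lintegral_indicator_one hA, lintegral_chartVol hg p (measurable_one.indicator hA)]
  rw [← inter_eq_left.2 (inter_subset_left : (extChartAt (𝓡 n) p).target ∩ (extChartAt (𝓡 n) p).symm ⁻¹' A
    ⊆ (extChartAt (𝓡 n) p).target), ← setLIntegral_indicator (measurableSet_inter_preimage p hA)]
  refine setLIntegral_congr_fun (measurableSet_target p) fun y hy => ?_
  by_cases h2 : (extChartAt (𝓡 n) p).symm y ∈ A
  · simp only [indicator, h2, mem_inter_iff, mem_preimage, hy, and_self, if_true, Pi.one_apply, mul_one]
  · simp only [indicator, h2, mem_inter_iff, mem_preimage, hy, and_false, if_false, mul_zero]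

lemma chartVol_compl_source (hg : ContDensity g) (p : M) : chartVol g p (extChartAt (𝓡 n) p).sourceᶜ = 0 := by
  rw [chartVol_apply hg p (measurableSet_source p).compl]
  have : (extChartAt (𝓡 n) p).target ∩ (extChartAt (𝓡 n) p).symm ⁻¹' (extChartAt (𝓡 n) p).sourceᶜ = ∅ := by
    ext y
    simp only [mem_inter_iff, mem_preimage, mem_compl_iff, mem_empty_iff_false, iff_false, not_and, not_not]
    exact fun h => (extChartAt (𝓡 n) p).map_target h
  rw [this]; simp

lemma det_fderiv_eq (Φ : Euc n → Euc n) {y : Euc n} (h : DifferentiableAt ℝ Φ y) :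
    (fderiv ℝ Φ y).det = (jac Φ y).det := by
  have e : LinearMap.toMatrix (EuclideanSpace.basisFun (Fin n) ℝ).toBasis
      (EuclideanSpace.basisFun (Fin n) ℝ).toBasis (fderiv ℝ Φ y : Euc n →ₗ[ℝ] Euc n) = jac Φ y := by
    ext i a
    rw [LinearMap.toMatrix_apply]
    simp only [OrthonormalBasis.coe_toBasis, EuclideanSpace.basisFun_apply, ContinuousLinearMap.coe_coe,
      fderiv_single_eq_sum h]
    simp
  rw [← e, LinearMap.det_toMatrix]

/-- Change of variables: the Jacobian determinant of the transition is exactly the quotient of the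
two densities. -/
lemma chartVol_eq_of_subset [IsManifold (𝓡 n) ∞ M] (hg : ContDensity g) {p q : M} {A : Set M}
    (hA : MeasurableSet A) (hp : A ⊆ (extChartAt (𝓡 n) p).source) (hq : A ⊆ (extChartAt (𝓡 n) q).source) :
    chartVol g p A = chartVol g q A := by
  set S := (extChartAt (𝓡 n) p).target ∩ (extChartAt (𝓡 n) p).symm ⁻¹' A with hS
  have hSo : S ⊆ (overlap p q : Set (Euc n)) := fun y hy => ⟨hy.1, hq hy.2⟩
  have himg : transition p q '' S = (extChartAt (𝓡 n) q).target ∩ (extChartAt (𝓡 n) q).symm ⁻¹' A := by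
    ext z
    constructor
    · rintro ⟨y, hy, rfl⟩
      exact ⟨transition_mem (hSo hy), by rw [mem_preimage, symm_transition (hSo hy)]; exact hy.2⟩
    · rintro ⟨hz, hzA⟩
      have ho : z ∈ (overlap q p : Set (Euc n)) := ⟨hz, hp hzA⟩
      exact ⟨transition q p z, ⟨transition_mem ho, by rw [mem_preimage, symm_transition ho]; exact hzA⟩,
        transition_transition ho⟩
  have hd : ∀ y ∈ S, HasFDerivWithinAt (transition p q) (fderiv ℝ (transition p q) y) S y := fun y hy =>
    ((contDiffAt_transition (hSo hy)).differentiableAt (by simp)).hasFDerivAt.hasFDerivWithinAt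
  have hinj : InjOn (transition p q) S := fun y hy z hz h => by
    rw [← transition_transition (hSo hy), h, transition_transition (hSo hz)]
  rw [chartVol_apply hg p hA, chartVol_apply hg q hA, ← himg,
    lintegral_image_eq_lintegral_abs_det_fderiv_mul volume (measurableSet_inter_preimage p hA) hd hinj]
  refine setLIntegral_congr_fun (measurableSet_inter_preimage p hA) fun y hy => ?_
  show _ = _ * _
  rw [det_fderiv_eq _ ((contDiffAt_transition (hSo hy)).differentiableAt (by simp)),
    density_transition g (hSo hy), ENNReal.ofReal_mul (abs_nonneg _)]

/-- On the domain of one chart its measure dominates those of all other charts. Hence that measure,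
plus the volume restricted to the complement, is an upper bound of the family, so it dominates the
supremum. -/
lemma vol_restrict_source [IsManifold (𝓡 n) ∞ M] (hg : ContDensity g) (p : M) :
    (vol g).restrict (extChartAt (𝓡 n) p).source = chartVol g p := by
  have hs := measurableSet_source (n := n) p
  have h1 : ∀ A, MeasurableSet A → A ⊆ (extChartAt (𝓡 n) p).source → ∀ q, chartVol g q A ≤ chartVol g p A := by
    intro A hA hAp q
    have hB := hA.inter (measurableSet_source (n := n) q)
    calc chartVol g q A = chartVol g q (A ∩ (extChartAt (𝓡 n) q).source) := by
          rw [measure_inter_conull (chartVol_compl_source hg q)]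
      _ = chartVol g p (A ∩ (extChartAt (𝓡 n) q).source) :=
          chartVol_eq_of_subset hg hB inter_subset_right (inter_subset_left.trans hAp)
      _ ≤ _ := measure_mono inter_subset_left
  have h2 : vol g ≤ chartVol g p + (vol g).restrict (extChartAt (𝓡 n) p).sourceᶜ := by
    conv_lhs => rw [vol_eq_iSup]
    refine iSup_le fun q => Measure.le_iff.2 fun A hA => ?_
    rw [← measure_inter_add_sdiff A hs, Measure.add_apply, Measure.restrict_apply hA, sdiff_eq]
    refine add_le_add ((h1 _ (hA.inter hs) inter_subset_right q).trans (measure_mono inter_subset_left)) ?_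
    exact le_iSup (chartVol g) q _
  refine le_antisymm (Measure.le_iff.2 fun A hA => ?_) (Measure.le_iff.2 fun A hA => ?_)
  · rw [Measure.restrict_apply hA]
    refine (h2 _).trans ?_
    rw [Measure.add_apply, Measure.restrict_apply (hA.inter hs)]
    have : A ∩ (extChartAt (𝓡 n) p).source ∩ (extChartAt (𝓡 n) p).sourceᶜ = ∅ := by
      rw [inter_assoc, inter_compl_self, inter_empty]
    rw [this, measure_empty, add_zero]
    exact measure_mono inter_subset_left
  · rw [Measure.restrict_apply hA, ← measure_inter_conull (s := A) (t := (extChartAt (𝓡 n) p).source)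
      (chartVol_compl_source hg p)]
    exact le_iSup (chartVol g) p _

end Measurable

end

section

variable {n : ℕ} {M : Type*} [TopologicalSpace M] [ChartedSpace (EuclideanSpace ℝ (Fin n)) M]

/-! ### Conformal change of the volume -/

lemma continuous_of_inChart {v : M → ℝ}
    (hv : ∀ p : M, ∀ y ∈ (extChartAt (𝓡 n) p).target, ContinuousAt (inChart p v : Euc n → ℝ) y) :
    Continuous v := by
  refine continuous_iff_continuousAt.2 fun x => ?_
  have h1 := hv x _ (mem_extChartAt_target x)
  have h2 : ContinuousAt (fun z => inChart x v (extChartAt (𝓡 n) x z)) x :=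
    ContinuousAt.comp (f := extChartAt (𝓡 n) x) h1 (continuousAt_extChartAt x)
  refine h2.congr ?_
  filter_upwards [extChartAt_source_mem_nhds (I := 𝓡 n) x] with z hz
  simp only [inChart, (extChartAt (𝓡 n) x).left_inv hz]

lemma SmoothInCharts.continuous {v : M → ℝ} (hv : SmoothInCharts (n := n) v) : Continuous v :=
  continuous_of_inChart fun p y hy => (hv p y hy).continuousAt

lemma density_conformal (g : BilinField n M) (v : M → ℝ) (p : M) (y : Euc n) :
    density (conformal g v) p y = Real.exp (-n * inChart p v y) * density g p y := by
  have h : Real.exp (-2 * inChart p v y) ^ n = Real.exp (-n * inChart p v y) ^ 2 := by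
    rw [← Real.exp_nat_mul, ← Real.exp_nat_mul]; congr 1; push_cast; ring
  rw [density, coeff_conformal, confM, Matrix.det_smul, Fintype.card_fin, h, Real.sqrt_mul (sq_nonneg _),
    Real.sqrt_sq (Real.exp_pos _).le]
  rfl

lemma ContDensity.conformal {g : BilinField n M} (hg : ContDensity g) {v : M → ℝ} (hv : Continuous v) :
    ContDensity (conformal g v) := by
  intro p
  rw [show density (SigmaTwoFlow.conformal g v) p = _ from funext (density_conformal g v p)]
  refine ContinuousOn.mul ?_ (hg p)
  exact Real.continuous_exp.comp_continuousOn (continuousOn_const.mul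
    (hv.comp_continuousOn (continuousOn_extChartAt_symm p)))

lemma contDensity_metric [IsManifold (𝓡 n) ∞ M] (g₀ : Bundle.ContMDiffRiemannianMetric (𝓡 n) ∞
    (EuclideanSpace ℝ (Fin n)) (fun x : M => TangentSpace (𝓡 n) x)) : ContDensity g₀.inner := by
  intro p
  have h : ContinuousOn (coeff g₀.inner p) (extChartAt (𝓡 n) p).target :=
    continuousOn_pi.2 fun i => continuousOn_pi.2 fun j => (contDiffOn_coeff g₀ p i j).continuousOn
  exact Real.continuous_sqrt.comp_continuousOn ((continuous_id.matrix_det).comp_continuousOn h)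

lemma density_pos [IsManifold (𝓡 n) ∞ M] (g₀ : Bundle.ContMDiffRiemannianMetric (𝓡 n) ∞
    (EuclideanSpace ℝ (Fin n)) (fun x : M => TangentSpace (𝓡 n) x)) {p : M} {y : Euc n}
    (hy : y ∈ (extChartAt (𝓡 n) p).target) : 0 < density g₀.inner p y :=
  Real.sqrt_pos.2 ((isMetricOn_coeff g₀ p).posDef y hy).det_pos

lemma exists_finite_sources [CompactSpace M] :
    ∃ S : Finset M, ⋃ p ∈ S, (extChartAt (𝓡 n) p).source = univ := by
  obtain ⟨S, hS⟩ := CompactSpace.elim_nhds_subcover (fun p : M => (extChartAt (𝓡 n) p).source)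
    fun p => extChartAt_source_mem_nhds (I := 𝓡 n) p
  exact ⟨S, hS⟩

section Measurable

variable [IsManifold (𝓡 n) ∞ M] [MeasurableSpace M] [BorelSpace M] {g : BilinField n M}

/-- By compactness finitely many chart domains cover, and two measures that agree on each of
countably many covering sets are equal. In a chart the density acquires the factor `e^{-nv}`. -/
lemma vol_conformal [CompactSpace M] (hg : ContDensity g) {v : M → ℝ} (hv : Continuous v) :
    vol (conformal g v) = (vol g).withDensity fun x => ENNReal.ofReal (Real.exp (-n * v x)) := by
  obtain ⟨S, hS⟩ := exists_finite_sources (n := n) (M := M)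
  have hm : Measurable fun x => ENNReal.ofReal (Real.exp (-n * v x)) :=
    ((Real.continuous_exp.comp (continuous_const.mul hv)).measurable).ennreal_ofReal
  refine Measure.ext_of_biUnion_eq_univ (S := (S : Set M)) (s := fun p => (extChartAt (𝓡 n) p).source)
    S.countable_toSet (by simpa using hS) fun p _ => ?_
  rw [restrict_withDensity (measurableSet_source p), vol_restrict_source hg,
    vol_restrict_source (hg.conformal hv)]
  ext A hA
  rw [withDensity_apply _ hA, ← lintegral_indicator hA, lintegral_chartVol hg p (hm.indicator hA),
    ← lintegral_indicator_one hA, lintegral_chartVol (hg.conformal hv) p (measurable_one.indicator hA)]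
  refine lintegral_congr fun y => ?_
  rw [density_conformal, ENNReal.ofReal_mul (Real.exp_pos _).le]
  by_cases h : (extChartAt (𝓡 n) p).symm y ∈ A
  · simp only [indicator, h, if_true, Pi.one_apply, mul_one]
    rw [mul_comm]; rfl
  · simp only [indicator, h, if_false, mul_zero]

/-- Each point has a neighbourhood whose coordinate image lies in a compact set, where the
continuous density is integrable. Compactness of the manifold does the rest. -/
lemma isFiniteMeasure_vol [CompactSpace M] (hg : ContDensity g) : IsFiniteMeasure (vol g) := by
  have : IsLocallyFiniteMeasure (vol g) := by
    refine ⟨fun x => ?_⟩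
    obtain ⟨K, hK, hxK, hKt⟩ := exists_compact_subset (isOpen_extChartAt_target (I := 𝓡 n) x)
      (mem_extChartAt_target x)
    set s := (extChartAt (𝓡 n) x).source ∩ extChartAt (𝓡 n) x ⁻¹' interior K
    have hs : IsOpen s := (continuousOn_extChartAt x).isOpen_inter_preimage (isOpen_extChartAt_source x)
      isOpen_interior
    refine ⟨s, hs.mem_nhds ⟨mem_extChartAt_source x, hxK⟩, ?_⟩
    have h1 : vol g s = chartVol g x s := by
      rw [← vol_restrict_source hg, Measure.restrict_apply hs.measurableSet,
        inter_eq_left.2 inter_subset_left]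
    rw [h1, chartVol_apply hg x hs.measurableSet]
    have h2 : (extChartAt (𝓡 n) x).target ∩ (extChartAt (𝓡 n) x).symm ⁻¹' s ⊆ K := by
      rintro y ⟨hy, hys⟩
      have := hys.2
      rw [mem_preimage, (extChartAt (𝓡 n) x).right_inv hy] at this
      exact interior_subset this
    exact (lintegral_mono_set h2).trans_lt (((hg x).mono hKt).integrableOn_compact hK).lintegral_lt_top
  exact CompactSpace.isFiniteMeasure

/-- Integration in a chart. -/
lemma integral_vol_eq (hg : ContDensity g) {p : M} {f : M → ℝ} (hf : Measurable f)
    (hp : ∀ x, x ∉ (extChartAt (𝓡 n) p).source → f x = 0) :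
    ∫ x, f x ∂(vol g) = ∫ y in (extChartAt (𝓡 n) p).target,
      density g p y * f ((extChartAt (𝓡 n) p).symm y) := by
  rw [← setIntegral_eq_integral_of_forall_compl_eq_zero hp, vol_restrict_source hg, chartVol,
    integral_map ((aemeasurable_symm p).mono_ac (withDensity_absolutelyContinuous _ _))
      hf.aestronglyMeasurable,
    integral_withDensity_eq_integral_toReal_smul₀ (aemeasurable_density hg p) (by simp)]
  refine integral_congr_ae (Filter.Eventually.of_forall fun y => ?_)
  simp only [ENNReal.toReal_ofReal (density_nonneg g p y), smul_eq_mul]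

lemma integral_vol_conformal [CompactSpace M] (hg : ContDensity g) {v : M → ℝ} (hv : Continuous v)
    (f : M → ℝ) : ∫ x, f x ∂(vol (conformal g v)) = ∫ x, Real.exp (-n * v x) * f x ∂(vol g) := by
  have hm : Measurable fun x => ENNReal.ofReal (Real.exp (-n * v x)) :=
    ((Real.continuous_exp.comp (continuous_const.mul hv)).measurable).ennreal_ofReal
  rw [vol_conformal hg hv, integral_withDensity_eq_integral_toReal_smul₀ hm.aemeasurable (by simp)]
  refine integral_congr_ae (Filter.Eventually.of_forall fun y => ?_)
  simp only [ENNReal.toReal_ofReal (Real.exp_pos _).le, smul_eq_mul]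

lemma integrable_vol [CompactSpace M] (hg : ContDensity g) {f : M → ℝ} (hf : Continuous f) :
    Integrable f (vol g) := by
  have := isFiniteMeasure_vol hg
  obtain ⟨C, hC⟩ := isCompact_univ.exists_bound_of_continuousOn hf.continuousOn
  exact Integrable.of_bound hf.measurable.aestronglyMeasurable C
    (Filter.Eventually.of_forall fun x => hC x (mem_univ x))

end Measurable

end

section

variable {n : ℕ}

/-! ### The divergence theorem for the Newton tensor -/

lemma hessian_sum {ι : Type*} {s : Finset ι} {G : Euc n → Matrix (Fin n) (Fin n) ℝ} {f : ι → Euc n → ℝ}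
    {D : Set (Euc n)} (hD : IsOpen D) {y : Euc n} (hy : y ∈ D)
    (hf : ∀ a ∈ s, ∀ z ∈ D, ContDiffAt ℝ ∞ (f a) z) :
    hessian G (fun z => ∑ a ∈ s, f a z) y = ∑ a ∈ s, hessian G (f a) y := by
  have e : ∀ j, ∀ z ∈ D, pd j (fun z => ∑ a ∈ s, f a z) z = ∑ a ∈ s, pd j (f a) z := fun j z hz =>
    pd_sum j fun a ha => (hf a ha z hz).smooth_differentiableAt
  ext i j
  simp only [hessian, Matrix.of_apply, Matrix.sum_apply, e _ y hy]
  rw [pd_congr_on hD hy i (e j), pd_sum i fun a ha => (contDiffAt_pd j (hf a ha y hy)).smooth_differentiableAt,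
    Finset.sum_sub_distrib, Finset.sum_comm]
  simp only [Finset.mul_sum]

lemma hessian_zero (G : Euc n → Matrix (Fin n) (Fin n) ℝ) (y : Euc n) : hessian G (fun _ => 0) y = 0 := by
  have e : ∀ j, pd j (fun _ : Euc n => (0 : ℝ)) = fun _ => 0 := fun j => funext fun z => pd_const j 0 z
  ext i j
  simp [hessian, e]

variable {M : Type*} [TopologicalSpace M] [ChartedSpace (EuclideanSpace ℝ (Fin n)) M]

/-- The contraction of the Newton tensor with a Hessian, in a chart. -/
def newtonHessIn (g : BilinField n M) (η : M → ℝ) (p : M) (y : Euc n) : ℝ :=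
  (newton (coeff g p y) (schouten (coeff g p) y) * hessian (coeff g p) (inChart p η) y).trace

/-- The contraction of the Newton tensor with a Hessian. -/
def newtonHess (g : BilinField n M) (η : M → ℝ) (x : M) : ℝ := newtonHessIn g η x (extChartAt (𝓡 n) x x)

/-- All coefficient matrices of `g` are smooth and positive definite. -/
def IsMetric (g : BilinField n M) : Prop := ∀ p, IsMetricOn (extChartAt (𝓡 n) p).target (coeff g p)

lemma IsMetric.contDensity {g : BilinField n M} (hg : IsMetric g) : ContDensity g := by
  intro p
  have h : ContinuousOn (coeff g p) (extChartAt (𝓡 n) p).target :=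
    continuousOn_pi.2 fun i => continuousOn_pi.2 fun j => fun y hy =>
      ((hg p).smooth y hy i j).continuousAt.continuousWithinAt
  exact Real.continuous_sqrt.comp_continuousOn ((continuous_id.matrix_det).comp_continuousOn h)

lemma IsMetric.conformal {g : BilinField n M} (hg : IsMetric g) {v : M → ℝ} (hv : SmoothInCharts (n := n) v) :
    IsMetric (conformal g v) := by
  intro p
  rw [coeff_conformal]
  exact (hg p).conf (hv p)

lemma newtonHessIn_zero (g : BilinField n M) {η : M → ℝ} {p : M} {y : Euc n}
    {D : Set (Euc n)} (hD : IsOpen D) (hy : y ∈ D) (h : ∀ z ∈ D, inChart p η z = 0) :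
    newtonHessIn g η p y = 0 := by
  rw [newtonHessIn, hessian_congr (f' := fun _ => 0) hD (fun z _ => rfl) h hy, hessian_zero, mul_zero,
    Matrix.trace_zero]

section

variable {g : BilinField n M} {η : M → ℝ}

lemma contDiffAt_newtonHessIn (hg : IsMetric g) (hη : SmoothInCharts (n := n) η)
    {p : M} {y : Euc n} (hy : y ∈ (extChartAt (𝓡 n) p).target) :
    ContDiffAt ℝ ∞ (newtonHessIn g η p) y :=
  contDiffAt_trace (contDiffAt_matrix_mul (contDiffAt_newton (hg p) hy)
    (contDiffAt_hessian (hg p) hy (hη p y hy)))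

variable [IsManifold (𝓡 n) ∞ M]

lemma newtonHessIn_transition (hg : IsMetric g) (hη : SmoothInCharts (n := n) η)
    {p q : M} {y : Euc n} (hy : y ∈ overlap p q) :
    newtonHessIn g η p y = newtonHessIn g η q (transition p q y) := by
  have hΦ := isChange_transition (n := n) p q
  have hJ := hΦ.isUnit_det hy
  have hJt : IsUnit ((jac (transition p q) y)ᵀ).det := by rwa [Matrix.det_transpose]
  have e : ∀ z ∈ overlap p q, coeff g p z = pullM (transition p q) (coeff g q) z := fun z hz =>
    coeff_transition g hz
  rw [newtonHessIn, hessian_congr (isOpen_overlap p q) e (fun z hz => inChart_transition η hz) hy,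
    schouten_congr (isOpen_overlap p q) e hy, e y hy, schouten_pull (hg q) hΦ hy,
    hessian_pull (hg q) hΦ hy (hη q), newton_pull hΦ hy, newtonHessIn,
    ← trace_conj hJ (newton _ _ * hessian _ (inChart q η) _)]
  congr 1
  simp only [← Matrix.mul_assoc]
  rw [Matrix.mul_assoc _ ((jac (transition p q) y)ᵀ)⁻¹, Matrix.nonsing_inv_mul _ hJt, Matrix.mul_one]

lemma inChart_newtonHess (hg : IsMetric g) (hη : SmoothInCharts (n := n) η)
    {p : M} {y : Euc n} (hy : y ∈ (extChartAt (𝓡 n) p).target) :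
    inChart p (newtonHess g η) y = newtonHessIn g η p y := by
  have ho : y ∈ (overlap p ((extChartAt (𝓡 n) p).symm y) : Set (Euc n)) :=
    ⟨hy, mem_extChartAt_source (I := 𝓡 n) _⟩
  rw [newtonHessIn_transition hg hη ho]
  rfl

lemma continuous_newtonHess (hg : IsMetric g) (hη : SmoothInCharts (n := n) η)
    : Continuous (newtonHess g η) := by
  refine continuous_of_inChart (n := n) fun p y hy => ?_
  refine (contDiffAt_newtonHessIn hg hη hy).continuousAt.congr ?_
  filter_upwards [(isOpen_extChartAt_target p).mem_nhds hy] with z hz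
  exact (inChart_newtonHess hg hη hz).symm

/-- The divergence theorem for functions with support in a chart. -/
lemma integral_newtonHess_of_tsupport (hg : IsMetric g) (hη : SmoothInCharts (n := n) η)
    (hn : 2 < n) [T2Space M] [CompactSpace M] [MeasurableSpace M]
    [BorelSpace M] {p : M}
    (hs : tsupport η ⊆ (extChartAt (𝓡 n) p).source) : ∫ x, newtonHess g η x ∂(vol g) = 0 := by
  have hz : ∀ x, x ∉ tsupport η → newtonHess g η x = 0 := by
    intro x hx
    have hD : IsOpen ((extChartAt (𝓡 n) x).target ∩ (extChartAt (𝓡 n) x).symm ⁻¹' (tsupport η)ᶜ) :=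
      (continuousOn_extChartAt_symm x).isOpen_inter_preimage (isOpen_extChartAt_target x)
        (isClosed_tsupport η).isOpen_compl
    refine newtonHessIn_zero g hD ⟨mem_extChartAt_target x, ?_⟩ fun z hz => ?_
    · rw [mem_preimage, extChartAt_to_inv]; exact hx
    · exact image_eq_zero_of_notMem_tsupport (f := η) hz.2
  set K := extChartAt (𝓡 n) p '' tsupport η with hK
  have hKc : IsCompact K := (isClosed_tsupport η).isCompact.image_of_continuousOn
    ((continuousOn_extChartAt p).mono hs)
  have hKt : K ⊆ (extChartAt (𝓡 n) p).target := by
    rintro _ ⟨x, hx, rfl⟩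
    exact (extChartAt (𝓡 n) p).map_source (hs hx)
  -- Extension by zero is smooth on the whole coordinate space, because the image of the support is
  -- compact inside the open target of the chart.
  set f : Euc n → ℝ := (extChartAt (𝓡 n) p).target.indicator (inChart p η) with hf
  have hf0 : ∀ y, y ∉ K → f y = 0 := by
    intro y hy
    by_cases h : y ∈ (extChartAt (𝓡 n) p).target
    · rw [hf, indicator_of_mem h]
      refine image_eq_zero_of_notMem_tsupport (f := η) fun h2 => hy ⟨_, h2, ?_⟩
      exact (extChartAt (𝓡 n) p).right_inv h
    · rw [hf, indicator_of_notMem h]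
  have hft : ∀ y ∈ (extChartAt (𝓡 n) p).target, f y = inChart p η y := fun y hy => indicator_of_mem hy _
  have hfc : ContDiff ℝ ∞ f := by
    refine contDiff_iff_contDiffAt.2 fun y => ?_
    by_cases h : y ∈ (extChartAt (𝓡 n) p).target
    · refine (hη p y h).congr_of_eventuallyEq ?_
      filter_upwards [(isOpen_extChartAt_target p).mem_nhds h] with z hz using hft z hz
    · refine (contDiffAt_const (c := (0 : ℝ))).congr_of_eventuallyEq ?_
      filter_upwards [hKc.isClosed.isOpen_compl.mem_nhds fun h2 => h (hKt h2)] with z hz using hf0 z hz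
  have hsupp : tsupport f ⊆ K := closure_minimal (fun y hy => by
    by_contra h
    exact hy (hf0 y h)) hKc.isClosed
  have hcs : HasCompactSupport f := hKc.of_isClosed_subset (isClosed_tsupport f) hsupp
  rw [integral_vol_eq hg.contDensity (continuous_newtonHess hg hη).measurable
      (p := p) (fun x hx => hz x fun h => hx (hs h)),
    ← integral_newton_hessian hn (hg p) hfc hcs (hsupp.trans hKt)]
  symm
  rw [← setIntegral_eq_integral_of_forall_compl_eq_zero (s := (extChartAt (𝓡 n) p).target)]
  · refine setIntegral_congr_fun (measurableSet_target p) fun y hy => ?_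
    have e := inChart_newtonHess hg hη hy
    rw [inChart] at e
    simp only [e, density, newtonHessIn]
    rw [hessian_congr (isOpen_extChartAt_target p) (fun z _ => rfl) hft hy]
  · intro y hy
    rw [hessian_congr (f' := fun _ => 0) hKc.isClosed.isOpen_compl (fun z _ => rfl) hf0 fun h => hy (hKt h),
      hessian_zero, mul_zero, Matrix.trace_zero, mul_zero]

end

lemma smoothInCharts_of_contMDiff [IsManifold (𝓡 n) ∞ M] {v : M → ℝ} (hv : ContMDiff (𝓡 n) 𝓘(ℝ, ℝ) ∞ v) :
    SmoothInCharts (n := n) v := by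
  intro p y hy
  have h1 := hv.comp_contMDiffOn (contMDiffOn_extChartAt_symm (I := 𝓡 n) (n := ∞) p)
  exact (contMDiffOn_iff_contDiffOn.1 h1).contDiffAt ((isOpen_extChartAt_target p).mem_nhds hy)

/-- The divergence theorem for the Newton tensor. -/
theorem integral_newtonHess (hn : 2 < n) [IsManifold (𝓡 n) ∞ M] [T2Space M] [CompactSpace M]
    [MeasurableSpace M] [BorelSpace M] {g : BilinField n M} (hg : IsMetric g) {η : M → ℝ}
    (hη : SmoothInCharts (n := n) η) : ∫ x, newtonHess g η x ∂(vol g) = 0 := by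
  obtain ⟨S, hS⟩ := exists_finite_sources (n := n) (M := M)
  obtain ⟨ρ, hρ⟩ := SmoothPartitionOfUnity.exists_isSubordinate (𝓡 n) (s := (univ : Set M)) isClosed_univ
    (fun p : S => (extChartAt (𝓡 n) (p : M)).source) (fun p => isOpen_extChartAt_source _)
    (by rw [← hS, iUnion_subtype])
  have hρs : ∀ p : S, SmoothInCharts (n := n) fun x => ρ p x * η x := fun p q y hy =>
    (smoothInCharts_of_contMDiff (ρ p).contMDiff q y hy).mul (hη q y hy)
  have h1 : ∀ x, η x = ∑ p : S, ρ p x * η x := fun x => by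
    rw [← Finset.sum_mul, ← finsum_eq_sum_of_fintype, ρ.sum_eq_one (mem_univ x), one_mul]
  -- The integrand is linear in `η`, so the partition of unity reduces the claim to functions
  -- supported in one chart.
  have h2 : ∀ x, newtonHess g η x = ∑ p : S, newtonHess g (fun x => ρ p x * η x) x := by
    intro x
    have h3 : hessian (coeff g x) (inChart x η) (extChartAt (𝓡 n) x x)
        = ∑ p : S, hessian (coeff g x) (inChart x fun x => ρ p x * η x) (extChartAt (𝓡 n) x x) := by
      rw [← hessian_sum (isOpen_extChartAt_target x) (mem_extChartAt_target x) fun p _ z hz => hρs p x z hz]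
      exact hessian_congr (isOpen_extChartAt_target x) (fun z _ => rfl) (fun z _ => h1 _)
        (mem_extChartAt_target x)
    simp only [newtonHess, newtonHessIn]
    rw [h3, Finset.mul_sum, Matrix.trace_sum]
  simp only [h2]
  rw [integral_finsetSum _ fun p _ => integrable_vol hg.contDensity (continuous_newtonHess hg (hρs p))]
  refine Finset.sum_eq_zero fun p _ => integral_newtonHess_of_tsupport hg (hρs p) hn (p := (p : M)) ?_
  exact (closure_mono (Function.support_mul_subset_left _ _)).trans (hρ p)

end

section

/-! ### Integrals that depend on a parameter -/

section Parameter

variable {X : Type*} [TopologicalSpace X] {I : Set ℝ} {Θ Θ' : ℝ → X → ℝ}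

lemma continuous_of_uncurry (h : ContinuousOn (fun q : ℝ × X => Θ q.1 q.2) (I ×ˢ univ)) {t : ℝ}
    (ht : t ∈ I) : Continuous (Θ t) :=
  continuousOn_univ.1 (h.comp (f := fun x => (t, x)) (by fun_prop) fun x _ => ⟨ht, mem_univ x⟩)

variable [MeasurableSpace X] [BorelSpace X] {μ : Measure X} [CompactSpace X] [IsFiniteMeasure μ]

/-- On a compact neighbourhood of the time the derivative is bounded by a constant, which is
integrable for a finite measure and serves as the dominating function. -/
lemma hasDerivAt_integral_of_continuousOn (hI : IsOpen I)
    (h : ContinuousOn (fun q : ℝ × X => Θ q.1 q.2) (I ×ˢ univ))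
    (h' : ContinuousOn (fun q : ℝ × X => Θ' q.1 q.2) (I ×ˢ univ))
    (hd : ∀ t ∈ I, ∀ x, HasDerivAt (fun τ => Θ τ x) (Θ' t x) t) {t : ℝ} (ht : t ∈ I) :
    HasDerivAt (fun τ => ∫ x, Θ τ x ∂μ) (∫ x, Θ' t x ∂μ) t := by
  obtain ⟨δ, hδ, hδI⟩ := Metric.isOpen_iff.1 hI t ht
  have hK : Metric.closedBall t (δ / 2) ⊆ I := (Metric.closedBall_subset_ball (by linarith)).trans hδI
  obtain ⟨C, hC⟩ := ((isCompact_closedBall t (δ / 2)).prod (isCompact_univ (X := X))).exists_bound_of_continuousOn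
    (h'.mono (prod_mono_left hK))
  have hb : Metric.closedBall t (δ / 2) ∈ 𝓝 t := Metric.closedBall_mem_nhds t (by linarith)
  obtain ⟨C₀, hC₀⟩ := (isCompact_univ (X := X)).exists_bound_of_continuousOn
    (continuous_of_uncurry h ht).continuousOn
  refine (hasDerivAt_integral_of_dominated_loc_of_deriv_le (bound := fun _ => C) hb ?_ ?_ ?_ ?_
    (integrable_const C) ?_).2
  · filter_upwards [hI.mem_nhds ht] with τ hτ
    exact (continuous_of_uncurry h hτ).measurable.aestronglyMeasurable
  · exact Integrable.of_bound (continuous_of_uncurry h ht).measurable.aestronglyMeasurable C₀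
      (Eventually.of_forall fun x => hC₀ x (mem_univ x))
  · exact (continuous_of_uncurry h' ht).measurable.aestronglyMeasurable
  · exact Eventually.of_forall fun x τ hτ => hC (τ, x) ⟨hτ, mem_univ x⟩
  · exact Eventually.of_forall fun x τ hτ => hd τ (hK hτ) x

lemma continuousOn_integral_of_continuousOn (hI : IsCompact I)
    (h : ContinuousOn (fun q : ℝ × X => Θ q.1 q.2) (I ×ˢ univ)) :
    ContinuousOn (fun τ => ∫ x, Θ τ x ∂μ) I := by
  obtain ⟨C, hC⟩ := (hI.prod (isCompact_univ (X := X))).exists_bound_of_continuousOn h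
  refine continuousOn_of_dominated (bound := fun _ => C) ?_ ?_ (integrable_const C) ?_
  · exact fun t ht => (continuous_of_uncurry h ht).measurable.aestronglyMeasurable
  · exact fun t ht => Eventually.of_forall fun x => hC (t, x) ⟨ht, mem_univ x⟩
  · exact Eventually.of_forall fun x => h.comp (f := fun t => (t, x)) (by fun_prop)
      fun t ht => ⟨ht, mem_univ x⟩

end Parameter

variable {n : ℕ}

/-! ### The variation of `σ₂` -/

section Variation

variable {D : Set (Euc n)} {I : Set ℝ} {G : Euc n → Matrix (Fin n) (Fin n) ℝ} {u : ℝ → Euc n → ℝ}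

lemma IsMetricOn.jsmoothM (h : IsMetricOn D G) : JSmoothM I D (fun _ : ℝ => G) :=
  fun i j => JSmooth.of_smooth fun z hz => h.smooth z hz i j

lemma IsMetricOn.det_ne (h : IsMetricOn D G) : ∀ t ∈ I, ∀ z ∈ D, (G z).det ≠ 0 :=
  fun _ _ z hz => (h.posDef z hz).det_pos.ne'

lemma JSmooth.hessian (hu : JSmooth I D u) (h : IsMetricOn D G) (hI : UniqueDiffOn ℝ I) :
    JSmoothM I D (fun t => hessian G (u t)) :=
  JSmoothM.hessian h.jsmoothM h.det_ne hI h.isOpen hu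

lemma JSmooth.gradSq (hu : JSmooth I D u) (h : IsMetricOn D G) (hI : UniqueDiffOn ℝ I) :
    JSmooth I D (fun t => gradSq G (u t)) := by
  have e : (fun t => SigmaTwoFlow.gradSq G (u t)) = fun t z =>
    ∑ i, SigmaTwoFlow.pd i (u t) z * ∑ j, (G z)⁻¹ i j * SigmaTwoFlow.pd j (u t) z := rfl
  rw [e]
  exact JSmooth.sum fun i _ => (hu.pd hI h.isOpen i).mul
    (JSmooth.sum fun j _ => (h.jsmoothM.inv h.det_ne i j).mul (hu.pd hI h.isOpen j))

lemma JSmooth.Wmat (hu : JSmooth I D u) (h : IsMetricOn D G) (hI : UniqueDiffOn ℝ I) :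
    JSmoothM I D (fun t => Wmat G (u t)) := by
  intro i j
  simp only [Wmat_apply]
  exact (((JSmooth.of_smooth fun z hz => h.smooth_schouten hz i j).add (hu.hessian h hI i j)).add
    ((hu.pd hI h.isOpen i).mul (hu.pd hI h.isOpen j))).sub
    ((JSmooth.const _).mul ((hu.gradSq h hI).mul (h.jsmoothM i j)))

lemma hessian_confM_apply (h : IsMetricOn D G) {v : Euc n → ℝ} (hv : ∀ z ∈ D, ContDiffAt ℝ ∞ v z) {y : Euc n}
    (hy : y ∈ D) (η : Euc n → ℝ) (i j : Fin n) :
    hessian (confM v G) η y i j = hessian G η y i j + pd i v y * pd j η y + pd j v y * pd i η y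
      - (grad η y ⬝ᵥ (G y)⁻¹ *ᵥ grad v y) * G y i j := by
  have e : ∀ k, christoffel (confM v G) k i j y = christoffel G k i j y
      + (- pd i v y * (1 : Matrix (Fin n) (Fin n) ℝ) k j - pd j v y * (1 : Matrix (Fin n) (Fin n) ℝ) k i
        + G y i j * ((G y)⁻¹ *ᵥ grad v y) k) := fun k =>
    congrFun (congrFun (conn_conf h hv hy i) k) j
  simp only [hessian, Matrix.of_apply, e, add_mul, sub_mul, Finset.sum_add_distrib, Finset.sum_sub_distrib]
  have e1 : ∀ (c : ℝ) (m : Fin n), ∑ k, c * (1 : Matrix (Fin n) (Fin n) ℝ) k m * pd k η y = c * pd m η y := by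
    intro c m
    simp [Matrix.one_apply]
  have e2 : ∑ k, G y i j * ((G y)⁻¹ *ᵥ grad v y) k * pd k η y
      = (grad η y ⬝ᵥ (G y)⁻¹ *ᵥ grad v y) * G y i j := by
    simp only [dotProduct, grad, Finset.sum_mul]
    exact Finset.sum_congr rfl fun k _ => by ring
  rw [e1, e1, e2]
  ring

/-- The variation of `W` is the Hessian of `u_t` for the evolving metric, not for the fixed one: the
derivatives of the quadratic gradient terms are exactly the change of the Christoffel symbols under
the conformal factor. The divergence theorem then applies in the evolving metric. -/
lemma hasDerivAt_Wmat (h : IsMetricOn D G) (hI : IsOpen I) (hu : JSmooth I D u) {t : ℝ} (ht : t ∈ I) {y : Euc n}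
    (hy : y ∈ D) (i j : Fin n) :
    HasDerivAt (fun τ => Wmat G (u τ) y i j)
      (hessian (confM (u t) G) (fun z => deriv (fun τ => u τ z) t) y i j) t := by
  set η : Euc n → ℝ := fun z => deriv (fun τ => u τ z) t with hη
  have h1 : ∀ k, HasDerivAt (fun τ => pd k (u τ) y) (pd k η y) t := fun k =>
    hu.hasDerivAt_pd hI h.isOpen ht hy k
  have h2 : HasDerivAt (fun τ => pd i (pd j (u τ)) y) (pd i (pd j η) y) t := by
    have h3 := (hu.pd hI.uniqueDiffOn h.isOpen j).hasDerivAt_pd hI h.isOpen ht hy i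
    rwa [pd_congr_on (g := pd j η) h.isOpen hy i fun z hz => (hu.hasDerivAt_pd hI h.isOpen ht hz j).deriv] at h3
  have h3 : HasDerivAt (fun τ => hessian G (u τ) y i j) (hessian G η y i j) t := by
    simp only [hessian, Matrix.of_apply]
    exact h2.sub (HasDerivAt.fun_sum fun k _ => (h1 k).const_mul _)
  have h4 : HasDerivAt (fun τ => gradSq G (u τ) y) (2 * (grad η y ⬝ᵥ (G y)⁻¹ *ᵥ grad (u t) y)) t := by
    have h5 : HasDerivAt (fun τ => ∑ k, pd k (u τ) y * ∑ l, (G y)⁻¹ k l * pd l (u τ) y)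
        (∑ k, (pd k η y * ∑ l, (G y)⁻¹ k l * pd l (u t) y
          + pd k (u t) y * ∑ l, (G y)⁻¹ k l * pd l η y)) t :=
      HasDerivAt.fun_sum fun k _ => (h1 k).mul (HasDerivAt.fun_sum fun l _ => (h1 l).const_mul _)
    refine HasDerivAt.congr_deriv (f := fun τ => gradSq G (u τ) y) h5 ?_
    have e1 : grad η y ⬝ᵥ (G y)⁻¹ *ᵥ grad (u t) y = grad (u t) y ⬝ᵥ (G y)⁻¹ *ᵥ grad η y := by
      have hs : ((G y)⁻¹)ᵀ = (G y)⁻¹ := by rw [Matrix.transpose_nonsing_inv, h.symm hy]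
      rw [Matrix.dotProduct_mulVec, ← Matrix.mulVec_transpose, hs, dotProduct_comm]
    rw [Finset.sum_add_distrib, two_mul]
    nth_rewrite 2 [e1]
    rfl
  rw [hessian_confM_apply h (fun z hz => hu.slice h.isOpen ht hz) hy]
  simp only [Wmat_apply]
  refine ((((hasDerivAt_const t (schouten G y i j)).add h3).add ((h1 i).mul (h1 j))).sub
    (((h4.mul_const (G y i j)).const_mul (1 / 2)))).congr_deriv ?_
  ring

/-- The first Newton tensor is by design the gradient of `σ₂`. -/
lemma hasDerivAt_sigma2 {A : Matrix (Fin n) (Fin n) ℝ} {W : ℝ → Matrix (Fin n) (Fin n) ℝ}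
    {W' : Matrix (Fin n) (Fin n) ℝ} {t : ℝ} (hW : ∀ i j, HasDerivAt (fun τ => W τ i j) (W' i j) t) :
    HasDerivAt (fun τ => sigma2 (A⁻¹ * W τ)) (newton A (W t) * W').trace t := by
  have h1 : ∀ i j, HasDerivAt (fun τ => (A⁻¹ * W τ) i j) ((A⁻¹ * W') i j) t := by
    intro i j
    simp only [Matrix.mul_apply]
    exact HasDerivAt.fun_sum fun k _ => (hW k j).const_mul _
  have h2 : HasDerivAt (fun τ => (A⁻¹ * W τ).trace) (A⁻¹ * W').trace t := by
    simp only [Matrix.trace, Matrix.diag]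
    exact HasDerivAt.fun_sum fun k _ => h1 k k
  have h3 : HasDerivAt (fun τ => (A⁻¹ * W τ * (A⁻¹ * W τ)).trace)
      ((A⁻¹ * W') * (A⁻¹ * W t) + (A⁻¹ * W t) * (A⁻¹ * W')).trace t := by
    simp only [Matrix.trace, Matrix.diag, Matrix.mul_apply (M := A⁻¹ * W _), Matrix.add_apply,
      Matrix.mul_apply (M := A⁻¹ * W')]
    refine HasDerivAt.fun_sum fun k _ => ?_
    rw [← Finset.sum_add_distrib]
    exact HasDerivAt.fun_sum fun l _ => (h1 k l).mul (h1 l k)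
  unfold sigma2
  refine (((h2.pow 2).sub h3).div_const 2).congr_deriv ?_
  rw [newton, Matrix.sub_mul, Matrix.trace_sub, Matrix.smul_mul, Matrix.trace_smul, smul_eq_mul,
    Matrix.trace_add, Matrix.trace_mul_comm (A⁻¹ * W')]
  simp only [Matrix.mul_assoc]
  push_cast
  ring

lemma newton_confM {v : Euc n → ℝ} {y : Euc n} (hG : IsUnit (G y).det) (A : Matrix (Fin n) (Fin n) ℝ) :
    newton (confM v G y) A = Real.exp (2 * v y) ^ 2 • newton (G y) A := by
  rw [newton, newton, confM, inv_exp_smul _ hG]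
  simp only [Matrix.smul_mul, Matrix.mul_smul, Matrix.trace_smul, smul_eq_mul, smul_sub, smul_smul, pow_two]
  congr 2
  ring

end Variation

end

/-! ### Monotonicity of the curvature integral and of `r_ε` along the flow. -/

section

variable {n : ℕ}

lemma JSmooth.differentiableAt_left {I : Set ℝ} {D : Set (Euc n)} {X : ℝ → Euc n → ℝ} (hX : JSmooth I D X)
    (hI : IsOpen I) (hD : IsOpen D) {t : ℝ} (ht : t ∈ I) {z : Euc n} (hz : z ∈ D) :
    DifferentiableAt ℝ (fun τ => X τ z) t := by
  have h1 : DifferentiableAt ℝ (fun q : ℝ × Euc n => X q.1 q.2) (t, z) :=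
    (ContDiffOn.contDiffAt hX ((hI.prod hD).mem_nhds ⟨ht, hz⟩)).differentiableAt (by simp)
  exact h1.comp (f := fun τ => (τ, z)) t (by fun_prop)

/-! ### Smooth families of functions -/

section Family

variable {M : Type*} [TopologicalSpace M] [ChartedSpace (EuclideanSpace ℝ (Fin n)) M]

/-- Smoothness of a family of functions on a manifold, tested in charts. -/
def FamSmooth (n : ℕ) {M : Type*} [TopologicalSpace M] [ChartedSpace (EuclideanSpace ℝ (Fin n)) M]
    (I : Set ℝ) (Θ : ℝ → M → ℝ) : Prop :=
  ∀ p : M, JSmooth (n := n) I (extChartAt (𝓡 n) p).target fun t => inChart p (Θ t)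

variable {I : Set ℝ} {Θ : ℝ → M → ℝ}

lemma FamSmooth.slice (h : FamSmooth n I Θ) {t : ℝ} (ht : t ∈ I) : SmoothInCharts (n := n) (Θ t) :=
  fun p _ hy => (h p).slice (isOpen_extChartAt_target p) ht hy

lemma FamSmooth.deriv (h : FamSmooth n I Θ) (hI : IsOpen I) :
    FamSmooth n I fun t x => deriv (fun τ => Θ τ x) t :=
  fun p => (h p).deriv hI (isOpen_extChartAt_target p)

lemma FamSmooth.hasDerivAt (h : FamSmooth n I Θ) (hI : IsOpen I) {t : ℝ} (ht : t ∈ I) (x : M) :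
    HasDerivAt (fun τ => Θ τ x) (_root_.deriv (fun τ => Θ τ x) t) t := by
  have h1 := (h x).differentiableAt_left hI (isOpen_extChartAt_target x) ht (mem_extChartAt_target x)
  simp only [inChart, extChartAt_to_inv] at h1
  exact h1.hasDerivAt

lemma FamSmooth.mono (h : FamSmooth n I Θ) {J : Set ℝ} (hJ : J ⊆ I) : FamSmooth n J Θ :=
  fun p => (h p).mono hJ le_rfl

lemma continuousOn_of_charts (h : ∀ p : M, ContinuousOn (fun q : ℝ × Euc n => inChart p (Θ q.1) q.2)
    (I ×ˢ (extChartAt (𝓡 n) p).target)) :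
    ContinuousOn (fun q : ℝ × M => Θ q.1 q.2) (I ×ˢ univ) := by
  rintro ⟨t, x⟩ ⟨ht, -⟩
  have hs : I ×ˢ (extChartAt (𝓡 n) x).source ∈ 𝓝[I ×ˢ univ] (t, x) := by
    refine mem_nhdsWithin.2 ⟨univ ×ˢ (extChartAt (𝓡 n) x).source,
      isOpen_univ.prod (isOpen_extChartAt_source x), ⟨mem_univ _, mem_extChartAt_source x⟩, ?_⟩
    rintro ⟨τ, z⟩ ⟨⟨-, hz⟩, hτ, -⟩
    exact ⟨hτ, hz⟩
  have h1 : ContinuousOn (fun q : ℝ × M => (q.1, extChartAt (𝓡 n) x q.2))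
      (I ×ˢ (extChartAt (𝓡 n) x).source) :=
    continuousOn_fst.prodMk ((continuousOn_extChartAt x).comp continuousOn_snd fun q hq => hq.2)
  have h2 : ContinuousOn (fun q : ℝ × M => Θ q.1 q.2) (I ×ˢ (extChartAt (𝓡 n) x).source) := by
    refine ((h x).comp h1 fun q hq => ⟨hq.1, (extChartAt (𝓡 n) x).map_source hq.2⟩).congr fun q hq => ?_
    simp only [Function.comp, inChart, (extChartAt (𝓡 n) x).left_inv hq.2]
  exact ((h2 (t, x) ⟨ht, mem_extChartAt_source x⟩).mono_of_mem_nhdsWithin hs)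

lemma FamSmooth.continuousOn (h : FamSmooth n I Θ) :
    ContinuousOn (fun q : ℝ × M => Θ q.1 q.2) (I ×ˢ univ) :=
  continuousOn_of_charts fun p => (h p).continuousOn

lemma FamSmooth.hasDerivAt_integral [CompactSpace M] [MeasurableSpace M] [BorelSpace M] {μ : Measure M}
    [IsFiniteMeasure μ] (h : FamSmooth n I Θ) (hI : IsOpen I) {t : ℝ} (ht : t ∈ I) :
    HasDerivAt (fun τ => ∫ x, Θ τ x ∂μ) (∫ x, _root_.deriv (fun τ => Θ τ x) t ∂μ) t :=
  hasDerivAt_integral_of_continuousOn hI h.continuousOn (h.deriv hI).continuousOn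
    (fun _ hτ x => h.hasDerivAt hI hτ x) ht

end Family

/-! ### Quantities along the flow -/

section Flow

variable {M : Type*} [TopologicalSpace M] [ChartedSpace (EuclideanSpace ℝ (Fin n)) M]
  [IsManifold (𝓡 n) ∞ M]
  {g₀ : Bundle.ContMDiffRiemannianMetric (𝓡 n) ∞ (EuclideanSpace ℝ (Fin n))
    (fun x : M => TangentSpace (𝓡 n) x)}

lemma isMetric_metric : IsMetric g₀.inner := fun p => isMetricOn_coeff g₀ p

lemma jsmooth_s {I : Set ℝ} (hI : UniqueDiffOn ℝ I) {u : ℝ → M → ℝ} (hu : FamSmooth n I u) (p : M) :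
    JSmooth (n := n) I (extChartAt (𝓡 n) p).target (fun t => s1 g₀.inner (u t) p) ∧
      JSmooth (n := n) I (extChartAt (𝓡 n) p).target (fun t => s2 g₀.inner (u t) p) := by
  have hm := isMetricOn_coeff g₀ p
  have h := (hm.jsmoothM.inv hm.det_ne).mul ((hu p).Wmat hm hI)
  exact ⟨h.sigma1, h.sigma2⟩

lemma famSmooth_sig (hn : 2 < n) {I : Set ℝ} (hI : UniqueDiffOn ℝ I) {u : ℝ → M → ℝ} (hu : FamSmooth n I u) :
    FamSmooth n I (fun t => sig1 (conformal g₀.inner (u t))) ∧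
      FamSmooth n I (fun t => sig2 (conformal g₀.inner (u t))) := by
  refine ⟨fun p => ?_, fun p => ?_⟩
  · refine (((JSmooth.const 2).mul (hu p)).exp.mul (jsmooth_s (g₀ := g₀) hI hu p).1).congr fun t ht z hz => ?_
    exact (sig_conformal g₀ hn (hu.slice ht) hz).1
  · have h1 := ((JSmooth.const 2).mul (hu p)).exp
    refine ((h1.mul h1).mul (jsmooth_s (g₀ := g₀) hI hu p).2).congr fun t ht z hz => ?_
    rw [← pow_two]
    exact (sig_conformal g₀ hn (hu.slice ht) hz).2

/-- The derivative of the density `e^{-nu} σ₂`. -/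
lemma hasDerivAt_sig2_density (hn : 2 < n) {I : Set ℝ} (hI : IsOpen I) {u : ℝ → M → ℝ} (hu : FamSmooth n I u)
    {t : ℝ} (ht : t ∈ I) (x : M) :
    HasDerivAt (fun τ => Real.exp (-n * u τ x) * sig2 (conformal g₀.inner (u τ)) x)
      (Real.exp (-n * u t x) * ((4 - n) * (sig2 (conformal g₀.inner (u t)) x * deriv (fun τ => u τ x) t)
        + newtonHess (conformal g₀.inner (u t)) (fun x => deriv (fun τ => u τ x) t) x)) t := by
  have hm := isMetricOn_coeff g₀ x
  set y := extChartAt (𝓡 n) x x with hy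
  have hyt : y ∈ (extChartAt (𝓡 n) x).target := mem_extChartAt_target x
  have hx : (extChartAt (𝓡 n) x).symm y = x := extChartAt_to_inv x
  have hv : ∀ τ, inChart x (u τ) y = u τ x := fun τ => by rw [inChart, hx]
  have h1 := hasDerivAt_sigma2 (A := coeff g₀.inner x y) fun i j => hasDerivAt_Wmat hm hI (hu x) ht hyt i j
  have h2 := hu.hasDerivAt hI ht x
  have e : ∀ τ ∈ I, sig2 (conformal g₀.inner (u τ)) x = Real.exp (2 * u τ x) ^ 2 * s2 g₀.inner (u τ) x y := by
    intro τ hτ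
    have := (sig_conformal g₀ hn (hu.slice hτ) hyt).2
    rwa [hx, hv] at this
  have e' : newtonHess (conformal g₀.inner (u t)) (fun x => deriv (fun τ => u τ x) t) x
      = Real.exp (2 * u t x) ^ 2 * (newton (coeff g₀.inner x y) (Wmat (coeff g₀.inner x) (inChart x (u t)) y)
        * hessian (confM (inChart x (u t)) (coeff g₀.inner x))
          (fun z => deriv (fun τ => inChart x (u τ) z) t) y).trace := by
    rw [newtonHess, newtonHessIn, coeff_conformal, ← hy, schouten_confM hn hm (hu.slice ht x) hyt,
      newton_confM (hm.isUnit_det hyt), Matrix.smul_mul, Matrix.trace_smul, smul_eq_mul, hv]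
    rfl
  have h3 : HasDerivAt (fun τ => Real.exp (-n * u τ x) * (Real.exp (2 * u τ x) ^ 2 * s2 g₀.inner (u τ) x y))
      _ t := ((h2.const_mul (-n : ℝ)).exp).mul ((((h2.const_mul 2).exp).pow 2).mul h1)
  have h4 := h3.congr_of_eventuallyEq (f₁ := fun τ => Real.exp (-n * u τ x) * sig2 (conformal g₀.inner (u τ)) x)
    (by filter_upwards [hI.mem_nhds ht] with τ hτ; rw [e τ hτ])
  refine h4.congr_deriv ?_
  -- The density contributes `-n` and the factor `e^{4u}` of `σ₂` contributes `4`, whence the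
  -- coefficient `4 - n`.
  rw [e t ht, e', s2]
  simp only [Pi.pow_apply]
  push_cast
  ring

variable [MeasurableSpace M] {ε T : ℝ} {u : ℝ → M → ℝ}

lemma IsFlowSolution.famSmooth (h : IsFlowSolution g₀.inner ε T u)
    : FamSmooth n (Icc 0 T) u := jsmooth_inChart h.smooth

lemma IsFlowSolution.continuous (h : IsFlowSolution g₀.inner ε T u)
    {t : ℝ} (ht : t ∈ Icc 0 T) : Continuous (u t) :=
  (h.famSmooth.slice ht).continuous

lemma IsFlowSolution.deriv_eq (h : IsFlowSolution g₀.inner ε T u) {t : ℝ} (ht : t ∈ Ioo 0 T) (x : M) :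
    deriv (fun τ => u τ x) t = quot g₀.inner ε (u t) x + sEps g₀.inner ε (u t) :=
  ((h.flow t (Ioo_subset_Icc_self ht) x).hasDerivAt (Icc_mem_nhds ht.1 ht.2)).deriv

lemma IsFlowSolution.continuous_deriv (h : IsFlowSolution g₀.inner ε T u) {t : ℝ} (ht : t ∈ Ioo 0 T) :
    Continuous fun x => deriv (fun τ => u τ x) t :=
  (((h.famSmooth.mono Ioo_subset_Icc_self).deriv isOpen_Ioo).slice ht).continuous

/-- By the equation it differs from the time derivative of a smooth function by a constant in space.
-/
lemma IsFlowSolution.continuous_quot (h : IsFlowSolution g₀.inner ε T u)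
    {t : ℝ} (ht : t ∈ Ioo 0 T) : Continuous (quot g₀.inner ε (u t)) := by
  have h1 : quot g₀.inner ε (u t) = fun x => deriv (fun τ => u τ x) t - sEps g₀.inner ε (u t) :=
    funext fun x => by rw [h.deriv_eq ht]; ring
  rw [h1]
  exact (h.continuous_deriv ht).sub continuous_const

/-- At a fixed point a sign change in time would, by the intermediate value theorem, produce a zero.
-/
lemma IsFlowSolution.sig1_pos (h : IsFlowSolution g₀.inner ε T u)
    (hn : 2 < n) (hpos : ∀ x, 0 < sig1 (conformal g₀.inner (u 0)) x) {t : ℝ}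
    (ht : t ∈ Icc 0 T) (x : M) : 0 < sig1 (conformal g₀.inner (u t)) x := by
  rcases ht.1.eq_or_lt with h0 | h0
  · rw [← h0]; exact hpos x
  have hT : 0 < T := h0.trans_le ht.2
  have hc := ((famSmooth_sig (g₀ := g₀) hn (uniqueDiffOn_Icc hT) h.famSmooth).1).continuousOn
  have hc' : ContinuousOn (fun τ => sig1 (conformal g₀.inner (u τ)) x) (Icc 0 T) :=
    hc.comp (f := fun τ => (τ, x)) (by fun_prop) fun τ hτ => ⟨hτ, mem_univ _⟩
  by_contra hneg
  have h1 : (0 : ℝ) ∈ (fun τ => sig1 (conformal g₀.inner (u τ)) x) '' Icc 0 t :=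
    intermediate_value_Icc' h0.le (hc'.mono (Icc_subset_Icc_right ht.2)) ⟨not_lt.1 hneg, (hpos x).le⟩
  obtain ⟨τ, hτ, hτ0⟩ := h1
  exact h.sig1_ne τ ⟨hτ.1, hτ.2.trans ht.2⟩ x hτ0

variable [CompactSpace M] [BorelSpace M]

lemma integral_exp_vol (v : M → ℝ) (hv : Continuous v) :
    ∫ x, Real.exp (2 * ε * v x) ∂(vol (conformal g₀.inner v))
      = ∫ x, Real.exp ((2 * ε - n) * v x) ∂(vol g₀.inner) := by
  rw [integral_vol_conformal (contDensity_metric g₀) hv]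
  refine integral_congr_ae (Eventually.of_forall fun x => ?_)
  simp only [← Real.exp_add]
  ring_nf

/-- This is what `sEps` is defined for. The hypothesis on `rEps` ensures that the denominator is
nonzero, since division by zero would make `rEps` zero. -/
lemma IsFlowSolution.integral_exp_mul_deriv (h : IsFlowSolution g₀.inner ε T u) {t : ℝ} (ht : t ∈ Ioo 0 T)
    (hr : rEps g₀.inner ε (u t) ≠ 0) :
    ∫ x, Real.exp (2 * ε * u t x) * deriv (fun τ => u τ x) t ∂(vol (conformal g₀.inner (u t))) = 0 := by
  have hu := h.continuous (Ioo_subset_Icc_self ht)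
  have hd := (contDensity_metric g₀).conformal hu
  have hV : ∫ x, Real.exp (2 * ε * u t x) ∂(vol (conformal g₀.inner (u t))) ≠ 0 := by
    intro h0
    rw [rEps, h0, div_zero] at hr
    exact hr rfl
  have hec : Continuous fun x => Real.exp (2 * ε * u t x) := by fun_prop
  simp only [h.deriv_eq ht, mul_add]
  rw [integral_add (integrable_vol hd (hec.fun_mul (h.continuous_quot ht)))
    (integrable_vol hd (hec.fun_mul continuous_const)), integral_mul_const, sEps, neg_div, mul_neg,
    mul_div_cancel₀ _ hV, add_neg_cancel]

/-- Subtracting `r e^{2εu}` from `σ₂` costs nothing, as its product with `u_t` has integral zero.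
The constant `s` then drops out, because the difference has integral zero by the choice of `r`. What
remains is the integral of `e^{-2u} (σ₂ - r e^{2εu})² / σ₁`. -/
lemma IsFlowSolution.integral_sig2_mul_deriv_nonneg (h : IsFlowSolution g₀.inner ε T u)
    (hn : 2 < n) {t : ℝ} (ht : t ∈ Ioo 0 T)
    (hpos : ∀ x, 0 < sig1 (conformal g₀.inner (u t)) x)
    (hr : rEps g₀.inner ε (u t) ≠ 0) :
    0 ≤ ∫ x, sig2 (conformal g₀.inner (u t)) x * deriv (fun τ => u τ x) t
      ∂(vol (conformal g₀.inner (u t))) := by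
  have hu := h.continuous (Ioo_subset_Icc_self ht)
  have hd := (contDensity_metric g₀).conformal hu
  have hV : ∫ x, Real.exp (2 * ε * u t x) ∂(vol (conformal g₀.inner (u t))) ≠ 0 := by
    intro h0
    rw [rEps, h0, div_zero] at hr
    exact hr rfl
  have hec : Continuous fun x => Real.exp (2 * ε * u t x) := by fun_prop
  have hsc : Continuous (sig2 (conformal g₀.inner (u t))) :=
    ((famSmooth_sig (g₀ := g₀) hn isOpen_Ioo.uniqueDiffOn (h.famSmooth.mono Ioo_subset_Icc_self)).2.slice
      ht).continuous
  set r := rEps g₀.inner ε (u t) with hrd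
  set s := sEps g₀.inner ε (u t) with hsd
  have e : ∀ x, sig2 (conformal g₀.inner (u t)) x * deriv (fun τ => u τ x) t
      = (sig2 (conformal g₀.inner (u t)) x - r * Real.exp (2 * ε * u t x)) * quot g₀.inner ε (u t) x
        + (s * (sig2 (conformal g₀.inner (u t)) x - r * Real.exp (2 * ε * u t x))
          + r * (Real.exp (2 * ε * u t x) * deriv (fun τ => u τ x) t)) := fun x => by
    rw [h.deriv_eq ht]; ring
  have hsr : Continuous fun x => sig2 (conformal g₀.inner (u t)) x - r * Real.exp (2 * ε * u t x) :=
    hsc.sub (continuous_const.fun_mul hec)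
  have i2 := integrable_vol hd (continuous_const (y := s) |>.fun_mul hsr)
  have i3 := integrable_vol hd (continuous_const (y := r) |>.fun_mul (hec.fun_mul (h.continuous_deriv ht)))
  simp only [e]
  rw [integral_add (integrable_vol hd (hsr.fun_mul (h.continuous_quot ht))) (i2.fun_add i3), integral_add i2 i3,
    integral_const_mul, integral_const_mul, h.integral_exp_mul_deriv ht hr,
    integral_sub (integrable_vol hd hsc) (integrable_vol hd (continuous_const.fun_mul hec)), integral_const_mul]
  have hrV : ∫ x, sig2 (conformal g₀.inner (u t)) x ∂(vol (conformal g₀.inner (u t)))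
      - r * ∫ x, Real.exp (2 * ε * u t x) ∂(vol (conformal g₀.inner (u t))) = 0 := by
    rw [hrd, rEps, div_mul_cancel₀ _ hV, sub_self]
  rw [hrV, mul_zero, mul_zero, add_zero, add_zero]
  refine integral_nonneg fun x => ?_
  have hq : (sig2 (conformal g₀.inner (u t)) x - r * Real.exp (2 * ε * u t x)) * quot g₀.inner ε (u t) x
      = Real.exp (-2 * u t x) * (sig2 (conformal g₀.inner (u t)) x - r * Real.exp (2 * ε * u t x)) ^ 2
        / sig1 (conformal g₀.inner (u t)) x := by
    rw [quot]; ring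
  show 0 ≤ _ * _
  rw [hq]
  exact div_nonneg (mul_nonneg (Real.exp_pos _).le (sq_nonneg _)) (hpos x).le

/-- The weighted volume is constant along the flow. -/
lemma IsFlowSolution.integral_exp_eq (h : IsFlowSolution g₀.inner ε T u)
    (hr : ∀ t ∈ Icc 0 T, 0 < rEps g₀.inner ε (u t)) {t : ℝ}
    (ht : t ∈ Icc 0 T) :
    ∫ x, Real.exp ((2 * ε - n) * u t x) ∂(vol g₀.inner)
      = ∫ x, Real.exp ((2 * ε - n) * u 0 x) ∂(vol g₀.inner) := by
  have := isFiniteMeasure_vol (contDensity_metric g₀)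
  have hE : FamSmooth n (Icc 0 T) fun t x => Real.exp ((2 * ε - n) * u t x) := fun p =>
    ((JSmooth.const _).mul (h.famSmooth p)).exp
  have hc := continuousOn_integral_of_continuousOn (μ := vol g₀.inner)
    (Θ := fun t x => Real.exp ((2 * ε - n) * u t x)) isCompact_Icc hE.continuousOn
  have hd : ∀ τ ∈ Ioo 0 T, HasDerivAt (fun t => ∫ x, Real.exp ((2 * ε - n) * u t x) ∂(vol g₀.inner)) 0 τ := by
    intro τ hτ
    have hu := h.continuous (Ioo_subset_Icc_self hτ)
    refine ((hE.mono Ioo_subset_Icc_self).hasDerivAt_integral isOpen_Ioo hτ).congr_deriv ?_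
    have h2 := h.integral_exp_mul_deriv hτ (hr τ (Ioo_subset_Icc_self hτ)).ne'
    rw [integral_vol_conformal (contDensity_metric g₀) hu] at h2
    rw [← mul_zero (2 * ε - n : ℝ), ← h2, ← integral_const_mul]
    refine integral_congr_ae (Eventually.of_forall fun x => ?_)
    have h3 := ((h.famSmooth.mono Ioo_subset_Icc_self).hasDerivAt isOpen_Ioo hτ x).const_mul (2 * ε - n : ℝ)
    show deriv (fun t => Real.exp ((2 * ε - n) * u t x)) τ = _
    rw [h3.exp.deriv, show (2 * ε - n) * u τ x = -n * u τ x + 2 * ε * u τ x by ring, Real.exp_add]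
    ring
  have h0 : (0 : ℝ) ∈ Icc 0 T := ⟨le_rfl, ht.1.trans ht.2⟩
  refine le_antisymm ?_ ?_
  · refine antitoneOn_of_deriv_nonpos (convex_Icc 0 T) hc (fun τ hτ => ?_) (fun τ hτ => ?_) h0 ht ht.1
    · rw [interior_Icc] at hτ; exact (hd τ hτ).differentiableAt.differentiableWithinAt
    · rw [interior_Icc] at hτ; rw [(hd τ hτ).deriv]
  · refine monotoneOn_of_deriv_nonneg (convex_Icc 0 T) hc (fun τ hτ => ?_) (fun τ hτ => ?_) h0 ht ht.1
    · rw [interior_Icc] at hτ; exact (hd τ hτ).differentiableAt.differentiableWithinAt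
    · rw [interior_Icc] at hτ; rw [(hd τ hτ).deriv]

variable [T2Space M]

/-- The total `σ₂`-curvature does not increase along the flow. -/
lemma IsFlowSolution.integral_sig2_le (h : IsFlowSolution g₀.inner ε T u)
    (hn : 4 < n) (hpos : ∀ x, 0 < sig1 (conformal g₀.inner (u 0)) x)
    (hr : ∀ t ∈ Icc 0 T, 0 < rEps g₀.inner ε (u t)) {t : ℝ} (ht : t ∈ Icc 0 T) :
    ∫ x, sig2 (conformal g₀.inner (u t)) x ∂(vol (conformal g₀.inner (u t)))
      ≤ ∫ x, sig2 (conformal g₀.inner (u 0)) x ∂(vol (conformal g₀.inner (u 0))) := by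
  have := isFiniteMeasure_vol (contDensity_metric g₀)
  have hn2 : 2 < n := by omega
  rcases ht.1.eq_or_lt with h00 | h00
  · rw [← h00]
  have hT : 0 < T := h00.trans_le ht.2
  have hE : FamSmooth n (Icc 0 T) fun t x => Real.exp (-n * u t x) * sig2 (conformal g₀.inner (u t)) x :=
    fun p => (((JSmooth.const _).mul (h.famSmooth p)).exp).mul
      ((famSmooth_sig hn2 (uniqueDiffOn_Icc hT) h.famSmooth).2 p)
  have hc := continuousOn_integral_of_continuousOn (μ := vol g₀.inner)
    (Θ := fun t x => Real.exp (-n * u t x) * sig2 (conformal g₀.inner (u t)) x) isCompact_Icc hE.continuousOn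
  have hd : ∀ τ ∈ Ioo 0 T, HasDerivAt (fun t => ∫ x, Real.exp (-n * u t x) *
      sig2 (conformal g₀.inner (u t)) x ∂(vol g₀.inner))
      ((4 - n) * ∫ x, sig2 (conformal g₀.inner (u τ)) x * deriv (fun τ => u τ x) τ
        ∂(vol (conformal g₀.inner (u τ)))) τ := by
    intro τ hτ
    have hI := Ioo_subset_Icc_self hτ
    have hu := h.continuous hI
    have hdc := (contDensity_metric g₀).conformal hu
    have hf := h.famSmooth.mono Ioo_subset_Icc_self
    have hη := (hf.deriv isOpen_Ioo).slice hτ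
    have hm := (isMetric_metric (g₀ := g₀)).conformal (h.famSmooth.slice hI)
    refine ((hE.mono Ioo_subset_Icc_self).hasDerivAt_integral isOpen_Ioo hτ).congr_deriv ?_
    have hsc : Continuous (sig2 (conformal g₀.inner (u τ))) :=
      ((famSmooth_sig (g₀ := g₀) hn2 isOpen_Ioo.uniqueDiffOn hf).2.slice hτ).continuous
    -- The Newton tensor of the evolving metric is divergence free, so its pairing with the Hessian
    -- of `u_t` has zero integral and only the factor `4 - n` term is left.
    have h2 := integral_newtonHess hn2 hm hη
    rw [← add_zero (_ * _), ← h2, ← integral_const_mul, ← integral_add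
      (integrable_vol hdc (continuous_const.fun_mul (hsc.fun_mul hη.continuous)))
      (integrable_vol hdc (continuous_newtonHess hm hη)),
      integral_vol_conformal (contDensity_metric g₀) hu]
    exact integral_congr_ae (Eventually.of_forall fun x => (hasDerivAt_sig2_density hn2 isOpen_Ioo hf hτ x).deriv)
  have h1 := antitoneOn_of_deriv_nonpos (convex_Icc 0 T) hc (fun τ hτ => by
      rw [interior_Icc] at hτ; exact (hd τ hτ).differentiableAt.differentiableWithinAt) (fun τ hτ => by
      rw [interior_Icc] at hτ
      rw [(hd τ hτ).deriv]
      refine mul_nonpos_of_nonpos_of_nonneg ?_ (h.integral_sig2_mul_deriv_nonneg hn2 hτ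
        (h.sig1_pos hn2 hpos (Ioo_subset_Icc_self hτ)) (hr τ (Ioo_subset_Icc_self hτ)).ne')
      have : (4 : ℝ) < n := by exact_mod_cast hn
      linarith) ⟨le_rfl, hT.le⟩ ht ht.1
  rwa [integral_vol_conformal (contDensity_metric g₀) (h.continuous ht),
    integral_vol_conformal (contDensity_metric g₀) (h.continuous ⟨le_rfl, hT.le⟩)]

/-- The number `r_ε` does not increase along the flow. -/
lemma IsFlowSolution.rEps_le (h : IsFlowSolution g₀.inner ε T u)
    (hn : 4 < n) (hpos : ∀ x, 0 < sig1 (conformal g₀.inner (u 0)) x)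
    (hr : ∀ t ∈ Icc 0 T, 0 < rEps g₀.inner ε (u t)) {t : ℝ} (ht : t ∈ Icc 0 T) :
    rEps g₀.inner ε (u t) ≤ rEps g₀.inner ε (u 0) := by
  have h0 : (0 : ℝ) ∈ Icc 0 T := ⟨le_rfl, ht.1.trans ht.2⟩
  rw [rEps, rEps, integral_exp_vol _ (h.continuous ht), integral_exp_vol _ (h.continuous h0),
    h.integral_exp_eq hr ht]
  exact div_le_div_of_nonneg_right (h.integral_sig2_le hn hpos hr ht)
    (integral_nonneg fun x => (Real.exp_pos _).le)

end Flow

end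

section

variable {n : ℕ}

/-! ### Inequalities for symmetric matrices -/

section Algebra

variable {G H : Matrix (Fin n) (Fin n) ℝ}

lemma trace_inv_mul_nonneg (hG : G.PosDef) (hH : H.PosSemidef) : 0 ≤ (G⁻¹ * H).trace := by
  obtain ⟨B, hB⟩ := exists_eq_transpose_mul hG.inv.posSemidef
  have h1 : (B * H * Bᵀ).PosSemidef := by simpa using hH.mul_mul_conjTranspose_same B
  rw [hB, Matrix.mul_assoc, Matrix.trace_mul_comm]
  exact h1.trace_nonneg

lemma trace_sq_le_of_posSemidef (hG : G.PosDef) (hH : H.PosSemidef) :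
    (G⁻¹ * H * G⁻¹ * H).trace ≤ n ^ 2 * (G⁻¹ * H).trace ^ 2 := by
  obtain ⟨B, hB⟩ := exists_eq_transpose_mul hG.inv.posSemidef
  have h1 : (B * H * Bᵀ).PosSemidef := by simpa using hH.mul_mul_conjTranspose_same B
  have e1 : (G⁻¹ * H).trace = (B * H * Bᵀ).trace := by
    rw [hB, Matrix.mul_assoc, Matrix.trace_mul_comm]
  have e2 : (G⁻¹ * H * G⁻¹ * H).trace = ((B * H * Bᵀ) * (B * H * Bᵀ)).trace := by
    rw [hB, show Bᵀ * B * H * (Bᵀ * B) * H = Bᵀ * (B * H * (Bᵀ * B) * H) by simp only [Matrix.mul_assoc],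
      Matrix.trace_mul_comm]
    simp only [Matrix.mul_assoc]
  rw [e1, e2]
  have h2 : ∀ i j, (B * H * Bᵀ) i j * (B * H * Bᵀ) j i ≤ (B * H * Bᵀ).trace ^ 2 := fun i j => by
    refine (le_abs_self _).trans ?_
    rw [pow_two]
    exact abs_mul_le' (abs_le_trace_of_posSemidef h1 i j) (abs_le_trace_of_posSemidef h1 j i)
  simp only [Matrix.trace, Matrix.diag, Matrix.mul_apply (M := B * H * Bᵀ)]
  refine (Finset.sum_le_sum fun i _ => Finset.sum_le_sum fun j _ => h2 i j).trans (le_of_eq ?_)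
  simp only [Finset.sum_const, Finset.card_univ, Fintype.card_fin, nsmul_eq_mul, Matrix.trace, Matrix.diag]
  ring

/-- Cauchy-Schwarz for a covector and a vector, from the discriminant of the nonnegative quadratic
`|w - s G⁻¹ d|²`. -/
lemma dotProduct_sq_le (hG : G.PosDef) (w d : Fin n → ℝ) :
    (w ⬝ᵥ d) ^ 2 ≤ (d ⬝ᵥ G⁻¹ *ᵥ d) * (w ⬝ᵥ G *ᵥ w) := by
  have hu : IsUnit G.det := hG.det_pos.ne'.isUnit
  have hs : Gᵀ = G := by simpa using hG.isHermitian.eq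
  have e1 : G *ᵥ G⁻¹ *ᵥ d = d := by
    rw [Matrix.mulVec_mulVec, Matrix.mul_nonsing_inv _ hu, Matrix.one_mulVec]
  have key : ∀ s : ℝ, 0 ≤ (d ⬝ᵥ G⁻¹ *ᵥ d) * (s * s) + (-2 * (w ⬝ᵥ d)) * s + w ⬝ᵥ G *ᵥ w := by
    intro s
    have h1 := hG.posSemidef.dotProduct_mulVec_nonneg (w - s • G⁻¹ *ᵥ d)
    rw [star_trivial, Matrix.mulVec_sub, Matrix.mulVec_smul, e1, sub_dotProduct, dotProduct_sub,
      dotProduct_sub, smul_dotProduct, smul_dotProduct, dotProduct_smul, dotProduct_smul] at h1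
    have e2 : (G⁻¹ *ᵥ d) ⬝ᵥ G *ᵥ w = w ⬝ᵥ d := by
      rw [Matrix.dotProduct_mulVec, ← Matrix.mulVec_transpose, hs, e1, dotProduct_comm]
    rw [e2, dotProduct_comm (G⁻¹ *ᵥ d) d] at h1
    simp only [smul_eq_mul] at h1
    linarith
  have := discrim_le_zero key
  rw [discrim] at this
  linarith

lemma trace_inv_mul_vecMulVec (d : Fin n → ℝ) :
    (G⁻¹ * Matrix.vecMulVec d d).trace = d ⬝ᵥ G⁻¹ *ᵥ d := by
  rw [Matrix.mul_vecMulVec, Matrix.trace_vecMulVec, dotProduct_comm]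

/-- Cauchy-Schwarz between `H` and the rank one form `V = (Gw) ⊗ (Gw)`, whose norm is `N = |w|²`:
expand the nonnegative square norm of `N² H - l V`. -/
lemma quad_sq_le (hG : G.PosDef) (hH : Hᵀ = H) (w : Fin n → ℝ) :
    (w ⬝ᵥ H *ᵥ w) ^ 2 ≤ (w ⬝ᵥ G *ᵥ w) ^ 2 * (G⁻¹ * H * G⁻¹ * H).trace := by
  have hu : IsUnit G.det := hG.det_pos.ne'.isUnit
  have hs : Gᵀ = G := by simpa using hG.isHermitian.eq
  set N := w ⬝ᵥ G *ᵥ w with hN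
  set l := w ⬝ᵥ H *ᵥ w with hl
  set V := Matrix.vecMulVec (G *ᵥ w) (G *ᵥ w) with hV
  have hVt : Vᵀ = V := by rw [hV, Matrix.transpose_vecMulVec]
  have e1 : G⁻¹ *ᵥ G *ᵥ w = w := by
    rw [Matrix.mulVec_mulVec, Matrix.nonsing_inv_mul _ hu, Matrix.one_mulVec]
  have hGV : G⁻¹ * V = Matrix.vecMulVec w (G *ᵥ w) := by rw [hV, Matrix.mul_vecMulVec, e1]
  have t1 : (G⁻¹ * V * (G⁻¹ * V)).trace = N ^ 2 := by
    rw [hGV, Matrix.vecMulVec_mul_vecMulVec, Matrix.vecMulVec_smul, Matrix.trace_smul,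
      Matrix.trace_vecMulVec, smul_eq_mul, dotProduct_comm (G *ᵥ w), ← hN, pow_two]
  have t2 : (G⁻¹ * H * (G⁻¹ * V)).trace = l := by
    have e2 : (G⁻¹ *ᵥ H *ᵥ w) ⬝ᵥ G *ᵥ w = (H *ᵥ w) ⬝ᵥ G⁻¹ *ᵥ G *ᵥ w := by
      rw [Matrix.dotProduct_mulVec, Matrix.dotProduct_mulVec, Matrix.dotProduct_mulVec,
        ← Matrix.mulVec_transpose G⁻¹, Matrix.transpose_nonsing_inv, hs]
    rw [hGV, Matrix.mul_vecMulVec, Matrix.trace_vecMulVec, ← Matrix.mulVec_mulVec, e2, e1, dotProduct_comm]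
  have h := trace_sq_nonneg hG.inv.posSemidef (Y := N ^ 2 • H - l • V) (by
    rw [Matrix.transpose_sub, Matrix.transpose_smul, Matrix.transpose_smul, hH, hVt])
  have t3 : (G⁻¹ * V * (G⁻¹ * H)).trace = l := by rw [Matrix.trace_mul_comm, t2]
  have e : G⁻¹ * (N ^ 2 • H - l • V) * G⁻¹ * (N ^ 2 • H - l • V) = N ^ 4 • (G⁻¹ * H * G⁻¹ * H)
      - (N ^ 2 * l) • (G⁻¹ * H * (G⁻¹ * V)) - (N ^ 2 * l) • (G⁻¹ * V * (G⁻¹ * H))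
      + l ^ 2 • (G⁻¹ * V * (G⁻¹ * V)) := by
    simp only [Matrix.mul_sub, Matrix.sub_mul, Matrix.smul_mul, Matrix.mul_smul, Matrix.mul_assoc]
    module
  rw [e, Matrix.trace_add, Matrix.trace_sub, Matrix.trace_sub] at h
  simp only [Matrix.trace_smul, t1, t2, t3, smul_eq_mul] at h
  rcases eq_or_ne w 0 with h0 | h0
  · rw [hl, h0]; simp [hN, h0]
  have hNp : 0 < N := by simpa using hG.dotProduct_mulVec_pos h0
  have h4 : 0 ≤ N ^ 2 * (N ^ 2 * (G⁻¹ * H * G⁻¹ * H).trace - l ^ 2) := by linarith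
  linarith [nonneg_of_mul_nonneg_right h4 (by positivity)]

/-- The trace-free part of `H` has nonnegative square norm. -/
lemma trace_sq_le (hG : G.PosDef) (hH : Hᵀ = H) :
    (G⁻¹ * H).trace ^ 2 ≤ n * (G⁻¹ * H * G⁻¹ * H).trace := by
  have hu : IsUnit G.det := hG.det_pos.ne'.isUnit
  have hs : Gᵀ = G := by simpa using hG.isHermitian.eq
  rcases Nat.eq_zero_or_pos n with h0 | h0
  · subst h0; simp [Matrix.trace]
  have hn : (0 : ℝ) < n := by exact_mod_cast h0
  set τ := (G⁻¹ * H).trace with hτ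
  have h := trace_sq_nonneg hG.inv.posSemidef (Y := H - (τ / n) • G) (by
    rw [Matrix.transpose_sub, Matrix.transpose_smul, hH, hs])
  have e : G⁻¹ * (H - (τ / n) • G) * G⁻¹ * (H - (τ / n) • G)
      = G⁻¹ * H * G⁻¹ * H - (2 * (τ / n)) • (G⁻¹ * H) + (τ / n) ^ 2 • 1 := by
    have e1 : G⁻¹ * (H - (τ / n) • G) = G⁻¹ * H - (τ / n) • 1 := by
      rw [Matrix.mul_sub, Matrix.mul_smul, Matrix.nonsing_inv_mul _ hu]
    rw [Matrix.mul_assoc _ G⁻¹, e1, Matrix.mul_assoc (G⁻¹ * H) G⁻¹]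
    simp only [Matrix.mul_sub, Matrix.sub_mul, Matrix.smul_mul, Matrix.mul_smul, Matrix.one_mul, Matrix.mul_one]
    module
  rw [e, Matrix.trace_add, Matrix.trace_sub, Matrix.trace_smul, Matrix.trace_smul, Matrix.trace_one,
    Fintype.card_fin, ← hτ, smul_eq_mul, smul_eq_mul] at h
  have h2 : (τ / n) * n = τ := div_mul_cancel₀ _ hn.ne'
  have h3 : (G⁻¹ * H * G⁻¹ * H).trace - 2 * (τ / n) * τ + (τ / n) ^ 2 * n
      = (G⁻¹ * H * G⁻¹ * H).trace - τ ^ 2 / n := by field_simp; ring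
  rw [h3, sub_nonneg, div_le_iff₀ hn] at h
  linarith

end Algebra

end

section

variable {n : ℕ}

/-! ### Pointwise bounds -/

/-- The square of the length of the Hessian. -/
def hessSq (G : Euc n → Matrix (Fin n) (Fin n) ℝ) (f : Euc n → ℝ) (y : Euc n) : ℝ :=
  ((G y)⁻¹ * hessian G f y * (G y)⁻¹ * hessian G f y).trace

section Pointwise

variable {D : Set (Euc n)} {G : Euc n → Matrix (Fin n) (Fin n) ℝ} {f : Euc n → ℝ} {y : Euc n} {a b c : ℝ}

lemma hessian_symm (h : IsMetricOn D G) (hy : y ∈ D)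
    (hf : ContDiffAt ℝ ∞ f y) : (hessian G f y)ᵀ = hessian G f y := by
  ext i j
  simp only [Matrix.transpose_apply, hessian, Matrix.of_apply]
  rw [pd_comm i j hf]
  exact congrArg _ (Finset.sum_congr rfl fun k _ => by rw [christoffel_symm h hy])

lemma gradSq_nonneg (h : IsMetricOn D G) (hy : y ∈ D) : 0 ≤ gradSq G f y := by
  have := (h.posDef y hy).inv.posSemidef.dotProduct_mulVec_nonneg (grad f y)
  rwa [star_trivial] at this

lemma trace_inv_mul_Wmat (h : IsMetricOn D G) (hy : y ∈ D) : ((G y)⁻¹ * Wmat G f y).trace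
    = ((G y)⁻¹ * schouten G y).trace + ((G y)⁻¹ * hessian G f y).trace + (1 - n / 2) * gradSq G f y := by
  rw [Wmat, Matrix.mul_sub, Matrix.mul_add, Matrix.mul_add, Matrix.trace_sub, Matrix.trace_add,
    Matrix.trace_add, trace_inv_mul_vecMulVec, Matrix.mul_smul, Matrix.nonsing_inv_mul _ (h.isUnit_det hy),
    Matrix.trace_smul, Matrix.trace_one, Fintype.card_fin, ← gradSq, smul_eq_mul]
  ring

/-- The upper bound `∇²f ≤ (c - |∇f|²) G` bounds the Laplacian above by `n(c - |∇f|²)`, whereas `σ₁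
> 0` bounds it below by `-a` when `n ≥ 2`. Together they bound the gradient. Moreover `cG - ∇²f` is
positive semidefinite with trace at most `nc + a`, so its norm, and with it that of the Hessian, is
controlled. -/
lemma bounds_of_quadBar (h : IsMetricOn D G) (hy : y ∈ D)
    (hn : 2 ≤ n) (hf : ContDiffAt ℝ ∞ f y) (hQ : ∀ w, quadBar G c f y w ≤ 0)
    (hσ : 0 < sigma1 ((G y)⁻¹ * Wmat G f y)) (ha : |((G y)⁻¹ * schouten G y).trace| ≤ a) (hc : 0 ≤ c) :
    gradSq G f y ≤ c + a ∧ hessSq G f y ≤ n * c ^ 2 + n ^ 2 * (n * c + a) ^ 2 := by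
  have hG := h.posDef y hy
  have hu := h.isUnit_det hy
  have hg := gradSq_nonneg (f := f) h hy
  have hHt := hessian_symm h hy hf
  have hGt := h.symm hy
  set g := gradSq G f y with hgd
  set H := hessian G f y with hH
  have psd : ∀ t, c - g ≤ t → (t • G y - H).PosSemidef := by
    intro t ht
    refine Matrix.PosSemidef.of_dotProduct_mulVec_nonneg ?_ fun w => ?_
    · rw [Matrix.IsHermitian, Matrix.conjTranspose_eq_transpose_of_trivial, Matrix.transpose_sub,
        Matrix.transpose_smul, hGt, hHt]
    · have h1 := hQ w
      have h2 := hG.posSemidef.dotProduct_mulVec_nonneg w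
      rw [star_trivial] at h2 ⊢
      rw [quadBar, ← hgd, ← hH] at h1
      rw [Matrix.sub_mulVec, Matrix.smul_mulVec, dotProduct_sub, dotProduct_smul, smul_eq_mul]
      nlinarith
  have tr : ∀ t : ℝ, ((G y)⁻¹ * (t • G y - H)).trace = n * t - ((G y)⁻¹ * H).trace := by
    intro t
    rw [Matrix.mul_sub, Matrix.mul_smul, Matrix.nonsing_inv_mul _ hu, Matrix.trace_sub, Matrix.trace_smul,
      Matrix.trace_one, Fintype.card_fin, smul_eq_mul]
    ring
  have h1 := trace_inv_mul_nonneg hG (psd (c - g) le_rfl)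
  rw [tr] at h1
  have hσ' : 0 < ((G y)⁻¹ * schouten G y).trace + ((G y)⁻¹ * H).trace + (1 - n / 2) * g := by
    rw [← trace_inv_mul_Wmat h hy]; exact hσ
  set τ := ((G y)⁻¹ * H).trace with hτ
  have ha1 := (abs_le.1 ha).2
  have ha0 : 0 ≤ a := (abs_nonneg _).trans ha
  have hn' : (2 : ℝ) ≤ n := by exact_mod_cast hn
  have h2 : 0 ≤ (n / 2 - 1 : ℝ) * g := mul_nonneg (by linarith) hg
  constructor
  · have h3 : (n : ℝ) * g ≤ n * (c + a) := by nlinarith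
    exact le_of_mul_le_mul_left h3 (by linarith)
  · have hP := psd c (by linarith)
    have h3 := trace_inv_mul_nonneg hG hP
    have h4 := trace_sq_le_of_posSemidef hG hP
    rw [tr] at h3 h4
    have h5 : n * c - τ ≤ n * c + a := by linarith
    have e : (G y)⁻¹ * (c • G y - H) * (G y)⁻¹ * (c • G y - H)
        = (G y)⁻¹ * H * (G y)⁻¹ * H - (2 * c) • ((G y)⁻¹ * H) + c ^ 2 • 1 := by
      have e1 : (G y)⁻¹ * (c • G y - H) = c • 1 - (G y)⁻¹ * H := by
        rw [Matrix.mul_sub, Matrix.mul_smul, Matrix.nonsing_inv_mul _ hu]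
      rw [Matrix.mul_assoc _ (G y)⁻¹, e1, Matrix.mul_assoc ((G y)⁻¹ * H) (G y)⁻¹]
      simp only [Matrix.mul_sub, Matrix.sub_mul, Matrix.smul_mul, Matrix.mul_smul, Matrix.one_mul, Matrix.mul_one]
      module
    rw [e, Matrix.trace_add, Matrix.trace_sub, Matrix.trace_smul, Matrix.trace_smul, Matrix.trace_one,
      Fintype.card_fin, ← hτ, smul_eq_mul, smul_eq_mul] at h4
    have h6 : (n : ℝ) ^ 2 * (n * c - τ) ^ 2 ≤ n ^ 2 * (n * c + a) ^ 2 :=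
      mul_le_mul_of_nonneg_left (pow_le_pow_left₀ h3 h5 2) (by positivity)
    have h7 : 0 ≤ c * (n * c - τ) := mul_nonneg hc h3
    rw [hessSq, ← hH]
    nlinarith

/-- Supplies the barrier bound at the initial time from the `C²` norm. -/
lemma quadBar_nonpos_of_bounds (h : IsMetricOn D G) (hy : y ∈ D)
    (hf : ContDiffAt ℝ ∞ f y) (hb : 0 ≤ b) (h1 : gradSq G f y ≤ b ^ 2)
    (h2 : hessSq G f y ≤ b ^ 2) (w : Fin n → ℝ) : quadBar G (b + b ^ 2) f y w ≤ 0 := by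
  have hG := h.posDef y hy
  have hN := hG.posSemidef.dotProduct_mulVec_nonneg w
  rw [star_trivial] at hN
  have h3 := quad_sq_le hG (hessian_symm h hy hf) w
  have h4 : (w ⬝ᵥ hessian G f y *ᵥ w) ^ 2 ≤ ((w ⬝ᵥ G y *ᵥ w) * b) ^ 2 := by
    rw [mul_pow]
    exact h3.trans (mul_le_mul_of_nonneg_left h2 (sq_nonneg _))
  have h5 := (abs_le_of_sq_le_sq' h4 (mul_nonneg hN hb)).2
  rw [quadBar]
  nlinarith

lemma sigma2_le_of_bounds (h : IsMetricOn D G) (hy : y ∈ D)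
    (hn : 2 ≤ n) (hf : ContDiffAt ℝ ∞ f y) (hb : 0 ≤ b) (h1 : gradSq G f y ≤ b ^ 2)
    (h2 : hessSq G f y ≤ b ^ 2) (ha : |((G y)⁻¹ * schouten G y).trace| ≤ a) :
    sigma2 ((G y)⁻¹ * Wmat G f y) ≤ (a + n * b + n * b ^ 2) ^ 2 := by
  have hG := h.posDef y hy
  have h3 := trace_sq_nonneg hG.inv.posSemidef (Wmat_symm h hy hf)
  have h4 := trace_sq_le hG (hessian_symm h hy hf)
  rw [← hessSq] at h4
  have hn' : (2 : ℝ) ≤ n := by exact_mod_cast hn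
  have hg := gradSq_nonneg (f := f) h hy
  have h5 : ((G y)⁻¹ * hessian G f y).trace ^ 2 ≤ (n * b) ^ 2 := by
    refine h4.trans ?_
    have : (n : ℝ) * hessSq G f y ≤ n * b ^ 2 := mul_le_mul_of_nonneg_left h2 (by linarith)
    nlinarith [sq_nonneg b]
  have h6 := abs_le_of_sq_le_sq h5 (by positivity)
  have h7 : |(1 - n / 2 : ℝ) * gradSq G f y| ≤ n * b ^ 2 := by
    refine abs_mul_le' ?_ (by rwa [abs_of_nonneg hg])
    rw [abs_le]; constructor <;> linarith
  have h8 : |((G y)⁻¹ * Wmat G f y).trace| ≤ a + n * b + n * b ^ 2 := by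
    rw [trace_inv_mul_Wmat h hy]
    exact (abs_add_three _ _ _).trans (by linarith)
  have h9 := sq_le_sq' (abs_le.1 h8).1 (abs_le.1 h8).2
  rw [sigma2, ← Matrix.mul_assoc]
  nlinarith [sq_nonneg ((G y)⁻¹ * Wmat G f y).trace]

/-- The Euclidean gradient is controlled by the Riemannian one. -/
lemma abs_fderiv_le (h : IsMetricOn D G) (hy : y ∈ D)
    {B L : ℝ} (hB : ∀ i j, |G y i j| ≤ B) (hL : 0 ≤ L) (hg : gradSq G f y ≤ L ^ 2) :
    ‖fderiv ℝ f y‖ ≤ (n * B + 1) * L := by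
  have hG := h.posDef y hy
  by_cases hn0 : n = 0
  · subst hn0
    have : fderiv ℝ f y = 0 := Subsingleton.elim _ _
    rw [this, norm_zero]; push_cast; linarith
  have hB0 : 0 ≤ B := (abs_nonneg _).trans (hB ⟨0, by omega⟩ ⟨0, by omega⟩)
  have hnB : (0 : ℝ) ≤ n * B := by positivity
  refine ContinuousLinearMap.opNorm_le_bound _ (by positivity) fun w => ?_
  rw [fderiv_eq_sum_pd]
  have h1 := dotProduct_sq_le hG (fun i => w i) (grad f y)
  have h2 : (fun i => w i) ⬝ᵥ G y *ᵥ (fun i => w i) ≤ (n * B) * ‖w‖ ^ 2 := by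
    rw [EuclideanSpace.norm_sq_eq]
    simp only [dotProduct, Matrix.mulVec, Finset.mul_sum, Real.norm_eq_abs, sq_abs]
    have h3 : ∀ i j, w i * (G y i j * w j) ≤ B * (w i ^ 2 / 2 + w j ^ 2 / 2) := by
      intro i j
      have h4 : |w i * (G y i j * w j)| ≤ |w i| * (B * |w j|) := by
        rw [abs_mul, abs_mul]
        exact mul_le_mul_of_nonneg_left (mul_le_mul_of_nonneg_right (hB i j) (abs_nonneg _)) (abs_nonneg _)
      have h5 := le_abs_self (w i * (G y i j * w j))
      have h6 : |w i| * |w j| ≤ w i ^ 2 / 2 + w j ^ 2 / 2 := by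
        nlinarith [sq_nonneg (|w i| - |w j|), sq_abs (w i), sq_abs (w j)]
      nlinarith [mul_le_mul_of_nonneg_left h6 hB0]
    refine (Finset.sum_le_sum fun i _ => Finset.sum_le_sum fun j _ => h3 i j).trans (le_of_eq ?_)
    simp only [← Finset.mul_sum, Finset.sum_add_distrib, Finset.sum_const, Finset.card_univ,
      Fintype.card_fin, nsmul_eq_mul, ← Finset.sum_div]
    ring
  have h3 : ((fun i => w i) ⬝ᵥ grad f y) ^ 2 ≤ ((n * B + 1) * L * ‖w‖) ^ 2 := by
    have h4 : 0 ≤ (fun i => w i) ⬝ᵥ G y *ᵥ (fun i => w i) := by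
      have := hG.posSemidef.dotProduct_mulVec_nonneg (fun i => w i); rwa [star_trivial] at this
    calc _ ≤ gradSq G f y * ((fun i => w i) ⬝ᵥ G y *ᵥ (fun i => w i)) := h1
      _ ≤ L ^ 2 * ((n * B) * ‖w‖ ^ 2) := mul_le_mul hg h2 h4 (sq_nonneg _)
      _ ≤ L ^ 2 * ((n * B + 1) ^ 2 * ‖w‖ ^ 2) := by
        refine mul_le_mul_of_nonneg_left (mul_le_mul_of_nonneg_right ?_ (sq_nonneg _)) (sq_nonneg _)
        nlinarith
      _ = _ := by ring
  exact abs_le_of_sq_le_sq h3 (by positivity)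

end Pointwise

/-! ### The `C²` norm -/

section Norm

variable {M : Type*} [TopologicalSpace M] [ChartedSpace (EuclideanSpace ℝ (Fin n)) M]
  {g : BilinField n M} {v : M → ℝ}

lemma gradNorm_eq (x : M) :
    gradNorm g v x = Real.sqrt (gradSq (coeff g x) (inChart x v) (extChartAt (𝓡 n) x x)) := by
  rw [gradNorm, gradSq]
  congr 1
  simp only [dotProduct, Matrix.mulVec, grad, Finset.mul_sum]
  exact Finset.sum_congr rfl fun i _ => Finset.sum_congr rfl fun j _ => by ring

lemma hessNorm_eq (hg : IsMetric g) (hv : SmoothInCharts (n := n) v) (x : M) :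
    hessNorm g v x = Real.sqrt (hessSq (coeff g x) (inChart x v) (extChartAt (𝓡 n) x x)) := by
  rw [hessNorm, hessSq]
  have hx : extChartAt (𝓡 n) x x ∈ (extChartAt (𝓡 n) x).target := mem_extChartAt_target x
  have e : ∀ i j, hessian (coeff g x) (inChart x v) (extChartAt (𝓡 n) x x) i j
      = hessian (coeff g x) (inChart x v) (extChartAt (𝓡 n) x x) j i := fun i j =>
    (congrFun (congrFun (hessian_symm (hg x) hx (hv x _ hx)) j) i)
  have e2 : ∀ i j, (coeff g x (extChartAt (𝓡 n) x x))⁻¹ i j = (coeff g x (extChartAt (𝓡 n) x x))⁻¹ j i := by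
    intro i j
    have : ((coeff g x (extChartAt (𝓡 n) x x))⁻¹)ᵀ = (coeff g x (extChartAt (𝓡 n) x x))⁻¹ := by
      rw [Matrix.transpose_nonsing_inv, (hg x).symm hx]
    exact congrFun (congrFun this j) i
  congr 1
  set A := (coeff g x (extChartAt (𝓡 n) x x))⁻¹
  set H := hessian (coeff g x) (inChart x v) (extChartAt (𝓡 n) x x)
  have e3 : (A * H * A * H).trace = ∑ k, ∑ j, (∑ i, A k i * H i j) * ∑ l, A j l * H l k := by
    rw [Matrix.mul_assoc (A * H)]
    simp only [Matrix.trace, Matrix.diag, Matrix.mul_apply (M := A * H), Matrix.mul_apply (M := A)]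
  rw [e3]
  simp only [Finset.sum_mul_sum]
  calc _ = ∑ i, ∑ k, ∑ j, ∑ l, A i k * A j l * H i j * H k l :=
        Finset.sum_congr rfl fun i _ => Finset.sum_comm
    _ = ∑ k, ∑ i, ∑ j, ∑ l, A i k * A j l * H i j * H k l := Finset.sum_comm
    _ = ∑ k, ∑ j, ∑ i, ∑ l, A i k * A j l * H i j * H k l :=
        Finset.sum_congr rfl fun k _ => Finset.sum_comm
    _ = _ := Finset.sum_congr rfl fun k _ => Finset.sum_congr rfl fun j _ => Finset.sum_congr rfl fun i _ =>
        Finset.sum_congr rfl fun l _ => by rw [e2 i k, e k l]; ring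

lemma bounds_of_c2Norm_le {Λ : ℝ} (hv : c2Norm g v ≤ ENNReal.ofReal Λ) (x : M) :
    |v x| ≤ max Λ 0 ∧ gradNorm g v x ≤ max Λ 0 ∧ hessNorm g v x ≤ max Λ 0 := by
  have key : ∀ t : ℝ, ENNReal.ofReal t ≤ c2Norm g v → t ≤ max Λ 0 := by
    intro t ht
    rcases le_or_gt t 0 with h0 | h0
    · exact h0.trans (le_max_right _ _)
    · exact ((ENNReal.ofReal_le_ofReal_iff' .. |>.1 (ht.trans hv)).resolve_right (not_le.2 h0)).trans
        (le_max_left _ _)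
  refine ⟨key _ ?_, key _ ?_, key _ ?_⟩
  · exact (le_iSup (fun x => ENNReal.ofReal |v x|) x).trans (le_add_right (le_add_right le_rfl))
  · exact (le_iSup (fun x => ENNReal.ofReal (gradNorm g v x)) x).trans (le_add_right (le_add_left le_rfl))
  · exact (le_iSup (fun x => ENNReal.ofReal (hessNorm g v x)) x).trans (le_add_left le_rfl)

lemma c2Norm_le {A B C : ℝ} (hA : 0 ≤ A) (hB : 0 ≤ B) (hC : 0 ≤ C) (h0 : ∀ x, |v x| ≤ A)
    (h1 : ∀ x, gradNorm g v x ≤ B) (h2 : ∀ x, hessNorm g v x ≤ C) :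
    c2Norm g v ≤ ENNReal.ofReal (A + B + C) := by
  rw [ENNReal.ofReal_add (add_nonneg hA hB) hC, ENNReal.ofReal_add hA hB]
  exact add_le_add (add_le_add (iSup_le fun x => ENNReal.ofReal_le_ofReal (h0 x))
    (iSup_le fun x => ENNReal.ofReal_le_ofReal (h1 x))) (iSup_le fun x => ENNReal.ofReal_le_ofReal (h2 x))

end Norm

end

section

variable {n : ℕ} {M : Type*} [TopologicalSpace M] [ChartedSpace (EuclideanSpace ℝ (Fin n)) M]

/-! ### Consequences of a gradient bound -/

/-- The bound `|∇v| ≤ L`. -/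
def GradBound (g : BilinField n M) (L : ℝ) (v : M → ℝ) : Prop :=
  ∀ p : M, ∀ y ∈ (extChartAt (𝓡 n) p).target, gradSq (coeff g p) (inChart p v) y ≤ L ^ 2

lemma exists_finite_compacts [CompactSpace M] : ∃ (S : Finset M) (K : M → Set (Euc n)),
    (∀ p, IsCompact (K p)) ∧ (∀ p, K p ⊆ (extChartAt (𝓡 n) p).target) ∧
    (∀ p, extChartAt (𝓡 n) p p ∈ K p) ∧
    ∀ x : M, ∃ p ∈ S, x ∈ (extChartAt (𝓡 n) p).source ∧ extChartAt (𝓡 n) p x ∈ K p := by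
  have h := fun p : M => exists_compact_subset (isOpen_extChartAt_target (I := 𝓡 n) p)
    (mem_extChartAt_target p)
  choose K hK hpK hKt using h
  obtain ⟨S, hS⟩ := CompactSpace.elim_nhds_subcover
    (fun p : M => (extChartAt (𝓡 n) p).source ∩ extChartAt (𝓡 n) p ⁻¹' interior (K p))
    fun p => ((continuousOn_extChartAt p).isOpen_inter_preimage (isOpen_extChartAt_source p)
      isOpen_interior).mem_nhds ⟨mem_extChartAt_source p, hpK p⟩
  refine ⟨S, K, hK, hKt, fun p => interior_subset (hpK p), fun x => ?_⟩
  have hx : x ∈ ⋃ p ∈ S, (extChartAt (𝓡 n) p).source ∩ extChartAt (𝓡 n) p ⁻¹' interior (K p) := by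
    rw [hS]; trivial
  obtain ⟨p, hp, hx⟩ := mem_iUnion₂.1 hx
  exact ⟨p, hp, hx.1, interior_subset hx.2⟩

variable [IsManifold (𝓡 n) ∞ M]

section Metric

variable (g₀ : Bundle.ContMDiffRiemannianMetric (𝓡 n) ∞ (EuclideanSpace ℝ (Fin n))
  (fun x : M => TangentSpace (𝓡 n) x))

/-- Near a compact subset of a chart the metric is comparable with the Euclidean one, so a gradient
bound is a Lipschitz bound on small coordinate balls. Radius, Lipschitz factor and lower density
bound are uniform over the compact set and over all functions. -/
lemma exists_lipschitz (p : M) {K : Set (Euc n)} (hK : IsCompact K) (hKt : K ⊆ (extChartAt (𝓡 n) p).target) :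
    ∃ ρ A d : ℝ, 0 < ρ ∧ 0 < A ∧ 0 < d ∧ ∀ y ∈ K, ∀ z ∈ Metric.ball y ρ,
      z ∈ (extChartAt (𝓡 n) p).target ∧ d ≤ density g₀.inner p z ∧
      ∀ (v : M → ℝ) (L : ℝ), SmoothInCharts (n := n) v → 0 ≤ L → GradBound g₀.inner L v →
        |inChart p v z - inChart p v y| ≤ A * L * ‖z - y‖ := by
  obtain ⟨ρ, hρ, hρt⟩ := hK.exists_cthickening_subset_open (isOpen_extChartAt_target p) hKt
  have hK' : IsCompact (Metric.cthickening ρ K) := hK.cthickening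
  have hb : ∀ y ∈ K, Metric.ball y ρ ⊆ Metric.cthickening ρ K := fun y hy z hz =>
    Metric.mem_cthickening_of_dist_le z y ρ K hy (Metric.mem_ball.1 hz).le
  have hm := isMetricOn_coeff g₀ p
  obtain ⟨B, hB⟩ : ∃ B, ∀ z ∈ Metric.cthickening ρ K, ∀ i j, |coeff g₀.inner p z i j| ≤ B := by
    have h1 : ∀ i j, ∃ B, ∀ z ∈ Metric.cthickening ρ K, ‖coeff g₀.inner p z i j‖ ≤ B := fun i j =>
      hK'.exists_bound_of_continuousOn (((contDiffOn_coeff g₀ p i j).continuousOn).mono hρt)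
    choose B hB using h1
    refine ⟨∑ i, ∑ j, |B i j|, fun z hz i j => ?_⟩
    calc |coeff g₀.inner p z i j| ≤ |B i j| := (hB i j z hz).trans (le_abs_self _)
      _ ≤ ∑ j, |B i j| := Finset.single_le_sum (f := fun j => |B i j|) (fun _ _ => abs_nonneg _) (Finset.mem_univ j)
      _ ≤ _ := Finset.single_le_sum (f := fun i => ∑ j, |B i j|)
        (fun _ _ => Finset.sum_nonneg fun _ _ => abs_nonneg _) (Finset.mem_univ i)
  obtain ⟨d, hd, hd'⟩ : ∃ d : ℝ, 0 < d ∧ ∀ z ∈ Metric.cthickening ρ K, d ≤ density g₀.inner p z := by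
    rcases (Metric.cthickening ρ K).eq_empty_or_nonempty with he | hne
    · exact ⟨1, one_pos, by simp [he]⟩
    · obtain ⟨z, hz, hmin⟩ := hK'.exists_isMinOn hne ((contDensity_metric g₀ p).mono hρt)
      exact ⟨_, density_pos g₀ (hρt hz), fun w hw => hmin hw⟩
  refine ⟨ρ, |n * B + 1| + 1, d, hρ, by positivity, hd, fun y hy z hz =>
    ⟨hρt (hb y hy hz), hd' z (hb y hy hz), fun v L hv hL hg => ?_⟩⟩
  refine Convex.norm_image_sub_le_of_norm_fderiv_le (𝕜 := ℝ) (s := Metric.ball y ρ)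
    (fun w hw => (hv p w (hρt (hb y hy hw))).differentiableAt (by simp)) (fun w hw => ?_)
    (convex_ball y ρ) (Metric.mem_ball_self hρ) hz
  have hwt := hρt (hb y hy hw)
  refine (abs_fderiv_le hm hwt (hB w (hb y hy hw)) hL (hg p w hwt)).trans ?_
  exact mul_le_mul_of_nonneg_right ((le_abs_self _).trans (by linarith)) hL

/-- The points at which the difference from a base value is bounded uniformly over all admissible
`v` form an open and closed set, hence everything by connectedness. A finite cover makes the bound
uniform. No Riemannian distance is used. -/
lemma exists_osc_bound [CompactSpace M] [ConnectedSpace M] {L : ℝ} (hL : 0 ≤ L) :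
    ∃ C : ℝ, 0 ≤ C ∧ ∀ v : M → ℝ, SmoothInCharts (n := n) v → GradBound g₀.inner L v →
      ∀ x y, v x ≤ v y + C := by
  have h1 : ∀ p : M, ∃ U ∈ 𝓝 p, ∃ c : ℝ, ∀ v : M → ℝ, SmoothInCharts (n := n) v → GradBound g₀.inner L v →
      ∀ z ∈ U, |v z - v p| ≤ c := by
    intro p
    obtain ⟨ρ, A, d, hρ, hA, -, h⟩ := exists_lipschitz g₀ p (isCompact_singleton (x := extChartAt (𝓡 n) p p))
      (singleton_subset_iff.2 (mem_extChartAt_target p))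
    refine ⟨(extChartAt (𝓡 n) p).source ∩ extChartAt (𝓡 n) p ⁻¹' Metric.ball (extChartAt (𝓡 n) p p) ρ,
      ((continuousOn_extChartAt p).isOpen_inter_preimage (isOpen_extChartAt_source p)
        Metric.isOpen_ball).mem_nhds ⟨mem_extChartAt_source p, Metric.mem_ball_self hρ⟩, A * L * ρ,
      fun v hv hg z hz => ?_⟩
    have h2 := (h _ rfl _ hz.2).2.2 v L hv hL hg
    rw [inChart, inChart, extChartAt_to_inv, (extChartAt (𝓡 n) p).left_inv hz.1] at h2
    refine h2.trans (mul_le_mul_of_nonneg_left ?_ (by positivity))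
    exact (mem_ball_iff_norm.1 hz.2).le
  choose U hU c hc using h1
  obtain ⟨x₀⟩ := (inferInstance : Nonempty M)
  set E : Set M := {y | ∃ C : ℝ, ∀ v : M → ℝ, SmoothInCharts (n := n) v → GradBound g₀.inner L v →
    |v y - v x₀| ≤ C} with hE
  have hEo : IsOpen E := by
    refine isOpen_iff_mem_nhds.2 fun y ⟨C, hC⟩ => mem_of_superset (hU y) fun z hz => ?_
    exact ⟨c y + C, fun v hv hg => (abs_sub_le _ (v y) _).trans (add_le_add (hc y v hv hg z hz) (hC v hv hg))⟩
  have hEc : IsClosed E := by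
    refine ⟨isOpen_iff_mem_nhds.2 fun y hy => mem_of_superset (hU y) fun z hz => ?_⟩
    rintro ⟨C, hC⟩
    refine hy ⟨c y + C, fun v hv hg => (abs_sub_le _ (v z) _).trans (add_le_add ?_ (hC v hv hg))⟩
    rw [abs_sub_comm]; exact hc y v hv hg z hz
  have hEu : E = univ := IsClopen.eq_univ ⟨hEc, hEo⟩ ⟨x₀, 0, fun v _ _ => by simp⟩
  have h2 : ∀ y, y ∈ E := fun y => hEu ▸ mem_univ y
  choose C hC using h2
  obtain ⟨S, hS⟩ := CompactSpace.elim_nhds_subcover U hU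
  set B := ∑ p ∈ S, (|c p| + |C p|) with hB
  have hB0 : 0 ≤ B := Finset.sum_nonneg fun p _ => by positivity
  have h3 : ∀ v : M → ℝ, SmoothInCharts (n := n) v → GradBound g₀.inner L v → ∀ z, |v z - v x₀| ≤ B := by
    intro v hv hg z
    have hz : z ∈ ⋃ p ∈ S, U p := by rw [hS]; trivial
    obtain ⟨p, hp, hzp⟩ := mem_iUnion₂.1 hz
    calc |v z - v x₀| ≤ |c p| + |C p| := (abs_sub_le _ (v p) _).trans
          (add_le_add ((hc p v hv hg z hzp).trans (le_abs_self _)) ((hC p v hv hg).trans (le_abs_self _)))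
      _ ≤ B := Finset.single_le_sum (f := fun p => |c p| + |C p|) (fun p _ => by positivity) hp
  refine ⟨2 * B, by positivity, fun v hv hg x y => ?_⟩
  have hx := abs_le.1 (h3 v hv hg x)
  have hy := abs_le.1 (h3 v hv hg y)
  linarith [hx.2, hy.1]

/-- For the zero conformal factor this trace is the scalar `σ₁` of the background metric, a
continuous function on a compact manifold. -/
lemma exists_schouten_bound (hn : 2 < n) [CompactSpace M] :
    ∃ a : ℝ, 0 ≤ a ∧ ∀ p : M, ∀ y ∈ (extChartAt (𝓡 n) p).target,
      |((coeff g₀.inner p y)⁻¹ * schouten (coeff g₀.inner p) y).trace| ≤ a := by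
  have h0 : FamSmooth n univ (fun _ (_ : M) => (0 : ℝ)) := fun p => JSmooth.const 0
  have hc := ((famSmooth_sig (g₀ := g₀) hn uniqueDiffOn_univ h0).1.slice (mem_univ 0)).continuous
  obtain ⟨a, ha⟩ := isCompact_univ.exists_bound_of_continuousOn hc.continuousOn
  refine ⟨|a|, abs_nonneg _, fun p y hy => ?_⟩
  have h1 := (sig_conformal g₀ hn (h0.slice (mem_univ 0)) hy).1
  have h2 : s1 g₀.inner (fun _ => 0) p y = ((coeff g₀.inner p y)⁻¹ * schouten (coeff g₀.inner p) y).trace := by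
    have hz : inChart p (fun _ : M => (0 : ℝ)) = (fun _ : Euc n => (0 : ℝ)) := rfl
    have hg : gradSq (coeff g₀.inner p) (fun _ => 0) y = 0 := by
      have : grad (fun _ : Euc n => (0 : ℝ)) y = 0 := funext fun i => pd_const i 0 y
      rw [gradSq, this, zero_dotProduct]
    rw [s1, sigma1, trace_inv_mul_Wmat (isMetricOn_coeff g₀ p) hy, hz, hg, hessian_zero]
    simp
  rw [h2, show inChart p (fun _ : M => (0 : ℝ)) y = 0 from rfl, mul_zero, Real.exp_zero, one_mul] at h1
  rw [← h1]
  exact (ha _ (mem_univ _)).trans (le_abs_self a)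

/-- A lower bound for the weighted volume in terms of a value and a gradient bound. -/
lemma exists_volume_bound [CompactSpace M] [MeasurableSpace M] [BorelSpace M] {b : ℝ} (hb : 0 ≤ b) :
    ∃ κ : ℝ, 0 < κ ∧ ∀ (v : M → ℝ) (L : ℝ), SmoothInCharts (n := n) v → 1 ≤ L → GradBound g₀.inner L v →
      ∀ x, κ * Real.exp (-b * v x) * (L⁻¹) ^ n ≤ ∫ z, Real.exp (-b * v z) ∂(vol g₀.inner) := by
  obtain ⟨S, K, hK, hKt, -, hS⟩ := exists_finite_compacts (n := n) (M := M)
  have hfin := isFiniteMeasure_vol (contDensity_metric g₀)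
  have h1 : ∀ p : M, ∃ κ : ℝ, 0 < κ ∧ ∀ (v : M → ℝ) (L : ℝ), SmoothInCharts (n := n) v → 1 ≤ L →
      GradBound g₀.inner L v → ∀ x, x ∈ (extChartAt (𝓡 n) p).source → extChartAt (𝓡 n) p x ∈ K p →
      κ * Real.exp (-b * v x) * (L⁻¹) ^ n ≤ ∫ z, Real.exp (-b * v z) ∂(vol g₀.inner) := by
    intro p
    obtain ⟨ρ, A, d, hρ, hA, hd, h⟩ := exists_lipschitz g₀ p (hK p) (hKt p)
    -- On the coordinate ball of radius `ρ'/L` the Lipschitz bound lets `v` vary by at most 1. This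
    -- costs the factor `e^{-b}`, and the ball has volume of order `L^{-n}`.
    set ρ' := min ρ A⁻¹ with hρ'
    have hρ'0 : 0 < ρ' := lt_min hρ (inv_pos.2 hA)
    set θ := volume.real (Metric.ball (0 : Euc n) 1) with hθ
    have hθ0 : 0 < θ := ENNReal.toReal_pos (Metric.measure_ball_pos _ _ one_pos).ne' measure_ball_lt_top.ne
    refine ⟨Real.exp (-b) * (d * (ρ' ^ n * θ)), by positivity, fun v L hv hL hg x hx hxK => ?_⟩
    have hL0 : 0 < L := one_pos.trans_le hL
    set y := extChartAt (𝓡 n) p x with hy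
    set δ := ρ' * L⁻¹ with hδ
    have hδ0 : 0 < δ := by positivity
    have hδρ : δ ≤ ρ := by
      have : L⁻¹ ≤ 1 := inv_le_one_of_one_le₀ hL
      calc δ ≤ ρ' * 1 := mul_le_mul_of_nonneg_left this hρ'0.le
        _ ≤ ρ := by rw [mul_one]; exact min_le_left _ _
    have hδA : A * L * δ ≤ 1 := by
      have : A * ρ' ≤ 1 := by
        calc A * ρ' ≤ A * A⁻¹ := mul_le_mul_of_nonneg_left (min_le_right _ _) hA.le
          _ = 1 := mul_inv_cancel₀ hA.ne'
      calc A * L * δ = A * ρ' := by rw [hδ]; field_simp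
        _ ≤ 1 := this
    set s := (extChartAt (𝓡 n) p).source ∩ extChartAt (𝓡 n) p ⁻¹' Metric.ball y δ with hs
    have hso : IsOpen s := (continuousOn_extChartAt p).isOpen_inter_preimage (isOpen_extChartAt_source p)
      Metric.isOpen_ball
    have hball := Metric.ball_subset_ball (x := y) hδρ
    have hvs : ∀ z ∈ s, Real.exp (-b) * Real.exp (-b * v x) ≤ Real.exp (-b * v z) := by
      intro z hz
      have h2 := (h y hxK _ (hball hz.2)).2.2 v L hv hL0.le hg
      rw [inChart, inChart, (extChartAt (𝓡 n) p).left_inv hz.1, hy, (extChartAt (𝓡 n) p).left_inv hx] at h2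
      have h3 : A * L * ‖extChartAt (𝓡 n) p z - y‖ ≤ 1 :=
        (mul_le_mul_of_nonneg_left (mem_ball_iff_norm.1 hz.2).le (by positivity)).trans hδA
      have h4 := (abs_le.1 (h2.trans h3)).2
      rw [← Real.exp_add]
      exact Real.exp_le_exp.2 (by nlinarith)
    have hms : d * (ρ' ^ n * θ) * (L⁻¹) ^ n ≤ (vol g₀.inner).real s := by
      have h2 : ENNReal.ofReal d * volume (Metric.ball y δ) ≤ vol g₀.inner s := by
        refine le_trans ?_ (le_iSup (chartVol g₀.inner) p s)
        rw [chartVol_apply (contDensity_metric g₀) p hso.measurableSet, ← setLIntegral_const]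
        calc ∫⁻ _ in Metric.ball y δ, ENNReal.ofReal d
            ≤ ∫⁻ z in Metric.ball y δ, ENNReal.ofReal (density g₀.inner p z) :=
              setLIntegral_mono' measurableSet_ball fun z hz =>
                ENNReal.ofReal_le_ofReal (h y hxK z (hball hz)).2.1
          _ ≤ _ := by
              refine lintegral_mono_set fun z hz => ?_
              have hzt := (h y hxK z (hball hz)).1
              refine ⟨hzt, (extChartAt (𝓡 n) p).map_target hzt, ?_⟩
              rw [mem_preimage, (extChartAt (𝓡 n) p).right_inv hzt]; exact hz
      have h3 := ENNReal.toReal_mono (measure_ne_top _ _) h2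
      rw [ENNReal.toReal_mul, ENNReal.toReal_ofReal hd.le, Measure.addHaar_ball_of_pos volume y hδ0,
        ENNReal.toReal_mul, ENNReal.toReal_ofReal (by positivity), finrank_euclideanSpace, Fintype.card_fin] at h3
      calc _ = d * (δ ^ n * θ) := by rw [hδ]; ring
        _ ≤ _ := h3
    have hint : Integrable (fun z => Real.exp (-b * v z)) (vol g₀.inner) :=
      integrable_vol (contDensity_metric g₀) (Real.continuous_exp.comp (continuous_const.mul hv.continuous))
    calc Real.exp (-b) * (d * (ρ' ^ n * θ)) * Real.exp (-b * v x) * L⁻¹ ^ n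
        = (Real.exp (-b) * Real.exp (-b * v x)) * (d * (ρ' ^ n * θ) * L⁻¹ ^ n) := by ring
      _ ≤ (Real.exp (-b) * Real.exp (-b * v x)) * (vol g₀.inner).real s :=
        mul_le_mul_of_nonneg_left hms (by positivity)
      _ ≤ ∫ z in s, Real.exp (-b * v z) ∂(vol g₀.inner) :=
        setIntegral_ge_of_const_le_real hso.measurableSet (measure_ne_top _ _) hvs hint.integrableOn
      _ ≤ _ := setIntegral_le_integral hint (Eventually.of_forall fun z => (Real.exp_pos _).le)
  choose κ hκ hκ' using h1
  rcases S.eq_empty_or_nonempty with he | hne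
  · refine ⟨1, one_pos, fun v L _ _ _ x => ?_⟩
    obtain ⟨p, hp, -⟩ := hS x
    simp [he] at hp
  obtain ⟨p₀, hp₀, hmin⟩ := S.exists_min_image κ hne
  refine ⟨κ p₀, hκ p₀, fun v L hv hL hg x => ?_⟩
  obtain ⟨p, hp, hx, hxK⟩ := hS x
  refine le_trans ?_ (hκ' p v L hv hL hg x hx hxK)
  have : 0 < L⁻¹ := inv_pos.2 (one_pos.trans_le hL)
  exact mul_le_mul_of_nonneg_right (mul_le_mul_of_nonneg_right (hmin p hp) (Real.exp_pos _).le) (by positivity)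

end Metric

end

section

variable {n : ℕ}

/-! ### The maximum principle on a closed manifold -/

section Quad

variable {G : Euc n → Matrix (Fin n) (Fin n) ℝ} {c c' : ℝ} {f : Euc n → ℝ} {y : Euc n}

lemma quadBar_smul (t : ℝ) (w : Fin n → ℝ) : quadBar G c f y (t • w) = t ^ 2 * quadBar G c f y w := by
  simp only [quadBar, Matrix.mulVec_smul, smul_dotProduct, dotProduct_smul, smul_eq_mul]
  ring

lemma quadBar_mono (hG : (G y).PosDef) (hc : c ≤ c') (w : Fin n → ℝ) :
    quadBar G c' f y w ≤ quadBar G c f y w := by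
  have h := hG.posSemidef.dotProduct_mulVec_nonneg w
  rw [star_trivial] at h
  rw [quadBar, quadBar]
  nlinarith

/-- The largest number `c` with `quadBar G c f y w ≥ 0`. -/
def quadRatio (G : Euc n → Matrix (Fin n) (Fin n) ℝ) (f : Euc n → ℝ) (y : Euc n) (w : Fin n → ℝ) : ℝ :=
  (w ⬝ᵥ hessian G f y *ᵥ w) / (w ⬝ᵥ G y *ᵥ w) + gradSq G f y

lemma quadBar_eq (hG : (G y).PosDef) {w : Fin n → ℝ} (hw : w ≠ 0) :
    quadBar G c f y w = (w ⬝ᵥ G y *ᵥ w) * (quadRatio G f y w - c) := by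
  have h : 0 < w ⬝ᵥ G y *ᵥ w := by simpa using hG.dotProduct_mulVec_pos hw
  rw [quadBar, quadRatio]
  field_simp
  ring

lemma quadBar_nonpos_iff (hG : (G y).PosDef) {w : Fin n → ℝ} (hw : w ≠ 0) :
    quadBar G c f y w ≤ 0 ↔ quadRatio G f y w ≤ c := by
  have h : 0 < w ⬝ᵥ G y *ᵥ w := by simpa using hG.dotProduct_mulVec_pos hw
  rw [quadBar_eq hG hw]
  exact ⟨fun h1 => by_contra fun h2 => absurd h1 (not_le.2 (mul_pos h (by linarith))),
    fun h1 => mul_nonpos_of_nonneg_of_nonpos h.le (by linarith)⟩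

lemma JSmooth.quadBar {I : Set ℝ} {D : Set (Euc n)} {u : ℝ → Euc n → ℝ} (hu : JSmooth I D u)
    (h : IsMetricOn D G) (hI : UniqueDiffOn ℝ I) (c : ℝ) (w : Fin n → ℝ) :
    JSmooth I D (fun t z => quadBar G c (u t) z w) := by
  have quad : ∀ {A : ℝ → Euc n → Matrix (Fin n) (Fin n) ℝ}, JSmoothM I D A →
      JSmooth I D (fun t z => w ⬝ᵥ A t z *ᵥ w) := fun hA => by
    simp only [dotProduct, Matrix.mulVec]
    exact JSmooth.sum fun i _ => (JSmooth.const _).mul (JSmooth.sum fun j _ => (hA i j).mul (JSmooth.const _))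
  exact (quad (hu.hessian h hI)).add ((quad h.jsmoothM).mul ((hu.gradSq h hI).sub (JSmooth.const c)))

lemma continuousOn_quad {I : Set ℝ} {D : Set (Euc n)} {V : Set (Fin n → ℝ)}
    {A : ℝ → Euc n → Matrix (Fin n) (Fin n) ℝ} (hA : JSmoothM I D A) :
    ContinuousOn (fun q : ℝ × Euc n × (Fin n → ℝ) => q.2.2 ⬝ᵥ A q.1 q.2.1 *ᵥ q.2.2) (I ×ˢ D ×ˢ V) := by
  have hw : ∀ i, ContinuousOn (fun q : ℝ × Euc n × (Fin n → ℝ) => q.2.2 i) (I ×ˢ D ×ˢ V) := fun i =>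
    (by fun_prop : Continuous fun q : ℝ × Euc n × (Fin n → ℝ) => q.2.2 i).continuousOn
  have hc : ∀ i j, ContinuousOn (fun q : ℝ × Euc n × (Fin n → ℝ) => A q.1 q.2.1 i j) (I ×ˢ D ×ˢ V) := fun i j =>
    (hA i j).continuousOn.comp (f := fun q : ℝ × Euc n × (Fin n → ℝ) => (q.1, q.2.1))
      (by fun_prop : Continuous fun q : ℝ × Euc n × (Fin n → ℝ) => (q.1, q.2.1)).continuousOn
      fun q hq => ⟨hq.1, hq.2.1⟩
  simp only [dotProduct, Matrix.mulVec]
  exact continuousOn_finsetSum _ fun i _ => (hw i).mul (continuousOn_finsetSum _ fun j _ => (hc i j).mul (hw j))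

lemma continuousOn_quadRatio {I : Set ℝ} {D : Set (Euc n)} {V : Set (Fin n → ℝ)} {u : ℝ → Euc n → ℝ}
    (hu : JSmooth I D u) (h : IsMetricOn D G) (hI : UniqueDiffOn ℝ I) (hV : ∀ w ∈ V, w ≠ 0) :
    ContinuousOn (fun q : ℝ × Euc n × (Fin n → ℝ) => quadRatio G (u q.1) q.2.1 q.2.2) (I ×ˢ D ×ˢ V) := by
  have hg : ContinuousOn (fun q : ℝ × Euc n × (Fin n → ℝ) => gradSq G (u q.1) q.2.1) (I ×ˢ D ×ˢ V) :=
    (hu.gradSq h hI).continuousOn.comp (f := fun q : ℝ × Euc n × (Fin n → ℝ) => (q.1, q.2.1))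
      (by fun_prop : Continuous fun q : ℝ × Euc n × (Fin n → ℝ) => (q.1, q.2.1)).continuousOn
      fun q hq => ⟨hq.1, hq.2.1⟩
  have h1 := continuousOn_quad (V := V) (hu.hessian h hI)
  have h2 := continuousOn_quad (I := I) (V := V) h.jsmoothM
  refine (h1.div h2 fun q hq => ?_).add hg
  have := (h.posDef _ hq.2.1).dotProduct_mulVec_pos (hV _ hq.2.2)
  rw [star_trivial] at this
  exact this.ne'

end Quad

section Manifold

variable {M : Type*} [TopologicalSpace M] [ChartedSpace (EuclideanSpace ℝ (Fin n)) M]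

/-- The bound `∇²v + |∇v|² g ≤ c g`. -/
def QuadBound (g : BilinField n M) (c : ℝ) (v : M → ℝ) : Prop :=
  ∀ p : M, ∀ y ∈ (extChartAt (𝓡 n) p).target, ∀ w, quadBar (coeff g p) c (inChart p v) y w ≤ 0

variable [IsManifold (𝓡 n) ∞ M]
  {g₀ : Bundle.ContMDiffRiemannianMetric (𝓡 n) ∞ (EuclideanSpace ℝ (Fin n))
    (fun x : M => TangentSpace (𝓡 n) x)} {v : M → ℝ}

lemma QuadBound.mono {c c' : ℝ} (h : QuadBound g₀.inner c v) (hc : c ≤ c') : QuadBound g₀.inner c' v :=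
  fun p y hy w => (quadBar_mono ((isMetricOn_coeff g₀ p).posDef y hy) hc w).trans (h p y hy w)

/-- By invariance under transitions and homogeneity in `w`, it suffices to test unit vectors over
finitely many compact sets that cover the manifold, where a maximum exists. -/
lemma quadBound_of_compacts (hv : SmoothInCharts (n := n) v) {c : ℝ} {S : Finset M} {K : M → Set (Euc n)}
    (hK : ∀ p, K p ⊆ (extChartAt (𝓡 n) p).target)
    (hS : ∀ x : M, ∃ p ∈ S, x ∈ (extChartAt (𝓡 n) p).source ∧ extChartAt (𝓡 n) p x ∈ K p)
    (h : ∀ p ∈ S, ∀ y ∈ K p, ∀ w : Fin n → ℝ, w ∈ Metric.sphere 0 1 →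
      quadRatio (coeff g₀.inner p) (inChart p v) y w ≤ c) : QuadBound g₀.inner c v := by
  intro p y hy w
  obtain ⟨q, hq, hxq, hyq⟩ := hS ((extChartAt (𝓡 n) p).symm y)
  have ho : y ∈ (overlap p q : Set (Euc n)) := ⟨hy, hxq⟩
  rw [quadBar_transition g₀ hv ho]
  set w' := jac (transition p q) y *ᵥ w
  rcases eq_or_ne w' 0 with h0 | h0
  · rw [h0]; simp [quadBar]
  have hn : ‖w'‖ ≠ 0 := norm_ne_zero_iff.2 h0
  have e : w' = ‖w'‖ • (‖w'‖⁻¹ • w') := by rw [smul_smul, mul_inv_cancel₀ hn, one_smul]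
  have hs : ‖w'‖⁻¹ • w' ∈ Metric.sphere (0 : Fin n → ℝ) 1 := by
    rw [mem_sphere_zero_iff_norm, norm_smul, norm_inv, norm_norm, inv_mul_cancel₀ hn]
  rw [e, quadBar_smul]
  refine mul_nonpos_of_nonneg_of_nonpos (sq_nonneg _) ?_
  exact (quadBar_nonpos_iff ((isMetricOn_coeff g₀ q).posDef _ (hK q hyq))
    (Metric.ne_of_mem_sphere hs one_ne_zero)).2 (h q hq _ hyq _ hs)

lemma bounds_of_c2Norm {Λ : ℝ} (hv : SmoothInCharts (n := n) v)
    (h : c2Norm g₀.inner v ≤ ENNReal.ofReal Λ) (x : M) :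
    gradSq (coeff g₀.inner x) (inChart x v) (extChartAt (𝓡 n) x x) ≤ max Λ 0 ^ 2 ∧
      hessSq (coeff g₀.inner x) (inChart x v) (extChartAt (𝓡 n) x x) ≤ max Λ 0 ^ 2 := by
  obtain ⟨-, h1, h2⟩ := bounds_of_c2Norm_le h x
  rw [gradNorm_eq, Real.sqrt_le_iff] at h1
  rw [hessNorm_eq isMetric_metric hv, Real.sqrt_le_iff] at h2
  exact ⟨h1.2, h2.2⟩

lemma quadBound_of_c2Norm {Λ : ℝ} (hv : SmoothInCharts (n := n) v)
    (h : c2Norm g₀.inner v ≤ ENNReal.ofReal Λ) : QuadBound g₀.inner (max Λ 0 + max Λ 0 ^ 2) v := by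
  intro p y hy w
  set x := (extChartAt (𝓡 n) p).symm y
  have ho : y ∈ (overlap p x : Set (Euc n)) := ⟨hy, mem_extChartAt_source (I := 𝓡 n) x⟩
  have hx := mem_extChartAt_target (I := 𝓡 n) x
  obtain ⟨h1, h2⟩ := bounds_of_c2Norm hv h x
  rw [quadBar_transition g₀ hv ho]
  exact quadBar_nonpos_of_bounds (isMetricOn_coeff g₀ x) hx (hv x _ hx) (le_max_right _ _) h1 h2 _

lemma s1_pos (hn : 2 < n) (hv : SmoothInCharts (n := n) v) (h : ∀ x, 0 < sig1 (conformal g₀.inner v) x)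
    {p : M} {y : Euc n} (hy : y ∈ (extChartAt (𝓡 n) p).target) : 0 < s1 g₀.inner v p y := by
  have h1 := h ((extChartAt (𝓡 n) p).symm y)
  rw [(sig_conformal g₀ hn hv hy).1] at h1
  exact pos_of_mul_pos_right h1 (Real.exp_pos _).le

variable (g₀) in
/-- The a priori bound for the Hessian in terms of a lower bound for the solution. -/
theorem exists_quadBound (hn : 4 < n) [CompactSpace M] [Nonempty M] [MeasurableSpace M] {ε : ℝ} (hε : ε < 1)
    (Λ : ℝ) : ∃ C : ℝ, 0 ≤ C ∧ ∀ (T : ℝ) (u : ℝ → M → ℝ) (R m : ℝ), IsFlowSolution g₀.inner ε T u →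
      (∀ x, 0 < sig1 (conformal g₀.inner (u 0)) x) →
      (∀ t ∈ Icc 0 T, 0 < rEps g₀.inner ε (u t) ∧ rEps g₀.inner ε (u t) ≤ R) →
      c2Norm g₀.inner (u 0) ≤ ENNReal.ofReal Λ → (∀ t ∈ Icc 0 T, ∀ x, m ≤ u t x) →
      ∀ t ∈ Icc 0 T, QuadBound g₀.inner (C * (1 + Real.sqrt (R * Real.exp (-(4 - 2 * ε) * m)))) (u t) := by
  obtain ⟨S, K, hK, hKt, hpK, hS⟩ := exists_finite_compacts (n := n) (M := M)
  have ha : 0 ≤ 4 - 2 * ε := by linarith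
  choose B hB0 hB using fun p : M =>
    exists_max_bound (n := n) (by omega) (isMetricOn_coeff g₀ p) (hK p) (hKt p) ha
  set b := max Λ 0 + max Λ 0 ^ 2 with hb
  have hb0 : 0 ≤ b := by positivity
  set C := b + ∑ p ∈ S, B p with hC
  have hBs : 0 ≤ ∑ p ∈ S, B p := Finset.sum_nonneg fun p _ => hB0 p
  refine ⟨C, by positivity, fun T u R m hu hpos hr hΛ hm => ?_⟩
  set E := Real.sqrt (R * Real.exp (-(4 - 2 * ε) * m)) with hE
  have hE0 : 0 ≤ E := Real.sqrt_nonneg _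
  have hbC : b ≤ C * (1 + E) := by nlinarith
  have hfam := hu.famSmooth
  have hinit : 0 ≤ T → QuadBound g₀.inner b (u 0) := fun hT =>
    quadBound_of_c2Norm (hfam.slice ⟨le_rfl, hT⟩) hΛ
  have hne : S.Nonempty := by
    obtain ⟨x⟩ := ‹Nonempty M›
    obtain ⟨p, hp, -⟩ := hS x
    exact ⟨p, hp⟩
  have hn0 : Nonempty (Fin n) := ⟨⟨0, by omega⟩⟩
  have hsphere : (Metric.sphere (0 : Fin n → ℝ) 1).Nonempty := NormedSpace.sphere_nonempty.2 zero_le_one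
  -- Stopping before `T` guarantees that the maximum is attained at a time where two-sided time
  -- derivatives exist, unless it is the initial time. The final time follows by continuity.
  have main : ∀ T' ∈ Ico 0 T, ∀ t ∈ Icc 0 T', QuadBound g₀.inner (C * (1 + E)) (u t) := by
    intro T' hT'
    have hT : 0 < T := hT'.1.trans_lt hT'.2
    have hsub : Icc 0 T' ⊆ Icc 0 T := Icc_subset_Icc_right hT'.2.le
    have hmax : ∀ p : M, ∃ q ∈ Icc 0 T' ×ˢ K p ×ˢ Metric.sphere (0 : Fin n → ℝ) 1,
        ∀ q' ∈ Icc 0 T' ×ˢ K p ×ˢ Metric.sphere (0 : Fin n → ℝ) 1,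
          quadRatio (coeff g₀.inner p) (inChart p (u q'.1)) q'.2.1 q'.2.2
            ≤ quadRatio (coeff g₀.inner p) (inChart p (u q.1)) q.2.1 q.2.2 := by
      intro p
      obtain ⟨q, hq, hqm⟩ := (isCompact_Icc.prod ((hK p).prod
        (isCompact_sphere (0 : Fin n → ℝ) 1))).exists_isMaxOn
        ((nonempty_Icc.2 hT'.1).prod (Nonempty.prod ⟨_, hpK p⟩ hsphere))
        ((continuousOn_quadRatio (hfam p) (isMetricOn_coeff g₀ p) (uniqueDiffOn_Icc hT)
          fun w hw => Metric.ne_of_mem_sphere hw one_ne_zero).mono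
          (prod_mono hsub (prod_mono (hKt p) le_rfl)))
      exact ⟨q, hq, fun q' hq' => hqm hq'⟩
    choose z hz hzm using hmax
    -- The largest of the finitely many chartwise maxima is the global maximum over time, points and
    -- directions.
    obtain ⟨p, hp, hpm⟩ := S.exists_max_image
      (fun p => quadRatio (coeff g₀.inner p) (inChart p (u (z p).1)) (z p).2.1 (z p).2.2) hne
    set c := quadRatio (coeff g₀.inner p) (inChart p (u (z p).1)) (z p).2.1 (z p).2.2 with hc
    have hQ : ∀ t ∈ Icc 0 T', QuadBound g₀.inner c (u t) := fun t ht =>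
      quadBound_of_compacts (hfam.slice (hsub ht)) hKt hS fun p' hp' y hy w hw =>
        (hzm p' (t, y, w) ⟨ht, hy, hw⟩).trans (hpm p' hp')
    obtain ⟨ht₀, hy₀, hw₀⟩ := hz p
    set t₀ := (z p).1
    set y₀ := (z p).2.1
    set w₀ := (z p).2.2
    have hyt := hKt p hy₀
    have hG := (isMetricOn_coeff g₀ p).posDef y₀ hyt
    have hw0 : w₀ ≠ 0 := Metric.ne_of_mem_sphere hw₀ one_ne_zero
    have hcC : c ≤ C * (1 + E) := by
      rcases ht₀.1.eq_or_lt with h0 | h0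
      · refine le_trans ?_ hbC
        have h1 := (quadBar_nonpos_iff hG hw0).1 (hinit hT.le p y₀ hyt w₀)
        rwa [hc, ← h0]
      · have ht : t₀ ∈ Ioo 0 T := ⟨h0, ht₀.2.trans_lt hT'.2⟩
        have htI := Ioo_subset_Icc_self ht
        have hv := hfam.slice htI
        set N := w₀ ⬝ᵥ coeff g₀.inner p y₀ *ᵥ w₀ with hN
        have hNp : 0 < N := by simpa using hG.dotProduct_mulVec_pos hw0
        -- The maximising vector had unit coordinate norm; it is rescaled to unit length in `g₀`,
        -- which does not change the ratio.
        have h1 := hB p (Ioo 0 T) (fun t => inChart p (u t)) t₀ (rEps g₀.inner ε (u t₀))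
          (sEps g₀.inner ε (u t₀)) c y₀ ((Real.sqrt N)⁻¹ • w₀) isOpen_Ioo
          ((hfam.mono Ioo_subset_Icc_self) p) ht hy₀ (hr t₀ htI).1.le
          (fun y hy => s1_pos (by omega) hv (hu.sig1_pos (by omega) hpos htI) hy)
          (fun y hy => by
            have h2 := hu.deriv_eq ht ((extChartAt (𝓡 n) p).symm y)
            rw [quot_eq g₀ (by omega) hv ε hy] at h2
            exact h2)
          (by
            rw [Matrix.mulVec_smul, smul_dotProduct, dotProduct_smul, ← hN, smul_eq_mul, smul_eq_mul,
              ← mul_assoc, ← mul_inv, Real.mul_self_sqrt hNp.le, inv_mul_cancel₀ hNp.ne'])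
          (by rw [quadBar_smul, quadBar_eq hG hw0, ← hc, sub_self, mul_zero, mul_zero])
          (fun t ht' htt y hy w => hQ t ⟨ht'.1.le, htt.trans ht₀.2⟩ p y hy w)
        refine h1.trans ?_
        have h2 : Real.sqrt (rEps g₀.inner ε (u t₀) * Real.exp (-(4 - 2 * ε) * inChart p (u t₀) y₀)) ≤ E := by
          refine Real.sqrt_le_sqrt (mul_le_mul (hr t₀ htI).2 (Real.exp_le_exp.2 ?_) (Real.exp_pos _).le
            ((hr t₀ htI).1.le.trans (hr t₀ htI).2))
          have := hm t₀ htI ((extChartAt (𝓡 n) p).symm y₀)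
          rw [inChart]; nlinarith
        have h3 : B p ≤ C := by
          have := Finset.single_le_sum (f := B) (fun p _ => hB0 p) hp
          linarith
        exact mul_le_mul h3 (by linarith) (by positivity) (by positivity)
    exact fun t ht => (hQ t ht).mono hcC
  intro t ht
  rcases ht.2.eq_or_lt with h0 | h0
  · rcases ht.1.eq_or_lt with h00 | h00
    · rw [← h00]; exact (hinit (ht.1.trans ht.2)).mono hbC
    · subst h0
      intro p y hy w
      have h1 : ContinuousOn (fun τ => quadBar (coeff g₀.inner p) (C * (1 + E)) (inChart p (u τ)) y w)
          (Icc 0 t) :=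
        ((hfam p).quadBar (isMetricOn_coeff g₀ p) (uniqueDiffOn_Icc h00) _ w).continuousOn.comp
          (f := fun τ => (τ, y)) (by fun_prop) fun τ hτ => ⟨hτ, hy⟩
      have h2 := (h1 t ht).mono Ico_subset_Icc_self
      have : (𝓝[Ico 0 t] t).NeBot := mem_closure_iff_nhdsWithin_neBot.1 (by
        rw [closure_Ico h00.ne]; exact ht)
      refine le_of_tendsto h2 ?_
      filter_upwards [self_mem_nhdsWithin] with τ hτ
      exact main τ hτ τ ⟨hτ.1, le_rfl⟩ p y hy w
  · exact main t ⟨ht.1, h0⟩ t ⟨ht.1, le_rfl⟩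

end Manifold

end

section

/-! ### The bounds from above and below -/

/-- Taking logarithms, the exponent is `-(n - 2ε)m + (n/2)(2 - ε)m = -m ε(n - 4)/2`. Its coefficient
is positive precisely because `ε > 0` and `n > 4`. -/
lemma neg_le_of_volume_le {n : ℕ} {κ V C ε m : ℝ} (hκ : 0 < κ) (hC : 0 < C)
    (h : κ * Real.exp (-(n - 2 * ε) * m) * (Real.sqrt (C * Real.exp (-(2 - ε) * m)))⁻¹ ^ n ≤ V) :
    -m * (ε * (n - 4) / 2) ≤ Real.log V - Real.log κ + n / 2 * Real.log C := by
  have hE : 0 < C * Real.exp (-(2 - ε) * m) := by positivity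
  have hs := Real.sqrt_pos.2 hE
  have hs' : 0 < (Real.sqrt (C * Real.exp (-(2 - ε) * m)))⁻¹ ^ n := by positivity
  have h1 := Real.log_le_log (by positivity) h
  rw [Real.log_mul (by positivity) hs'.ne', Real.log_mul hκ.ne' (Real.exp_pos _).ne', Real.log_exp,
    Real.log_pow, Real.log_inv, Real.log_sqrt hE.le, Real.log_mul hC.ne' (Real.exp_pos _).ne',
    Real.log_exp] at h1
  linarith

variable {n : ℕ} {M : Type*} [TopologicalSpace M] [ChartedSpace (EuclideanSpace ℝ (Fin n)) M]
  [IsManifold (𝓡 n) ∞ M]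

section

variable {g₀ : Bundle.ContMDiffRiemannianMetric (𝓡 n) ∞ (EuclideanSpace ℝ (Fin n))
  (fun x : M => TangentSpace (𝓡 n) x)} {v : M → ℝ} {a c : ℝ}

/-- The bounds for the gradient and the Hessian. -/
lemma QuadBound.bounds (hn : 2 < n) (h : QuadBound g₀.inner c v) (hv : SmoothInCharts (n := n) v)
    (hpos : ∀ x, 0 < sig1 (conformal g₀.inner v) x) (hc : 0 ≤ c)
    (ha : ∀ p : M, ∀ y ∈ (extChartAt (𝓡 n) p).target,
      |((coeff g₀.inner p y)⁻¹ * schouten (coeff g₀.inner p) y).trace| ≤ a) (p : M)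
    {y : Euc n} (hy : y ∈ (extChartAt (𝓡 n) p).target) :
    gradSq (coeff g₀.inner p) (inChart p v) y ≤ c + a ∧
      hessSq (coeff g₀.inner p) (inChart p v) y ≤ n * c ^ 2 + n ^ 2 * (n * c + a) ^ 2 :=
  bounds_of_quadBar (isMetricOn_coeff g₀ p) hy hn.le (hv p y hy) (h p y hy) (s1_pos hn hv hpos hy)
    (ha p y hy) hc

variable [CompactSpace M] [MeasurableSpace M] [BorelSpace M]

lemma exp_le_integral {k B : ℝ} (hv : Continuous v) (h : ∀ x, B ≤ k * v x) :
    Real.exp B * (vol g₀.inner).real univ ≤ ∫ x, Real.exp (k * v x) ∂(vol g₀.inner) := by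
  have := isFiniteMeasure_vol (contDensity_metric g₀)
  have h1 := integral_mono (integrable_const (Real.exp B))
    (integrable_vol (contDensity_metric g₀) (Real.continuous_exp.comp (continuous_const.mul hv)))
    fun x => Real.exp_le_exp.2 (h x)
  rwa [integral_const, smul_eq_mul, mul_comm] at h1

lemma integral_exp_le {k B : ℝ} (hv : Continuous v) (h : ∀ x, k * v x ≤ B) :
    ∫ x, Real.exp (k * v x) ∂(vol g₀.inner) ≤ Real.exp B * (vol g₀.inner).real univ := by
  have := isFiniteMeasure_vol (contDensity_metric g₀)
  have h1 := integral_mono (integrable_vol (contDensity_metric g₀)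
    (Real.continuous_exp.comp (continuous_const.mul hv))) (integrable_const (Real.exp B))
    fun x => Real.exp_le_exp.2 (h x)
  rwa [integral_const, smul_eq_mul, mul_comm _ (Real.exp B)] at h1

variable (g₀) in
/-- The number `r_ε` is bounded in terms of the `C²` norm. -/
lemma exists_rEps_bound (hn : 2 < n) {ε : ℝ} (hε₀ : 0 < ε) (hε₁ : ε < 1) (Λ : ℝ) :
    ∃ R : ℝ, 0 ≤ R ∧ ∀ v : M → ℝ, SmoothInCharts (n := n) v → c2Norm g₀.inner v ≤ ENNReal.ofReal Λ →
      rEps g₀.inner ε v ≤ R := by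
  have hfin := isFiniteMeasure_vol (contDensity_metric g₀)
  obtain ⟨a, ha0, ha⟩ := exists_schouten_bound g₀ hn
  set b := max Λ 0 with hb
  have hb0 : 0 ≤ b := le_max_right _ _
  have hn' : (2 : ℝ) < n := by exact_mod_cast hn
  set P := (a + n * b + n * b ^ 2) ^ 2 with hP
  have hP0 : 0 ≤ P := sq_nonneg _
  set Q := Real.exp (n * b) * (Real.exp (2 * b) ^ 2 * P) with hQ
  refine ⟨Real.exp (n * b) * Q, by positivity, fun v hv hΛ => ?_⟩
  have hvb := fun x => abs_le.1 (bounds_of_c2Norm_le hΛ x).1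
  have hs2 : ∀ x, sig2 (conformal g₀.inner v) x ≤ Real.exp (2 * b) ^ 2 * P := by
    intro x
    have hx := mem_extChartAt_target (I := 𝓡 n) x
    have h1 := (sig_conformal g₀ hn hv hx).2
    rw [extChartAt_to_inv] at h1
    obtain ⟨h2, h3⟩ := bounds_of_c2Norm hv hΛ x
    have h4 := sigma2_le_of_bounds (isMetricOn_coeff g₀ x) hx hn.le (hv x _ hx) hb0 h2 h3 (ha x _ hx)
    have h5 : Real.exp (2 * inChart x v (extChartAt (𝓡 n) x x)) ^ 2 ≤ Real.exp (2 * b) ^ 2 := by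
      refine pow_le_pow_left₀ (Real.exp_pos _).le (Real.exp_le_exp.2 ?_) 2
      have := (hvb ((extChartAt (𝓡 n) x).symm (extChartAt (𝓡 n) x x))).2
      rw [inChart]; linarith
    rw [h1, s2]
    exact (mul_le_mul_of_nonneg_left h4 (sq_nonneg _)).trans (mul_le_mul_of_nonneg_right h5 hP0)
  have hconst : FamSmooth n univ fun _ : ℝ => v := fun p => JSmooth.of_smooth (hv p)
  have hsc : Continuous (sig2 (conformal g₀.inner v)) :=
    ((famSmooth_sig (g₀ := g₀) hn uniqueDiffOn_univ hconst).2.slice (mem_univ 0)).continuous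
  have hF : ∫ x, sig2 (conformal g₀.inner v) x ∂(vol (conformal g₀.inner v)) ≤ Q * (vol g₀.inner).real univ := by
    rw [integral_vol_conformal (contDensity_metric g₀) hv.continuous]
    have hec : Continuous fun x => Real.exp (-n * v x) :=
      Real.continuous_exp.comp (continuous_const.mul hv.continuous)
    have h1 := integral_mono (integrable_vol (contDensity_metric g₀) (hec.fun_mul hsc)) (integrable_const Q)
      fun x => by
        have h2 : Real.exp (-n * v x) ≤ Real.exp (n * b) := Real.exp_le_exp.2 (by nlinarith [(hvb x).1])
        exact (mul_le_mul_of_nonneg_left (hs2 x) (Real.exp_pos _).le).trans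
          (mul_le_mul_of_nonneg_right h2 (by positivity))
    rwa [integral_const, smul_eq_mul, mul_comm _ Q] at h1
  have hV : Real.exp (-(n * b)) * (vol g₀.inner).real univ
      ≤ ∫ x, Real.exp ((2 * ε - n) * v x) ∂(vol g₀.inner) :=
    exp_le_integral hv.continuous fun x => by nlinarith [(hvb x).1, (hvb x).2]
  rw [rEps, integral_exp_vol _ hv.continuous]
  -- Numerator and denominator are both compared with the total volume of the background metric,
  -- which cancels.
  refine div_le_of_le_mul₀ (integral_nonneg fun x => (Real.exp_pos _).le) (by positivity) (hF.trans ?_)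
  refine le_trans (le_of_eq ?_) (mul_le_mul_of_nonneg_left hV (by positivity))
  have : Real.exp (n * b) * Real.exp (-(n * b)) = 1 := by rw [← Real.exp_add, add_neg_cancel, Real.exp_zero]
  calc Q * (vol g₀.inner).real univ
      = Q * (vol g₀.inner).real univ * (Real.exp (n * b) * Real.exp (-(n * b))) := by rw [this, mul_one]
    _ = _ := by ring

end

variable (g₀ : Bundle.ContMDiffRiemannianMetric (𝓡 n) ∞ (EuclideanSpace ℝ (Fin n))
  (fun x : M => TangentSpace (𝓡 n) x)) [T2Space M] [CompactSpace M] [ConnectedSpace M]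
  [MeasurableSpace M] [BorelSpace M]

set_option maxHeartbeats 1000000 in
/-- The a priori bounds for the flow. -/
theorem exists_c2Norm_bound (hn : 4 < n) {ε : ℝ} (hε₀ : 0 < ε) (hε₁ : ε < 1) (Λ : ℝ) :
    ∃ C : ℝ, ∀ (T : ℝ) (u : ℝ → M → ℝ), 0 ≤ T → IsFlowSolution g₀.inner ε T u →
      (∀ x, 0 < sig1 (conformal g₀.inner (u 0)) x) → (∀ t ∈ Icc 0 T, 0 < rEps g₀.inner ε (u t)) →
      c2Norm g₀.inner (u 0) ≤ ENNReal.ofReal Λ →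
      ∀ t ∈ Icc 0 T, c2Norm g₀.inner (u t) ≤ ENNReal.ofReal C := by
  have hn2 : 2 < n := by omega
  have hn4 : (4 : ℝ) < n := by exact_mod_cast hn
  obtain ⟨a, ha0, ha⟩ := exists_schouten_bound g₀ hn2
  obtain ⟨R, hR0, hR⟩ := exists_rEps_bound g₀ hn2 hε₀ hε₁ Λ
  obtain ⟨A, hA0, hA⟩ := exists_quadBound g₀ hn hε₁ Λ
  obtain ⟨κ, hκ, hvol⟩ := exists_volume_bound g₀ (b := n - 2 * ε) (by linarith)
  set b := max Λ 0 with hb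
  have hb0 : 0 ≤ b := le_max_right _ _
  set ν := (vol g₀.inner).real univ with hν
  -- `C₁ E` is at least 1 and dominates the squared gradient bound once `E = e^{-(2-ε)m} ≥ 1`.
  set C₁ := A * (1 + Real.sqrt R) + a + 1 with hC₁
  have hC₁1 : 1 ≤ C₁ := by have : 0 ≤ A * (1 + Real.sqrt R) := by positivity
                           linarith
  set V := Real.exp (n * b) * ν with hV
  -- The bound that `neg_le_of_volume_le` yields for `-m`.
  set m₀ := max 0 ((Real.log V - Real.log κ + n / 2 * Real.log C₁) / (ε * (n - 4) / 2)) with hm₀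
  have hd : 0 < ε * (n - 4) / 2 := by have := mul_pos hε₀ (sub_pos.2 hn4); linarith
  set c := A * (1 + Real.sqrt (R * Real.exp (-(4 - 2 * ε) * -m₀))) with hc
  have hc0 : 0 ≤ c := by positivity
  obtain ⟨O, hO0, hO⟩ := exists_osc_bound g₀ (Real.sqrt_nonneg (c + a))
  set H := n * c ^ 2 + n ^ 2 * (n * c + a) ^ 2 with hH
  refine ⟨max m₀ (b + 1 + O) + Real.sqrt (c + a) + Real.sqrt H, fun T u hT hu hpos hr hΛ => ?_⟩
  have h0 : (0 : ℝ) ∈ Icc 0 T := ⟨le_rfl, hT⟩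
  have hs := fun t (ht : t ∈ Icc 0 T) => hu.famSmooth.slice ht
  have hσ := fun t (ht : t ∈ Icc 0 T) => hu.sig1_pos hn2 hpos ht
  have hrR : ∀ t ∈ Icc 0 T, 0 < rEps g₀.inner ε (u t) ∧ rEps g₀.inner ε (u t) ≤ R := fun t ht =>
    ⟨hr t ht, (hu.rEps_le hn hpos hr ht).trans (hR _ (hs 0 h0) hΛ)⟩
  have hub := fun x => abs_le.1 (bounds_of_c2Norm_le hΛ x).1
  have hVt : ∀ t ∈ Icc 0 T, ∫ x, Real.exp ((2 * ε - n) * u t x) ∂(vol g₀.inner) ≤ V := fun t ht => by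
    rw [hu.integral_exp_eq hr ht]
    exact integral_exp_le (hu.continuous h0) fun x => by nlinarith [(hub x).1, (hub x).2]
  have hneg : -(n - 2 * ε : ℝ) = 2 * ε - n := by ring
  have hbounds : ∀ t ∈ Icc 0 T, ∀ m, (∀ t ∈ Icc 0 T, ∀ x, m ≤ u t x) → ∀ p : M,
      ∀ y ∈ (extChartAt (𝓡 n) p).target,
      gradSq (coeff g₀.inner p) (inChart p (u t)) y
        ≤ A * (1 + Real.sqrt (R * Real.exp (-(4 - 2 * ε) * m))) + a ∧
      hessSq (coeff g₀.inner p) (inChart p (u t)) y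
        ≤ n * (A * (1 + Real.sqrt (R * Real.exp (-(4 - 2 * ε) * m)))) ^ 2
          + n ^ 2 * (n * (A * (1 + Real.sqrt (R * Real.exp (-(4 - 2 * ε) * m)))) + a) ^ 2 :=
    fun t ht m hm p y hy =>
    (hA T u R m hu hpos hrR hΛ hm t ht).bounds hn2 (hs t ht) (hσ t ht) (by positivity) ha p hy
  -- the lower bound
  have hlow : ∀ t ∈ Icc 0 T, ∀ x, -m₀ ≤ u t x := by
    -- The minimum is taken over all of space-time, so the same number `m` enters the Hessian bound
    -- and is attained where the volume estimate is centred.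
    obtain ⟨⟨t₁, x₁⟩, ⟨ht₁, -⟩, hmin⟩ := (isCompact_Icc.prod (isCompact_univ (X := M))).exists_isMinOn
      (s := Icc 0 T ×ˢ univ) ⟨(0, Classical.arbitrary M), h0, mem_univ _⟩ hu.famSmooth.continuousOn
    set m := u t₁ x₁ with hm
    have hml : ∀ t ∈ Icc 0 T, ∀ x, m ≤ u t x := fun t ht x => hmin (a := (t, x)) ⟨ht, mem_univ x⟩
    suffices -m₀ ≤ m from fun t ht x => this.trans (hml t ht x)
    rcases le_or_gt 0 m with hm0 | hm0
    · have : 0 ≤ m₀ := le_max_left _ _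
      linarith
    set E := Real.exp (-(2 - ε) * m) with hE
    have hE1 : 1 ≤ E := Real.one_le_exp (by nlinarith)
    -- The square root from the maximum principle halves the exponent `4 - 2ε`. With the full
    -- exponent the volume argument would not close.
    have hsq : Real.sqrt (R * Real.exp (-(4 - 2 * ε) * m)) = Real.sqrt R * E := by
      rw [Real.sqrt_mul hR0, show -(4 - 2 * ε) * m = -(2 - ε) * m + -(2 - ε) * m by ring, Real.exp_add,
        Real.sqrt_mul_self (Real.exp_pos _).le]
    have hCE : 1 ≤ C₁ * E := by nlinarith
    have hg : GradBound g₀.inner (Real.sqrt (C₁ * E)) (u t₁) := by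
      intro p y hy
      refine (hbounds t₁ ht₁ m hml p y hy).1.trans ?_
      rw [Real.sq_sqrt (by linarith), hsq, hC₁]
      have h1 : 0 ≤ (E - 1) * (A + a) := mul_nonneg (by linarith) (by linarith)
      nlinarith
    have hV' : ∫ z, Real.exp (-(n - 2 * ε) * u t₁ z) ∂(vol g₀.inner) ≤ V := by
      rw [hneg]; exact hVt t₁ ht₁
    have h1 := (hvol (u t₁) (Real.sqrt (C₁ * E)) (hs t₁ ht₁) (Real.one_le_sqrt.2 hCE) hg x₁).trans hV'
    have h2 := neg_le_of_volume_le hκ (by linarith) h1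
    have h3 : -m ≤ m₀ := ((le_div_iff₀ hd).2 h2).trans (le_max_right _ _)
    linarith
  intro t ht
  have hQ := hbounds t ht (-m₀) hlow
  have hg : GradBound g₀.inner (Real.sqrt (c + a)) (u t) := fun p y hy => by
    rw [Real.sq_sqrt (by positivity)]
    exact (hQ p y hy).1
  -- the upper bound
  obtain ⟨y, hy⟩ : ∃ y, u t y ≤ b + 1 := by
    by_contra! hcon
    -- The added 1 makes the gradient bound at least 1, as the volume estimate requires. Here that
    -- estimate only shows that the integral, and hence the total volume, is positive.
    have hg' : GradBound g₀.inner (Real.sqrt (c + a + 1)) (u t) := fun p y hy => by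
      rw [Real.sq_sqrt (by positivity)]
      linarith [(hQ p y hy).1]
    have hL : 1 ≤ Real.sqrt (c + a + 1) := Real.one_le_sqrt.2 (by linarith)
    have h1 := hvol (u t) _ (hs t ht) hL hg' (Classical.arbitrary M)
    rw [hneg] at h1
    have hL0 := one_pos.trans_le hL
    have h2 : 0 < ∫ x, Real.exp ((2 * ε - n) * u t x) ∂(vol g₀.inner) := lt_of_lt_of_le (by positivity) h1
    have h3 : ∫ x, Real.exp ((2 * ε - n) * u t x) ∂(vol g₀.inner) ≤ Real.exp ((2 * ε - n) * (b + 1)) * ν :=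
      integral_exp_le (hu.continuous ht) fun x => by nlinarith [hcon x]
    have h4 : Real.exp ((2 * ε - n) * b) * ν ≤ ∫ x, Real.exp ((2 * ε - n) * u 0 x) ∂(vol g₀.inner) :=
      exp_le_integral (hu.continuous h0) fun x => by nlinarith [(hub x).2]
    rw [← hu.integral_exp_eq hr ht] at h4
    have hν0 : 0 < ν := pos_of_mul_pos_right (h2.trans_le h3) (Real.exp_pos _).le
    -- If `u > b + 1` everywhere at time `t`, the conserved integral would be strictly below its
    -- initial value, where `u ≤ b`.
    have h5 := Real.exp_le_exp.1 (le_of_mul_le_mul_right (h4.trans h3) hν0)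
    nlinarith
  refine c2Norm_le ((le_max_left 0 _).trans (le_max_left _ _)) (Real.sqrt_nonneg _) (Real.sqrt_nonneg _)
    (fun x => ?_) (fun x => ?_) fun x => ?_
  · refine abs_le.2 ⟨?_, ?_⟩
    · linarith [hlow t ht x, le_max_left m₀ (b + 1 + O)]
    · linarith [hO (u t) (hs t ht) hg x y, le_max_right m₀ (b + 1 + O)]
  · rw [gradNorm_eq]
    exact Real.sqrt_le_sqrt (hQ x _ (mem_extChartAt_target x)).1
  · rw [hessNorm_eq isMetric_metric (hs t ht)]
    exact Real.sqrt_le_sqrt (hQ x _ (mem_extChartAt_target x)).2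

end

end SigmaTwoFlow

end

theorem mainTheorem6 {n : ℕ} (hn : 4 < n)
    {M : Type*} [TopologicalSpace M] [T2Space M] [CompactSpace M] [ConnectedSpace M]
    [ChartedSpace (EuclideanSpace ℝ (Fin n)) M] [IsManifold (𝓡 n) ∞ M]
    [MeasurableSpace M] [BorelSpace M]
    (g₀ : Bundle.ContMDiffRiemannianMetric (𝓡 n) ∞ (EuclideanSpace ℝ (Fin n))
      (fun x : M => TangentSpace (𝓡 n) x))
    (ε : ℝ) (hε₀ : 0 < ε) (hε₁ : ε < 1) (Λ : ℝ) :
    ∃ C : ℝ, ∀ (T : ℝ) (u : ℝ → M → ℝ), 0 ≤ T →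
      IsFlowSolution g₀.inner ε T u →
      (∀ x, 0 < sig1 (conformal g₀.inner (u 0)) x) →
      (∀ t ∈ Icc 0 T, 0 < rEps g₀.inner ε (u t)) →
      c2Norm g₀.inner (u 0) ≤ ENNReal.ofReal Λ →
      ∀ t ∈ Icc 0 T, c2Norm g₀.inner (u t) ≤ ENNReal.ofReal C := by
  exact exists_c2Norm_bound g₀ hn hε₀ hε₁ Λ
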